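/- **Conventions.** A *Dynkin diagram* is here a finite (possibly empty or disconnected) Dynkin diagram $S$ either all of whose connected components are of finite type, or all of whose connected components are of affine type. Its vertices are identified with simple roots $\alpha$, with coroots $\alpha^\vee$; it is the same as its Cartan matrix $(\langle\alpha,\beta^\vee\rangle)_{\alpha,\beta\in S}$. If $S$ is affine, $\overline\alpha$ denotes the gradient of $\alpha$ (so $\sum_\alpha k(\alpha)\overline\alpha=0$ on each component, $k(\alpha)$ being the labels), and $\overline\alpha=\alpha$ if $S$ is finite; $k(\alpha^\vee)$ is the colabel, i.e. the label of $\alpha^\vee$ in the dual diagram. For a subset $S'$ of a graph $T$, the connected closure of $S'$ in $T$ is the union of the connected components of $T$ which meet $S'$. *Numbering.* Finite types have vertices $\alpha_1,\dots,\alpha_n$ in Bourbaki's order ($\alpha_n$ is short in $\mathsf B_n$ and long in $\mathsf C_n$; $\alpha_3,\alpha_4$ are short in $\mathsf F_4$; $\alpha_1$ is short in $\mathsf G_2$). Affine types have vertices $\alpha_0,\dots,\alpha_n$: $\mathsf A_1^{(1)}$; $\mathsf A_n^{(1)}$ ($n\ge2$), a cycle; $\mathsf B_n^{(1)}$ ($n\ge3$),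 with $\alpha_0,\alpha_1$ joined to $\alpha_2$, then a chain $\alpha_2,\dots,\alpha_n$ with $\alpha_n$ short; $\mathsf C_n^{(1)}$ ($n\ge2$), a chain with $\alpha_0,\alpha_n$ long; $\mathsf D_n^{(1)}$ ($n\ge4$), with $\alpha_0,\alpha_1$ joined to $\alpha_2$, a chain $\alpha_2,\dots,\alpha_{n-2}$, and $\alpha_{n-1},\alpha_n$ joined to $\alpha_{n-2}$; $\mathsf A_2^{(2)}$ with $\alpha_0$ short, $\alpha_1$ long; $\mathsf A_{2n}^{(2)}$ ($n\ge2$), a chain with $\alpha_0$ short, $\alpha_n$ long; $\mathsf A_{2n-1}^{(2)}$ ($n\ge3$), with $\alpha_0,\alpha_1$ joined to $\alpha_2$, then a chain with $\alpha_n$ long; $\mathsf D_{n+1}^{(2)}$ ($n\ge2$), a chain with $\alpha_0,\alpha_n$ short; $\mathsf F_4^{(1)}$, a chain with $\alpha_3,\alpha_4$ short; $\mathsf E_6^{(2)}$, a chain with $\alpha_3,\alpha_4$ long; $\mathsf G_2^{(1)}$, a chain with $\alpha_2$ short; $\mathsf D_4^{(3)}$, a chain with $\alpha_2$ long. **Local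 diagrams.** A *local diagram* is a triple $\mathcal D=(S,S',c)$, $c\in\{\frac12,1,2,i\}$ ($i$ a formal symbol), isomorphic to one of the following. Homogeneous ones ($c\ne i$), with their weight $\omega_{\mathcal D}$: - $a_n$ ($n\ge1$): $S=\mathsf A_n$, $S'=\{\alpha_1,\alpha_n\}$, $c=1$, $\omega=\alpha_1+\dots+\alpha_n$; $2a_1$: $S=S'=\mathsf A_1$, $c=2$, $\omega=2\alpha_1$; - $b_n$, $2b_n$ ($n\ge2$): $S=\mathsf B_n$, $S'=\{\alpha_1\}$, $c=1$ resp. $2$, $\omega=c(\alpha_1+\dots+\alpha_n)$; - $c_n$ ($n\ge3$): $S=\mathsf C_n$, $S'=\{\alpha_2\}$, $c=1$, $\omega=\alpha_1+2\alpha_2+\dots+2\alpha_{n-1}+\alpha_n$; - $d_n$, $\frac12d_n$ ($n\ge4$): $S=\mathsf D_n$, $S'=\{\alpha_1\}$, $c=1$ resp. $\frac12$, $\omega=c(2\alpha_1+\dots+2\alpha_{n-2}+\alpha_{n-1}+\alpha_n)$; - $d_3$, $\frac12d_3$: $S=\mathsf A_3$, $S'=\{\alpha_2\}$, $c=1$ resp.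 $\frac12$, $\omega=c(\alpha_1+2\alpha_2+\alpha_3)$; - $d_2$, $\frac12d_2$: $S=S'=\mathsf A_1\times\mathsf A_1=\{\alpha,\alpha'\}$, $c=1$ resp. $\frac12$, $\omega=c(\alpha+\alpha')$; - $f_4$: $S=\mathsf F_4$, $S'=\{\alpha_4\}$, $c=1$, $\omega=\alpha_1+2\alpha_2+3\alpha_3+2\alpha_4$; - $g_2$, $2g_2$: $S=\mathsf G_2$, $S'=\{\alpha_1\}$, $c=1$ resp. $2$, $\omega=c(2\alpha_1+\alpha_2)$; - $b_3'$, $\frac12b_3'$: $S=\mathsf B_3$, $S'=\{\alpha_3\}$, $c=1$ resp. $\frac12$, $\omega=c(\alpha_1+2\alpha_2+3\alpha_3)$. Inhomogeneous ones ($c=i$): $\mathbf a_0$: $S=S'=\varnothing$; $\mathbf a_n$ ($n\ge1$): $S=\mathsf A_n$, $S'=\{\alpha_1\}$; $\mathbf c_n$ ($n\ge2$): $S=\mathsf C_n$, $S'=\{\alpha_1\}$. If such a diagram is non-empty, $\alpha_{\mathcal D}$ denotes the unique element of $S'$. **Primitive spherical diagrams.** Let $\mathcal D=(S,S_1',c_1,S_2',c_2)$,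 where $S$ is a Dynkin diagram, $S_1',S_2'\subseteq S$ are disjoint and $c_1,c_2\in\{\frac12,1,2,i\}$. For $\{i,j\}=\{1,2\}$ let $S_i$ be the connected closure of $S_i'$ in $S\setminus S_j'$. Then $\mathcal D$ is a *primitive spherical diagram* if 1. $S=S_1\cup S_2$; 2. the triples $\mathcal D_i=(S_i,S_i',c_i)$ are local diagrams; 3. (a) if both $\mathcal D_i$ are homogeneous, then $\overline{\omega_{\mathcal D_1}}+\overline{\omega_{\mathcal D_2}}=0$; (b) if $\mathcal D_i$ is homogeneous and $\mathcal D_j$ is inhomogeneous with $S_j\neq\varnothing$, then $\langle\omega_{\mathcal D_i},\alpha_{\mathcal D_j}^\vee\rangle=-1$; (c) if both $\mathcal D_i$ are inhomogeneous with $S_1,S_2\ne\varnothing$ and $S$ is affine and irreducible, then $k(\alpha_{\mathcal D_1}^\vee)=k(\alpha_{\mathcal D_2}^\vee)$. Two quintuples are *isomorphic* if an isomorphism of Dynkin diagrams carries one to the other, possibly after interchanging the indices $1$ and $2$. **Theorem.** Every primitive spherical diagram is isomorphic to an entry of the following list. An entry is written $(X\mid Y)_{c_1,c_2}$ with $S_1'=\{\alpha_x:x\in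 X\}$, $S_2'=\{\alpha_y:y\in Y\}$; if several pairs of factors are given, each of them gives an entry. On a product, unprimed indices belong to the first and primed indices to the second component. *Affine, irreducible.* - $\mathsf A_1^{(1)}$: $(0\mid1)_{i,i}$; $(0\mid1)_{1,1\text{ or }2,2}$. - $\mathsf A_n^{(1)}$, $n\ge2$: $(0\mid1)_{i,i}$; $(0,p{-}1\mid p,n)_{1,1}$, $1\le p\le n$. For $n=3$ also $(0\mid2)_{1,1\text{ or }\frac12,\frac12}$; $(0,2\mid1,3)_{1,1\text{ or }\frac12,\frac12}$. - $\mathsf B_n^{(1)}$, $n\ge3$: $(0\mid1)_{1,1\text{ or }2,2}$; $(p{-}1\mid p)_{1,2\text{ or }\frac12,1}$, $3\le p\le n$; $(0,1\mid2)_{1,2\text{ or }\frac12,1}$. For $n=3$ also $(0\mid3)_{i,\frac12}$; $(0,3\mid2)_{\frac12,i}$. - $\mathsf C_n^{(1)}$, $n\ge2$: $(p{-}1\mid p)_{i,i}$, $1\le p\le n$; $(p\mid p{+}2)_{1,1}$, $0\le p\le n-2$; $(0,n\mid1,n{-}1)_{\frac12,1}$. For $n=2$ also $(0\mid2)_{2,2}$;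 $(0,2\mid1)_{1,2}$. - $\mathsf D_n^{(1)}$, $n\ge4$: $(0\mid1)_{1,1\text{ or }\frac12,\frac12}$; $(p{-}1\mid p)_{1,1\text{ or }\frac12,\frac12}$, $3\le p\le n-2$; $(0,1\mid2)_{1,1\text{ or }\frac12,\frac12}$; $(0,n{-}1\mid1,n)_{1,1}$. - $\mathsf F_4^{(1)}$: $(0\mid4)_{1,1}$; $(1\mid3)_{\frac12,1}$; $(2\mid3,4)_{i,1}$. - $\mathsf G_2^{(1)}$: $(0\mid2)_{i,1}$; $(1\mid2)_{i,1}$; $(0,2\mid1)_{\frac12,i}$. - $\mathsf A_2^{(2)}$: $(0\mid1)_{1,i}$; $(0\mid1)_{2,1}$. - $\mathsf A_{2n}^{(2)}$, $n\ge2$: $(p{-}1\mid p)_{1,i}$, $1\le p\le n$; $(n{-}1\mid n)_{2,1}$. - $\mathsf A_{2n-1}^{(2)}$, $n\ge3$: $(0\mid1)_{i,i}$; $(0\mid2)_{1,1}$; $(p{-}1\mid p)_{\frac12,i}$, $3\le p\le n$; $(0,1\mid2)_{\frac12,i}$; $(n{-}1\mid n)_{1,1}$; $(0,1\mid3)_{1,1}$.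 - $\mathsf D_{n+1}^{(2)}$, $n\ge2$: $(p{-}1\mid p)_{1,1\text{ or }2,2}$, $1\le p\le n$; $(0,n\mid1,n{-}1)_{1,1}$. For $n=2$ also $(0\mid2)_{i,i}$; $(0,2\mid1)_{\frac12,i}$. For $n=3$ also $(0\mid3)_{1,1\text{ or }\frac12,\frac12}$; $(0,2\mid1,3)_{1,1\text{ or }\frac12,\frac12}$. - $\mathsf E_6^{(2)}$: $(0\mid1)_{1,1}$; $(1\mid4)_{1,1}$; $(0,2\mid3)_{1,i}$. - $\mathsf D_4^{(3)}$: $(0\mid1)_{1,1\text{ or }2,2}$; $(0,1\mid2)_{1,i}$; $(0,2\mid1)_{1,2\text{ or }\frac12,1}$. *Affine, reducible.* - $\mathsf A_1^{(1)}\times\mathsf A_1^{(1)}$: $(0,0'\mid1,1')_{1,1\text{ or }\frac12,\frac12}$. - $\mathsf A_2^{(2)}\times\mathsf A_2^{(2)}$: $(0,0'\mid1,1')_{1,\frac12}$. *Finite, empty or irreducible.* - $\varnothing$: $(\varnothing\mid\varnothing)_{i,i}$. - $\mathsf A_n$, $n\ge1$: $(1\mid\varnothing)_{i,i}$; $(1,n\mid\varnothing)_{1,i}$;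 $(p\mid p{+}1)_{i,i}$ and $(p\mid p{+}1,n)_{i,1}$, $1\le p\le n-1$; $(1\mid n)_{i,i}$ if $n\ge3$. For $n=1$ also $(1\mid\varnothing)_{2,i}$. For $n=3$ also $(2\mid\varnothing)_{1,i\text{ or }\frac12,i}$; $(1,3\mid2)_{\frac12,i}$. For $n=4$ also $(1\mid3)_{i,1}$. - $\mathsf B_n$, $n\ge2$: $(1\mid\varnothing)_{1,i\text{ or }2,i}$; $(p\mid p{+}1)_{i,1}$, $1\le p\le n-1$; $(n{-}1\mid n)_{i,i}$. For $n=3$ also $(3\mid\varnothing)_{1,i\text{ or }\frac12,i}$; $(1\mid3)_{i,i}$; $(1,3\mid2)_{\frac12,i}$. For $n=4$ also $(1\mid4)_{i,1}$; $(2\mid4)_{\frac12,i}$. - $\mathsf C_n$: $(1\mid\varnothing)_{i,i}$, $n\ge2$. For $n\ge3$ also $(2\mid\varnothing)_{1,i}$; $(p\mid p{+}1)_{i,i}$ and $(1,p\mid p{+}1)_{1,i}$, $1\le p\le n-1$; $(1\mid3)_{i,1}$. - $\mathsf D_n$, $n\ge4$: $(1\mid\varnothing)_{1,i\text{ or }\frac12,i}$;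 $(p\mid p{+}1)_{i,\frac12}$, $1\le p\le n-3$; $(n{-}2\mid n{-}1,n)_{i,\frac12}$; $(n{-}1\mid n)_{i,i}$; $(1,n{-}1\mid n)_{1,i}$. For $n=5$ also $(1\mid4)_{i,1}$. - $\mathsf F_4$: $(4\mid\varnothing)_{1,i}$; $(1\mid3)_{i,1}$; $(1\mid4)_{1,i}$; $(2\mid3)_{i,i}$; $(2\mid3,4)_{i,1}$. - $\mathsf G_2$: $(1\mid\varnothing)_{1,i\text{ or }2,i}$; $(2\mid1)_{i,i}$; $(2\mid1)_{i,1}$. *Finite, reducible.* - $\mathsf A_1\times\mathsf A_1$: $(1,1'\mid\varnothing)_{1,i\text{ or }\frac12,i}$. - $(1\mid1')_{i,i}$ on $\mathsf A_m\times\mathsf A_n$ ($m,n\ge1$), on $\mathsf A_m\times\mathsf C_n$ ($m\ge1$, $n\ge2$) and on $\mathsf C_m\times\mathsf C_n$ ($m,n\ge2$). - $\mathsf A_1\times\mathsf A_n$, $n\ge2$: $(1,1'\mid2')_{1,i}$. - $\mathsf A_1\times\mathsf B_n$, $n\ge2$: $(1,n'\mid(n{-}1)')_{1,i}$. - $\mathsf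 A_1\times\mathsf C_n$: $(1,1'\mid2')_{1,i}$, $n\ge3$; $(1,n'\mid(n{-}1)')_{\frac12,i}$, $n\ge2$. - $\mathsf A_1\times\mathsf G_2$: $(1,1'\mid2')_{1,i}$. -/

import Mathlib

/-! ### Dynkin diagrams

A Dynkin diagram with vertex set `S` is recorded by its Cartan matrix
`A i j = ⟨α i, (α j)^∨⟩`. -/

namespace PrimSph

open Matrix

/-- Generalized Cartan matrices. -/
structure IsGCM {S : Type*} (A : Matrix S S ℤ) : Prop where
  diag : ∀ i, A i i = 2
  offDiag : ∀ i j, i ≠ j → A i j ≤ 0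
  zero_symm : ∀ i j, A i j = 0 → A j i = 0

/-- All connected components are of finite type: some strictly positive combination of the simple
roots is strictly dominant (criterion of Vinberg and Kac; integral coefficients suffice, because the
condition is open and homogeneous). -/
def IsFiniteType {S : Type*} [Fintype S] (A : Matrix S S ℤ) : Prop :=
  ∃ u : S → ℤ, (∀ i, 0 < u i) ∧ ∀ j, 0 < (u ᵥ* A) j

/-- All connected components are of affine type: some strictly positive combination of (the gradients
of) the simple roots vanishes. -/
def IsAffineType {S : Type*} [Fintype S] (A : Matrix S S ℤ) : Prop :=
  ∃ u : S → ℤ, (∀ i, 0 < u i) ∧ u ᵥ* A = 0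

/-- Cartan matrices of finite or (properly) affine, possibly reducible or empty, Dynkin diagrams. -/
def IsDynkin {S : Type*} [Fintype S] (A : Matrix S S ℤ) : Prop :=
  IsGCM A ∧ (IsFiniteType A ∨ IsAffineType A)

/-- The graph underlying a Dynkin diagram. -/
def graph {S : Type*} (A : Matrix S S ℤ) : SimpleGraph S where
  Adj i j := i ≠ j ∧ (A i j ≠ 0 ∨ A j i ≠ 0)
  symm := ⟨fun _ _ h => ⟨h.1.symm, h.2.symm⟩⟩
  loopless := ⟨fun _ h => h.1 rfl⟩

/-- The connected closure of `U` in `T`: the vertices of `T` which can be joined to a vertex of `U`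
by a path inside `T`. -/
def closureIn {S : Type*} (G : SimpleGraph S) (U T : Set S) : Set S :=
  {x | ∃ hx : x ∈ T, ∃ y : T, (y : S) ∈ U ∧ (G.induce T).Reachable ⟨x, hx⟩ y}

/-- `k` is the family of Dynkin labels: positive coprime integers with `∑ k i • α i = 0`. -/
def IsLabeling {S : Type*} [Fintype S] (A : Matrix S S ℤ) (k : S → ℤ) : Prop :=
  (∀ i, 0 < k i) ∧ Finset.univ.gcd k = 1 ∧ k ᵥ* A = 0

/-- Colabels are the labels of the dual diagram, whose Cartan matrix is the transpose. -/
def IsColabeling {S : Type*} [Fintype S] (A : Matrix S S ℤ) (k : S → ℤ) : Prop :=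
  IsLabeling Aᵀ k

/-! ### Local models -/

/-- The values `1/2`, `1`, `2` and the formal symbol `i` of the inhomogeneous models. -/
inductive Factor
  | half
  | one
  | two
  | inh

/-- The vertices of `Fin n` whose number (counted from `0`) occurs in `l`. -/
def nodes {n : ℕ} (l : List ℕ) : Set (Fin n) := {x | (x : ℕ) ∈ l}

/-- The combinatorial data of a local model: a Dynkin diagram, the decorated vertices, the factor
`c` and, in the homogeneous case, the coefficients of the weight `ω` with respect to the simple
roots. (The field `weight` is not used for inhomogeneous models.) -/
structure LocalModel where
  rank : ℕ
  cartan : Matrix (Fin rank) (Fin rank) ℤ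
  dec : Set (Fin rank)
  factor : Factor
  weight : Fin rank → ℚ

open CartanMatrix in
/-- The table of local models. The vertices of `A n`, `B n`, `C n`, `D n`, `F₄` have the usual order
(but start with `0`); in `G₂` vertex `0` is long and vertex `1` is short; `D 3` is the diagram
of type `A₃` with middle vertex `0`, and `D 2` is `A₁ × A₁`. -/
inductive IsLocalModel : LocalModel → Prop
  | a (n : ℕ) (h : 1 ≤ n) : IsLocalModel ⟨n, A n, nodes [0, n - 1], .one, fun _ => 1⟩
  | two_a_one : IsLocalModel ⟨1, A 1, nodes [0], .two, fun _ => 2⟩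
  | b (n : ℕ) (h : 2 ≤ n) : IsLocalModel ⟨n, B n, nodes [0], .one, fun _ => 1⟩
  | two_b (n : ℕ) (h : 2 ≤ n) : IsLocalModel ⟨n, B n, nodes [0], .two, fun _ => 2⟩
  | c (n : ℕ) (h : 3 ≤ n) : IsLocalModel
      ⟨n, C n, nodes [1], .one, fun i => if (i : ℕ) = 0 ∨ (i : ℕ) + 1 = n then 1 else 2⟩
  | half_d (n : ℕ) (h : 3 ≤ n) : IsLocalModel
      ⟨n, D n, nodes [0], .half, fun i => if (i : ℕ) + 2 < n then 1 else 1 / 2⟩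
  | d (n : ℕ) (h : 3 ≤ n) : IsLocalModel
      ⟨n, D n, nodes [0], .one, fun i => if (i : ℕ) + 2 < n then 2 else 1⟩
  | half_d_two : IsLocalModel ⟨2, D 2, nodes [0, 1], .half, fun _ => 1 / 2⟩
  | d_two : IsLocalModel ⟨2, D 2, nodes [0, 1], .one, fun _ => 1⟩
  | f_four : IsLocalModel ⟨4, F₄, nodes [3], .one, ![1, 2, 3, 2]⟩
  | g_two : IsLocalModel ⟨2, G₂, nodes [1], .one, ![1, 2]⟩
  | two_g_two : IsLocalModel ⟨2, G₂, nodes [1], .two, ![2, 4]⟩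
  | half_b_three' : IsLocalModel ⟨3, B 3, nodes [2], .half, ![1 / 2, 1, 3 / 2]⟩
  | b_three' : IsLocalModel ⟨3, B 3, nodes [2], .one, ![1, 2, 3]⟩
  | inh_a (n : ℕ) : IsLocalModel ⟨n, A n, nodes [0], .inh, 0⟩
  | inh_c (n : ℕ) (h : 2 ≤ n) : IsLocalModel ⟨n, C n, nodes [0], .inh, 0⟩

/-- The embedding `e` identifies the local model `M` with the full subdiagram `T` of `A`,
its decorated vertices with `T'` and its factor with `c`; so `(T, T', c)` is a local diagram. -/
structure LocalModel.Identifies {S : Type*} (M : LocalModel) (e : Fin M.rank ↪ S)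
    (A : Matrix S S ℤ) (T T' : Set S) (c : Factor) : Prop where
  isLocalModel : IsLocalModel M
  range_eq : Set.range e = T
  image_dec : e '' M.dec = T'
  factor_eq : M.factor = c
  cartan_eq : ∀ i j, A (e i) (e j) = M.cartan i j

/-- The pairing `⟨ω, β^∨⟩` of the weight of a homogeneous local diagram with a simple coroot. -/
def LocalModel.pair {S : Type*} (M : LocalModel) (e : Fin M.rank ↪ S) (A : Matrix S S ℤ)
    (β : S) : ℚ :=
  ∑ i, M.weight i * (A (e i) β : ℚ)

/-! ### Primitive spherical diagrams -/

/-- Quintuples `(S, S₁', c₁, S₂', c₂)`, where `S` is given by its Cartan matrix. -/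
structure Diagram (S : Type*) where
  cartan : Matrix S S ℤ
  dec₁ : Set S
  c₁ : Factor
  dec₂ : Set S
  c₂ : Factor

namespace Diagram

variable {S T : Type*}

/-- `S₁`, the connected closure of `S₁'` in `S ∖ S₂'`. -/
def part₁ (D : Diagram S) : Set S := closureIn (graph D.cartan) D.dec₁ D.dec₂ᶜ

/-- `S₂`, the connected closure of `S₂'` in `S ∖ S₁'`. -/
def part₂ (D : Diagram S) : Set S := closureIn (graph D.cartan) D.dec₂ D.dec₁ᶜ

/-- Primitive spherical diagrams. The weights of the two local diagrams do not depend on the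
chosen identifications with the local models. An element of the span of the gradients of the simple
roots is zero if and only if its pairing with every simple coroot is zero. An inhomogeneous local
diagram has exactly one decorated vertex unless it is empty. -/
def IsPrimitiveSpherical [Fintype S] (D : Diagram S) : Prop :=
  IsDynkin D.cartan ∧ Disjoint D.dec₁ D.dec₂ ∧ D.part₁ ∪ D.part₂ = Set.univ ∧
  ∃ (M₁ M₂ : LocalModel) (e₁ : Fin M₁.rank ↪ S) (e₂ : Fin M₂.rank ↪ S),
    M₁.Identifies e₁ D.cartan D.part₁ D.dec₁ D.c₁ ∧
    M₂.Identifies e₂ D.cartan D.part₂ D.dec₂ D.c₂ ∧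
    (D.c₁ ≠ .inh → D.c₂ ≠ .inh → ∀ β, M₁.pair e₁ D.cartan β + M₂.pair e₂ D.cartan β = 0) ∧
    (D.c₁ ≠ .inh → D.c₂ = .inh → ∀ β ∈ D.dec₂, M₁.pair e₁ D.cartan β = -1) ∧
    (D.c₁ = .inh → D.c₂ ≠ .inh → ∀ α ∈ D.dec₁, M₂.pair e₂ D.cartan α = -1) ∧
    (D.c₁ = .inh → D.c₂ = .inh → IsAffineType D.cartan → (graph D.cartan).Connected →
      ∀ k, IsColabeling D.cartan k → ∀ α ∈ D.dec₁, ∀ β ∈ D.dec₂, k α = k β)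

/-- Isomorphism of quintuples, up to interchanging the indices `1` and `2`. -/
def IsIsomorphic (D : Diagram S) (E : Diagram T) : Prop :=
  ∃ e : S ≃ T, (∀ i j, E.cartan (e i) (e j) = D.cartan i j) ∧
    ((e '' D.dec₁ = E.dec₁ ∧ D.c₁ = E.c₁ ∧ e '' D.dec₂ = E.dec₂ ∧ D.c₂ = E.c₂) ∨
      (e '' D.dec₁ = E.dec₂ ∧ D.c₁ = E.c₂ ∧ e '' D.dec₂ = E.dec₁ ∧ D.c₂ = E.c₁))

end Diagram

/-! ### Affine Cartan matrices

The matrices below have the vertices `0, …, n`. -/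

/-- Entries of a simply laced chain `0 - 1 - 2 - ⋯`. -/
def link (i j : ℕ) : ℤ := if i = j then 2 else if i + 1 = j ∨ j + 1 = i then -1 else 0

/-- Entries of a simply laced chain `1 - 2 - 3 - ⋯` with a further vertex `0` joined to `2`. -/
def forkLink (i j : ℕ) : ℤ :=
  if i = 0 ∧ j = 2 ∨ i = 2 ∧ j = 0 then -1
  else if i = 0 ∧ j ≠ 0 ∨ i ≠ 0 ∧ j = 0 then 0
  else link i j

/-- `A₁⁽¹⁾` -/
def affA1 : Matrix (Fin 2) (Fin 2) ℤ := !![2, -2; -2, 2]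

/-- `A₂⁽²⁾`; vertex `0` is short, vertex `1` is long. -/
def twA2 : Matrix (Fin 2) (Fin 2) ℤ := !![2, -1; -4, 2]

/-- `Aₙ⁽¹⁾`, `n ≥ 2`: a cycle. -/
def affA (n : ℕ) : Matrix (Fin (n + 1)) (Fin (n + 1)) ℤ := of fun i j =>
  if i.val = 0 ∧ j.val = n ∨ i.val = n ∧ j.val = 0 then -1 else link i j

/-- `Bₙ⁽¹⁾`, `n ≥ 3`: vertices `0`, `1` are joined to `2`; vertex `n` is short. -/
def affB (n : ℕ) : Matrix (Fin (n + 1)) (Fin (n + 1)) ℤ := of fun i j =>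
  if i.val + 1 = n ∧ j.val = n then -2 else forkLink i j

/-- `Cₙ⁽¹⁾`, `n ≥ 2`: a chain; vertices `0` and `n` are long. -/
def affC (n : ℕ) : Matrix (Fin (n + 1)) (Fin (n + 1)) ℤ := of fun i j =>
  if i.val = 0 ∧ j.val = 1 ∨ i.val = n ∧ j.val + 1 = n then -2 else link i j

/-- `Dₙ⁽¹⁾`, `n ≥ 4`: vertices `0`, `1` are joined to `2`, and `n - 1`, `n` to `n - 2`. -/
def affD (n : ℕ) : Matrix (Fin (n + 1)) (Fin (n + 1)) ℤ := of fun i j =>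
  if i.val = n ∧ j.val + 2 = n ∨ i.val + 2 = n ∧ j.val = n then -1
  else if i.val = n ∧ j.val ≠ n ∨ i.val ≠ n ∧ j.val = n then 0
  else forkLink i j

/-- `A₂ₙ⁽²⁾`, `n ≥ 2`: a chain; vertex `0` is short and vertex `n` is long. -/
def twAeven (n : ℕ) : Matrix (Fin (n + 1)) (Fin (n + 1)) ℤ := of fun i j =>
  if i.val = 1 ∧ j.val = 0 ∨ i.val = n ∧ j.val + 1 = n then -2 else link i j

/-- `A₂ₙ₋₁⁽²⁾`, `n ≥ 3`: vertices `0`, `1` are joined to `2`; vertex `n` is long. -/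
def twAodd (n : ℕ) : Matrix (Fin (n + 1)) (Fin (n + 1)) ℤ := of fun i j =>
  if i.val = n ∧ j.val + 1 = n then -2 else forkLink i j

/-- `Dₙ₊₁⁽²⁾`, `n ≥ 2`: a chain; vertices `0` and `n` are short. -/
def twD (n : ℕ) : Matrix (Fin (n + 1)) (Fin (n + 1)) ℤ := of fun i j =>
  if i.val = 1 ∧ j.val = 0 ∨ i.val + 1 = n ∧ j.val = n then -2 else link i j

/-- `F₄⁽¹⁾`; vertices `3`, `4` are short. -/
def affF4 : Matrix (Fin 5) (Fin 5) ℤ :=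
  !![ 2, -1,  0,  0,  0;
     -1,  2, -1,  0,  0;
      0, -1,  2, -2,  0;
      0,  0, -1,  2, -1;
      0,  0,  0, -1,  2]

/-- `E₆⁽²⁾`; vertices `3`, `4` are long. -/
def twE6 : Matrix (Fin 5) (Fin 5) ℤ :=
  !![ 2, -1,  0,  0,  0;
     -1,  2, -1,  0,  0;
      0, -1,  2, -1,  0;
      0,  0, -2,  2, -1;
      0,  0,  0, -1,  2]

/-- `G₂⁽¹⁾`; vertex `2` is short. -/
def affG2 : Matrix (Fin 3) (Fin 3) ℤ := !![2, -1, 0; -1, 2, -3; 0, -1, 2]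

/-- `D₄⁽³⁾`; vertex `2` is long. -/
def twD4 : Matrix (Fin 3) (Fin 3) ℤ := !![2, -1, 0; -1, 2, -1; 0, -3, 2]

/-! ### The list of primitive diagrams -/

/-- The quintuple on the diagram `X` with decorated sets `l₁`, `l₂` and factors `c₁`, `c₂`. -/
def single {n : ℕ} (X : Matrix (Fin n) (Fin n) ℤ) (l₁ : List ℕ) (c₁ : Factor) (l₂ : List ℕ)
    (c₂ : Factor) : Diagram (Fin n) :=
  ⟨X, nodes l₁, c₁, nodes l₂, c₂⟩

/-- The quintuple on the disjoint union of the diagrams `X` and `Y`, whose decorated sets consist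
of the vertices `l₁`, `l₂` of `X` and the vertices `r₁`, `r₂` of `Y`. -/
def double {m n : ℕ} (X : Matrix (Fin m) (Fin m) ℤ) (Y : Matrix (Fin n) (Fin n) ℤ)
    (l₁ r₁ : List ℕ) (c₁ : Factor) (l₂ r₂ : List ℕ) (c₂ : Factor) : Diagram (Fin m ⊕ Fin n) :=
  ⟨fromBlocks X 0 0 Y, Sum.inl '' nodes l₁ ∪ Sum.inr '' nodes r₁, c₁,
    Sum.inl '' nodes l₂ ∪ Sum.inr '' nodes r₂, c₂⟩

open CartanMatrix in
/-- The list of primitive diagrams. The name of an entry gives the type of `S`, followed by the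
types of the two local diagrams, where `aa` and `cc` denote the inhomogeneous models, `hd` is
`1/2 d`, and `x` separates the factors of a product. The conventions `b₁ = a₁`, `2b₁ = 2a₁`,
`c₂ = b₂`, `cc₁ = aa₁` are used at the boundary of the parameter range. -/
inductive IsListed : {T : Type} → Diagram T → Prop
  -- affine, irreducible
  | affA1_aa_aa : IsListed (single affA1 [0] .inh [1] .inh)
  | affA1_a_a (c : Factor) (hc : c = .one ∨ c = .two) : IsListed (single affA1 [0] c [1] c)
  | affA_aa_aa (n : ℕ) (hn : 2 ≤ n) : IsListed (single (affA n) [0] .inh [1] .inh)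
  | affA_a_a (n p : ℕ) (hn : 2 ≤ n) (hp : 1 ≤ p) (hpn : p ≤ n) :
      IsListed (single (affA n) [0, p - 1] .one [p, n] .one)
  | affA3_d3_d3 (c : Factor) (hc : c = .one ∨ c = .half) : IsListed (single (affA 3) [0] c [2] c)
  | affA3_d2_d2 (c : Factor) (hc : c = .one ∨ c = .half) :
      IsListed (single (affA 3) [0, 2] c [1, 3] c)
  | affB_b_b (n : ℕ) (c : Factor) (hn : 3 ≤ n) (hc : c = .one ∨ c = .two) :
      IsListed (single (affB n) [0] c [1] c)
  | affB_d_2b (n p : ℕ) (hp : 3 ≤ p) (hpn : p ≤ n) :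
      IsListed (single (affB n) [p - 1] .one [p] .two)
  | affB_hd_b (n p : ℕ) (hp : 3 ≤ p) (hpn : p ≤ n) :
      IsListed (single (affB n) [p - 1] .half [p] .one)
  | affB_d2_2b (n : ℕ) (hn : 3 ≤ n) : IsListed (single (affB n) [0, 1] .one [2] .two)
  | affB_hd2_b (n : ℕ) (hn : 3 ≤ n) : IsListed (single (affB n) [0, 1] .half [2] .one)
  | affB3_aa_hb' : IsListed (single (affB 3) [0] .inh [3] .half)
  | affB3_hd2_aa : IsListed (single (affB 3) [0, 3] .half [2] .inh)
  | affC_cc_cc (n p : ℕ) (hn : 2 ≤ n) (hp : 1 ≤ p) (hpn : p ≤ n) :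
      IsListed (single (affC n) [p - 1] .inh [p] .inh)
  | affC_c_c (n p : ℕ) (hpn : p + 2 ≤ n) : IsListed (single (affC n) [p] .one [p + 2] .one)
  | affC2_2b_2b : IsListed (single (affC 2) [0] .two [2] .two)
  | affC_hd2_a (n : ℕ) (hn : 2 ≤ n) : IsListed (single (affC n) [0, n] .half [1, n - 1] .one)
  | affC2_d2_2a : IsListed (single (affC 2) [0, 2] .one [1] .two)
  | affD_d_d (n : ℕ) (c : Factor) (hn : 4 ≤ n) (hc : c = .one ∨ c = .half) :
      IsListed (single (affD n) [0] c [1] c)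
  | affD_d_d' (n p : ℕ) (c : Factor) (hp : 3 ≤ p) (hpn : p + 2 ≤ n) (hc : c = .one ∨ c = .half) :
      IsListed (single (affD n) [p - 1] c [p] c)
  | affD_d2_d (n : ℕ) (c : Factor) (hn : 4 ≤ n) (hc : c = .one ∨ c = .half) :
      IsListed (single (affD n) [0, 1] c [2] c)
  | affD_a_a (n : ℕ) (hn : 4 ≤ n) : IsListed (single (affD n) [0, n - 1] .one [1, n] .one)
  | affF4_b_f : IsListed (single affF4 [0] .one [4] .one)
  | affF4_hd3_c : IsListed (single affF4 [1] .half [3] .one)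
  | affF4_aa_a : IsListed (single affF4 [2] .inh [3, 4] .one)
  | affG2_aa_g : IsListed (single affG2 [0] .inh [2] .one)
  | affG2_aa_a : IsListed (single affG2 [1] .inh [2] .one)
  | affG2_hd2_aa : IsListed (single affG2 [0, 2] .half [1] .inh)
  | twA2_a_aa : IsListed (single twA2 [0] .one [1] .inh)
  | twA2_2a_a : IsListed (single twA2 [0] .two [1] .one)
  | twAeven_b_cc (n p : ℕ) (hn : 2 ≤ n) (hp : 1 ≤ p) (hpn : p ≤ n) :
      IsListed (single (twAeven n) [p - 1] .one [p] .inh)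
  | twAeven_2b_a (n : ℕ) (hn : 2 ≤ n) : IsListed (single (twAeven n) [n - 1] .two [n] .one)
  | twAodd_cc_cc (n : ℕ) (hn : 3 ≤ n) : IsListed (single (twAodd n) [0] .inh [1] .inh)
  | twAodd_a_c (n : ℕ) (hn : 3 ≤ n) : IsListed (single (twAodd n) [0] .one [2] .one)
  | twAodd_hd_cc (n p : ℕ) (hp : 3 ≤ p) (hpn : p ≤ n) :
      IsListed (single (twAodd n) [p - 1] .half [p] .inh)
  | twAodd_hd2_cc (n : ℕ) (hn : 3 ≤ n) : IsListed (single (twAodd n) [0, 1] .half [2] .inh)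
  | twAodd_d_a (n : ℕ) (hn : 3 ≤ n) : IsListed (single (twAodd n) [n - 1] .one [n] .one)
  | twAodd_a3_c (n : ℕ) (hn : 3 ≤ n) : IsListed (single (twAodd n) [0, 1] .one [3] .one)
  | twD_b_b (n p : ℕ) (c : Factor) (hn : 2 ≤ n) (hp : 1 ≤ p) (hpn : p ≤ n)
      (hc : c = .one ∨ c = .two) : IsListed (single (twD n) [p - 1] c [p] c)
  | twD_d2_a (n : ℕ) (hn : 2 ≤ n) : IsListed (single (twD n) [0, n] .one [1, n - 1] .one)
  | twD3_cc_cc : IsListed (single (twD 2) [0] .inh [2] .inh)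
  | twD3_hd2_aa : IsListed (single (twD 2) [0, 2] .half [1] .inh)
  | twD4_b'_b' (c : Factor) (hc : c = .one ∨ c = .half) : IsListed (single (twD 3) [0] c [3] c)
  | twD4_d2_d2 (c : Factor) (hc : c = .one ∨ c = .half) :
      IsListed (single (twD 3) [0, 2] c [1, 3] c)
  | twE6_a_f : IsListed (single twE6 [0] .one [1] .one)
  | twE6_c_b : IsListed (single twE6 [1] .one [4] .one)
  | twE6_a_aa : IsListed (single twE6 [0, 2] .one [3] .inh)
  | triD4_a_g (c : Factor) (hc : c = .one ∨ c = .two) : IsListed (single twD4 [0] c [1] c)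
  | triD4_a_aa : IsListed (single twD4 [0, 1] .one [2] .inh)
  | triD4_d2_2a : IsListed (single twD4 [0, 2] .one [1] .two)
  | triD4_hd2_a : IsListed (single twD4 [0, 2] .half [1] .one)
  -- affine, reducible
  | affA1xaffA1_d2_d2 (c : Factor) (hc : c = .one ∨ c = .half) :
      IsListed (double affA1 affA1 [0] [0] c [1] [1] c)
  | twA2xtwA2_d2_hd2 : IsListed (double twA2 twA2 [0] [0] .one [1] [1] .half)
  -- finite, irreducible or empty
  | empty : IsListed (single (A 0) [] .inh [] .inh)
  | A_aa (n : ℕ) (hn : 1 ≤ n) : IsListed (single (A n) [0] .inh [] .inh)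
  | A_a (n : ℕ) (hn : 1 ≤ n) : IsListed (single (A n) [0, n - 1] .one [] .inh)
  | A1_2a : IsListed (single (A 1) [0] .two [] .inh)
  | A3_d3 (c : Factor) (hc : c = .one ∨ c = .half) : IsListed (single (A 3) [1] c [] .inh)
  | A_aa_aa (n p : ℕ) (hp : 1 ≤ p) (hpn : p + 1 ≤ n) :
      IsListed (single (A n) [p - 1] .inh [p] .inh)
  | A_aa_aa' (n : ℕ) (hn : 3 ≤ n) : IsListed (single (A n) [0] .inh [n - 1] .inh)
  | A_aa_a (n p : ℕ) (hp : 1 ≤ p) (hpn : p + 1 ≤ n) :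
      IsListed (single (A n) [p - 1] .inh [p, n - 1] .one)
  | A3_hd2_aa : IsListed (single (A 3) [0, 2] .half [1] .inh)
  | A4_aa_d3 : IsListed (single (A 4) [0] .inh [2] .one)
  | B_b (n : ℕ) (c : Factor) (hn : 2 ≤ n) (hc : c = .one ∨ c = .two) :
      IsListed (single (B n) [0] c [] .inh)
  | B3_b' (c : Factor) (hc : c = .one ∨ c = .half) : IsListed (single (B 3) [2] c [] .inh)
  | B_aa_b (n p : ℕ) (hp : 1 ≤ p) (hpn : p + 1 ≤ n) :
      IsListed (single (B n) [p - 1] .inh [p] .one)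
  | B_aa_aa (n : ℕ) (hn : 2 ≤ n) : IsListed (single (B n) [n - 2] .inh [n - 1] .inh)
  | B3_aa_cc : IsListed (single (B 3) [0] .inh [2] .inh)
  | B3_hd2_aa : IsListed (single (B 3) [0, 2] .half [1] .inh)
  | B4_aa_b' : IsListed (single (B 4) [0] .inh [3] .one)
  | B4_hd3_cc : IsListed (single (B 4) [1] .half [3] .inh)
  | C_cc (n : ℕ) (hn : 2 ≤ n) : IsListed (single (C n) [0] .inh [] .inh)
  | C_c (n : ℕ) (hn : 3 ≤ n) : IsListed (single (C n) [1] .one [] .inh)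
  | C_aa_cc (n p : ℕ) (hn : 3 ≤ n) (hp : 1 ≤ p) (hpn : p + 1 ≤ n) :
      IsListed (single (C n) [p - 1] .inh [p] .inh)
  | C_a_cc (n p : ℕ) (hn : 3 ≤ n) (hp : 1 ≤ p) (hpn : p + 1 ≤ n) :
      IsListed (single (C n) [0, p - 1] .one [p] .inh)
  | C_aa_c (n : ℕ) (hn : 3 ≤ n) : IsListed (single (C n) [0] .inh [2] .one)
  | D_d (n : ℕ) (c : Factor) (hn : 4 ≤ n) (hc : c = .one ∨ c = .half) :
      IsListed (single (D n) [0] c [] .inh)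
  | D_aa_hd (n p : ℕ) (hn : 4 ≤ n) (hp : 1 ≤ p) (hpn : p + 3 ≤ n) :
      IsListed (single (D n) [p - 1] .inh [p] .half)
  | D_aa_hd2 (n : ℕ) (hn : 4 ≤ n) : IsListed (single (D n) [n - 3] .inh [n - 2, n - 1] .half)
  | D_aa_aa (n : ℕ) (hn : 4 ≤ n) : IsListed (single (D n) [n - 2] .inh [n - 1] .inh)
  | D_a_aa (n : ℕ) (hn : 4 ≤ n) : IsListed (single (D n) [0, n - 2] .one [n - 1] .inh)
  | D5_aa_d : IsListed (single (D 5) [0] .inh [3] .one)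
  | F4_f : IsListed (single F₄ [3] .one [] .inh)
  | F4_aa_c : IsListed (single F₄ [0] .inh [2] .one)
  | F4_b_cc : IsListed (single F₄ [0] .one [3] .inh)
  | F4_aa_aa : IsListed (single F₄ [1] .inh [2] .inh)
  | F4_aa_a : IsListed (single F₄ [1] .inh [2, 3] .one)
  | G2_g (c : Factor) (hc : c = .one ∨ c = .two) : IsListed (single G₂ [1] c [] .inh)
  | G2_aa_aa : IsListed (single G₂ [0] .inh [1] .inh)
  | G2_aa_a : IsListed (single G₂ [0] .inh [1] .one)
  -- finite, reducible
  | A1xA1_d2 (c : Factor) (hc : c = .one ∨ c = .half) :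
      IsListed (double (A 1) (A 1) [0] [0] c [] [] .inh)
  | AxA_aa_aa (m n : ℕ) (hm : 1 ≤ m) (hn : 1 ≤ n) :
      IsListed (double (A m) (A n) [0] [] .inh [] [0] .inh)
  | AxC_aa_cc (m n : ℕ) (hm : 1 ≤ m) (hn : 2 ≤ n) :
      IsListed (double (A m) (C n) [0] [] .inh [] [0] .inh)
  | CxC_cc_cc (m n : ℕ) (hm : 2 ≤ m) (hn : 2 ≤ n) :
      IsListed (double (C m) (C n) [0] [] .inh [] [0] .inh)
  | A1xA_d2_aa (n : ℕ) (hn : 2 ≤ n) : IsListed (double (A 1) (A n) [0] [0] .one [] [1] .inh)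
  | A1xB_d2_aa (n : ℕ) (hn : 2 ≤ n) :
      IsListed (double (A 1) (B n) [0] [n - 1] .one [] [n - 2] .inh)
  | A1xC_d2_cc (n : ℕ) (hn : 3 ≤ n) : IsListed (double (A 1) (C n) [0] [0] .one [] [1] .inh)
  | A1xC_hd2_aa (n : ℕ) (hn : 2 ≤ n) :
      IsListed (double (A 1) (C n) [0] [n - 1] .half [] [n - 2] .inh)
  | A1xG2_d2_aa : IsListed (double (A 1) G₂ [0] [1] .one [] [0] .inh)

end PrimSph

namespace PrimSph

open Matrix

/-! ### Chains and forks with vertices indexed by natural numbers -/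

/-! The connected closures `S₁`, `S₂` are used only through adjacency (`Glue`): a vertex outside
`S₁'` which is adjacent to `S₂` lies in `S₂`, and symmetrically. So the two local diagrams determine
the Cartan matrix of `S` once it is known which vertices they share and how `S₁'` is bonded to
`S₂'`. Both are restricted so severely by condition 3 and by the finite or affine type that going
through all pairs of local models is feasible. The classification of finite and affine diagrams is
not needed.

Disjoint parts. Every bond between the parts joins decorated vertices (`Glue.cross_eq_zero`), of
which each part has at most two. If both parts are homogeneous, `ω₁ + ω₂ = 0` is evaluated on the
decorated coroots; the resulting equations for the Cartan integers of the bonds either have no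
admissible solution or lead to an entry of the list. The type of `S` plays no role here. If only the
first part is homogeneous, the condition on its weight prescribes its pairing with the decorated
coroot of the other part, while the Cartan integers `-q` in the opposite direction are merely
bounded by the type: a nonzero vector `v ≥ 0` with `A v ≤ 0` excludes finite type and satisfies `A v
= 0` in affine type (`IsDynkin.mulVec_eq_zero`). The test vectors decrease along the inhomogeneous
chain like affine labels (`Caps.point`, `Caps.two` and so on). Two inhomogeneous parts are treated
by the same bounds; some of the extremal, affine cases are then discarded because the colabels of
the decorated vertices differ (`Edge.colabel_eq`).

Common vertices. They are undecorated, and `S₁ ∩ S₂` is a union of connected components of both `S₁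
∖ S₁'` and `S₂ ∖ S₂'`. In the local models such a component is a chain (`Arm`), apart from the fork
left over from `D n` with `n ≥ 5`. Two chains with a common vertex coincide up to direction
(`Arm.eq_or_reverse`), two forks coincide up to their leaves (`Glue.fork_eq`), and a fork never
meets a chain (`Glue.not_common_fork`). If one part is homogeneous, a common neighbour of a
decorated vertex contributes to the pairing of the weight of the other part. All contributions have
the same sign and the total is prescribed, so either the remaining bonds vanish or there is a
contradiction (`HomHom.bound`, `HomInh.bound`). For two inhomogeneous parts test vectors decide
again (`InhInh.eq_zero_of_common`).

Once the matrix is known, the isomorphism with an entry is an explicit matching of vertices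
(`Glue.listed_of_disjoint`, `Glue.listed_of_common`, `listed_of_double`). -/

/-- Entries of a chain `0 - 1 - ⋯ - (n - 1)` whose last bond is `(-r, -s)`. -/
def chain (r s : ℤ) (n i j : ℕ) : ℤ :=
  if i = j then 2
  else if i + 1 = j then (if j + 1 = n then -r else -1)
  else if j + 1 = i then (if i + 1 = n then -s else -1)
  else 0

/-- Entries of the Cartan matrix of type `D n`. -/
def fork (n i j : ℕ) : ℤ :=
  if i = j then 2
  else if n ≤ 2 then 0
  else if i + 1 = j ∧ j + 2 < n then -1
  else if j + 1 = i ∧ i + 2 < n then -1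
  else if i + 3 = n ∧ (j + 2 = n ∨ j + 1 = n) then -1
  else if j + 3 = n ∧ (i + 2 = n ∨ i + 1 = n) then -1
  else 0

/-- Entries of the Cartan matrix of type `F₄`. -/
def chainF (i j : ℕ) : ℤ := if i = 1 ∧ j = 2 then -2 else link i j

attribute [grind =] chain fork chainF link forkLink

/-! ### Entries of the listed matrices -/

/-- The extension of a matrix by zero. -/
def ext {N : ℕ} (X : Matrix (Fin N) (Fin N) ℤ) (i j : ℕ) : ℤ :=
  if h : i < N ∧ j < N then X ⟨i, h.1⟩ ⟨j, h.2⟩ else 0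

theorem ext_of_lt {N : ℕ} (X : Matrix (Fin N) (Fin N) ℤ) {i j : ℕ} (hi : i < N) (hj : j < N) :
    ext X i j = X ⟨i, hi⟩ ⟨j, hj⟩ :=
  dif_pos ⟨hi, hj⟩

section Entries

variable (n i j : ℕ)

theorem A_apply (hi : i < n) (hj : j < n) : CartanMatrix.A n ⟨i, hi⟩ ⟨j, hj⟩ = chain 1 1 n i j := by
  simp only [CartanMatrix.A, of_apply, Fin.mk.injEq, chain]
  grind

theorem B_apply (hi : i < n) (hj : j < n) : CartanMatrix.B n ⟨i, hi⟩ ⟨j, hj⟩ = chain 2 1 n i j := by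
  simp only [CartanMatrix.B, of_apply, Fin.mk.injEq, chain]
  grind

theorem C_apply (hi : i < n) (hj : j < n) : CartanMatrix.C n ⟨i, hi⟩ ⟨j, hj⟩ = chain 1 2 n i j := by
  simp only [CartanMatrix.C, of_apply, Fin.mk.injEq, chain]
  grind

theorem D_apply (hi : i < n) (hj : j < n) : CartanMatrix.D n ⟨i, hi⟩ ⟨j, hj⟩ = fork n i j := by
  simp only [CartanMatrix.D, of_apply, Fin.mk.injEq, fork]

theorem F₄_apply (hi : i < 4) (hj : j < 4) : CartanMatrix.F₄ ⟨i, hi⟩ ⟨j, hj⟩ = chainF i j := by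
  interval_cases i <;> interval_cases j <;> rfl

theorem G₂_apply (hi : i < 2) (hj : j < 2) :
    CartanMatrix.G₂ ⟨i, hi⟩ ⟨j, hj⟩ = chain 3 1 2 i j := by
  interval_cases i <;> interval_cases j <;> rfl

@[grind =]
theorem ext_affA1 (hi : i < 2) (hj : j < 2) : ext affA1 i j =
    if i = j then 2 else -2 := by
  rw [ext_of_lt _ hi hj]
  interval_cases i <;> interval_cases j <;> rfl

@[grind =]
theorem ext_twA2 (hi : i < 2) (hj : j < 2) : ext twA2 i j =
    if i = j then 2 else if i = 0 then -1 else -4 := by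
  rw [ext_of_lt _ hi hj]
  interval_cases i <;> interval_cases j <;> rfl

@[grind =]
theorem ext_twE6 (hi : i < 5) (hj : j < 5) : ext twE6 i j =
    if i = 3 ∧ j = 2 then -2 else link i j := by
  rw [ext_of_lt _ hi hj]
  interval_cases i <;> interval_cases j <;> rfl

@[grind =]
theorem ext_affF4 (hi : i < 5) (hj : j < 5) : ext affF4 i j =
    if i = 2 ∧ j = 3 then -2 else link i j := by
  rw [ext_of_lt _ hi hj]
  interval_cases i <;> interval_cases j <;> rfl

@[grind =]
theorem ext_affG2 (hi : i < 3) (hj : j < 3) : ext affG2 i j =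
    if i = 1 ∧ j = 2 then -3 else link i j := by
  rw [ext_of_lt _ hi hj]
  interval_cases i <;> interval_cases j <;> rfl

@[grind =]
theorem ext_twD4 (hi : i < 3) (hj : j < 3) : ext twD4 i j =
    if i = 2 ∧ j = 1 then -3 else link i j := by
  rw [ext_of_lt _ hi hj]
  interval_cases i <;> interval_cases j <;> rfl

@[grind =]
theorem ext_A (hi : i < n) (hj : j < n) : ext (CartanMatrix.A n) i j = chain 1 1 n i j := by
  rw [ext_of_lt _ hi hj, A_apply]

@[grind =]
theorem ext_B (hi : i < n) (hj : j < n) : ext (CartanMatrix.B n) i j = chain 2 1 n i j := by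
  rw [ext_of_lt _ hi hj, B_apply]

@[grind =]
theorem ext_C (hi : i < n) (hj : j < n) : ext (CartanMatrix.C n) i j = chain 1 2 n i j := by
  rw [ext_of_lt _ hi hj, C_apply]

@[grind =]
theorem ext_D (hi : i < n) (hj : j < n) : ext (CartanMatrix.D n) i j = fork n i j := by
  rw [ext_of_lt _ hi hj, D_apply]

@[grind =]
theorem ext_F₄ (hi : i < 4) (hj : j < 4) : ext CartanMatrix.F₄ i j = chainF i j := by
  rw [ext_of_lt _ hi hj, F₄_apply]

@[grind =]
theorem ext_G₂ (hi : i < 2) (hj : j < 2) : ext CartanMatrix.G₂ i j = chain 3 1 2 i j := by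
  rw [ext_of_lt _ hi hj, G₂_apply]

variable (hi : i < n + 1) (hj : j < n + 1)

include hi hj

@[grind =]
theorem ext_affA : ext (affA n) i j =
    if i = 0 ∧ j = n ∨ i = n ∧ j = 0 then -1 else link i j := by
  rw [ext_of_lt _ hi hj]
  rfl

@[grind =]
theorem ext_affB : ext (affB n) i j =
    if i + 1 = n ∧ j = n then -2 else forkLink i j := by
  rw [ext_of_lt _ hi hj]
  rfl

@[grind =]
theorem ext_affC : ext (affC n) i j =
    if i = 0 ∧ j = 1 ∨ i = n ∧ j + 1 = n then -2 else link i j := by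
  rw [ext_of_lt _ hi hj]
  rfl

@[grind =]
theorem ext_affD : ext (affD n) i j =
    if i = n ∧ j + 2 = n ∨ i + 2 = n ∧ j = n then -1
    else if i = n ∧ j ≠ n ∨ i ≠ n ∧ j = n then 0 else forkLink i j := by
  rw [ext_of_lt _ hi hj]
  rfl

@[grind =]
theorem ext_twAeven : ext (twAeven n) i j =
    if i = 1 ∧ j = 0 ∨ i = n ∧ j + 1 = n then -2 else link i j := by
  rw [ext_of_lt _ hi hj]
  rfl

@[grind =]
theorem ext_twAodd : ext (twAodd n) i j =
    if i = n ∧ j + 1 = n then -2 else forkLink i j := by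
  rw [ext_of_lt _ hi hj]
  rfl

@[grind =]
theorem ext_twD : ext (twD n) i j =
    if i = 1 ∧ j = 0 ∨ i + 1 = n ∧ j = n then -2 else link i j := by
  rw [ext_of_lt _ hi hj]
  rfl

end Entries

/-! ### Models and parts -/

/-- The data of a local model with doubled weights, whose vertices are natural numbers. -/
structure Model where
  rank : ℕ
  entry : ℕ → ℕ → ℤ
  dec : List ℕ
  weight : ℕ → ℤ

/-- The model `a n`, `n ≥ 2`. -/
abbrev mA (n : ℕ) : Model := ⟨n, chain 1 1 n, [0, n - 1], fun _ => 2⟩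

/-- The model `b n`, for `n = 1` the model `a 1`, with weight multiplied by `k`. -/
abbrev mB (n : ℕ) (k : ℤ) : Model := ⟨n, chain 2 1 n, [0], fun _ => 2 * k⟩

/-- The model `c n`. -/
abbrev mC (n : ℕ) : Model := ⟨n, chain 1 2 n, [1], fun i => if i = 0 ∨ i + 1 = n then 2 else 4⟩

/-- The model `d n`, `n ≥ 3`, with weight multiplied by `k / 2`. -/
abbrev mD (n : ℕ) (k : ℤ) : Model := ⟨n, fork n, [0], fun i => if i + 2 < n then 2 * k else k⟩

/-- The model `d 2` with weight multiplied by `k / 2`. -/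
abbrev mDD (k : ℤ) : Model := ⟨2, fork 2, [0, 1], fun _ => k⟩

/-- The model `f 4`. -/
abbrev mF : Model := ⟨4, chainF, [3], fun i => if i = 0 then 2 else if i = 2 then 6 else 4⟩

/-- The model `g 2` with weight multiplied by `k`. -/
abbrev mG (k : ℤ) : Model := ⟨2, chain 3 1 2, [1], fun i => if i = 0 then 2 * k else 4 * k⟩

/-- The model `b' 3` with weight multiplied by `k / 2`. -/
abbrev mB' (k : ℤ) : Model :=
  ⟨3, chain 2 1 3, [2], fun i => if i = 0 then k else if i = 1 then 2 * k else 3 * k⟩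

/-- The inhomogeneous model of type `A n`. -/
abbrev mAA (n : ℕ) : Model := ⟨n, chain 1 1 n, [0], fun _ => 0⟩

/-- The inhomogeneous model of type `C n`. -/
abbrev mCC (n : ℕ) : Model := ⟨n, chain 1 2 n, [0], fun _ => 0⟩

/-- The factor of a model with an integral multiple. -/
abbrev IsOneOrTwo (c : Factor) (k : ℤ) : Prop := c = .one ∧ k = 1 ∨ c = .two ∧ k = 2

/-- The factor of a model with a half-integral multiple. -/
abbrev IsHalfOrOne (c : Factor) (k : ℤ) : Prop := c = .half ∧ k = 1 ∨ c = .one ∧ k = 2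

/-- Weights are doubled so that those with factor `1/2` become integral. Models differing only by
the factor share one constructor with a parameter `k`. The one-vertex models `a 1` and `2a 1` are
separated from the others as `point`, because their only vertex plays the role of both ends of a
chain. -/
inductive IsModel : Model → Factor → Prop
  | point (c : Factor) (k : ℤ) (h : IsOneOrTwo c k) : IsModel (mB 1 k) c
  | a (n : ℕ) (h : 2 ≤ n) : IsModel (mA n) .one
  | b (n : ℕ) (h : 2 ≤ n) (c : Factor) (k : ℤ) (hc : IsOneOrTwo c k) : IsModel (mB n k) c
  | c (n : ℕ) (h : 3 ≤ n) : IsModel (mC n) .one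
  | d (n : ℕ) (h : 3 ≤ n) (c : Factor) (k : ℤ) (hc : IsHalfOrOne c k) : IsModel (mD n k) c
  | dd (c : Factor) (k : ℤ) (hc : IsHalfOrOne c k) : IsModel (mDD k) c
  | f : IsModel mF .one
  | g (c : Factor) (k : ℤ) (hc : IsOneOrTwo c k) : IsModel (mG k) c
  | b' (c : Factor) (k : ℤ) (hc : IsHalfOrOne c k) : IsModel (mB' k) c
  | aa (n : ℕ) : IsModel (mAA n) .inh
  | cc (n : ℕ) (h : 2 ≤ n) : IsModel (mCC n) .inh

variable {S : Type*}

/-- The map `f` identifies the vertices of the model `M` with `T` and the decorated ones with `T'`,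
so that the Cartan matrices correspond. -/
structure Part (A : Matrix S S ℤ) (T T' : Set S) (M : Model) (f : ℕ → S) : Prop where
  inj : ∀ i < M.rank, ∀ j < M.rank, f i = f j → i = j
  mem : ∀ x, x ∈ T ↔ ∃ i < M.rank, f i = x
  memDec : ∀ x, x ∈ T' ↔ ∃ i < M.rank, i ∈ M.dec ∧ f i = x
  cartan : ∀ i < M.rank, ∀ j < M.rank, A (f i) (f j) = M.entry i j

/-- What the definition of the two parts of a primitive diagram says about adjacency. -/
structure Glue (A : Matrix S S ℤ) (T₁ T₁' T₂ T₂' : Set S) : Prop where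
  gcm : IsGCM A
  cover : ∀ x, x ∈ T₁ ∨ x ∈ T₂
  not_mem₂ : ∀ x ∈ T₁', x ∉ T₂
  not_mem₁ : ∀ x ∈ T₂', x ∉ T₁
  step₂ : ∀ x y, x ∉ T₁' → y ∈ T₂ → A x y ≠ 0 → x ∈ T₂
  step₁ : ∀ x y, x ∉ T₂' → y ∈ T₁ → A x y ≠ 0 → x ∈ T₁

/-- The pairing of the doubled weight of a model with a coroot. -/
def pairing (A : Matrix S S ℤ) (M : Model) (f : ℕ → S) (x : S) : ℤ :=
  ∑ i ∈ Finset.range M.rank, M.weight i * A (f i) x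

/-- The diagram `(A, T₁', c₁, T₂', c₂)` is isomorphic to an entry of the list. -/
def Listed (A : Matrix S S ℤ) (T₁' : Set S) (c₁ : Factor) (T₂' : Set S) (c₂ : Factor) : Prop :=
  ∃ (T : Type) (E : Diagram T), IsListed E ∧ (⟨A, T₁', c₁, T₂', c₂⟩ : Diagram S).IsIsomorphic E

variable {A : Matrix S S ℤ} {T T' T₁ T₁' T₂ T₂' : Set S} {c₁ c₂ : Factor} {M : Model} {f : ℕ → S}

theorem Listed.symm (h : Listed A T₁' c₁ T₂' c₂) : Listed A T₂' c₂ T₁' c₁ := by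
  obtain ⟨T, E, hE, e, he, h⟩ := h
  exact ⟨T, E, hE, e, he, h.symm.imp (fun h => ⟨h.2.2.1, h.2.2.2, h.1, h.2.1⟩)
    (fun h => ⟨h.2.2.1, h.2.2.2, h.1, h.2.1⟩)⟩

theorem Glue.symm (g : Glue A T₁ T₁' T₂ T₂') : Glue A T₂ T₂' T₁ T₁' :=
  ⟨g.gcm, fun x => (g.cover x).symm, g.not_mem₁, g.not_mem₂, g.step₁, g.step₂⟩

theorem Part.mem_of_lt (p : Part A T T' M f) {i : ℕ} (hi : i < M.rank) : f i ∈ T :=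
  (p.mem _).2 ⟨i, hi, rfl⟩

theorem Part.mem_dec_iff (p : Part A T T' M f) {i : ℕ} (hi : i < M.rank) :
    f i ∈ T' ↔ i ∈ M.dec := by
  rw [p.memDec]
  refine ⟨?_, fun h => ⟨i, hi, h, rfl⟩⟩
  rintro ⟨j, hj, hl, he⟩
  rwa [← p.inj j hj i hi he]

/-- Transport of a part along an involution of its model. -/
theorem Part.comp (p : Part A T T' M f) (σ : ℕ → ℕ) (hσ : ∀ i < M.rank, σ i < M.rank)
    (hσσ : ∀ i < M.rank, σ (σ i) = i) (hdec : ∀ i < M.rank, i ∈ M.dec → σ i ∈ M.dec)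
    (hX : ∀ i < M.rank, ∀ j < M.rank, M.entry (σ i) (σ j) = M.entry i j) :
    Part A T T' M (fun i => f (σ i)) := by
  refine ⟨fun i hi j hj h => ?_, fun x => ?_, fun x => ?_, fun i hi j hj => ?_⟩
  · rw [← hσσ i hi, ← hσσ j hj, p.inj _ (hσ i hi) _ (hσ j hj) h]
  · rw [p.mem]
    refine ⟨?_, fun ⟨i, hi, h⟩ => ⟨σ i, hσ i hi, h⟩⟩
    rintro ⟨i, hi, rfl⟩
    exact ⟨σ i, hσ i hi, by rw [hσσ i hi]⟩
  · rw [p.memDec]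
    refine ⟨?_, fun ⟨i, hi, h, h'⟩ => ⟨σ i, hσ i hi, hdec i hi h, h'⟩⟩
    rintro ⟨i, hi, h, rfl⟩
    exact ⟨σ i, hσ i hi, hdec i hi h, by rw [hσσ i hi]⟩
  · rw [p.cartan _ (hσ i hi) _ (hσ j hj), hX i hi j hj]

/-- The flip of `A n` preserves the decorated pair of ends; it is used to normalise which end
carries a bond or how a common arm is directed. -/
theorem Part.reverse {n : ℕ} (p : Part A T T' (mA n) f) (hn : 2 ≤ n) :
    Part A T T' (mA n) (fun i => f (n - 1 - i)) := by
  refine p.comp (fun i => n - 1 - i) ?_ ?_ ?_ ?_ <;> simp only [chain] <;> grind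

theorem Part.swap {k : ℤ} (p : Part A T T' (mDD k) f) :
    Part A T T' (mDD k) (fun i => f (1 - i)) := by
  refine p.comp (fun i => 1 - i) ?_ ?_ ?_ ?_ <;> simp only [fork] <;> grind

/-! ### Recognising an entry of the list -/

/-- A diagram covered by two disjoint families `f 0, …, f (m - 1)` and `h 0, …, h (r - 1)` is listed
once these vertices are matched with those of an entry. -/
theorem Listed.of_cover_type {T : Type} [Fintype T] {E : Diagram T} (hE : IsListed E)
    (hA : ∀ x y, x ≠ y → A x y ≤ 0) (hA' : ∀ x, A x x = 2) {m r : ℕ} {h : ℕ → S}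
    (hf : ∀ i < m, ∀ j < m, f i = f j → i = j) (hh : ∀ i < r, ∀ j < r, h i = h j → i = j)
    (hfh : ∀ i < m, ∀ j < r, f i ≠ h j) (hc : ∀ x, (∃ i < m, f i = x) ∨ ∃ j < r, h j = x)
    (hcard : Fintype.card T = m + r) (a b : ℕ → T)
    (h₁₁ : ∀ i < m, ∀ i' < m, E.cartan (a i) (a i') = A (f i) (f i'))
    (h₂₂ : ∀ i < r, ∀ i' < r, E.cartan (b i) (b i') = A (h i) (h i'))
    (h₁₂ : ∀ i < m, ∀ j < r, E.cartan (a i) (b j) = A (f i) (h j) ∧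
      E.cartan (b j) (a i) = A (h j) (f i))
    (ha : ∀ i < m, (a i ∈ E.dec₁ ↔ f i ∈ T₁') ∧ (a i ∈ E.dec₂ ↔ f i ∈ T₂'))
    (hb : ∀ j < r, (b j ∈ E.dec₁ ↔ h j ∈ T₁') ∧ (b j ∈ E.dec₂ ↔ h j ∈ T₂')) :
    Listed A T₁' E.c₁ T₂' E.c₂ := by
  classical
  let t : Fin m ⊕ Fin r → S := Sum.elim (fun i => f i) (fun j => h j)
  let s : Fin m ⊕ Fin r → T := Sum.elim (fun i => a i) (fun j => b j)
  have ht : Function.Bijective t := by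
    constructor
    · rintro (i | i) (j | j) hij
      · exact congrArg Sum.inl (Fin.ext (hf i i.2 j j.2 hij))
      · exact absurd hij (hfh i i.2 j j.2)
      · exact absurd hij.symm (hfh j j.2 i i.2)
      · exact congrArg Sum.inr (Fin.ext (hh i i.2 j j.2 hij))
    · intro x
      rcases hc x with ⟨i, hi, rfl⟩ | ⟨j, hj, rfl⟩
      · exact ⟨Sum.inl ⟨i, hi⟩, rfl⟩
      · exact ⟨Sum.inr ⟨j, hj⟩, rfl⟩
  have hst : ∀ p q, E.cartan (s p) (s q) = A (t p) (t q) := by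
    rintro (i | i) (j | j)
    · exact h₁₁ i i.2 j j.2
    · exact (h₁₂ i i.2 j j.2).1
    · exact (h₁₂ j j.2 i i.2).2
    · exact h₂₂ i i.2 j j.2
  -- Injectivity comes for free from the Cartan entries: two vertices with the same image would have
  -- pairing 2, whereas off-diagonal entries are nonpositive. Surjectivity then follows by counting.
  have hs : Function.Injective s := by
    intro p q hpq
    by_contra hne
    have h1 := hA _ _ (fun h => hne (ht.1 h))
    rw [← hst p q, hpq, hst q q, hA'] at h1
    norm_num at h1
  have hs' : Function.Bijective s := by
    rw [Fintype.bijective_iff_injective_and_card]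
    exact ⟨hs, by simp [hcard]⟩
  let e : S ≃ T := (Equiv.ofBijective t ht).symm.trans (Equiv.ofBijective s hs')
  have het : ∀ p, e (t p) = s p := fun p => by
    simp only [e, Equiv.trans_apply]
    rw [Equiv.ofBijective_symm_apply_apply, Equiv.ofBijective_apply]
  have hd : ∀ (U : Set S) (V : Set T), (∀ p, s p ∈ V ↔ t p ∈ U) → e '' U = V := by
    intro U V hUV
    ext y
    obtain ⟨p, rfl⟩ := hs'.2 y
    rw [hUV, ← het, e.injective.mem_set_image]
  refine ⟨T, E, hE, e, fun x y => ?_, Or.inl ⟨hd _ _ ?_, rfl, hd _ _ ?_, rfl⟩⟩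
  · obtain ⟨p, rfl⟩ := ht.2 x
    obtain ⟨q, rfl⟩ := ht.2 y
    rw [het, het, hst]
  · rintro (i | i)
    · exact (ha i i.2).1
    · exact (hb i i.2).1
  · rintro (i | i)
    · exact (ha i i.2).2
    · exact (hb i i.2).2

theorem Listed.of_cover {N : ℕ} {X : Matrix (Fin N) (Fin N) ℤ} {l₁ l₂ : List ℕ}
    (hE : IsListed (single X l₁ c₁ l₂ c₂))
    (hA : IsGCM A) {m r : ℕ} {h : ℕ → S}
    (hf : ∀ i < m, ∀ j < m, f i = f j → i = j) (hh : ∀ i < r, ∀ j < r, h i = h j → i = j)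
    (hfh : ∀ i < m, ∀ j < r, f i ≠ h j) (hc : ∀ x, (∃ i < m, f i = x) ∨ ∃ j < r, h j = x)
    (hN : N = m + r) (a b : ℕ → ℕ) (ha' : ∀ i < m, a i < N) (hb' : ∀ j < r, b j < N)
    (h₁₁ : ∀ i < m, ∀ i' < m, ext X (a i) (a i') = A (f i) (f i'))
    (h₂₂ : ∀ i < r, ∀ i' < r, ext X (b i) (b i') = A (h i) (h i'))
    (h₁₂ : ∀ i < m, ∀ j < r, ext X (a i) (b j) = A (f i) (h j) ∧
      ext X (b j) (a i) = A (h j) (f i))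
    (ha : ∀ i < m, (a i ∈ l₁ ↔ f i ∈ T₁') ∧ (a i ∈ l₂ ↔ f i ∈ T₂'))
    (hb : ∀ j < r, (b j ∈ l₁ ↔ h j ∈ T₁') ∧ (b j ∈ l₂ ↔ h j ∈ T₂')) :
    Listed A T₁' c₁ T₂' c₂ := by
  -- The vertex `f 0` is enumerated by one of the families, so `N` is positive. The remainder modulo
  -- `N` only serves to make total maps into `Fin N`; it changes nothing on the relevant indices.
  have h0 : 0 < N := by rcases hc (f 0) with ⟨i, hi, _⟩ | ⟨i, hi, _⟩ <;> omega
  have key : ∀ {i} (_ : i < N), ((⟨i % N, Nat.mod_lt _ h0⟩ : Fin N)) = ⟨i, by assumption⟩ :=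
    fun h => Fin.ext (Nat.mod_eq_of_lt h)
  refine Listed.of_cover_type hE hA.offDiag hA.diag hf hh hfh hc (by simpa using hN)
    (fun i => ⟨a i % N, Nat.mod_lt _ h0⟩) (fun i => ⟨b i % N, Nat.mod_lt _ h0⟩) ?_ ?_ ?_ ?_ ?_
  · intro i hi i' hi'
    rw [key (ha' i hi), key (ha' i' hi')]
    exact (ext_of_lt X (ha' i hi) (ha' i' hi')).symm.trans (h₁₁ i hi i' hi')
  · intro i hi i' hi'
    rw [key (hb' i hi), key (hb' i' hi')]
    exact (ext_of_lt X (hb' i hi) (hb' i' hi')).symm.trans (h₂₂ i hi i' hi')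
  · intro i hi i' hi'
    rw [key (ha' i hi), key (hb' i' hi')]
    rw [← (h₁₂ i hi i' hi').1, ← (h₁₂ i hi i' hi').2, ext_of_lt X (ha' i hi) (hb' i' hi'),
      ext_of_lt X (hb' i' hi') (ha' i hi)]
    exact ⟨rfl, rfl⟩
  · intro i hi
    rw [key (ha' i hi)]
    exact ha i hi
  · intro i hi
    rw [key (hb' i hi)]
    exact hb i hi

end PrimSph

namespace PrimSph

open Matrix

variable {S : Type*} {A : Matrix S S ℤ} {T₁ T₁' T₂ T₂' : Set S} {c₁ c₂ : Factor}

/-! ### Passing from local models to parts -/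

/-- The transition from `Fin n` and rational weights to natural indices and doubled integral
weights. Outside the rank the enumeration takes an arbitrary value, which is why `S` has to be
nonempty. -/
theorem LocalModel.Identifies.exists_part_of [Nonempty S] {n : ℕ} {Y : Matrix (Fin n) (Fin n) ℤ}
    {l : List ℕ} {c' c : Factor} {w : Fin n → ℚ} {e : Fin n ↪ S} {T T' : Set S}
    (h : LocalModel.Identifies ⟨n, Y, nodes l, c', w⟩ e A T T' c)
    {X : ℕ → ℕ → ℤ} {W : ℕ → ℤ} {l' : List ℕ} (hl : ∀ i, i ∈ l ↔ i ∈ l')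
    (hM : IsModel ⟨n, X, l', W⟩ c)
    (hX : ∀ i (hi : i < n) j (hj : j < n), Y ⟨i, hi⟩ ⟨j, hj⟩ = X i j)
    (hW : ∀ i : Fin n, (W i : ℚ) = 2 * w i) :
    ∃ M f, IsModel M c ∧ Part A T T' M f ∧
      ∀ x, (pairing A M f x : ℚ) = 2 * LocalModel.pair ⟨n, Y, nodes l, c', w⟩ e A x := by
  obtain ⟨-, h₁, h₂, -, h₄⟩ := h
  simp only at e h₁ h₂ h₄
  have hf : ∀ i (hi : i < n), (if h : i < n then e ⟨i, h⟩ else Classical.arbitrary S) = e ⟨i, hi⟩ :=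
    fun i hi => dif_pos hi
  refine ⟨⟨n, X, l', W⟩, fun i => if h : i < n then e ⟨i, h⟩ else Classical.arbitrary S, hM,
    ⟨fun i hi j hj hij => ?_, fun x => ?_, fun x => ?_, fun i hi j hj => ?_⟩, fun x => ?_⟩
  · rw [hf i hi, hf j hj] at hij
    simpa using e.injective hij
  · rw [← h₁]
    constructor
    · rintro ⟨i, rfl⟩
      exact ⟨i, i.2, hf _ _⟩
    · rintro ⟨i, hi, rfl⟩
      exact ⟨⟨i, hi⟩, (hf _ _).symm⟩
  · rw [← h₂]
    constructor
    · rintro ⟨i, hi, rfl⟩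
      exact ⟨i, i.2, (hl _).1 hi, hf _ _⟩
    · rintro ⟨i, hi, hi', rfl⟩
      exact ⟨⟨i, hi⟩, (hl _).2 hi', (hf _ _).symm⟩
  · rw [hf i hi, hf j hj, h₄, hX]
  · simp only [pairing, LocalModel.pair, Finset.sum_range, Finset.mul_sum, Int.cast_sum,
      Int.cast_mul]
    refine Finset.sum_congr rfl fun i _ => ?_
    rw [hW, hf i i.2]
    ring

theorem LocalModel.Identifies.exists_part [Nonempty S] {M : LocalModel} {e : Fin M.rank ↪ S}
    {T T' : Set S} {c : Factor} (h : M.Identifies e A T T' c) :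
    ∃ N f, IsModel N c ∧ Part A T T' N f ∧
      ∀ x, (pairing A N f x : ℚ) = 2 * M.pair e A x := by
  have hc := h.factor_eq
  have hM := h.isLocalModel
  subst hc
  have hAB : ∀ i (hi : i < 1) j (hj : j < 1), CartanMatrix.A 1 ⟨i, hi⟩ ⟨j, hj⟩ = chain 2 1 1 i j :=
    by
    intro i hi j hj; rw [A_apply]; grind
  cases hM with
  | a n hn =>
    -- `a 1` has a single decorated vertex and is filed under `point`.
    rcases Nat.lt_or_ge 1 n with h1 | h1
    · exact h.exists_part_of (by simp) (.a n h1) (fun i hi j hj => A_apply n i j hi hj) (by simp)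
    · obtain rfl : n = 1 := by omega
      exact h.exists_part_of (by simp) (.point .one 1 (Or.inl ⟨rfl, rfl⟩)) hAB (by simp)
  | two_a_one =>
    exact h.exists_part_of (by simp) (.point .two 2 (Or.inr ⟨rfl, rfl⟩)) hAB (by norm_num)
  | b n hn =>
    exact h.exists_part_of (by simp) (.b n hn .one 1 (Or.inl ⟨rfl, rfl⟩))
      (fun i hi j hj => B_apply n i j hi hj) (by norm_num)
  | two_b n hn =>
    exact h.exists_part_of (by simp) (.b n hn .two 2 (Or.inr ⟨rfl, rfl⟩))
      (fun i hi j hj => B_apply n i j hi hj) (by norm_num)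
  | c n hn =>
    refine h.exists_part_of (by simp) (.c n hn) (fun i hi j hj => C_apply n i j hi hj) fun i => ?_
    split_ifs <;> norm_num
  | half_d n hn =>
    refine h.exists_part_of (by simp) (.d n hn .half 1 (Or.inl ⟨rfl, rfl⟩))
      (fun i hi j hj => D_apply n i j hi hj) fun i => ?_
    split_ifs <;> norm_num
  | d n hn =>
    refine h.exists_part_of (by simp) (.d n hn .one 2 (Or.inr ⟨rfl, rfl⟩))
      (fun i hi j hj => D_apply n i j hi hj) fun i => ?_
    split_ifs <;> norm_num
  | half_d_two =>
    exact h.exists_part_of (by simp) (.dd .half 1 (Or.inl ⟨rfl, rfl⟩))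
      (fun i hi j hj => D_apply 2 i j hi hj) (by norm_num)
  | d_two =>
    exact h.exists_part_of (by simp) (.dd .one 2 (Or.inr ⟨rfl, rfl⟩))
      (fun i hi j hj => D_apply 2 i j hi hj) (by norm_num)
  | f_four =>
    refine h.exists_part_of (by simp) .f (fun i hi j hj => F₄_apply i j hi hj) fun i => ?_
    fin_cases i <;> norm_num
  | g_two =>
    refine h.exists_part_of (by simp) (.g .one 1 (Or.inl ⟨rfl, rfl⟩))
      (fun i hi j hj => G₂_apply i j hi hj) fun i => ?_
    fin_cases i <;> norm_num
  | two_g_two =>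
    refine h.exists_part_of (by simp) (.g .two 2 (Or.inr ⟨rfl, rfl⟩))
      (fun i hi j hj => G₂_apply i j hi hj) fun i => ?_
    fin_cases i <;> norm_num
  | half_b_three' =>
    refine h.exists_part_of (by simp) (.b' .half 1 (Or.inl ⟨rfl, rfl⟩))
      (fun i hi j hj => B_apply 3 i j hi hj) fun i => ?_
    fin_cases i <;> norm_num
  | b_three' =>
    refine h.exists_part_of (by simp) (.b' .one 2 (Or.inr ⟨rfl, rfl⟩))
      (fun i hi j hj => B_apply 3 i j hi hj) fun i => ?_
    fin_cases i <;> norm_num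
  | inh_a n =>
    exact h.exists_part_of (by simp) (.aa n) (fun i hi j hj => A_apply n i j hi hj)
      (by simp)
  | inh_c n hn =>
    exact h.exists_part_of (by simp) (.cc n hn)
      (fun i hi j hj => C_apply n i j hi hj) (by simp)

/-- A connected closure absorbs the neighbours of its elements inside the ambient set. Together with
the fact that the closure avoids the decorated set of the other index, this is all that is ever used
about it. -/
theorem closureIn_step {U V : Set S} {x y : S} (hx : x ∈ V) (hy : y ∈ closureIn (graph A) U V)
    (hxy : A x y ≠ 0) : x ∈ closureIn (graph A) U V := by
  obtain ⟨hyV, z, hz, hr⟩ := hy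
  rcases eq_or_ne x y with rfl | hne
  · exact ⟨hyV, z, hz, hr⟩
  · have hadj : ((graph A).induce V).Adj ⟨x, hx⟩ ⟨y, hyV⟩ := ⟨hne, Or.inl hxy⟩
    exact ⟨hx, z, hz, hadj.reachable.trans hr⟩

theorem Diagram.IsPrimitiveSpherical.glue [Fintype S] {D : Diagram S}
    (h : D.IsPrimitiveSpherical) : Glue D.cartan D.part₁ D.dec₁ D.part₂ D.dec₂ where
  gcm := h.1.1
  cover x := by
    have : x ∈ D.part₁ ∪ D.part₂ := h.2.2.1 ▸ Set.mem_univ x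
    exact this
  not_mem₂ x hx hx' := hx'.1 hx
  not_mem₁ x hx hx' := hx'.1 hx
  step₂ _ _ hx hy hxy := closureIn_step hx hy hxy
  step₁ _ _ hx hy hxy := closureIn_step hx hy hxy

end PrimSph

namespace PrimSph

open Matrix

variable {S : Type*} {A : Matrix S S ℤ} {T T' T₁ T₁' T₂ T₂' : Set S} {c₁ c₂ : Factor}
  {M M₁ M₂ : Model} {f f₁ f₂ : ℕ → S} {n : ℕ} {k : ℤ}

/-! ### Disjoint parts -/

/-- An undecorated vertex of one part adjacent to the other part would be absorbed by the closure
and belong to both parts. -/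
theorem Glue.cross_eq_zero (g : Glue A T₁ T₁' T₂ T₂') (hd : ∀ x ∈ T₁, x ∉ T₂)
    (p₁ : Part A T₁ T₁' M₁ f₁) (p₂ : Part A T₂ T₂' M₂ f₂) {i j : ℕ}
    (hi : i < M₁.rank) (hj : j < M₂.rank) (h : ¬ (i ∈ M₁.dec ∧ j ∈ M₂.dec)) : A (f₁ i)
      (f₂ j) = 0 ∧ A (f₂ j) (f₁ i) = 0 := by
  by_cases h₁ : i ∈ M₁.dec
  · have h₂ : f₂ j ∉ T₂' := fun h' => h ⟨h₁, (p₂.mem_dec_iff hj).1 h'⟩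
    have : A (f₂ j) (f₁ i) = 0 := by
      by_contra hne
      exact hd _ (g.step₁ _ _ h₂ (p₁.mem_of_lt hi) hne) (p₂.mem_of_lt hj)
    exact ⟨g.gcm.zero_symm _ _ this, this⟩
  · have h₂ : f₁ i ∉ T₁' := fun h' => h₁ ((p₁.mem_dec_iff hi).1 h')
    have : A (f₁ i) (f₂ j) = 0 := by
      by_contra hne
      exact hd _ (p₁.mem_of_lt hi) (g.step₂ _ _ h₂ (p₂.mem_of_lt hj) hne)
    exact ⟨this, g.gcm.zero_symm _ _ this⟩

theorem Glue.exists_cover (g : Glue A T₁ T₁' T₂ T₂')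
    (p₁ : Part A T₁ T₁' M₁ f₁) (p₂ : Part A T₂ T₂' M₂ f₂) (x : S) :
    (∃ i < M₁.rank, f₁ i = x) ∨ ∃ j < M₂.rank, f₂ j = x :=
  (g.cover x).imp (p₁.mem x).1 (p₂.mem x).1

/-- Only the bonds between decorated vertices have to be compared with the entry; all other cross
entries vanish by `Glue.cross_eq_zero`. -/
theorem Glue.listed_of_disjoint (g : Glue A T₁ T₁' T₂ T₂') (hd : ∀ x ∈ T₁, x ∉ T₂)
    (p₁ : Part A T₁ T₁' M₁ f₁) (p₂ : Part A T₂ T₂' M₂ f₂)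
    {N : ℕ} {X : Matrix (Fin N) (Fin N) ℤ} {k₁ k₂ : List ℕ}
    (hE : IsListed (single X k₁ c₁ k₂ c₂)) (a b : ℕ → ℕ) (hN : N = M₁.rank + M₂.rank)
    (ha : ∀ i < M₁.rank, a i < N ∧ (a i ∈ k₁ ↔ i ∈ M₁.dec) ∧ a i ∉ k₂)
    (hb : ∀ j < M₂.rank, b j < N ∧ (b j ∈ k₂ ↔ j ∈ M₂.dec) ∧ b j ∉ k₁)
    (h₁₁ : ∀ i < M₁.rank, ∀ j < M₁.rank, ext X (a i) (a j) = M₁.entry i j)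
    (h₂₂ : ∀ i < M₂.rank, ∀ j < M₂.rank, ext X (b i) (b j) = M₂.entry i j)
    (h₁₂ : ∀ i < M₁.rank, ∀ j < M₂.rank,
      (i ∈ M₁.dec → j ∈ M₂.dec → ext X (a i) (b j) = A (f₁ i) (f₂ j) ∧
        ext X (b j) (a i) = A (f₂ j) (f₁ i)) ∧
      (¬ (i ∈ M₁.dec ∧ j ∈ M₂.dec) → ext X (a i) (b j) = 0 ∧ ext X (b j) (a i) = 0)) :
    Listed A T₁' c₁ T₂' c₂ := by
  refine Listed.of_cover hE g.gcm p₁.inj p₂.inj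
    (fun i hi j hj h => hd _ (p₁.mem_of_lt hi) (h ▸ p₂.mem_of_lt hj)) (g.exists_cover p₁ p₂) hN a b
    (fun i hi => (ha i hi).1) (fun i hi => (hb i hi).1) (fun i hi j hj => ?_)
    (fun i hi j hj => ?_) (fun i hi j hj => ?_) (fun i hi => ?_) (fun j hj => ?_)
  · rw [h₁₁ i hi j hj, p₁.cartan i hi j hj]
  · rw [h₂₂ i hi j hj, p₂.cartan i hi j hj]
  · by_cases h : i ∈ M₁.dec ∧ j ∈ M₂.dec
    · exact (h₁₂ i hi j hj).1 h.1 h.2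
    · have h1 := (h₁₂ i hi j hj).2 h
      have h2 := g.cross_eq_zero hd p₁ p₂ hi hj h
      rw [h1.1, h1.2, h2.1, h2.2]
      exact ⟨rfl, rfl⟩
  · rw [p₁.mem_dec_iff hi]
    refine ⟨(ha i hi).2.1, iff_of_false (ha i hi).2.2 fun h => ?_⟩
    exact g.not_mem₁ _ h (p₁.mem_of_lt hi)
  · rw [p₂.mem_dec_iff hj]
    refine ⟨iff_of_false (hb j hj).2.2 fun h => ?_, (hb j hj).2.1⟩
    exact g.not_mem₂ _ h (p₂.mem_of_lt hj)

/-- The version for products: the families `u` and `v` enumerate the two factors. -/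
theorem listed_of_double (hA : IsGCM A) {N₁ N₂ : ℕ} {X : Matrix (Fin N₁) (Fin N₁) ℤ}
    {Y : Matrix (Fin N₂) (Fin N₂) ℤ} {k₁ k₂ r₁ r₂ : List ℕ}
    (hE : IsListed (double X Y k₁ r₁ c₁ k₂ r₂ c₂)) (u v : ℕ → S)
    (hc : ∀ x, (∃ i < N₁, u i = x) ∨ ∃ j < N₂, v j = x)
    (hX : ∀ i < N₁, ∀ j < N₁, A (u i) (u j) = ext X i j)
    (hY : ∀ i < N₂, ∀ j < N₂, A (v i) (v j) = ext Y i j)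
    (hX' : ∀ i < N₁, ∀ j < N₁, i ≠ j → ext X i j ≠ 2)
    (hY' : ∀ i < N₂, ∀ j < N₂, i ≠ j → ext Y i j ≠ 2)
    (h : ∀ i < N₁, ∀ j < N₂, A (u i) (v j) = 0)
    (hu : ∀ i < N₁, (i ∈ k₁ ↔ u i ∈ T₁') ∧ (i ∈ k₂ ↔ u i ∈ T₂'))
    (hv : ∀ j < N₂, (j ∈ r₁ ↔ v j ∈ T₁') ∧ (j ∈ r₂ ↔ v j ∈ T₂')) :
    Listed A T₁' c₁ T₂' c₂ := by
  have hT : Nonempty (Fin N₁ ⊕ Fin N₂) := by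
    rcases hc (u 0) with ⟨i, hi, -⟩ | ⟨i, hi, -⟩
    · exact ⟨Sum.inl ⟨i, hi⟩⟩
    · exact ⟨Sum.inr ⟨i, hi⟩⟩
  have ha : ∀ j (hj : j < N₁), (if hj : j < N₁ then (Sum.inl ⟨j, hj⟩ : Fin N₁ ⊕ Fin N₂) else
      Classical.arbitrary _) = Sum.inl ⟨j, hj⟩ := fun j hj => dif_pos hj
  have hb : ∀ j (hj : j < N₂), (if hj : j < N₂ then (Sum.inr ⟨j, hj⟩ : Fin N₁ ⊕ Fin N₂) else
      Classical.arbitrary _) = Sum.inr ⟨j, hj⟩ := fun j hj => dif_pos hj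
  refine Listed.of_cover_type hE hA.offDiag hA.diag (m := N₁) (r := N₂) (f := u) (h := v)
    ?_ ?_ ?_ hc (by simp)
    (fun j => if hj : j < N₁ then (Sum.inl ⟨j, hj⟩ : Fin N₁ ⊕ Fin N₂) else Classical.arbitrary _)
    (fun j => if hj : j < N₂ then (Sum.inr ⟨j, hj⟩ : Fin N₁ ⊕ Fin N₂) else Classical.arbitrary _)
    ?_ ?_ ?_ ?_ ?_
  -- Equal vertices would turn an off-diagonal entry of `X` into the diagonal value 2.
  · intro i hi j hj hij
    by_contra hne
    refine hX' i hi j hj hne ?_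
    rw [← hX i hi j hj, hij, hA.diag]
  · intro i hi j hj hij
    by_contra hne
    refine hY' i hi j hj hne ?_
    rw [← hY i hi j hj, hij, hA.diag]
  · intro i hi j hj hij
    have h1 := h i hi j hj
    rw [hij, hA.diag] at h1
    norm_num at h1
  · intro i hi j hj
    simp only [ha i hi, ha j hj, hX i hi j hj, ext_of_lt X hi hj]
    rfl
  · intro i hi j hj
    simp only [hb i hi, hb j hj, hY i hi j hj, ext_of_lt Y hi hj]
    rfl
  · intro i hi j hj
    simp only [ha i hi, hb j hj, h i hi j hj, hA.zero_symm _ _ (h i hi j hj)]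
    exact ⟨rfl, rfl⟩
  · intro i hi
    simp only [ha i hi, ← (hu i hi).1, ← (hu i hi).2]
    simp [double, nodes]
  · intro i hi
    simp only [hb i hi, ← (hv i hi).1, ← (hv i hi).2]
    simp [double, nodes]

/-! ### Pairings -/

theorem pairing_eq_sum {x : S} (I : Finset ℕ) (hI : ∀ i ∈ I, i < M.rank)
    (h : ∀ i < M.rank, i ∉ I → A (f i) x = 0) :
    pairing A M f x = ∑ i ∈ I, M.weight i * A (f i) x := by
  symm
  refine Finset.sum_subset (fun i hi => Finset.mem_range.2 (hI i hi)) fun i hi hi' => ?_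
  rw [h i (Finset.mem_range.1 hi) hi', mul_zero]

theorem Part.pairing_self (p : Part A T T' M f) {j : ℕ} (hj : j < M.rank) (I : Finset ℕ)
    (hI : ∀ i ∈ I, i < M.rank) (h : ∀ i < M.rank, i ∉ I → M.entry i j = 0) :
    pairing A M f (f j) = ∑ i ∈ I, M.weight i * M.entry i j := by
  rw [pairing_eq_sum I hI]
  · exact Finset.sum_congr rfl fun i hi => by rw [p.cartan i (hI i hi) j hj]
  · intro i hi hi'
    rw [p.cartan i hi j hj, h i hi hi']

/-- The values in this group, twice the pairings of `ω` with the decorated coroots of its own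
diagram, are the constant terms of all equations below. They are `4 k` for a single vertex and `2 k`
otherwise, with `k = 1` for the models without parameter. -/
theorem Part.pairing_point (p : Part A T T' (mB 1 k) f) : pairing A (mB 1 k) f (f 0) = 4 * k := by
  rw [p.pairing_self zero_lt_one {0} (by simp) (by simp)]
  grind [Finset.sum_singleton]

theorem Part.pairing_b (p : Part A T T' (mB n k) f) (hn : 2 ≤ n) :
    pairing A (mB n k) f (f 0) = 2 * k := by
  rw [p.pairing_self (by grind) {0, 1} (by simp; omega) (by grind), Finset.sum_pair (by simp)]
  grind

theorem Part.pairing_a (p : Part A T T' (mA n) f) (hn : 2 ≤ n) :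
    pairing A (mA n) f (f 0) = 2 ∧ pairing A (mA n) f (f (n - 1)) = 2 := by
  constructor
  · rw [p.pairing_self (by grind) {0, 1} (by simp; omega) (by grind), Finset.sum_pair (by simp)]
    grind
  · rw [p.pairing_self (by grind) {n - 1, n - 2} (by simp; omega) (by grind),
      Finset.sum_pair (by omega)]
    grind

theorem Part.pairing_c (p : Part A T T' (mC n) f) (hn : 3 ≤ n) :
    pairing A (mC n) f (f 1) = 2 := by
  rw [p.pairing_self (by grind) {0, 1, 2} (by simp; omega) (by grind), Finset.sum_insert (by simp),
    Finset.sum_pair (by simp)]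
  grind

theorem Part.pairing_d (p : Part A T T' (mD n k) f) (hn : 3 ≤ n) :
    pairing A (mD n k) f (f 0) = 2 * k := by
  rw [p.pairing_self (by grind) {0, 1, 2} (by simp; omega) (by grind (splits := 20)),
    Finset.sum_insert (by simp), Finset.sum_pair (by simp)]
  grind (splits := 20)

theorem Part.pairing_dd (p : Part A T T' (mDD k) f) {j : ℕ} (hj : j < 2) :
    pairing A (mDD k) f (f j) = 2 * k := by
  rw [p.pairing_self hj {j} (by simpa using hj) (by grind), Finset.sum_singleton]
  grind

theorem Part.pairing_f (p : Part A T T' mF f) : pairing A mF f (f 3) = 2 := by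
  rw [p.pairing_self (by simp) {2, 3} (by simp) (by grind), Finset.sum_pair (by simp)]
  simp [chainF, link]

theorem Part.pairing_g (p : Part A T T' (mG k) f) : pairing A (mG k) f (f 1) = 2 * k := by
  rw [p.pairing_self (by simp) {0, 1} (by simp) (by grind), Finset.sum_pair (by simp)]
  grind

theorem Part.pairing_b' (p : Part A T T' (mB' k) f) : pairing A (mB' k) f (f 2) = 2 * k := by
  rw [p.pairing_self (by simp) {1, 2} (by simp) (by grind), Finset.sum_pair (by simp)]
  grind

/-- For disjoint parts only decorated vertices see the other part, so the pairing collapses to one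
term, and to two in `Glue.pairing_double`. -/
theorem Glue.pairing_single (g : Glue A T₁ T₁' T₂ T₂') (hd : ∀ x ∈ T₁, x ∉ T₂)
    (p₁ : Part A T₁ T₁' M₁ f₁) (p₂ : Part A T₂ T₂' M₂ f₂) {e : ℕ} (hl : M₁.dec = [e])
    (he : e < M₁.rank) {j : ℕ} (hj : j < M₂.rank) :
    pairing A M₁ f₁ (f₂ j) = M₁.weight e * A (f₁ e) (f₂ j) := by
  rw [pairing_eq_sum {e} (by simpa using he), Finset.sum_singleton]
  intro i hi hie
  exact (g.cross_eq_zero hd p₁ p₂ hi hj (fun h => hie (by simpa [hl] using h.1))).1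

theorem Glue.pairing_double (g : Glue A T₁ T₁' T₂ T₂') (hd : ∀ x ∈ T₁, x ∉ T₂)
    (p₁ : Part A T₁ T₁' M₁ f₁) (p₂ : Part A T₂ T₂' M₂ f₂) {e e' : ℕ} (hl : M₁.dec = [e, e'])
    (he : e < M₁.rank) (he' : e' < M₁.rank) (hne : e ≠ e') {j : ℕ} (hj : j < M₂.rank) :
    pairing A M₁ f₁ (f₂ j) =
      M₁.weight e * A (f₁ e) (f₂ j) + M₁.weight e' * A (f₁ e') (f₂ j) := by
  rw [pairing_eq_sum {e, e'}, Finset.sum_pair hne]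
  · intro i hi
    rcases Finset.mem_insert.1 hi with rfl | h
    · exact he
    · rwa [Finset.mem_singleton.1 h]
  · intro i hi hie
    exact (g.cross_eq_zero hd p₁ p₂ hi hj (fun h => hie (by simpa [hl] using h.1))).1

end PrimSph

namespace PrimSph

open Matrix

variable {S : Type*} {A : Matrix S S ℤ} {T₁ T₁' T₂ T₂' : Set S} {c₁ c₂ : Factor}
  {M₁ M₂ : Model} {f₁ f₂ : ℕ → S} {m n : ℕ} {k₁ k₂ : ℤ}

/-! ### Two homogeneous parts without common vertices -/

/-- Two homogeneous parts whose weights add up to zero. -/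
structure HomHom (A : Matrix S S ℤ) (T₁ T₁' T₂ T₂' : Set S) (M₁ : Model) (f₁ : ℕ → S) (M₂ : Model)
    (f₂ : ℕ → S) : Prop where
  glue : Glue A T₁ T₁' T₂ T₂'
  part₁ : Part A T₁ T₁' M₁ f₁
  part₂ : Part A T₂ T₂' M₂ f₂
  sum : ∀ x, pairing A M₁ f₁ x + pairing A M₂ f₂ x = 0

namespace HomHom

theorem symm (H : HomHom A T₁ T₁' T₂ T₂' M₁ f₁ M₂ f₂) : HomHom A T₂ T₂' T₁ T₁' M₂ f₂ M₁ f₁ :=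
  ⟨H.glue.symm, H.part₂, H.part₁, fun x => by rw [add_comm]; exact H.sum x⟩

theorem _root_.PrimSph.disjoint_symm {T₁ T₂ : Set S} (hd : ∀ x ∈ T₁, x ∉ T₂) : ∀ x ∈ T₂, x ∉ T₁ :=
  fun x h h' => hd x h' h

/-- With one decorated vertex on either side there is only one possible bond, and the vanishing of
`ω₁ + ω₂` on the two decorated coroots determines both of its Cartan integers. -/
theorem single_single {e e' : ℕ} {V₁ V₂ : ℤ} (H : HomHom A T₁ T₁' T₂ T₂' M₁ f₁ M₂ f₂)
    (hd : ∀ x ∈ T₁, x ∉ T₂) (h₁ : pairing A M₁ f₁ (f₁ e) = V₁)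
    (h₂ : pairing A M₂ f₂ (f₂ e') = V₂)
    (hl : M₁.dec = [e] := by rfl) (hl' : M₂.dec = [e'] := by rfl) (he : e < M₁.rank := by grind)
    (he' : e' < M₂.rank := by grind) :
    M₁.weight e * A (f₁ e) (f₂ e') + V₂ = 0 ∧ M₂.weight e' * A (f₂ e') (f₁ e) + V₁ = 0 := by
  have e1 := H.sum (f₂ e')
  have e2 := H.sum (f₁ e)
  rw [H.glue.pairing_single hd H.part₁ H.part₂ hl he he', h₂] at e1
  rw [h₁, H.glue.symm.pairing_single (disjoint_symm hd) H.part₂ H.part₁ hl' he' he, add_comm] at e2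
  exact ⟨e1, e2⟩

theorem double_single {e₀ e₁ e' : ℕ} {V₁ V₂ : ℤ} (H : HomHom A T₁ T₁' T₂ T₂' M₁ f₁ M₂ f₂)
    (hd : ∀ x ∈ T₁, x ∉ T₂) (h₀ : pairing A M₁ f₁ (f₁ e₀) = V₁)
    (h₁ : pairing A M₁ f₁ (f₁ e₁) = V₁) (h₂ : pairing A M₂ f₂ (f₂ e') = V₂)
    (hl : M₁.dec = [e₀, e₁] := by rfl) (hl' : M₂.dec = [e'] := by rfl)
    (he₀ : e₀ < M₁.rank := by grind) (he₁ : e₁ < M₁.rank := by grind) (hne : e₀ ≠ e₁ := by grind)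
    (he' : e' < M₂.rank := by grind) :
    M₁.weight e₀ * A (f₁ e₀) (f₂ e') + M₁.weight e₁ * A (f₁ e₁) (f₂ e') + V₂ = 0 ∧
      M₂.weight e' * A (f₂ e') (f₁ e₀) + V₁ = 0 ∧ M₂.weight e' * A (f₂ e') (f₁ e₁) + V₁ = 0 := by
  have e1 := H.sum (f₂ e')
  have e2 := H.sum (f₁ e₀)
  have e3 := H.sum (f₁ e₁)
  have hs := H.glue.symm
  rw [H.glue.pairing_double hd H.part₁ H.part₂ hl he₀ he₁ hne he', h₂] at e1
  rw [h₀, hs.pairing_single (disjoint_symm hd) H.part₂ H.part₁ hl' he' he₀, add_comm] at e2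
  rw [h₁, hs.pairing_single (disjoint_symm hd) H.part₂ H.part₁ hl' he' he₁, add_comm] at e3
  exact ⟨e1, e2, e3⟩

theorem double_double {e₀ e₁ e₀' e₁' : ℕ} {V₁ V₂ : ℤ} (H : HomHom A T₁ T₁' T₂ T₂' M₁ f₁ M₂ f₂)
    (hd : ∀ x ∈ T₁, x ∉ T₂) (h₀ : pairing A M₁ f₁ (f₁ e₀) = V₁)
    (h₁ : pairing A M₁ f₁ (f₁ e₁) = V₁) (h₀' : pairing A M₂ f₂ (f₂ e₀') = V₂)
    (h₁' : pairing A M₂ f₂ (f₂ e₁') = V₂)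
    (hl : M₁.dec = [e₀, e₁] := by rfl) (hl' : M₂.dec = [e₀', e₁'] := by rfl)
    (he₀ : e₀ < M₁.rank := by grind) (he₁ : e₁ < M₁.rank := by grind) (hne : e₀ ≠ e₁ := by grind)
    (he₀' : e₀' < M₂.rank := by grind) (he₁' : e₁' < M₂.rank := by grind)
    (hne' : e₀' ≠ e₁' := by grind) :
    (M₁.weight e₀ * A (f₁ e₀) (f₂ e₀') + M₁.weight e₁ * A (f₁ e₁) (f₂ e₀') + V₂ = 0 ∧
      M₁.weight e₀ * A (f₁ e₀) (f₂ e₁') + M₁.weight e₁ * A (f₁ e₁) (f₂ e₁') + V₂ = 0) ∧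
    M₂.weight e₀' * A (f₂ e₀') (f₁ e₀) + M₂.weight e₁' * A (f₂ e₁') (f₁ e₀) + V₁ = 0 ∧
      M₂.weight e₀' * A (f₂ e₀') (f₁ e₁) + M₂.weight e₁' * A (f₂ e₁') (f₁ e₁) + V₁ = 0 := by
  have e1 := H.sum (f₂ e₀')
  have e2 := H.sum (f₂ e₁')
  have e3 := H.sum (f₁ e₀)
  have e4 := H.sum (f₁ e₁)
  have hs := H.glue.symm
  rw [H.glue.pairing_double hd H.part₁ H.part₂ hl he₀ he₁ hne he₀', h₀'] at e1
  rw [H.glue.pairing_double hd H.part₁ H.part₂ hl he₀ he₁ hne he₁', h₁'] at e2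
  rw [h₀, hs.pairing_double (disjoint_symm hd) H.part₂ H.part₁ hl' he₀' he₁' hne' he₀,
    add_comm] at e3
  rw [h₁, hs.pairing_double (disjoint_symm hd) H.part₂ H.part₁ hl' he₀' he₁' hne' he₁,
    add_comm] at e4
  exact ⟨⟨e1, e2⟩, e3, e4⟩

/-- With two decorated vertices an equation fixes only the sum of two entries. Signs and the
symmetric vanishing pattern supply the missing information. -/
theorem _root_.PrimSph.Glue.offDiag_nonpos (g : Glue A T₁ T₁' T₂ T₂') (hd : ∀ x ∈ T₁, x ∉ T₂)
    (p₁ : Part A T₁ T₁' M₁ f₁) (p₂ : Part A T₂ T₂' M₂ f₂) (i j : ℕ) (hi : i < M₁.rank := by grind)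
    (hj : j < M₂.rank := by grind) : A (f₁ i) (f₂ j) ≤ 0 ∧ A (f₂ j) (f₁ i) ≤ 0 ∧
      (A (f₁ i) (f₂ j) = 0 ↔ A (f₂ j) (f₁ i) = 0) := by
  have hne : f₁ i ≠ f₂ j := fun h => hd _ (p₁.mem_of_lt hi) (h ▸ p₂.mem_of_lt hj)
  exact ⟨g.gcm.offDiag _ _ hne, g.gcm.offDiag _ _ hne.symm, g.gcm.zero_symm _ _,
    g.gcm.zero_symm _ _⟩

/-- The two Cartan integers are `-2 k₂ / k₁` and `-2 k₁ / k₂`: equal factors give `A₁⁽¹⁾`, different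
ones `A₂⁽²⁾`. -/
theorem point_point (H : HomHom A T₁ T₁' T₂ T₂' (mB 1 k₁) f₁ (mB 1 k₂) f₂) (hd : ∀ x ∈ T₁, x ∉ T₂)
    (h₁ : IsOneOrTwo c₁ k₁) (h₂ : IsOneOrTwo c₂ k₂) : Listed A T₁' c₁ T₂' c₂ := by
  have he := H.single_single hd H.part₁.pairing_point H.part₂.pairing_point
  have hds := disjoint_symm hd
  rcases h₁ with ⟨rfl, rfl⟩ | ⟨rfl, rfl⟩ <;> rcases h₂ with ⟨rfl, rfl⟩ | ⟨rfl, rfl⟩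
  · refine H.glue.listed_of_disjoint hd H.part₁ H.part₂ (.affA1_a_a .one (Or.inl rfl))
      (fun _ => 0) (fun _ => 1) ?_ ?_ ?_ ?_ ?_ ?_ <;> grind
  · refine (H.glue.symm.listed_of_disjoint hds H.part₂ H.part₁ .twA2_2a_a
      (fun _ => 0) (fun _ => 1) ?_ ?_ ?_ ?_ ?_ ?_).symm <;> grind
  · refine H.glue.listed_of_disjoint hd H.part₁ H.part₂ .twA2_2a_a
      (fun _ => 0) (fun _ => 1) ?_ ?_ ?_ ?_ ?_ ?_ <;> grind
  · refine H.glue.listed_of_disjoint hd H.part₁ H.part₂ (.affA1_a_a .two (Or.inr rfl))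
      (fun _ => 0) (fun _ => 1) ?_ ?_ ?_ ?_ ?_ ?_ <;> grind

/-- The entries `b` from the point to the ends satisfy `k₂ b = -1`, so `k₂ = 1` and both ends are
bonded. The opposite entries add up to `-2`, hence are both `-1`, and the chain closes up to a
cycle. -/
theorem a_point (hm : 2 ≤ m) (H : HomHom A T₁ T₁' T₂ T₂' (mA m) f₁ (mB 1 k₂) f₂)
    (hd : ∀ x ∈ T₁, x ∉ T₂) (h₂ : IsOneOrTwo c₂ k₂) : Listed A T₁' .one T₂' c₂ := by
  have ha := H.part₁.pairing_a hm
  have he := H.double_single hd ha.1 ha.2 H.part₂.pairing_point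
  have g0 := H.glue.offDiag_nonpos hd H.part₁ H.part₂ 0 0
  have g1 := H.glue.offDiag_nonpos hd H.part₁ H.part₂ (m - 1) 0
  rcases h₂ with ⟨rfl, rfl⟩ | ⟨rfl, rfl⟩
  · refine (H.glue.symm.listed_of_disjoint (disjoint_symm hd) H.part₂ H.part₁
      (.affA_a_a m 1 hm le_rfl (by omega)) (fun _ => 0) (fun j => j + 1) ?_ ?_ ?_ ?_ ?_ ?_).symm <;>
      grind (splits := 20)
  · grind

theorem b_point (hm : 2 ≤ m) (H : HomHom A T₁ T₁' T₂ T₂' (mB m k₁) f₁ (mB 1 k₂) f₂)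
    (hd : ∀ x ∈ T₁, x ∉ T₂) (h₁ : IsOneOrTwo c₁ k₁) (h₂ : IsOneOrTwo c₂ k₂) :
    Listed A T₁' c₁ T₂' c₂ := by
  have he := H.single_single hd (H.part₁.pairing_b hm) H.part₂.pairing_point
  rcases eq_or_ne k₁ k₂ with rfl | hne
  · obtain ⟨rfl, hc⟩ : c₁ = c₂ ∧ (c₁ = .one ∨ c₁ = .two) := by grind
    refine (H.glue.symm.listed_of_disjoint (disjoint_symm hd) H.part₂ H.part₁
      (.twD_b_b m 1 c₁ hm le_rfl (by omega) hc) (fun _ => 0) (fun j => j + 1)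
      ?_ ?_ ?_ ?_ ?_ ?_).symm <;> grind (splits := 20)
  · obtain ⟨rfl, rfl, rfl, rfl⟩ : k₁ = 2 ∧ k₂ = 1 ∧ c₁ = .two ∧ c₂ = .one := by grind
    refine H.glue.listed_of_disjoint hd H.part₁ H.part₂ (.twAeven_2b_a m hm)
      (fun i => m - 1 - i) (fun _ => m) ?_ ?_ ?_ ?_ ?_ ?_ <;> grind (splits := 20)

theorem c_point (hm : 3 ≤ m) (H : HomHom A T₁ T₁' T₂ T₂' (mC m) f₁ (mB 1 k₂) f₂)
    (hd : ∀ x ∈ T₁, x ∉ T₂) (h₂ : IsOneOrTwo c₂ k₂) : Listed A T₁' .one T₂' c₂ := by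
  have he := H.single_single hd (H.part₁.pairing_c hm) H.part₂.pairing_point
  obtain ⟨rfl, rfl⟩ : c₂ = .one ∧ k₂ = 1 := by grind
  refine (H.glue.symm.listed_of_disjoint (disjoint_symm hd) H.part₂ H.part₁ (.twAodd_a_c m hm)
    (fun _ => 0) (fun j => j + 1) ?_ ?_ ?_ ?_ ?_ ?_).symm <;> grind (splits := 20)

theorem d_point (hm : 3 ≤ m) (H : HomHom A T₁ T₁' T₂ T₂' (mD m k₁) f₁ (mB 1 k₂) f₂)
    (hd : ∀ x ∈ T₁, x ∉ T₂) (h₁ : IsHalfOrOne c₁ k₁) (h₂ : IsOneOrTwo c₂ k₂) :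
    Listed A T₁' c₁ T₂' c₂ := by
  have he := H.single_single hd (H.part₁.pairing_d hm) H.part₂.pairing_point
  rcases h₁ with ⟨rfl, rfl⟩ | ⟨rfl, rfl⟩ <;> rcases h₂ with ⟨rfl, rfl⟩ | ⟨rfl, rfl⟩
  · refine H.glue.listed_of_disjoint hd H.part₁ H.part₂ (.affB_hd_b m m hm le_rfl)
      (fun i => m - 1 - i) (fun _ => m) ?_ ?_ ?_ ?_ ?_ ?_ <;> grind (splits := 25)
  · grind
  · refine H.glue.listed_of_disjoint hd H.part₁ H.part₂ (.twAodd_d_a m hm)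
      (fun i => m - 1 - i) (fun _ => m) ?_ ?_ ?_ ?_ ?_ ?_ <;> grind (splits := 25)
  · refine H.glue.listed_of_disjoint hd H.part₁ H.part₂ (.affB_d_2b m m hm le_rfl)
      (fun i => m - 1 - i) (fun _ => m) ?_ ?_ ?_ ?_ ?_ ?_ <;> grind (splits := 25)

theorem f_point (H : HomHom A T₁ T₁' T₂ T₂' mF f₁ (mB 1 k₂) f₂) (hd : ∀ x ∈ T₁, x ∉ T₂)
    (h₂ : IsOneOrTwo c₂ k₂) : Listed A T₁' .one T₂' c₂ := by
  have he := H.single_single hd H.part₁.pairing_f H.part₂.pairing_point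
  obtain ⟨rfl, rfl⟩ : c₂ = .one ∧ k₂ = 1 := by grind
  refine (H.glue.symm.listed_of_disjoint (disjoint_symm hd) H.part₂ H.part₁ .twE6_a_f
    (fun _ => 0) (fun j => 4 - j) ?_ ?_ ?_ ?_ ?_ ?_).symm <;> grind (splits := 20)

theorem g_point (H : HomHom A T₁ T₁' T₂ T₂' (mG k₁) f₁ (mB 1 k₂) f₂) (hd : ∀ x ∈ T₁, x ∉ T₂)
    (h₁ : IsOneOrTwo c₁ k₁) (h₂ : IsOneOrTwo c₂ k₂) : Listed A T₁' c₁ T₂' c₂ := by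
  have he := H.single_single hd H.part₁.pairing_g H.part₂.pairing_point
  obtain ⟨rfl, rfl, hc⟩ : k₁ = k₂ ∧ c₁ = c₂ ∧ (c₁ = .one ∨ c₁ = .two) := by grind
  refine (H.glue.symm.listed_of_disjoint (disjoint_symm hd) H.part₂ H.part₁ (.triD4_a_g c₁ hc)
    (fun _ => 0) (fun j => 2 - j) ?_ ?_ ?_ ?_ ?_ ?_).symm <;> grind (splits := 20)

theorem b_b (hm : 2 ≤ m) (hn : 2 ≤ n) (H : HomHom A T₁ T₁' T₂ T₂' (mB m k₁) f₁ (mB n k₂) f₂)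
    (hd : ∀ x ∈ T₁, x ∉ T₂) (h₁ : IsOneOrTwo c₁ k₁) (h₂ : IsOneOrTwo c₂ k₂) :
    Listed A T₁' c₁ T₂' c₂ := by
  have he := H.single_single hd (H.part₁.pairing_b hm) (H.part₂.pairing_b hn)
  obtain ⟨rfl, rfl, hc⟩ : k₁ = k₂ ∧ c₁ = c₂ ∧ (c₁ = .one ∨ c₁ = .two) := by grind
  refine H.glue.listed_of_disjoint hd H.part₁ H.part₂
    (.twD_b_b (m + n - 1) m c₁ (by omega) (by omega) (by omega) hc)
    (fun i => m - 1 - i) (fun j => m + j) ?_ ?_ ?_ ?_ ?_ ?_ <;> grind (splits := 20)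

theorem d_b (hm : 3 ≤ m) (hn : 2 ≤ n) (H : HomHom A T₁ T₁' T₂ T₂' (mD m k₁) f₁ (mB n k₂) f₂)
    (hd : ∀ x ∈ T₁, x ∉ T₂) (h₁ : IsHalfOrOne c₁ k₁) (h₂ : IsOneOrTwo c₂ k₂) :
    Listed A T₁' c₁ T₂' c₂ := by
  have he := H.single_single hd (H.part₁.pairing_d hm) (H.part₂.pairing_b hn)
  rcases h₁ with ⟨rfl, rfl⟩ | ⟨rfl, rfl⟩ <;> rcases h₂ with ⟨rfl, rfl⟩ | ⟨rfl, rfl⟩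
  · refine H.glue.listed_of_disjoint hd H.part₁ H.part₂ (.affB_hd_b (m + n - 1) m hm (by omega))
      (fun i => m - 1 - i) (fun j => m + j) ?_ ?_ ?_ ?_ ?_ ?_ <;> grind (splits := 25)
  · grind
  · grind
  · refine H.glue.listed_of_disjoint hd H.part₁ H.part₂ (.affB_d_2b (m + n - 1) m hm (by omega))
      (fun i => m - 1 - i) (fun j => m + j) ?_ ?_ ?_ ?_ ?_ ?_ <;> grind (splits := 25)

theorem d_d (hm : 3 ≤ m) (hn : 3 ≤ n) (H : HomHom A T₁ T₁' T₂ T₂' (mD m k₁) f₁ (mD n k₂) f₂)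
    (hd : ∀ x ∈ T₁, x ∉ T₂) (h₁ : IsHalfOrOne c₁ k₁) (h₂ : IsHalfOrOne c₂ k₂) :
    Listed A T₁' c₁ T₂' c₂ := by
  have he := H.single_single hd (H.part₁.pairing_d hm) (H.part₂.pairing_d hn)
  obtain ⟨rfl, rfl, hc⟩ : k₁ = k₂ ∧ c₁ = c₂ ∧ (c₁ = .one ∨ c₁ = .half) := by grind
  refine H.glue.listed_of_disjoint hd H.part₁ H.part₂
    (.affD_d_d' (m + n - 1) m c₁ hm (by omega) hc)
    (fun i => m - 1 - i) (fun j => m + j) ?_ ?_ ?_ ?_ ?_ ?_ <;> grind (splits := 25)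

theorem dd_b (hn : 2 ≤ n) (H : HomHom A T₁ T₁' T₂ T₂' (mDD k₁) f₁ (mB n k₂) f₂)
    (hd : ∀ x ∈ T₁, x ∉ T₂) (h₁ : IsHalfOrOne c₁ k₁) (h₂ : IsOneOrTwo c₂ k₂) :
    Listed A T₁' c₁ T₂' c₂ := by
  have he := H.double_single hd (H.part₁.pairing_dd (j := 0) (by simp))
    (H.part₁.pairing_dd (j := 1) (by simp))
    (H.part₂.pairing_b hn)
  have g0 := H.glue.offDiag_nonpos hd H.part₁ H.part₂ 0 0
  have g1 := H.glue.offDiag_nonpos hd H.part₁ H.part₂ 1 0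
  rcases h₁ with ⟨rfl, rfl⟩ | ⟨rfl, rfl⟩ <;> rcases h₂ with ⟨rfl, rfl⟩ | ⟨rfl, rfl⟩
  · refine H.glue.listed_of_disjoint hd H.part₁ H.part₂ (.affB_hd2_b (n + 1) (by omega))
      (fun i => i) (fun j => j + 2) ?_ ?_ ?_ ?_ ?_ ?_ <;> grind (splits := 25)
  · grind
  · grind
  · refine H.glue.listed_of_disjoint hd H.part₁ H.part₂ (.affB_d2_2b (n + 1) (by omega))
      (fun i => i) (fun j => j + 2) ?_ ?_ ?_ ?_ ?_ ?_ <;> grind (splits := 25)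

theorem dd_d (hn : 3 ≤ n) (H : HomHom A T₁ T₁' T₂ T₂' (mDD k₁) f₁ (mD n k₂) f₂)
    (hd : ∀ x ∈ T₁, x ∉ T₂) (h₁ : IsHalfOrOne c₁ k₁) (h₂ : IsHalfOrOne c₂ k₂) :
    Listed A T₁' c₁ T₂' c₂ := by
  have he := H.double_single hd (H.part₁.pairing_dd (j := 0) (by simp))
    (H.part₁.pairing_dd (j := 1) (by simp))
    (H.part₂.pairing_d hn)
  have g0 := H.glue.offDiag_nonpos hd H.part₁ H.part₂ 0 0
  have g1 := H.glue.offDiag_nonpos hd H.part₁ H.part₂ 1 0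
  obtain ⟨rfl, rfl, hc⟩ : k₁ = k₂ ∧ c₁ = c₂ ∧ (c₁ = .one ∨ c₁ = .half) := by grind
  have hx : A (f₁ 0) (f₂ 0) = -1 ∧ A (f₁ 1) (f₂ 0) = -1 ∧ A (f₂ 0) (f₁ 0) = -1 ∧
      A (f₂ 0) (f₁ 1) = -1 := by grind
  refine H.glue.listed_of_disjoint hd H.part₁ H.part₂ (.affD_d2_d (n + 1) c₁ (by omega) hc)
    (fun i => i) (fun j => j + 2) ?_ ?_ ?_ ?_ ?_ ?_ <;> grind (splits := 25)

end HomHom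

end PrimSph

/-! ### Disjoint homogeneous parts with two decorated vertices -/

namespace PrimSph

open Matrix

variable {S : Type*} {A : Matrix S S ℤ} {T₁ T₁' T₂ T₂' : Set S} {c₁ c₂ : Factor}
  {M₁ M₂ : Model} {f f₁ f₂ : ℕ → S} {m n : ℕ} {k k₁ k₂ : ℤ}

theorem pairing_reverse (x : S) :
    pairing A (mA n) (fun i => f (n - 1 - i)) x = pairing A (mA n) f x :=
  Finset.sum_range_reflect (fun i => 2 * A (f i) x) n

theorem pairing_swap (x : S) :
    pairing A (mDD k) (fun i => f (1 - i)) x = pairing A (mDD k) f x :=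
  Finset.sum_range_reflect (fun i => k * A (f i) x) 2

namespace HomHom

theorem reverse (hn : 2 ≤ n) (H : HomHom A T₁ T₁' T₂ T₂' M₁ f₁ (mA n) f₂) :
    HomHom A T₁ T₁' T₂ T₂' M₁ f₁ (mA n) fun i => f₂ (n - 1 - i) :=
  ⟨H.glue, H.part₁, H.part₂.reverse hn, fun x => by rw [pairing_reverse]; exact H.sum x⟩

theorem swap (H : HomHom A T₁ T₁' T₂ T₂' M₁ f₁ (mDD k) f₂) :
    HomHom A T₁ T₁' T₂ T₂' M₁ f₁ (mDD k) fun i => f₂ (1 - i) :=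
  ⟨H.glue, H.part₁, H.part₂.swap, fun x => by rw [pairing_swap]; exact H.sum x⟩

theorem dd_point (H : HomHom A T₁ T₁' T₂ T₂' (mDD k₁) f₁ (mB 1 k₂) f₂)
    (hd : ∀ x ∈ T₁, x ∉ T₂) (h₁ : IsHalfOrOne c₁ k₁) (h₂ : IsOneOrTwo c₂ k₂) :
    Listed A T₁' c₁ T₂' c₂ := by
  have he := H.double_single hd (H.part₁.pairing_dd (j := 0) (by simp))
    (H.part₁.pairing_dd (j := 1) (by simp)) H.part₂.pairing_point
  have g0 := H.glue.offDiag_nonpos hd H.part₁ H.part₂ 0 0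
  have g1 := H.glue.offDiag_nonpos hd H.part₁ H.part₂ 1 0
  rcases h₁ with ⟨rfl, rfl⟩ | ⟨rfl, rfl⟩ <;> rcases h₂ with ⟨rfl, rfl⟩ | ⟨rfl, rfl⟩
  -- Two negative integers with sum `-4`: the symmetric splitting gives `C₂⁽¹⁾`, the two others give
  -- `D₄⁽³⁾` with the vertices of `d 2` in either order.
  · have key : A (f₁ 0) (f₂ 0) = -2 ∨ A (f₁ 0) (f₂ 0) = -1 ∨ A (f₁ 1) (f₂ 0) = -1 := by grind
    rcases key with h | h | h
    · refine H.glue.listed_of_disjoint hd H.part₁ H.part₂ (.affC_hd2_a 2 le_rfl)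
        (fun i => 2 * i) (fun _ => 1) ?_ ?_ ?_ ?_ ?_ ?_ <;> grind (splits := 20)
    · refine H.glue.listed_of_disjoint hd H.part₁ H.part₂ .triD4_hd2_a
        (fun i => 2 * i) (fun _ => 1) ?_ ?_ ?_ ?_ ?_ ?_ <;> grind (splits := 20)
    · refine H.glue.listed_of_disjoint hd H.part₁ H.part₂ .triD4_hd2_a
        (fun i => 2 - 2 * i) (fun _ => 1) ?_ ?_ ?_ ?_ ?_ ?_ <;> grind (splits := 20)
  · grind
  · refine H.glue.listed_of_disjoint hd H.part₁ H.part₂ (.twD_d2_a 2 le_rfl)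
      (fun i => 2 * i) (fun _ => 1) ?_ ?_ ?_ ?_ ?_ ?_ <;> grind (splits := 20)
  · have key : A (f₁ 0) (f₂ 0) = -2 ∨ A (f₁ 0) (f₂ 0) = -1 ∨ A (f₁ 1) (f₂ 0) = -1 := by grind
    rcases key with h | h | h
    · refine H.glue.listed_of_disjoint hd H.part₁ H.part₂ .affC2_d2_2a
        (fun i => 2 * i) (fun _ => 1) ?_ ?_ ?_ ?_ ?_ ?_ <;> grind (splits := 20)
    · refine H.glue.listed_of_disjoint hd H.part₁ H.part₂ .triD4_d2_2a
        (fun i => 2 * i) (fun _ => 1) ?_ ?_ ?_ ?_ ?_ ?_ <;> grind (splits := 20)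
    · refine H.glue.listed_of_disjoint hd H.part₁ H.part₂ .triD4_d2_2a
        (fun i => 2 - 2 * i) (fun _ => 1) ?_ ?_ ?_ ?_ ?_ ?_ <;> grind (splits := 20)

/-- The entries between the ends form 2 × 2 matrices whose sums over either pair of ends are `-1`.
Thus the bonds are a perfect matching by simple bonds, and after a reversal they close up to a
cycle. -/
theorem a_a (hm : 2 ≤ m) (hn : 2 ≤ n) (H : HomHom A T₁ T₁' T₂ T₂' (mA m) f₁ (mA n) f₂)
    (hd : ∀ x ∈ T₁, x ∉ T₂) : Listed A T₁' .one T₂' .one := by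
  wlog h : A (f₁ 0) (f₂ 0) = 0 generalizing f₂
  · refine this (H.reverse hn) ?_
    have he := H.double_double hd (H.part₁.pairing_a hm).1 (H.part₁.pairing_a hm).2
      (H.part₂.pairing_a hn).1 (H.part₂.pairing_a hn).2
    have g0 := H.glue.offDiag_nonpos hd H.part₁ H.part₂ 0 0
    have g1 := H.glue.offDiag_nonpos hd H.part₁ H.part₂ 0 (n - 1)
    grind
  have he := H.double_double hd (H.part₁.pairing_a hm).1 (H.part₁.pairing_a hm).2
    (H.part₂.pairing_a hn).1 (H.part₂.pairing_a hn).2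
  have g0 := H.glue.offDiag_nonpos hd H.part₁ H.part₂ 0 0
  have g1 := H.glue.offDiag_nonpos hd H.part₁ H.part₂ 0 (n - 1)
  have g2 := H.glue.offDiag_nonpos hd H.part₁ H.part₂ (m - 1) 0
  have g3 := H.glue.offDiag_nonpos hd H.part₁ H.part₂ (m - 1) (n - 1)
  refine H.glue.listed_of_disjoint hd H.part₁ H.part₂ (.affA_a_a (m + n - 1) m (by omega)
    (by omega) (by omega)) (fun i => i) (fun j => m + j) ?_ ?_ ?_ ?_ ?_ ?_ <;>
    grind (splits := 25)

/-- The entries in one direction have sum `-k` at each vertex of `d 2`, those in the other direction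
have sum `-2 / k` at each end of the chain. One of the two numbers is `-1`, so the bonds match the
vertices of `d 2` with the ends; both bonds are double, and `k` decides on their direction. -/
theorem a_dd (hm : 2 ≤ m) (H : HomHom A T₁ T₁' T₂ T₂' (mA m) f₁ (mDD k) f₂)
    (hd : ∀ x ∈ T₁, x ∉ T₂) (h₂ : IsHalfOrOne c₂ k) : Listed A T₁' .one T₂' c₂ := by
  wlog h : A (f₁ 0) (f₂ 1) = 0 generalizing f₂
  · refine this H.swap ?_
    have he := H.double_double hd (H.part₁.pairing_a hm).1 (H.part₁.pairing_a hm).2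
      (H.part₂.pairing_dd (j := 0) (by simp)) (H.part₂.pairing_dd (j := 1) (by simp))
    have g0 := H.glue.offDiag_nonpos hd H.part₁ H.part₂ 0 0
    have g1 := H.glue.offDiag_nonpos hd H.part₁ H.part₂ 0 1
    have g2 := H.glue.offDiag_nonpos hd H.part₁ H.part₂ (m - 1) 0
    have g3 := H.glue.offDiag_nonpos hd H.part₁ H.part₂ (m - 1) 1
    rcases h₂ with ⟨rfl, rfl⟩ | ⟨rfl, rfl⟩ <;> grind
  have he := H.double_double hd (H.part₁.pairing_a hm).1 (H.part₁.pairing_a hm).2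
    (H.part₂.pairing_dd (j := 0) (by simp)) (H.part₂.pairing_dd (j := 1) (by simp))
  have g0 := H.glue.offDiag_nonpos hd H.part₁ H.part₂ 0 0
  have g1 := H.glue.offDiag_nonpos hd H.part₁ H.part₂ 0 1
  have g2 := H.glue.offDiag_nonpos hd H.part₁ H.part₂ (m - 1) 0
  have g3 := H.glue.offDiag_nonpos hd H.part₁ H.part₂ (m - 1) 1
  rcases h₂ with ⟨rfl, rfl⟩ | ⟨rfl, rfl⟩
  · have hx : A (f₁ (m - 1)) (f₂ 0) = 0 ∧ A (f₂ 0) (f₁ 0) = -2 ∧ A (f₁ 0) (f₂ 0) = -1 := by grind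
    refine (H.glue.symm.listed_of_disjoint (disjoint_symm hd) H.part₂ H.part₁
      (.affC_hd2_a (m + 1) (by omega)) (fun i => if i = 0 then 0 else m + 1) (fun j => j + 1)
      ?_ ?_ ?_ ?_ ?_ ?_).symm <;> grind (splits := 25)
  · have hx : A (f₁ (m - 1)) (f₂ 0) = 0 ∧ A (f₂ 0) (f₁ 0) = -1 ∧ A (f₁ 0) (f₂ 0) = -2 := by grind
    refine (H.glue.symm.listed_of_disjoint (disjoint_symm hd) H.part₂ H.part₁
      (.twD_d2_a (m + 1) (by omega)) (fun i => if i = 0 then 0 else m + 1) (fun j => j + 1)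
      ?_ ?_ ?_ ?_ ?_ ?_).symm <;> grind (splits := 25)

/-- If two opposite bonds are missing, the diagram falls apart into the pairs `{f₁ 1, f₂ 0}` and
`{f₁ 0, f₂ 1}`. This is where the reducible affine entries come from. -/
theorem _root_.PrimSph.Glue.listed_dd_dd (g : Glue A T₁ T₁' T₂ T₂') (hd : ∀ x ∈ T₁, x ∉ T₂)
    (p₁ : Part A T₁ T₁' (mDD k₁) f₁) (p₂ : Part A T₂ T₂' (mDD k₂) f₂)
    {X : Matrix (Fin 2) (Fin 2) ℤ} (hE : IsListed (double X X [0] [0] c₁ [1] [1] c₂))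
    (h₀ : A (f₁ 0) (f₂ 0) = 0) (h₁ : A (f₁ 1) (f₂ 1) = 0)
    (h : ∀ i < 2, ext X 0 1 = A (f₁ i) (f₂ (1 - i)) ∧ ext X 1 0 = A (f₂ (1 - i)) (f₁ i))
    (h' : ∀ i < 2, ext X i i = 2) : Listed A T₁' c₁ T₂' c₂ := by
  have d₁ : ∀ i < 2, f₁ i ∈ T₁' ∧ f₁ i ∉ T₂' := fun i hi =>
    ⟨(p₁.mem_dec_iff hi).2 (by grind), fun h => g.not_mem₁ _ h (p₁.mem_of_lt hi)⟩
  have d₂ : ∀ i < 2, f₂ i ∉ T₁' ∧ f₂ i ∈ T₂' := fun i hi =>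
    ⟨fun h => g.not_mem₂ _ h (p₂.mem_of_lt hi), (p₂.mem_dec_iff hi).2 (by grind)⟩
  have d := g.gcm.diag
  have e₁ := p₁.cartan 0 (by simp) 1 (by simp)
  have e₂ := p₂.cartan 0 (by simp) 1 (by simp)
  have e₁' := p₁.cartan 1 (by simp) 0 (by simp)
  have e₂' := p₂.cartan 1 (by simp) 0 (by simp)
  have g₀ := g.offDiag_nonpos hd p₁ p₂ 0 1
  have g₁ := g.offDiag_nonpos hd p₁ p₂ 1 0
  refine listed_of_double g.gcm hE (fun i => if i = 0 then f₁ 1 else f₂ 0)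
    (fun i => if i = 0 then f₁ 0 else f₂ 1) (fun x => ?_) ?_ ?_ ?_ ?_ ?_ ?_ ?_
  · rcases g.exists_cover p₁ p₂ x with ⟨i, hi, rfl⟩ | ⟨i, hi, rfl⟩
    · rcases (by grind : i = 0 ∨ i = 1) with rfl | rfl
      · exact Or.inr ⟨0, by simp⟩
      · exact Or.inl ⟨0, by simp⟩
    · rcases (by grind : i = 0 ∨ i = 1) with rfl | rfl
      · exact Or.inl ⟨1, by simp⟩
      · exact Or.inr ⟨1, by simp⟩
  · intro i hi j hj
    interval_cases i <;> interval_cases j <;> grind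
  · intro i hi j hj
    interval_cases i <;> interval_cases j <;> grind
  · grind
  · grind
  · intro i hi j hj
    have := g.gcm.zero_symm
    interval_cases i <;> interval_cases j <;> grind
  · grind
  · grind

/-- The entry sums are `-2 k₂ / k₁` and `-2 k₁ / k₂`. For equal factors, one missing bond leaves two
possibilities: the opposite bond is missing as well, or it is simple and the four vertices form the
path `D₄⁽²⁾`. For different factors one of the sums is `-1`, which forces a perfect matching. -/
theorem dd_dd_of_eq_zero (H : HomHom A T₁ T₁' T₂ T₂' (mDD k₁) f₁ (mDD k₂) f₂)
    (hd : ∀ x ∈ T₁, x ∉ T₂) (h₁ : IsHalfOrOne c₁ k₁) (h₂ : IsHalfOrOne c₂ k₂) (hk : k₂ ≤ k₁)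
    (h : A (f₁ 0) (f₂ 0) = 0) : Listed A T₁' c₁ T₂' c₂ := by
  have he := H.double_double hd (H.part₁.pairing_dd (j := 0) (by simp))
    (H.part₁.pairing_dd (j := 1) (by simp)) (H.part₂.pairing_dd (j := 0) (by simp))
    (H.part₂.pairing_dd (j := 1) (by simp))
  have g₀₀ := H.glue.offDiag_nonpos hd H.part₁ H.part₂ 0 0
  have g₀₁ := H.glue.offDiag_nonpos hd H.part₁ H.part₂ 0 1
  have g₁₀ := H.glue.offDiag_nonpos hd H.part₁ H.part₂ 1 0
  have g₁₁ := H.glue.offDiag_nonpos hd H.part₁ H.part₂ 1 1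
  rcases hk.eq_or_lt with rfl | hk
  · obtain ⟨rfl, hc⟩ : c₁ = c₂ ∧ (c₁ = .one ∨ c₁ = .half) := by grind
    by_cases h' : A (f₁ 1) (f₂ 1) = 0
    · refine H.glue.listed_dd_dd hd H.part₁ H.part₂ (.affA1xaffA1_d2_d2 c₁ hc) h h' ?_ ?_ <;> grind
    · have hx : A (f₁ 1) (f₂ 1) = -1 ∧ A (f₂ 1) (f₁ 1) = -1 ∧ A (f₁ 1) (f₂ 0) = -2 ∧
        A (f₂ 0) (f₁ 1) = -1 ∧ A (f₁ 0) (f₂ 1) = -1 ∧ A (f₂ 1) (f₁ 0) = -2 := by grind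
      refine (H.glue.symm.listed_of_disjoint (disjoint_symm hd) H.part₂ H.part₁
        (.twD4_d2_d2 c₁ hc) (fun i => 2 * i) (fun j => 3 - 2 * j) ?_ ?_ ?_ ?_ ?_ ?_).symm <;>
        grind (splits := 25)
  · obtain ⟨rfl, rfl, rfl, rfl⟩ : k₁ = 2 ∧ k₂ = 1 ∧ c₁ = .one ∧ c₂ = .half := by grind
    refine H.glue.listed_dd_dd hd H.part₁ H.part₂ .twA2xtwA2_d2_hd2 h ?_ ?_ ?_ <;> grind

/-- Swapping the vertices of either part moves a missing bond to the position treated before. If no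
bond is missing, all sums are at most `-2`, so the factors agree and all bonds are simple: a
4-cycle. -/
theorem dd_dd (H : HomHom A T₁ T₁' T₂ T₂' (mDD k₁) f₁ (mDD k₂) f₂)
    (hd : ∀ x ∈ T₁, x ∉ T₂) (h₁ : IsHalfOrOne c₁ k₁) (h₂ : IsHalfOrOne c₂ k₂) :
    Listed A T₁' c₁ T₂' c₂ := by
  wlog hk : k₂ ≤ k₁ generalizing T₁ T₂ T₁' T₂' k₁ k₂ f₁ f₂ c₁ c₂
  · exact (this H.symm (disjoint_symm hd) h₂ h₁ (by omega)).symm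
  by_cases h₀₀ : A (f₁ 0) (f₂ 0) = 0
  · exact H.dd_dd_of_eq_zero hd h₁ h₂ hk h₀₀
  by_cases h₀₁ : A (f₁ 0) (f₂ 1) = 0
  · exact H.swap.dd_dd_of_eq_zero hd h₁ h₂ hk h₀₁
  by_cases h₁₀ : A (f₁ 1) (f₂ 0) = 0
  · exact H.symm.swap.symm.dd_dd_of_eq_zero hd h₁ h₂ hk h₁₀
  by_cases h₁₁ : A (f₁ 1) (f₂ 1) = 0
  · exact H.symm.swap.symm.swap.dd_dd_of_eq_zero hd h₁ h₂ hk h₁₁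
  have he := H.double_double hd (H.part₁.pairing_dd (j := 0) (by simp))
    (H.part₁.pairing_dd (j := 1) (by simp)) (H.part₂.pairing_dd (j := 0) (by simp))
    (H.part₂.pairing_dd (j := 1) (by simp))
  have g₀₀ := H.glue.offDiag_nonpos hd H.part₁ H.part₂ 0 0
  have g₀₁ := H.glue.offDiag_nonpos hd H.part₁ H.part₂ 0 1
  have g₁₀ := H.glue.offDiag_nonpos hd H.part₁ H.part₂ 1 0
  have g₁₁ := H.glue.offDiag_nonpos hd H.part₁ H.part₂ 1 1
  obtain ⟨rfl, rfl, hc⟩ : k₁ = k₂ ∧ c₁ = c₂ ∧ (c₁ = .one ∨ c₁ = .half) := by grind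
  have hx : A (f₁ 0) (f₂ 0) = -1 ∧ A (f₂ 0) (f₁ 0) = -1 ∧ A (f₁ 0) (f₂ 1) = -1 ∧
    A (f₂ 1) (f₁ 0) = -1 ∧ A (f₁ 1) (f₂ 0) = -1 ∧ A (f₂ 0) (f₁ 1) = -1 ∧
    A (f₁ 1) (f₂ 1) = -1 ∧ A (f₂ 1) (f₁ 1) = -1 := by grind
  refine H.glue.listed_of_disjoint hd H.part₁ H.part₂ (.affA3_d2_d2 c₁ hc)
    (fun i => 2 * i) (fun j => 2 * j + 1) ?_ ?_ ?_ ?_ ?_ ?_ <;> grind (splits := 25)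

end HomHom

end PrimSph

/-! ### Disjoint homogeneous parts: exhaustion of all pairs of models -/

namespace PrimSph

open Matrix

variable {S : Type*} {A : Matrix S S ℤ} {T₁ T₁' T₂ T₂' : Set S} {c₁ c₂ : Factor}
  {M₁ M₂ : Model} {f₁ f₂ : ℕ → S} {m n : ℕ} {k₁ k₂ : ℤ}

namespace HomHom

/-- In this and the following lemmas the first model is fixed and the second one varies. Pairs
already treated are recalled by symmetry. The pairs missing from the list are those whose equations
have no admissible integral solution. -/
theorem point_hom (h₁ : IsOneOrTwo c₁ k₁) (H : HomHom A T₁ T₁' T₂ T₂' (mB 1 k₁) f₁ M₂ f₂)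
    (hd : ∀ x ∈ T₁, x ∉ T₂) (h₂ : IsModel M₂ c₂) (hc₂ : c₂ ≠ .inh) : Listed A T₁' c₁ T₂' c₂ := by
  have hs := disjoint_symm hd
  cases h₂ with
  | point c k h => exact point_point H hd h₁ h
  | a n hn => exact (a_point hn H.symm hs h₁).symm
  | b n hn c k h => exact (b_point hn H.symm hs h h₁).symm
  | dd c k h => exact (dd_point H.symm hs h h₁).symm
  | d n hn c k h => exact (d_point hn H.symm hs h h₁).symm
  | c n hn => exact (c_point hn H.symm hs h₁).symm
  | f => exact (f_point H.symm hs h₁).symm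
  | g c k h => exact (g_point H.symm hs h h₁).symm
  | b' c k h =>
    -- The coefficient of the decorated vertex of `b' 3` is `3 k`, which does not divide `4 k₁`.
    rcases h₁ with ⟨-, rfl⟩ | ⟨-, rfl⟩ <;> rcases h with ⟨-, rfl⟩ | ⟨-, rfl⟩ <;>
      grind [H.single_single hd H.part₁.pairing_point H.part₂.pairing_b']
  | aa => exact absurd rfl hc₂
  | cc => exact absurd rfl hc₂

theorem a_hom (hm : 2 ≤ m) (H : HomHom A T₁ T₁' T₂ T₂' (mA m) f₁ M₂ f₂)
    (hd : ∀ x ∈ T₁, x ∉ T₂) (h₂ : IsModel M₂ c₂) (hc₂ : c₂ ≠ .inh) : Listed A T₁' .one T₂' c₂ := by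
  have hs := disjoint_symm hd
  cases h₂ with
  | point c k h => exact (point_hom h H.symm hs (.a _ hm) (by grind)).symm
  | a n hn => exact a_a hm hn H hd
  | b n hn c k h =>
    -- The equations at the two ends show that both are bonded and that `k = 1`; but then the
    -- entries in the other direction add up to only `-1`.
    rcases h with ⟨-, rfl⟩ | ⟨-, rfl⟩ <;>
      grind [H.double_single hd (H.part₁.pairing_a hm).1 (H.part₁.pairing_a hm).2
          (H.part₂.pairing_b hn),
        H.glue.offDiag_nonpos hd H.part₁ H.part₂ 0 0,
        H.glue.offDiag_nonpos hd H.part₁ H.part₂ (m - 1) 0]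
  | dd c k h => exact a_dd hm H hd h
  | d n hn c k h =>
    rcases h with ⟨-, rfl⟩ | ⟨-, rfl⟩ <;>
      grind [H.double_single hd (H.part₁.pairing_a hm).1 (H.part₁.pairing_a hm).2
          (H.part₂.pairing_d hn),
        H.glue.offDiag_nonpos hd H.part₁ H.part₂ 0 0,
        H.glue.offDiag_nonpos hd H.part₁ H.part₂ (m - 1) 0]
  | c n hn =>
    grind [H.double_single hd (H.part₁.pairing_a hm).1 (H.part₁.pairing_a hm).2
        (H.part₂.pairing_c hn),
      H.glue.offDiag_nonpos hd H.part₁ H.part₂ 0 1,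
      H.glue.offDiag_nonpos hd H.part₁ H.part₂ (m - 1) 1]
  | f =>
    grind [H.double_single hd (H.part₁.pairing_a hm).1 (H.part₁.pairing_a hm).2 H.part₂.pairing_f,
      H.glue.offDiag_nonpos hd H.part₁ H.part₂ 0 3,
      H.glue.offDiag_nonpos hd H.part₁ H.part₂ (m - 1) 3]
  | g c k h =>
    rcases h with ⟨-, rfl⟩ | ⟨-, rfl⟩ <;>
      grind [H.double_single hd (H.part₁.pairing_a hm).1 (H.part₁.pairing_a hm).2 H.part₂.pairing_g,
        H.glue.offDiag_nonpos hd H.part₁ H.part₂ 0 1,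
        H.glue.offDiag_nonpos hd H.part₁ H.part₂ (m - 1) 1]
  | b' c k h =>
    rcases h with ⟨-, rfl⟩ | ⟨-, rfl⟩ <;>
      grind [H.double_single hd (H.part₁.pairing_a hm).1 (H.part₁.pairing_a hm).2
          H.part₂.pairing_b',
        H.glue.offDiag_nonpos hd H.part₁ H.part₂ 0 2,
        H.glue.offDiag_nonpos hd H.part₁ H.part₂ (m - 1) 2]
  | aa => exact absurd rfl hc₂
  | cc => exact absurd rfl hc₂

theorem b_hom (hm : 2 ≤ m) (h₁ : IsOneOrTwo c₁ k₁) (H : HomHom A T₁ T₁' T₂ T₂' (mB m k₁) f₁ M₂ f₂)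
    (hd : ∀ x ∈ T₁, x ∉ T₂) (h₂ : IsModel M₂ c₂) (hc₂ : c₂ ≠ .inh) : Listed A T₁' c₁ T₂' c₂ := by
  have hs := disjoint_symm hd
  cases h₂ with
  | point c k h => exact (point_hom h H.symm hs (.b _ hm _ _ h₁) (by grind)).symm
  | a n hn => exact (a_hom hn H.symm hs (.b _ hm _ _ h₁) (by grind)).symm
  | b n hn c k h => exact b_b hm hn H hd h₁ h
  | dd c k h => exact (dd_b hm H.symm hs h h₁).symm
  | d n hn c k h => exact (d_b hn hm H.symm hs h h₁).symm
  | c n hn =>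
    rcases h₁ with ⟨-, rfl⟩ | ⟨-, rfl⟩ <;>
      grind [H.single_single hd (H.part₁.pairing_b hm) (H.part₂.pairing_c hn)]
  | f =>
    rcases h₁ with ⟨-, rfl⟩ | ⟨-, rfl⟩ <;>
      grind [H.single_single hd (H.part₁.pairing_b hm) H.part₂.pairing_f]
  | g c k h =>
    rcases h₁ with ⟨-, rfl⟩ | ⟨-, rfl⟩ <;> rcases h with ⟨-, rfl⟩ | ⟨-, rfl⟩ <;>
      grind [H.single_single hd (H.part₁.pairing_b hm) H.part₂.pairing_g]
  | b' c k h =>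
    rcases h₁ with ⟨-, rfl⟩ | ⟨-, rfl⟩ <;> rcases h with ⟨-, rfl⟩ | ⟨-, rfl⟩ <;>
      grind [H.single_single hd (H.part₁.pairing_b hm) H.part₂.pairing_b']
  | aa => exact absurd rfl hc₂
  | cc => exact absurd rfl hc₂

theorem dd_hom (h₁ : IsHalfOrOne c₁ k₁) (H : HomHom A T₁ T₁' T₂ T₂' (mDD k₁) f₁ M₂ f₂)
    (hd : ∀ x ∈ T₁, x ∉ T₂) (h₂ : IsModel M₂ c₂) (hc₂ : c₂ ≠ .inh) : Listed A T₁' c₁ T₂' c₂ := by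
  have hs := disjoint_symm hd
  cases h₂ with
  | point c k h => exact (point_hom h H.symm hs (.dd _ _ h₁) (by grind)).symm
  | a n hn => exact (a_hom hn H.symm hs (.dd _ _ h₁) (by grind)).symm
  | b n hn c k h => exact (b_hom hn h H.symm hs (.dd _ _ h₁) (by grind)).symm
  | dd c k h => exact dd_dd H hd h₁ h
  | d n hn c k h => exact dd_d hn H hd h₁ h
  | c n hn =>
    rcases h₁ with ⟨-, rfl⟩ | ⟨-, rfl⟩ <;>
      grind [H.double_single hd (H.part₁.pairing_dd (j := 0) (by simp))
          (H.part₁.pairing_dd (j := 1) (by simp))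
          (H.part₂.pairing_c hn),
        H.glue.offDiag_nonpos hd H.part₁ H.part₂ 0 1, H.glue.offDiag_nonpos hd H.part₁ H.part₂ 1 1]
  | f =>
    rcases h₁ with ⟨-, rfl⟩ | ⟨-, rfl⟩ <;>
      grind [H.double_single hd (H.part₁.pairing_dd (j := 0) (by simp))
          (H.part₁.pairing_dd (j := 1) (by simp))
          H.part₂.pairing_f,
        H.glue.offDiag_nonpos hd H.part₁ H.part₂ 0 3, H.glue.offDiag_nonpos hd H.part₁ H.part₂ 1 3]
  | g c k h =>
    rcases h₁ with ⟨-, rfl⟩ | ⟨-, rfl⟩ <;> rcases h with ⟨-, rfl⟩ | ⟨-, rfl⟩ <;>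
      grind [H.double_single hd (H.part₁.pairing_dd (j := 0) (by simp))
          (H.part₁.pairing_dd (j := 1) (by simp))
          H.part₂.pairing_g,
        H.glue.offDiag_nonpos hd H.part₁ H.part₂ 0 1, H.glue.offDiag_nonpos hd H.part₁ H.part₂ 1 1]
  | b' c k h =>
    rcases h₁ with ⟨-, rfl⟩ | ⟨-, rfl⟩ <;> rcases h with ⟨-, rfl⟩ | ⟨-, rfl⟩ <;>
      grind [H.double_single hd (H.part₁.pairing_dd (j := 0) (by simp))
          (H.part₁.pairing_dd (j := 1) (by simp))
          H.part₂.pairing_b',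
        H.glue.offDiag_nonpos hd H.part₁ H.part₂ 0 2, H.glue.offDiag_nonpos hd H.part₁ H.part₂ 1 2]
  | aa => exact absurd rfl hc₂
  | cc => exact absurd rfl hc₂

theorem d_hom (hm : 3 ≤ m) (h₁ : IsHalfOrOne c₁ k₁) (H : HomHom A T₁ T₁' T₂ T₂' (mD m k₁) f₁ M₂ f₂)
    (hd : ∀ x ∈ T₁, x ∉ T₂) (h₂ : IsModel M₂ c₂) (hc₂ : c₂ ≠ .inh) : Listed A T₁' c₁ T₂' c₂ := by
  have hs := disjoint_symm hd
  cases h₂ with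
  | point c k h => exact (point_hom h H.symm hs (.d _ hm _ _ h₁) (by grind)).symm
  | a n hn => exact (a_hom hn H.symm hs (.d _ hm _ _ h₁) (by grind)).symm
  | b n hn c k h => exact (b_hom hn h H.symm hs (.d _ hm _ _ h₁) (by grind)).symm
  | dd c k h => exact (dd_hom h H.symm hs (.d _ hm _ _ h₁) (by grind)).symm
  | d n hn c k h => exact d_d hm hn H hd h₁ h
  | c n hn =>
    rcases h₁ with ⟨-, rfl⟩ | ⟨-, rfl⟩ <;>
      grind [H.single_single hd (H.part₁.pairing_d hm) (H.part₂.pairing_c hn)]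
  | f =>
    rcases h₁ with ⟨-, rfl⟩ | ⟨-, rfl⟩ <;>
      grind [H.single_single hd (H.part₁.pairing_d hm) H.part₂.pairing_f]
  | g c k h =>
    rcases h₁ with ⟨-, rfl⟩ | ⟨-, rfl⟩ <;> rcases h with ⟨-, rfl⟩ | ⟨-, rfl⟩ <;>
      grind [H.single_single hd (H.part₁.pairing_d hm) H.part₂.pairing_g]
  | b' c k h =>
    rcases h₁ with ⟨-, rfl⟩ | ⟨-, rfl⟩ <;> rcases h with ⟨-, rfl⟩ | ⟨-, rfl⟩ <;>
      grind [H.single_single hd (H.part₁.pairing_d hm) H.part₂.pairing_b']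
  | aa => exact absurd rfl hc₂
  | cc => exact absurd rfl hc₂

theorem c_hom (hm : 3 ≤ m) (H : HomHom A T₁ T₁' T₂ T₂' (mC m) f₁ M₂ f₂)
    (hd : ∀ x ∈ T₁, x ∉ T₂) (h₂ : IsModel M₂ c₂) (hc₂ : c₂ ≠ .inh) : Listed A T₁' .one T₂' c₂ := by
  have hs := disjoint_symm hd
  cases h₂ with
  | point c k h => exact (point_hom h H.symm hs (.c _ hm) (by grind)).symm
  | a n hn => exact (a_hom hn H.symm hs (.c _ hm) (by grind)).symm
  | b n hn c k h => exact (b_hom hn h H.symm hs (.c _ hm) (by grind)).symm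
  | dd c k h => exact (dd_hom h H.symm hs (.c _ hm) (by grind)).symm
  | d n hn c k h => exact (d_hom hn h H.symm hs (.c _ hm) (by grind)).symm
  | c n hn =>
    grind [H.single_single hd (H.part₁.pairing_c hm) (H.part₂.pairing_c hn)]
  | f =>
    grind [H.single_single hd (H.part₁.pairing_c hm) H.part₂.pairing_f]
  | g c k h =>
    rcases h with ⟨-, rfl⟩ | ⟨-, rfl⟩ <;>
      grind [H.single_single hd (H.part₁.pairing_c hm) H.part₂.pairing_g]
  | b' c k h =>
    rcases h with ⟨-, rfl⟩ | ⟨-, rfl⟩ <;>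
      grind [H.single_single hd (H.part₁.pairing_c hm) H.part₂.pairing_b']
  | aa => exact absurd rfl hc₂
  | cc => exact absurd rfl hc₂

theorem f_hom (H : HomHom A T₁ T₁' T₂ T₂' mF f₁ M₂ f₂)
    (hd : ∀ x ∈ T₁, x ∉ T₂) (h₂ : IsModel M₂ c₂) (hc₂ : c₂ ≠ .inh) : Listed A T₁' .one T₂' c₂ := by
  have hs := disjoint_symm hd
  cases h₂ with
  | point c k h => exact (point_hom h H.symm hs (.f) (by grind)).symm
  | a n hn => exact (a_hom hn H.symm hs (.f) (by grind)).symm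
  | b n hn c k h => exact (b_hom hn h H.symm hs (.f) (by grind)).symm
  | dd c k h => exact (dd_hom h H.symm hs (.f) (by grind)).symm
  | d n hn c k h => exact (d_hom hn h H.symm hs (.f) (by grind)).symm
  | c n hn => exact (c_hom hn H.symm hs (.f) (by grind)).symm
  | f =>
    grind [H.single_single hd H.part₁.pairing_f H.part₂.pairing_f]
  | g c k h =>
    rcases h with ⟨-, rfl⟩ | ⟨-, rfl⟩ <;>
      grind [H.single_single hd H.part₁.pairing_f H.part₂.pairing_g]
  | b' c k h =>
    rcases h with ⟨-, rfl⟩ | ⟨-, rfl⟩ <;>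
      grind [H.single_single hd H.part₁.pairing_f H.part₂.pairing_b']
  | aa => exact absurd rfl hc₂
  | cc => exact absurd rfl hc₂

theorem g_hom (h₁ : IsOneOrTwo c₁ k₁) (H : HomHom A T₁ T₁' T₂ T₂' (mG k₁) f₁ M₂ f₂)
    (hd : ∀ x ∈ T₁, x ∉ T₂) (h₂ : IsModel M₂ c₂) (hc₂ : c₂ ≠ .inh) : Listed A T₁' c₁ T₂' c₂ := by
  have hs := disjoint_symm hd
  cases h₂ with
  | point c k h => exact (point_hom h H.symm hs (.g _ _ h₁) (by grind)).symm
  | a n hn => exact (a_hom hn H.symm hs (.g _ _ h₁) (by grind)).symm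
  | b n hn c k h => exact (b_hom hn h H.symm hs (.g _ _ h₁) (by grind)).symm
  | dd c k h => exact (dd_hom h H.symm hs (.g _ _ h₁) (by grind)).symm
  | d n hn c k h => exact (d_hom hn h H.symm hs (.g _ _ h₁) (by grind)).symm
  | c n hn => exact (c_hom hn H.symm hs (.g _ _ h₁) (by grind)).symm
  | f => exact (f_hom H.symm hs (.g _ _ h₁) (by grind)).symm
  | g c k h =>
    rcases h₁ with ⟨-, rfl⟩ | ⟨-, rfl⟩ <;> rcases h with ⟨-, rfl⟩ | ⟨-, rfl⟩ <;>
      grind [H.single_single hd H.part₁.pairing_g H.part₂.pairing_g]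
  | b' c k h =>
    rcases h₁ with ⟨-, rfl⟩ | ⟨-, rfl⟩ <;> rcases h with ⟨-, rfl⟩ | ⟨-, rfl⟩ <;>
      grind [H.single_single hd H.part₁.pairing_g H.part₂.pairing_b']
  | aa => exact absurd rfl hc₂
  | cc => exact absurd rfl hc₂

theorem b'_hom (h₁ : IsHalfOrOne c₁ k₁) (H : HomHom A T₁ T₁' T₂ T₂' (mB' k₁) f₁ M₂ f₂)
    (hd : ∀ x ∈ T₁, x ∉ T₂) (h₂ : IsModel M₂ c₂) (hc₂ : c₂ ≠ .inh) : Listed A T₁' c₁ T₂' c₂ := by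
  have hs := disjoint_symm hd
  cases h₂ with
  | point c k h => exact (point_hom h H.symm hs (.b' _ _ h₁) (by grind)).symm
  | a n hn => exact (a_hom hn H.symm hs (.b' _ _ h₁) (by grind)).symm
  | b n hn c k h => exact (b_hom hn h H.symm hs (.b' _ _ h₁) (by grind)).symm
  | dd c k h => exact (dd_hom h H.symm hs (.b' _ _ h₁) (by grind)).symm
  | d n hn c k h => exact (d_hom hn h H.symm hs (.b' _ _ h₁) (by grind)).symm
  | c n hn => exact (c_hom hn H.symm hs (.b' _ _ h₁) (by grind)).symm
  | f => exact (f_hom H.symm hs (.b' _ _ h₁) (by grind)).symm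
  | g c k h => exact (g_hom h H.symm hs (.b' _ _ h₁) (by grind)).symm
  | b' c k h =>
    rcases h₁ with ⟨-, rfl⟩ | ⟨-, rfl⟩ <;> rcases h with ⟨-, rfl⟩ | ⟨-, rfl⟩ <;>
      grind [H.single_single hd H.part₁.pairing_b' H.part₂.pairing_b']
  | aa => exact absurd rfl hc₂
  | cc => exact absurd rfl hc₂

theorem listed_of_disjoint (H : HomHom A T₁ T₁' T₂ T₂' M₁ f₁ M₂ f₂) (hd : ∀ x ∈ T₁, x ∉ T₂)
    (h₁ : IsModel M₁ c₁) (hc₁ : c₁ ≠ .inh) (h₂ : IsModel M₂ c₂) (hc₂ : c₂ ≠ .inh) :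
    Listed A T₁' c₁ T₂' c₂ := by
  cases h₁ with
  | point c k h => exact point_hom h H hd h₂ hc₂
  | a n hn => exact a_hom hn H hd h₂ hc₂
  | b n hn c k h => exact b_hom hn h H hd h₂ hc₂
  | dd c k h => exact dd_hom h H hd h₂ hc₂
  | d n hn c k h => exact d_hom hn h H hd h₂ hc₂
  | c n hn => exact c_hom hn H hd h₂ hc₂
  | f => exact f_hom H hd h₂ hc₂
  | g c k h => exact g_hom h H hd h₂ hc₂
  | b' c k h => exact b'_hom h H hd h₂ hc₂
  | aa => exact absurd rfl hc₁
  | cc => exact absurd rfl hc₁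

end HomHom

end PrimSph

namespace PrimSph

open Matrix

variable {S : Type*} {A : Matrix S S ℤ} {T T' T₁ T₁' T₂ T₂' : Set S} {c₁ c₂ : Factor}
  {M M₁ M₂ : Model} {f f₁ f₂ : ℕ → S} {m n : ℕ} {k k₁ k₂ : ℤ}

/-! ### Bounds coming from finite or affine type -/

/-- A nonnegative vector with nonpositive image excludes finite type, and in the affine case it
is a null vector. -/
theorem IsDynkin.mulVec_eq_zero [Fintype S] (hA : IsDynkin A) (v : S → ℤ) (hv : ∀ x, 0 ≤ v x)
    {x₀ : S} (hx₀ : 0 < v x₀) (h : ∀ x, ∑ y, A x y * v y ≤ 0) :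
    IsAffineType A ∧ ∀ x, ∑ y, A x y * v y = 0 := by
  have key : ∀ u : S → ℤ, ∑ x, u x * ∑ y, A x y * v y = ∑ y, (u ᵥ* A) y * v y := by
    intro u
    simp only [vecMul, dotProduct, Finset.mul_sum, Finset.sum_mul]
    rw [Finset.sum_comm]
    simp only [mul_assoc]
  -- The number `u A v` is at most 0 by the assumption on `v`. It is positive in finite type. In
  -- affine type it vanishes, and since `u > 0` each of its nonpositive summands does.
  rcases hA.2 with ⟨u, hu, hu'⟩ | ⟨u, hu, hu'⟩
  · exfalso
    have h1 : ∑ x, u x * ∑ y, A x y * v y ≤ 0 :=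
      Finset.sum_nonpos fun x _ => mul_nonpos_of_nonneg_of_nonpos (hu x).le (h x)
    have h2 : 0 < ∑ y, (u ᵥ* A) y * v y :=
      Finset.sum_pos' (fun y _ => mul_nonneg (hu' y).le (hv y))
        ⟨x₀, Finset.mem_univ _, mul_pos (hu' x₀) hx₀⟩
    rw [key] at h1
    omega
  · refine ⟨⟨u, hu, hu'⟩, fun x => ?_⟩
    have h1 : ∑ x, u x * ∑ y, A x y * v y = 0 := by
      rw [key, hu']
      simp
    have h2 := (Finset.sum_eq_zero_iff_of_nonpos
      (fun x _ => mul_nonpos_of_nonneg_of_nonpos (hu x).le (h x))).1 h1 x (Finset.mem_univ _)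
    exact (mul_eq_zero.1 h2).resolve_left (hu x).ne'

/-- An affine diagram has no isolated vertices. -/
theorem IsAffineType.exists_ne_zero [Fintype S] (hA : IsAffineType A) {x : S} (hx : A x x = 2) :
    ∃ y, y ≠ x ∧ A y x ≠ 0 := by
  obtain ⟨u, hu, hu'⟩ := hA
  by_contra! hne
  have h1 : (u ᵥ* A) x = 0 := by rw [hu']; rfl
  rw [vecMul, dotProduct, Finset.sum_eq_single x (fun y _ hy => by rw [hne y hy, mul_zero])
    (by simp), hx] at h1
  have := hu x
  omega

/-- The vertices of two disjoint parts. -/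
theorem Glue.sum_eq [Fintype S] (g : Glue A T₁ T₁' T₂ T₂') (hd : ∀ x ∈ T₁, x ∉ T₂)
    (p₁ : Part A T₁ T₁' M₁ f₁) (p₂ : Part A T₂ T₂' M₂ f₂) (F : S → ℤ) :
    ∑ x, F x = ∑ i ∈ Finset.range M₁.rank, F (f₁ i) + ∑ j ∈ Finset.range M₂.rank, F (f₂ j) := by
  classical
  have hu : (Finset.univ : Finset S) =
      (Finset.range M₁.rank).image f₁ ∪ (Finset.range M₂.rank).image f₂ := by
    ext x
    simpa using g.exists_cover p₁ p₂ x
  rw [hu, Finset.sum_union, Finset.sum_image, Finset.sum_image]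
  · intro i hi j hj h
    exact p₂.inj i (by simpa using hi) j (by simpa using hj) h
  · intro i hi j hj h
    exact p₁.inj i (by simpa using hi) j (by simpa using hj) h
  · rw [Finset.disjoint_left]
    intro x h1 h2
    simp only [Finset.mem_image, Finset.mem_range] at h1 h2
    exact hd x ((p₁.mem x).2 h1) ((p₂.mem x).2 h2)

theorem Glue.exists_vector (g : Glue A T₁ T₁' T₂ T₂') (hd : ∀ x ∈ T₁, x ∉ T₂)
    (p₁ : Part A T₁ T₁' M₁ f₁) (p₂ : Part A T₂ T₂' M₂ f₂) (K₁ K₂ : ℕ → ℤ) :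
    ∃ v : S → ℤ, (∀ i < M₁.rank, v (f₁ i) = K₁ i) ∧ ∀ j < M₂.rank, v (f₂ j) = K₂ j := by
  classical
  have h : ∀ x, ∃ z, (∀ i < M₁.rank, f₁ i = x → z = K₁ i) ∧ ∀ j < M₂.rank, f₂ j = x → z = K₂ j := by
    intro x
    rcases g.exists_cover p₁ p₂ x with ⟨i, hi, rfl⟩ | ⟨j, hj, rfl⟩
    · refine ⟨K₁ i, fun i' hi' h => by rw [p₁.inj _ hi' _ hi h], fun j hj h => ?_⟩
      exact absurd (h ▸ p₂.mem_of_lt hj) (hd _ (p₁.mem_of_lt hi))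
    · refine ⟨K₂ j, fun i hi h => ?_, fun j' hj' h => by rw [p₂.inj _ hj' _ hj h]⟩
      exact absurd (h ▸ p₂.mem_of_lt hj) (hd _ (p₁.mem_of_lt hi))
  choose v hv using h
  exact ⟨v, fun i hi => (hv _).1 i hi rfl, fun j hj => (hv _).2 j hj rfl⟩

/-- The product of the `i`-th row of a model with a vector. -/
def Model.row (M : Model) (K : ℕ → ℤ) (i : ℕ) : ℤ := ∑ j ∈ Finset.range M.rank, M.entry i j * K j

theorem Glue.row_eq [Fintype S] (g : Glue A T₁ T₁' T₂ T₂') (hd : ∀ x ∈ T₁, x ∉ T₂)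
    (p₁ : Part A T₁ T₁' M₁ f₁) (p₂ : Part A T₂ T₂' M₂ f₂) {K₁ K₂ : ℕ → ℤ} {v : S → ℤ}
    (hv₁ : ∀ i < M₁.rank, v (f₁ i) = K₁ i) (hv₂ : ∀ j < M₂.rank, v (f₂ j) = K₂ j) {i : ℕ}
    (hi : i < M₁.rank) : ∑ y, A (f₁ i) y * v y =
      M₁.row K₁ i + ∑ j ∈ Finset.range M₂.rank, A (f₁ i) (f₂ j) * K₂ j := by
  rw [g.sum_eq hd p₁ p₂]
  congr 1
  · exact Finset.sum_congr rfl fun j hj => by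
      rw [p₁.cartan i hi j (Finset.mem_range.1 hj), hv₁ j (Finset.mem_range.1 hj)]
  · exact Finset.sum_congr rfl fun j hj => by rw [hv₂ j (Finset.mem_range.1 hj)]

/-- The criterion for a vector which is given on the two parts. -/
theorem Glue.mulVec_eq_zero [Fintype S] (g : Glue A T₁ T₁' T₂ T₂') (hd : ∀ x ∈ T₁, x ∉ T₂)
    (p₁ : Part A T₁ T₁' M₁ f₁) (p₂ : Part A T₂ T₂' M₂ f₂) (hA : IsDynkin A) (K₁ K₂ : ℕ → ℤ)
    (h₁ : ∀ i < M₁.rank, 0 ≤ K₁ i ∧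
      M₁.row K₁ i + ∑ j ∈ Finset.range M₂.rank, A (f₁ i) (f₂ j) * K₂ j ≤ 0)
    (h₂ : ∀ i < M₂.rank, 0 ≤ K₂ i ∧
      M₂.row K₂ i + ∑ j ∈ Finset.range M₁.rank, A (f₂ i) (f₁ j) * K₁ j ≤ 0)
    {j : ℕ} (hj : j < M₂.rank) (hK : 0 < K₂ j) :
    IsAffineType A ∧
    (∀ i < M₁.rank, M₁.row K₁ i + ∑ j ∈ Finset.range M₂.rank, A (f₁ i) (f₂ j) * K₂ j = 0) ∧
    ∀ i < M₂.rank, M₂.row K₂ i + ∑ j ∈ Finset.range M₁.rank, A (f₂ i) (f₁ j) * K₁ j = 0 := by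
  obtain ⟨v, hv₁, hv₂⟩ := g.exists_vector hd p₁ p₂ K₁ K₂
  have e₁ := fun i hi => g.row_eq hd p₁ p₂ hv₁ hv₂ (i := i) hi
  have e₂ := fun i hi => g.symm.row_eq (disjoint_symm hd) p₂ p₁ hv₂ hv₁ (i := i) hi
  have hv : ∀ x, 0 ≤ v x ∧ ∑ y, A x y * v y ≤ 0 := fun x => by
    rcases g.exists_cover p₁ p₂ x with ⟨i, hi, rfl⟩ | ⟨i, hi, rfl⟩
    · rw [hv₁ i hi, e₁ i hi]; exact h₁ i hi
    · rw [hv₂ i hi, e₂ i hi]; exact h₂ i hi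
  obtain ⟨ha, h⟩ := hA.mulVec_eq_zero v (fun x => (hv x).1) (x₀ := f₂ j) (by rwa [hv₂ j hj])
    (fun x => (hv x).2)
  exact ⟨ha, fun i hi => by rw [← e₁ i hi]; exact h _, fun i hi => by rw [← e₂ i hi]; exact h _⟩

/-- A vector `K` on a model which can be continued to a vertex `x` with value `b`; then `x` sees
`K` with weight `q`. -/
structure Caps (A : Matrix S S ℤ) (M : Model) (f : ℕ → S) (x : S) (K : ℕ → ℤ) (b q : ℤ) : Prop where
  nonneg : ∀ i < M.rank, 0 ≤ K i
  row_le : ∀ i < M.rank, M.row K i + A (f i) x * b ≤ 0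
  sum_eq : ∑ i ∈ Finset.range M.rank, A x (f i) * K i = -q

/-- The criterion if the second part has only one decorated vertex. -/
theorem Glue.eq_zero_of_caps [Fintype S] (g : Glue A T₁ T₁' T₂ T₂') (hd : ∀ x ∈ T₁, x ∉ T₂)
    (p₁ : Part A T₁ T₁' M₁ f₁) (p₂ : Part A T₂ T₂' M₂ f₂) (hA : IsDynkin A)
    (hl : M₂.dec = [0]) (h0 : 0 < M₂.rank) {K₁ : ℕ → ℤ} {b q : ℤ}
    (h : Caps A M₁ f₁ (f₂ 0) K₁ b q) (K₂ : ℕ → ℤ) (hb : K₂ 0 = b) (hb' : 0 < b)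
    (h₂ : ∀ j < M₂.rank, 0 ≤ K₂ j ∧ M₂.row K₂ j - (if j = 0 then q else 0) ≤ 0) :
    IsAffineType A ∧ (∀ i < M₁.rank, M₁.row K₁ i + A (f₁ i) (f₂ 0) * b = 0) ∧
    ∀ j < M₂.rank, M₂.row K₂ j - (if j = 0 then q else 0) = 0 := by
  have e₁ : ∀ i < M₁.rank, ∑ j ∈ Finset.range M₂.rank, A (f₁ i) (f₂ j) * K₂ j =
      A (f₁ i) (f₂ 0) * b := by
    intro i hi
    rw [← hb]
    refine Finset.sum_eq_single_of_mem 0 (by simpa using h0) fun j hj hne => ?_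
    rw [(g.cross_eq_zero hd p₁ p₂ hi (Finset.mem_range.1 hj) (by simp [hl, hne])).1, zero_mul]
  have e₂ : ∀ j < M₂.rank, ∑ i ∈ Finset.range M₁.rank, A (f₂ j) (f₁ i) * K₁ i =
      -if j = 0 then q else 0 := by
    intro j hj
    split_ifs with hj0
    · rw [hj0, h.sum_eq]
    · refine (Finset.sum_eq_zero fun i hi => ?_).trans neg_zero.symm
      rw [(g.cross_eq_zero hd p₁ p₂ (Finset.mem_range.1 hi) hj (by simp [hl, hj0])).2, zero_mul]
  obtain ⟨ha, h, h'⟩ := g.mulVec_eq_zero hd p₁ p₂ hA K₁ K₂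
    (fun i hi => by rw [e₁ i hi]; exact ⟨h.nonneg i hi, h.row_le i hi⟩)
    (fun i hi => by rw [e₂ i hi, ← sub_eq_add_neg]; exact h₂ i hi) h0 (by rwa [hb])
  exact ⟨ha, fun i hi => by rw [← e₁ i hi]; exact h i hi,
    fun i hi => by rw [sub_eq_add_neg, ← e₂ i hi]; exact h' i hi⟩

/-! ### Rows of chains and forks -/

theorem sum_chain (r s : ℤ) (K : ℕ → ℤ) {n i : ℕ} (hi : i < n) :
    ∑ j ∈ Finset.range n, chain r s n i j * K j = 2 * K i +
      (if i + 1 = n then 0 else (if i + 2 = n then -r else -1) * K (i + 1)) +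
      (if i = 0 then 0 else (if i + 1 = n then -s else -1) * K (i - 1)) := by
  have h : ∀ j ∈ Finset.range n, chain r s n i j * K j = (if j = i then 2 * K i else 0) +
      (if j = i + 1 then (if i + 2 = n then -r else -1) * K (i + 1) else 0) +
      (if j = i - 1 then (if i = 0 then 0 else
        (if i + 1 = n then -s else -1) * K (i - 1)) else 0) := by
    intro j hj
    rw [Finset.mem_range] at hj
    rw [chain]
    rcases (by omega : j = i ∨ j = i + 1 ∨ (j + 1 = i ∧ i ≠ 0) ∨ (i ≠ j ∧ j ≠ i + 1 ∧ j + 1 ≠ i))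
      with rfl | rfl | ⟨rfl, h⟩ | h
    · grind
    · grind
    · grind
    · grind
  rw [Finset.sum_congr rfl h]
  simp only [Finset.sum_add_distrib, Finset.sum_ite_eq', Finset.mem_range]
  grind

theorem sum_fork {n i : ℕ} (hn : 3 ≤ n) (hi : i < n) :
    ∑ j ∈ Finset.range n, fork n i j * (if j + 2 < n then 2 else 1) = if i = 0 then 2 else 0 := by
  have key : ∀ I : Finset ℕ, (∀ j ∈ I, j < n) → (∀ j < n, j ∉ I → fork n i j = 0) →
      ∑ j ∈ Finset.range n, fork n i j * (if j + 2 < n then 2 else 1) =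
        ∑ j ∈ I, fork n i j * (if j + 2 < n then 2 else 1) := by
    intro I hI h
    symm
    refine Finset.sum_subset (fun j hj => Finset.mem_range.2 (hI j hj)) fun j hj hj' => ?_
    rw [h j (Finset.mem_range.1 hj) hj', zero_mul]
  rcases (by omega : i + 1 = n ∨ i + 2 = n ∨ (i + 3 = n ∧ i = 0) ∨ (i + 3 = n ∧ 1 ≤ i) ∨
    (i + 3 < n ∧ i = 0) ∨ (i + 3 < n ∧ 1 ≤ i)) with h | h | ⟨h, rfl⟩ | h | ⟨h, rfl⟩ | h
  · rw [key {n - 3, i} (by grind) (by grind), Finset.sum_pair (by omega)]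
    grind
  · rw [key {n - 3, i} (by grind) (by grind), Finset.sum_pair (by omega)]
    grind
  · rw [key {0, 1, 2} (by grind) (by grind), Finset.sum_insert (by simp), Finset.sum_pair (by simp)]
    grind
  · rw [key {i - 1, i, n - 2, n - 1} (by grind) (by grind), Finset.sum_insert (by grind),
      Finset.sum_insert (by grind), Finset.sum_pair (by omega)]
    grind
  · rw [key {0, 1} (by grind) (by grind), Finset.sum_pair (by simp)]
    grind
  · rw [key {i - 1, i, i + 1} (by grind) (by grind), Finset.sum_insert (by grind),
      Finset.sum_pair (by omega)]
    grind

/-- The common form of the inhomogeneous models. -/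
abbrev mI (s : ℤ) (n : ℕ) : Model := ⟨n, chain 1 s n, [0], fun _ => 0⟩

@[grind =]
theorem row_a (K : ℕ → ℤ) {n i : ℕ} (hi : i < n) : (mA n).row K i =
    2 * K i - (if i + 1 = n then 0 else K (i + 1)) - (if i = 0 then 0 else K (i - 1)) := by
  refine (sum_chain 1 1 K hi).trans ?_
  grind

theorem row_b (k : ℤ) (K : ℕ → ℤ) {n i : ℕ} (hi : i < n) : (mB n k).row K i =
    2 * K i - (if i + 1 = n then 0 else (if i + 2 = n then 2 else 1) * K (i + 1)) -
      (if i = 0 then 0 else K (i - 1)) := by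
  refine (sum_chain 2 1 K hi).trans ?_
  grind

@[grind =]
theorem row_inh (s : ℤ) (K : ℕ → ℤ) {n i : ℕ} (hi : i < n) : (mI s n).row K i =
    2 * K i - (if i + 1 = n then 0 else K (i + 1)) -
      (if i = 0 then 0 else (if i + 1 = n then s else 1) * K (i - 1)) := by
  refine (sum_chain 1 s K hi).trans ?_
  grind

section Caps

variable [Fintype S] {s : ℤ} {K : ℕ → ℤ} {q : ℤ} (g : Glue A T₁ T₁' T₂ T₂')
  (hd : ∀ x ∈ T₁, x ∉ T₂) (p₁ : Part A T₁ T₁' M₁ f₁) (p₂ : Part A T₂ T₂' (mI s n) f₂)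
  (hA : IsDynkin A) (hs : 1 ≤ s)

include g hd p₁ p₂ hA

/-- The vector is continued by the constant `b` along the inhomogeneous chain of type `C n`. The
double bond makes the last row vanish, and the first row is `b - q`. -/
theorem Caps.const (b : ℤ) (hb : 0 < b) (h : Caps A M₁ f₁ (f₂ 0) K b q) (hn : 2 ≤ n) (hs : s = 2)
    (hq : b ≤ q) : q = b ∧ IsAffineType A ∧ ∀ i < M₁.rank, M₁.row K i + A (f₁ i) (f₂ 0) * b = 0 :=
      by
  subst hs
  obtain ⟨ha, e₁, e₂⟩ := g.eq_zero_of_caps hd p₁ p₂ hA rfl (by grind) h (fun _ => b) rfl hb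
    (by grind)
  have := e₂ 0 (by grind)
  exact ⟨by grind, ha, e₁⟩

include hs

/-- Continuation by `b` on the first vertex and 0 afterwards. The first row is `2 b - q`; a second
vertex would have a negative row, so equality forces `n = 1`. -/
theorem Caps.point (b : ℤ) (hb : 0 < b) (h : Caps A M₁ f₁ (f₂ 0) K b q) (hn : 1 ≤ n)
    (hq : 2 * b ≤ q) :
    q = 2 * b ∧ n = 1 ∧ IsAffineType A ∧ ∀ i < M₁.rank, M₁.row K i + A (f₁ i) (f₂ 0) * b = 0 := by
  have hsb : b ≤ s * b := le_mul_of_one_le_left hb.le hs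
  obtain ⟨ha, e₁, e₂⟩ := g.eq_zero_of_caps hd p₁ p₂ hA rfl (by grind) h
    (fun j => if j = 0 then b else 0) rfl hb (by grind (splits := 20))
  have h0 := e₂ 0 (by grind)
  have h1 := e₂ 1
  exact ⟨by grind, by grind, ha, e₁⟩

/-- Continuation by `2, 1, 0, …`, with first row `3 - q`. Equality requires that the chain stops
after two vertices and is simply laced. In the same way `3, 2, 1` and `4, 2` yield the bounds 4 and
6 in `Caps.three` and `Caps.four`. -/
theorem Caps.two (h : Caps A M₁ f₁ (f₂ 0) K 2 q) (hn : 2 ≤ n) (hq : 3 ≤ q) : q = 3 ∧ n = 2 ∧ s = 1 ∧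
    IsAffineType A ∧ ∀ i < M₁.rank, M₁.row K i + A (f₁ i) (f₂ 0) * 2 = 0 := by
  obtain ⟨ha, e₁, e₂⟩ := g.eq_zero_of_caps hd p₁ p₂ hA rfl (by grind) h
    (fun j => if j = 0 then 2 else if j = 1 then 1 else 0) rfl (by simp) (by grind (splits := 20))
  have h0 := e₂ 0 (by grind)
  have h1 := e₂ 1 (by grind)
  have h2 := e₂ 2
  exact ⟨by grind, by grind, by grind, ha, e₁⟩

theorem Caps.three (h : Caps A M₁ f₁ (f₂ 0) K 3 q) (hn : 3 ≤ n) (hq : 4 ≤ q) :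
    q = 4 ∧ n = 3 ∧ s = 1 ∧
    IsAffineType A ∧ ∀ i < M₁.rank, M₁.row K i + A (f₁ i) (f₂ 0) * 3 = 0 := by
  obtain ⟨ha, e₁, e₂⟩ := g.eq_zero_of_caps hd p₁ p₂ hA rfl (by grind) h
    (fun j => if j = 0 then 3 else if j = 1 then 2 else if j = 2 then 1 else 0) rfl (by simp)
    (by grind (splits := 20))
  have h0 := e₂ 0 (by grind)
  have h2 := e₂ 2 (by grind)
  have h3 := e₂ 3
  exact ⟨by grind, by grind, by grind, ha, e₁⟩

theorem Caps.four (h : Caps A M₁ f₁ (f₂ 0) K 4 q) (hn : 2 ≤ n) (hq : 6 ≤ q) :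
    q = 6 ∧ n = 2 ∧ s = 1 ∧
    IsAffineType A ∧ ∀ i < M₁.rank, M₁.row K i + A (f₁ i) (f₂ 0) * 4 = 0 := by
  obtain ⟨ha, e₁, e₂⟩ := g.eq_zero_of_caps hd p₁ p₂ hA rfl (by grind) h
    (fun j => if j = 0 then 4 else if j = 1 then 2 else 0) rfl (by simp) (by grind (splits := 20))
  have h0 := e₂ 0 (by grind)
  have h1 := e₂ 1 (by grind)
  have h2 := e₂ 2
  exact ⟨by grind, by grind, by grind, ha, e₁⟩

end Caps

end PrimSph

namespace PrimSph

open Matrix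

variable {S : Type*} [Fintype S] {A : Matrix S S ℤ} {T₁ T₁' T₂ T₂' : Set S} {c₁ c₂ : Factor}
  {M M₁ M₂ : Model} {f f₁ f₂ : ℕ → S} {m n : ℕ} {k k₁ k₂ s : ℤ}

/-! ### A homogeneous and an inhomogeneous part without common vertices -/

/-- A homogeneous part and an inhomogeneous part satisfying the condition on the weight. -/
structure HomInh (A : Matrix S S ℤ) (T₁ T₁' T₂ T₂' : Set S) (M₁ : Model) (f₁ : ℕ → S) (M₂ : Model)
    (f₂ : ℕ → S) : Prop where
  dynkin : IsDynkin A
  glue : Glue A T₁ T₁' T₂ T₂'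
  part₁ : Part A T₁ T₁' M₁ f₁
  part₂ : Part A T₂ T₂' M₂ f₂
  pair : ∀ x ∈ T₂', pairing A M₁ f₁ x = -2

omit [Fintype S] in
theorem Caps.of_single {x : S} {K : ℕ → ℤ} {b : ℤ} (h0 : 0 < M.rank)
    (hx : ∀ i < M.rank, i ≠ 0 → A (f i) x = 0 ∧ A x (f i) = 0)
    (h : ∀ i < M.rank, 0 ≤ K i ∧ M.row K i + (if i = 0 then A (f 0) x * b else 0) ≤ 0) :
    Caps A M f x K b (-(A x (f 0) * K 0)) := by
  refine ⟨fun i hi => (h i hi).1, fun i hi => ?_, ?_⟩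
  · rcases eq_or_ne i 0 with rfl | hne
    · simpa using (h 0 hi).2
    · simpa [hne, (hx i hi hne).1] using (h i hi).2
  · rw [neg_neg]
    refine Finset.sum_eq_single_of_mem 0 (by simpa using h0) fun i hi hne => ?_
    rw [(hx i (Finset.mem_range.1 hi) hne).2, zero_mul]

/-- Two models joined by one edge between their first vertices. -/
structure Edge (A : Matrix S S ℤ) (T₁ T₁' T₂ T₂' : Set S) (M₁ : Model) (f₁ : ℕ → S) (s : ℤ) (n : ℕ)
    (f₂ : ℕ → S) (p q : ℤ) : Prop where
  dynkin : IsDynkin A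
  glue : Glue A T₁ T₁' T₂ T₂'
  disjoint : ∀ x ∈ T₁, x ∉ T₂
  part₁ : Part A T₁ T₁' M₁ f₁
  part₂ : Part A T₂ T₂' (mI s n) f₂
  rank : 0 < M₁.rank
  type : s = 1 ∧ 1 ≤ n ∨ s = 2 ∧ 2 ≤ n
  left : A (f₁ 0) (f₂ 0) = -p
  right : A (f₂ 0) (f₁ 0) = -q
  eq_zero : ∀ i < M₁.rank, i ≠ 0 → A (f₁ i) (f₂ 0) = 0 ∧ A (f₂ 0) (f₁ i) = 0

namespace Edge

variable {p q : ℤ}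

section

variable (E : Edge A T₁ T₁' T₂ T₂' M₁ f₁ s n f₂ p q)

include E

/-- A vector on the first model is admissible if its row at the bonded vertex is at most `p b` and
all other rows are at most 0. The second part sees it with weight `q * K 0`; the following bounds on
`q` are the test vectors of `Caps` in this setting, including the conclusion that equality holds in
all rows. -/
theorem caps {K : ℕ → ℤ} {b : ℤ}
    (h : ∀ i < M₁.rank, 0 ≤ K i ∧ M₁.row K i ≤ if i = 0 then p * b else 0) :
    Caps A M₁ f₁ (f₂ 0) K b (q * K 0) := by
  have hc := Caps.of_single (b := b) (K := K) E.rank E.eq_zero fun i hi => ⟨(h i hi).1, ?_⟩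
  · rwa [E.right, neg_mul, neg_neg] at hc
  · have := (h i hi).2
    rw [E.left]
    split_ifs at this ⊢ with hi0 <;> linarith

theorem row_eq {K : ℕ → ℤ} {b : ℤ}
    (h : ∀ i < M₁.rank, M₁.row K i + A (f₁ i) (f₂ 0) * b = 0) :
    ∀ i < M₁.rank, M₁.row K i = if i = 0 then p * b else 0 := by
  intro i hi
  have := h i hi
  split_ifs with hi0
  · rw [hi0, E.left] at this
    rw [hi0]
    linarith
  · rw [(E.eq_zero i hi hi0).1] at this
    linarith

theorem one_le : 1 ≤ s ∧ 1 ≤ n := by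
  have := E.type
  omega

theorem bound_point {K : ℕ → ℤ} (b : ℤ) (hb : 0 < b)
    (h : ∀ i < M₁.rank, 0 ≤ K i ∧ M₁.row K i ≤ if i = 0 then p * b else 0)
    (hq : 2 * b ≤ q * K 0) : q * K 0 = 2 * b ∧ n = 1 ∧ IsAffineType A ∧
      ∀ i < M₁.rank, M₁.row K i = if i = 0 then p * b else 0 := by
  obtain ⟨h1, h2, ha, hr⟩ :=
    (E.caps h).point E.glue E.disjoint E.part₁ E.part₂ E.dynkin E.one_le.1 b hb E.one_le.2 hq
  exact ⟨h1, h2, ha, E.row_eq hr⟩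

theorem bound_const {K : ℕ → ℤ} (b : ℤ) (hb : 0 < b)
    (h : ∀ i < M₁.rank, 0 ≤ K i ∧ M₁.row K i ≤ if i = 0 then p * b else 0) (hs : s = 2)
    (hq : b ≤ q * K 0) : q * K 0 = b ∧ IsAffineType A ∧
      ∀ i < M₁.rank, M₁.row K i = if i = 0 then p * b else 0 := by
  obtain ⟨h1, ha, hr⟩ :=
    (E.caps h).const E.glue E.disjoint E.part₁ E.part₂ E.dynkin b hb
      (by have := E.type; omega) hs hq
  exact ⟨h1, ha, E.row_eq hr⟩

theorem bound_two {K : ℕ → ℤ}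
    (h : ∀ i < M₁.rank, 0 ≤ K i ∧ M₁.row K i ≤ if i = 0 then p * 2 else 0) (hn : 2 ≤ n)
    (hq : 3 ≤ q * K 0) : q * K 0 = 3 ∧ n = 2 ∧ s = 1 ∧ IsAffineType A ∧
      ∀ i < M₁.rank, M₁.row K i = if i = 0 then p * 2 else 0 := by
  obtain ⟨h1, h2, h3, ha, hr⟩ :=
    (E.caps h).two E.glue E.disjoint E.part₁ E.part₂ E.dynkin E.one_le.1 hn hq
  exact ⟨h1, h2, h3, ha, E.row_eq hr⟩

theorem bound_three {K : ℕ → ℤ}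
    (h : ∀ i < M₁.rank, 0 ≤ K i ∧ M₁.row K i ≤ if i = 0 then p * 3 else 0) (hn : 3 ≤ n)
    (hq : 4 ≤ q * K 0) : q * K 0 = 4 ∧ n = 3 ∧ s = 1 ∧ IsAffineType A ∧
      ∀ i < M₁.rank, M₁.row K i = if i = 0 then p * 3 else 0 := by
  obtain ⟨h1, h2, h3, ha, hr⟩ :=
    (E.caps h).three E.glue E.disjoint E.part₁ E.part₂ E.dynkin E.one_le.1 hn hq
  exact ⟨h1, h2, h3, ha, E.row_eq hr⟩

theorem bound_four {K : ℕ → ℤ}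
    (h : ∀ i < M₁.rank, 0 ≤ K i ∧ M₁.row K i ≤ if i = 0 then p * 4 else 0) (hn : 2 ≤ n)
    (hq : 6 ≤ q * K 0) : q * K 0 = 6 ∧ n = 2 ∧ s = 1 ∧ IsAffineType A ∧
      ∀ i < M₁.rank, M₁.row K i = if i = 0 then p * 4 else 0 := by
  obtain ⟨h1, h2, h3, ha, hr⟩ :=
    (E.caps h).four E.glue E.disjoint E.part₁ E.part₂ E.dynkin E.one_le.1 hn hq
  exact ⟨h1, h2, h3, ha, E.row_eq hr⟩

end

theorem point (E : Edge A T₁ T₁' T₂ T₂' (mB 1 k) f₁ s n f₂ 1 q) (hq : 1 ≤ q) :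
    Listed A T₁' .one T₂' .inh := by
  have h := E.type
  have hl := E.left
  have hr := E.right
  have hs := disjoint_symm E.disjoint
  have r0 : (mB 1 k).row (fun _ => 1) 0 = 2 := by rw [row_b] <;> simp
  -- `q ≥ 4` forces `q = 4` and `n = 1`, whereas `q ≥ 3` and `n ≥ 2` force `q = 3`, `n = 2` and a
  -- simply laced chain.
  have b1 := E.bound_point (K := fun _ => 1) 2 (by simp) (by grind)
  have b2 := E.bound_two (K := fun _ => 1) (by grind)
  rcases h with ⟨rfl, hn⟩ | ⟨rfl, hn⟩
  · rcases (by grind : q = 1 ∨ q = 2 ∨ q = 3 ∧ n = 1 ∨ q = 3 ∧ n = 2 ∨ q = 4 ∧ n = 1) with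
      rfl | rfl | ⟨rfl, rfl⟩ | ⟨rfl, rfl⟩ | ⟨rfl, rfl⟩
    · refine (E.glue.symm.listed_of_disjoint hs E.part₂ E.part₁ (.A_aa_a (n + 1) n hn (by omega))
        (fun j => n - 1 - j) (fun _ => n) ?_ ?_ ?_ ?_ ?_ ?_).symm <;> grind (splits := 20)
    · refine (E.glue.symm.listed_of_disjoint hs E.part₂ E.part₁ (.B_aa_b (n + 1) n hn (by omega))
        (fun j => n - 1 - j) (fun _ => n) ?_ ?_ ?_ ?_ ?_ ?_).symm <;> grind (splits := 20)
    · refine (E.glue.symm.listed_of_disjoint hs E.part₂ E.part₁ .G2_aa_a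
        (fun _ => 0) (fun _ => 1) ?_ ?_ ?_ ?_ ?_ ?_).symm <;> grind (splits := 20)
    · refine (E.glue.symm.listed_of_disjoint hs E.part₂ E.part₁ .affG2_aa_a
        (fun j => 1 - j) (fun _ => 2) ?_ ?_ ?_ ?_ ?_ ?_).symm <;> grind (splits := 20)
    · refine E.glue.listed_of_disjoint E.disjoint E.part₁ E.part₂ .twA2_a_aa
        (fun _ => 0) (fun _ => 1) ?_ ?_ ?_ ?_ ?_ ?_ <;> grind (splits := 20)
  · rcases (by grind : q = 1 ∨ q = 2) with rfl | rfl
    · refine E.glue.listed_of_disjoint E.disjoint E.part₁ E.part₂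
        (.C_a_cc (n + 1) 1 (by omega) le_rfl
        (by omega)) (fun _ => 0) (fun j => j + 1) ?_ ?_ ?_ ?_ ?_ ?_ <;> grind (splits := 20)
    · refine E.glue.listed_of_disjoint E.disjoint E.part₁ E.part₂ (.twAeven_b_cc n 1 hn le_rfl
        (by omega)) (fun _ => 0) (fun j => j + 1) ?_ ?_ ?_ ?_ ?_ ?_ <;> grind (splits := 20)

theorem b (hm : 2 ≤ m) (E : Edge A T₁ T₁' T₂ T₂' (mB m k) f₁ s n f₂ 1 q) (hq : 1 ≤ q) :
    Listed A T₁' .one T₂' .inh := by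
  have h := E.type
  have hl := E.left
  have hr := E.right
  have hs := disjoint_symm E.disjoint
  -- The vector `2, …, 2, 1` is annihilated by all rows of `B m` except the first one, which gives
  -- 2. Since the bonded vertex has value 2, a multiplicity `q ≥ 2` is possible only for `q = 2` and
  -- `n = 1`.
  have hK : ∀ i < (mB m k).rank, 0 ≤ (if i + 1 = m then (1 : ℤ) else 2) ∧
      (mB m k).row (fun i => if i + 1 = m then 1 else 2) i ≤ if i = 0 then 1 * 2 else 0 := by
    intro i hi
    rw [row_b k _ hi]
    grind
  have b1 := E.bound_point 2 (by simp) hK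
  have b2 := E.bound_two hK
  rcases (by grind : q = 1 ∧ s = 1 ∨ q = 1 ∧ s = 2 ∨ q = 2 ∧ s = 1 ∧ n = 1) with
    ⟨rfl, rfl⟩ | ⟨rfl, rfl⟩ | ⟨rfl, rfl, rfl⟩
  · refine (E.glue.symm.listed_of_disjoint hs E.part₂ E.part₁
      (.B_aa_b (m + n) n (by omega) (by omega))
      (fun j => n - 1 - j) (fun i => n + i) ?_ ?_ ?_ ?_ ?_ ?_).symm <;> grind (splits := 20)
  · refine E.glue.listed_of_disjoint E.disjoint E.part₁ E.part₂
      (.twAeven_b_cc (m + n - 1) m (by omega)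
      (by omega) (by omega)) (fun i => m - 1 - i) (fun j => m + j) ?_ ?_ ?_ ?_ ?_ ?_ <;>
      grind (splits := 20)
  · refine E.glue.listed_of_disjoint E.disjoint E.part₁ E.part₂ (.twAeven_b_cc m m (by omega)
      (by omega) (by omega)) (fun i => m - 1 - i) (fun j => m + j) ?_ ?_ ?_ ?_ ?_ ?_ <;>
      grind (splits := 20)

theorem d (hm : 3 ≤ m) (E : Edge A T₁ T₁' T₂ T₂' (mD m k) f₁ s n f₂ 1 q) (hq : 1 ≤ q) :
    Listed A T₁' .half T₂' .inh := by
  have h := E.type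
  have hl := E.left
  have hr := E.right
  have hs := disjoint_symm E.disjoint
  have hK : ∀ i < (mD m k).rank, 0 ≤ (if i + 2 < m then (2 : ℤ) else 1) ∧
      (mD m k).row (fun i => if i + 2 < m then 2 else 1) i ≤ if i = 0 then 1 * 2 else 0 :=
    fun i hi => ⟨by grind, by rw [Model.row, sum_fork hm hi]; rfl⟩
  have b1 := E.bound_point 2 (by simp) hK
  have b2 := E.bound_two hK
  rcases (by grind : q = 1 ∧ s = 1 ∨ q = 1 ∧ s = 2 ∨ q = 2 ∧ s = 1 ∧ n = 1) with
    ⟨rfl, rfl⟩ | ⟨rfl, rfl⟩ | ⟨rfl, rfl, rfl⟩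
  · refine (E.glue.symm.listed_of_disjoint hs E.part₂ E.part₁
      (.D_aa_hd (m + n) n (by omega) (by omega)
      (by omega)) (fun j => n - 1 - j) (fun i => n + i) ?_ ?_ ?_ ?_ ?_ ?_).symm <;>
      grind (splits := 25)
  · refine E.glue.listed_of_disjoint E.disjoint E.part₁ E.part₂ (.twAodd_hd_cc (m + n - 1) m hm
      (by omega)) (fun i => m - 1 - i) (fun j => m + j) ?_ ?_ ?_ ?_ ?_ ?_ <;>
      grind (splits := 25)
  · refine E.glue.listed_of_disjoint E.disjoint E.part₁ E.part₂ (.twAodd_hd_cc m m hm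
      le_rfl) (fun i => m - 1 - i) (fun j => m + j) ?_ ?_ ?_ ?_ ?_ ?_ <;>
      grind (splits := 25)

/-- Two simply laced chains joined by an edge of multiplicity `q`. -/
theorem chain_bound (hm : 2 ≤ M₁.rank)
    (hK : ∀ K i, i < M₁.rank → M₁.row K i = (mA M₁.rank).row K i)
    (E : Edge A T₁ T₁' T₂ T₂' M₁ f₁ 1 n f₂ 1 q) (hq : 2 ≤ q) :
    q = 2 ∧ n = 1 ∨ (q = 2 ∧ M₁.rank = 2 ∧ n = 2) ∨
    (IsAffineType A ∧ (q = 2 ∧ M₁.rank = 2 ∧ n = 3 ∨ q = 2 ∧ M₁.rank = 3 ∧ n = 2 ∨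
      q = 3 ∧ M₁.rank = 2 ∧ n = 1)) := by
  have h := E.type
  -- On a simply laced chain `2, 1, 0, …` has first row 3 and second row 0. A third vertex would
  -- have row `-1`, so every case of equality forces rank 2.
  have h2 : ∀ i < M₁.rank, 0 ≤ (if i = 0 then (2 : ℤ) else if i = 1 then 1 else 0) ∧
      M₁.row (fun i => if i = 0 then (2 : ℤ) else if i = 1 then 1 else 0) i ≤
        if i = 0 then 1 * 3 else 0 := by
    intro i hi
    rw [hK _ i hi]
    grind
  have b1 := E.bound_point 3 (by simp) h2
  have b2 := E.bound_three h2
  have r2 := hK (fun i => if i = 0 then (2 : ℤ) else if i = 1 then 1 else 0) 2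
  by_cases hq3 : 3 ≤ q
  · grind
  obtain rfl : q = 2 := by omega
  by_cases hn : 3 ≤ n
  · grind
  by_cases hn1 : n = 1
  · grind
  by_cases hm2 : M₁.rank = 2
  · grind
  -- What remains is `q = 2`, `n = 2` and rank at least 3. The vector `3, 2, 1, 0, …` has first row
  -- 4, and equality excludes a fourth vertex.
  have h3 : ∀ i < M₁.rank,
      0 ≤ (if i = 0 then (3 : ℤ) else if i = 1 then 2 else if i = 2 then 1 else 0) ∧
      M₁.row (fun i => if i = 0 then (3 : ℤ) else if i = 1 then 2 else if i = 2 then 1 else 0) i ≤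
        if i = 0 then 1 * 4 else 0 := by
    intro i hi
    rw [hK _ i hi]
    grind
  have b3 := E.bound_four h3
  have r3 := hK (fun i => if i = 0 then (3 : ℤ) else if i = 1 then 2 else if i = 2 then 1 else 0) 3
  grind

theorem a (hm : 2 ≤ m) (E : Edge A T₁ T₁' T₂ T₂' (mA m) f₁ s n f₂ 1 q) (hq : 1 ≤ q) :
    Listed A T₁' .one T₂' .inh := by
  have h := E.type
  have hl := E.left
  have hr := E.right
  have hs := disjoint_symm E.disjoint
  have hx := E.eq_zero (m - 1) (by grind) (by omega)
  rcases h with ⟨rfl, hn⟩ | ⟨rfl, hn⟩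
  · have hb := E.chain_bound hm (fun _ _ _ => rfl)
    rcases (by grind : q = 1 ∨ q = 2 ∧ n = 1 ∨ q = 2 ∧ m = 2 ∧ n = 2 ∨ q = 2 ∧ m = 2 ∧ n = 3 ∨
      q = 2 ∧ m = 3 ∧ n = 2 ∨ q = 3 ∧ m = 2 ∧ n = 1) with
      rfl | ⟨rfl, rfl⟩ | ⟨rfl, rfl, rfl⟩ | ⟨rfl, rfl, rfl⟩ | ⟨rfl, rfl, rfl⟩ | ⟨rfl, rfl, rfl⟩
    · refine (E.glue.symm.listed_of_disjoint hs E.part₂ E.part₁ (.A_aa_a (m + n) n (by omega)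
        (by omega)) (fun j => n - 1 - j) (fun i => n + i) ?_ ?_ ?_ ?_ ?_ ?_).symm <;>
        grind (splits := 20)
    · refine E.glue.listed_of_disjoint E.disjoint E.part₁ E.part₂ (.C_a_cc (m + 1) m (by omega)
        (by omega) (by omega)) (fun i => m - 1 - i) (fun _ => m) ?_ ?_ ?_ ?_ ?_ ?_ <;>
        grind (splits := 20)
    · refine (E.glue.symm.listed_of_disjoint hs E.part₂ E.part₁ .F4_aa_a (fun j => 1 - j)
        (fun i => 2 + i) ?_ ?_ ?_ ?_ ?_ ?_).symm <;> grind (splits := 20)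
    · refine (E.glue.symm.listed_of_disjoint hs E.part₂ E.part₁ .affF4_aa_a (fun j => 2 - j)
        (fun i => 3 + i) ?_ ?_ ?_ ?_ ?_ ?_).symm <;> grind (splits := 20)
    · refine E.glue.listed_of_disjoint E.disjoint E.part₁ E.part₂ .twE6_a_aa (fun i => 2 - i)
        (fun j => 3 + j) ?_ ?_ ?_ ?_ ?_ ?_ <;> grind (splits := 20)
    · refine E.glue.listed_of_disjoint E.disjoint E.part₁ E.part₂ .triD4_a_aa (fun i => 1 - i)
        (fun _ => 2) ?_ ?_ ?_ ?_ ?_ ?_ <;> grind (splits := 20)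
  -- For a second part of type `C n`, equality at `q = 2` would require the row of the second vertex
  -- of the chain to vanish, but it is `-1`.
  · have hb := E.bound_const (K := fun i => if i = 0 then 1 else 0) 2 (by simp)
      (by grind (splits := 20)) rfl
    obtain rfl : q = 1 := by
      by_contra hne
      have h1 := (hb (by grind)).2.2 1 (by grind)
      grind
    refine E.glue.listed_of_disjoint E.disjoint E.part₁ E.part₂ (.C_a_cc (m + n) m (by omega)
      (by omega) (by omega)) (fun i => m - 1 - i) (fun j => m + j) ?_ ?_ ?_ ?_ ?_ ?_ <;>
      grind (splits := 20)

end Edge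

end PrimSph

/-! ### The model `d 2` against an inhomogeneous part, and the remaining disjoint mixed cases -/

namespace PrimSph

open Matrix

variable {S : Type*} [Fintype S] {A : Matrix S S ℤ} {T₁ T₁' T₂ T₂' : Set S} {c₁ c₂ : Factor}
  {M M₁ M₂ : Model} {f f₁ f₂ : ℕ → S} {m n : ℕ} {k k₁ k₂ s : ℤ}

omit [Fintype S] in
/-- The second vertex of `d 2` is isolated, the other one is joined to an inhomogeneous part; the
second factor of the entry has its vertices enumerated by `f₁ 0` and `f₂ ∘ τ`. -/
theorem Glue.listed_dd_inh (g : Glue A T₁ T₁' T₂ T₂') (hd : ∀ x ∈ T₁, x ∉ T₂)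
    (p₁ : Part A T₁ T₁' (mDD k) f₁) (p₂ : Part A T₂ T₂' (mI s n) f₂) (h0 : A (f₁ 1) (f₂ 0) = 0)
    {N : ℕ} {Y : Matrix (Fin N) (Fin N) ℤ} {e e' : ℕ}
    (hE : IsListed (double (CartanMatrix.A 1) Y [0] [e] c₁ [] [e'] c₂)) (τ : ℕ → ℕ)
    (he : e < N) (hτ : ∀ j < N, j ≠ e → τ j < n ∧ (τ j = 0 ↔ j = e'))
    (hinj : ∀ i < N, i ≠ e → ∀ j < N, j ≠ e → τ i = τ j → i = j)
    (hτ' : ∀ i < n, ∃ j < N, j ≠ e ∧ τ j = i) (hee : e ≠ e')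
    (hY : ∀ i < N, i ≠ e → ∀ j < N, j ≠ e → ext Y i j = chain 1 s n (τ i) (τ j))
    (hYe : ext Y e e = 2) (hY' : ∀ j < N, j ≠ e →
      if j = e' then ext Y e j = A (f₁ 0) (f₂ 0) ∧ ext Y j e = A (f₂ 0) (f₁ 0) else
        ext Y e j = 0 ∧ ext Y j e = 0) : Listed A T₁' c₁ T₂' c₂ := by
  have d₁ : ∀ i < 2, f₁ i ∈ T₁' ∧ f₁ i ∉ T₂' := fun i hi =>
    ⟨(p₁.mem_dec_iff hi).2 (by grind), fun h => g.not_mem₁ _ h (p₁.mem_of_lt hi)⟩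
  have d₂ : ∀ i < n, f₂ i ∉ T₁' ∧ (f₂ i ∈ T₂' ↔ i = 0) := fun i hi =>
    ⟨fun h => g.not_mem₂ _ h (p₂.mem_of_lt hi), by rw [p₂.mem_dec_iff hi]; simp⟩
  have cr : ∀ i < 2, ∀ j < n, j ≠ 0 → A (f₁ i) (f₂ j) = 0 ∧ A (f₂ j) (f₁ i) = 0 :=
    fun i hi j hj hne => g.cross_eq_zero hd p₁ p₂ hi hj (by simp [hne])
  have hY₂ : ∀ i < N, ∀ j < N, A (if i = e then f₁ 0 else f₂ (τ i))
      (if j = e then f₁ 0 else f₂ (τ j)) = ext Y i j := by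
    intro i hi j hj
    by_cases hie : i = e
    · by_cases hje : j = e
      · simp [hie, hje, g.gcm.diag, hYe]
      · have h1 := hY' j hj hje
        have h2 := hτ j hj hje
        have h3 := cr 0 (by simp) (τ j) h2.1
        grind
    · by_cases hje : j = e
      · have h1 := hY' i hi hie
        have h2 := hτ i hi hie
        have h3 := cr 0 (by simp) (τ i) h2.1
        grind
      · simp only [hie, hje, if_false]
        rw [p₂.cartan _ (hτ i hi hie).1 _ (hτ j hj hje).1, hY i hi hie j hj hje]
  refine listed_of_double g.gcm hE (fun _ => f₁ 1) (fun j => if j = e then f₁ 0 else f₂ (τ j))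
    (fun x => ?_) ?_ hY₂ ?_ ?_ ?_ ?_ ?_
  · rcases g.exists_cover p₁ p₂ x with ⟨i, hi, rfl⟩ | ⟨i, hi, rfl⟩
    · rcases (by grind : i = 0 ∨ i = 1) with rfl | rfl
      · exact Or.inr ⟨e, by simp [he]⟩
      · exact Or.inl ⟨0, by simp⟩
    · obtain ⟨j, hj, hje, rfl⟩ := hτ' i hi
      exact Or.inr ⟨j, by simp [hje, hj]⟩
  · grind [g.gcm.diag (f₁ 1)]
  · grind
  · intro i hi j hj hij h
    by_cases hie : i = e
    · have := hY' j hj (by grind)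
      have := g.offDiag_nonpos hd p₁ p₂ 0 0
      grind
    · by_cases hje : j = e
      · have := hY' i hi (by grind)
        have := g.offDiag_nonpos hd p₁ p₂ 0 0
        grind
      · rw [hY i hi hie j hj hje] at h
        -- An entry 2 between different vertices contradicts the sign of off-diagonal entries.
        have h := (p₂.cartan _ (hτ i hi hie).1 _ (hτ j hj hje).1).trans h
        refine absurd (g.gcm.offDiag _ _ fun h' => hij ?_) (by rw [h]; norm_num)
        exact hinj i hi hie j hj hje (p₂.inj _ (hτ i hi hie).1 _ (hτ j hj hje).1 h')
  · intro i hi j hj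
    have := p₁.cartan 1 (by simp) 0 (by simp)
    have := cr 1 (by simp)
    grind
  · grind
  · grind

namespace HomInh

/-- The condition on the type of an inhomogeneous part. -/
abbrev IsInhType (s : ℤ) (n : ℕ) : Prop := s = 1 ∧ 1 ≤ n ∨ s = 2 ∧ 2 ≤ n

theorem reverse (hm : 2 ≤ m) (H : HomInh A T₁ T₁' T₂ T₂' (mA m) f₁ M₂ f₂) :
    HomInh A T₁ T₁' T₂ T₂' (mA m) (fun i => f₁ (m - 1 - i)) M₂ f₂ :=
  ⟨H.dynkin, H.glue, H.part₁.reverse hm, H.part₂, fun x hx => by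
    rw [pairing_reverse]; exact H.pair x hx⟩

theorem swap (H : HomInh A T₁ T₁' T₂ T₂' (mDD k) f₁ M₂ f₂) :
    HomInh A T₁ T₁' T₂ T₂' (mDD k) (fun i => f₁ (1 - i)) M₂ f₂ :=
  ⟨H.dynkin, H.glue, H.part₁.swap, H.part₂, fun x hx => by
    rw [pairing_swap]; exact H.pair x hx⟩

variable (H : HomInh A T₁ T₁' T₂ T₂' M₁ f₁ (mI s n) f₂) (hd : ∀ x ∈ T₁, x ∉ T₂)
  (hs : IsInhType s n)

include H hd hs

theorem single {e : ℕ} (hl : M₁.dec = [e]) (he : e < M₁.rank) :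
    M₁.weight e * A (f₁ e) (f₂ 0) = -2 := by
  rw [← H.glue.pairing_single hd H.part₁ H.part₂ hl he (by grind)]
  exact H.pair _ ((H.part₂.mem_dec_iff (by grind)).2 (by simp))

theorem double {e e' : ℕ} (hl : M₁.dec = [e, e']) (he : e < M₁.rank) (he' : e' < M₁.rank)
    (hne : e ≠ e') :
    M₁.weight e * A (f₁ e) (f₂ 0) + M₁.weight e' * A (f₁ e') (f₂ 0) = -2 := by
  rw [← H.glue.pairing_double hd H.part₁ H.part₂ hl he he' hne (by grind)]
  exact H.pair _ ((H.part₂.mem_dec_iff (by grind)).2 (by simp))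

theorem edge (h0 : 0 < M₁.rank) {p : ℤ} (hp : A (f₁ 0) (f₂ 0) = -p)
    (h : ∀ i < M₁.rank, i ≠ 0 → A (f₁ i) (f₂ 0) = 0) :
    Edge A T₁ T₁' T₂ T₂' M₁ f₁ s n f₂ p (-A (f₂ 0) (f₁ 0)) :=
  ⟨H.dynkin, H.glue, hd, H.part₁, H.part₂, h0, hs, hp, by simp,
    fun i hi hne => ⟨h i hi hne, H.glue.gcm.zero_symm _ _ (h i hi hne)⟩⟩

/-- A doubled coefficient 2 at the decorated vertex and the prescribed pairing `-2` give the entry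
`-1`. Only the opposite entry remains to be bounded. -/
theorem edge_single (h0 : 0 < M₁.rank) (hl : M₁.dec = [0]) (hw : M₁.weight 0 = 2) :
    Edge A T₁ T₁' T₂ T₂' M₁ f₁ s n f₂ 1 (-A (f₂ 0) (f₁ 0)) ∧ 1 ≤ -A (f₂ 0) (f₁ 0) := by
  have h := single H hd hs hl h0
  have h1 := H.glue.offDiag_nonpos hd H.part₁ H.part₂ 0 0 h0 (by grind)
  refine ⟨edge H hd hs h0 (by grind) fun i hi hne => ?_, by grind⟩
  exact (H.glue.cross_eq_zero hd H.part₁ H.part₂ hi (by grind) (by simp [hl, hne])).1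

end HomInh

namespace Edge

variable {q : ℤ}

/-- The second vertex of `d 2` would be isolated. Hence every case of equality in the bounds, which
entails affine type, is excluded. -/
theorem not_affine {p q : ℤ}
    (E : Edge A T₁ T₁' T₂ T₂' (mDD k) f₁ s n f₂ p q) : ¬ IsAffineType A := by
  intro ha
  obtain ⟨y, hy, hne⟩ := ha.exists_ne_zero (E.glue.gcm.diag (f₁ 1))
  rcases E.glue.exists_cover E.part₁ E.part₂ y with ⟨i, hi, rfl⟩ | ⟨i, hi, rfl⟩
  · have := E.part₁.cartan i hi 1 (by simp)
    grind
  · have h1 := E.eq_zero 1 (by simp) (by simp)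
    have h2 := E.glue.cross_eq_zero E.disjoint E.part₁ E.part₂ (i := 1) (by simp) hi
    grind

theorem dd_one (E : Edge A T₁ T₁' T₂ T₂' (mDD k) f₁ s n f₂ 1 q) (hq : 1 ≤ q) :
    Listed A T₁' .one T₂' .inh := by
  have h := E.type
  have hl := E.left
  have hr := E.right
  have hx := E.eq_zero 1 (by simp) (by simp)
  have hK : ∀ i < (mDD k).rank, 0 ≤ (if i = 0 then (1 : ℤ) else 0) ∧
      (mDD k).row (fun i => if i = 0 then 1 else 0) i ≤ if i = 0 then 1 * 2 else 0 := by
    intro i hi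
    simp only [Model.row, Finset.sum_range_succ, Finset.sum_range_zero]
    grind
  -- As equality is impossible, these bounds become strict: `q ≤ 3` always, `q ≤ 2` if `n ≥ 2`, and
  -- `q = 1` in type `C n`.
  have b1 := E.bound_point 2 (by simp) hK
  have b2 := E.bound_two hK
  have b3 := E.bound_const 2 (by simp) hK
  have ha := E.not_affine
  rcases (by grind : q = 1 ∧ s = 1 ∨ q = 1 ∧ s = 2 ∨ q = 2 ∧ s = 1 ∨ q = 3 ∧ s = 1 ∧ n = 1) with
    ⟨rfl, rfl⟩ | ⟨rfl, rfl⟩ | ⟨rfl, rfl⟩ | ⟨rfl, rfl, rfl⟩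
  · refine E.glue.listed_dd_inh E.disjoint E.part₁ E.part₂ hx.1 (.A1xA_d2_aa (n + 1) (by omega))
      (fun j => j - 1) ?_ ?_ ?_ (fun i hi => ⟨i + 1, by omega⟩) ?_ ?_ ?_ ?_ <;> grind (splits := 20)
  · refine E.glue.listed_dd_inh E.disjoint E.part₁ E.part₂ hx.1 (.A1xC_d2_cc (n + 1) (by omega))
      (fun j => j - 1) ?_ ?_ ?_ (fun i hi => ⟨i + 1, by omega⟩) ?_ ?_ ?_ ?_ <;> grind (splits := 20)
  · refine E.glue.listed_dd_inh E.disjoint E.part₁ E.part₂ hx.1 (.A1xB_d2_aa (n + 1) (by omega))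
      (fun j => n - 1 - j) ?_ ?_ ?_ (fun i hi => ⟨n - 1 - i, by omega⟩) ?_ ?_ ?_ ?_ <;>
      grind (splits := 20)
  · refine E.glue.listed_dd_inh E.disjoint E.part₁ E.part₂ hx.1 .A1xG2_d2_aa
      (fun _ => 0) ?_ ?_ ?_ (fun i hi => ⟨0, by omega⟩) ?_ ?_ ?_ ?_ <;> grind (splits := 20)

theorem dd_half (E : Edge A T₁ T₁' T₂ T₂' (mDD k) f₁ s n f₂ 2 q) (hq : 1 ≤ q) :
    Listed A T₁' .half T₂' .inh := by
  have h := E.type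
  have hl := E.left
  have hr := E.right
  have hx := E.eq_zero 1 (by simp) (by simp)
  have hK : ∀ i < (mDD k).rank, 0 ≤ (if i = 0 then (1 : ℤ) else 0) ∧
      (mDD k).row (fun i => if i = 0 then 1 else 0) i ≤ if i = 0 then 2 * 1 else 0 := by
    intro i hi
    simp only [Model.row, Finset.sum_range_succ, Finset.sum_range_zero]
    grind
  have b1 := E.bound_point 1 (by simp) hK
  have b3 := E.bound_const 1 (by simp) hK
  have ha := E.not_affine
  obtain ⟨rfl, rfl⟩ : q = 1 ∧ s = 1 := by grind
  refine E.glue.listed_dd_inh E.disjoint E.part₁ E.part₂ hx.1 (.A1xC_hd2_aa (n + 1) (by omega))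
    (fun j => n - 1 - j) ?_ ?_ ?_ (fun i hi => ⟨n - 1 - i, by omega⟩) ?_ ?_ ?_ ?_ <;>
    grind (splits := 20)

end Edge

namespace HomInh

variable (hd : ∀ x ∈ T₁, x ∉ T₂) (hs : IsInhType s n)

include hd hs

/-- The entries of the two ends add up to `-1`, so exactly one end is bonded; by reversal it is the
first. -/
theorem a_inh (hm : 2 ≤ m) (H : HomInh A T₁ T₁' T₂ T₂' (mA m) f₁ (mI s n) f₂) :
    Listed A T₁' .one T₂' .inh := by
  wlog h : A (f₁ (m - 1)) (f₂ 0) = 0 generalizing f₁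
  · refine this (H.reverse hm) ?_
    have he := double H hd hs rfl (by grind) (by grind) (by grind)
    have g0 := H.glue.offDiag_nonpos hd H.part₁ H.part₂ 0 0
    have g1 := H.glue.offDiag_nonpos hd H.part₁ H.part₂ (m - 1) 0
    grind
  have he := double H hd hs rfl (by grind) (by grind) (by grind)
  have g0 := H.glue.offDiag_nonpos hd H.part₁ H.part₂ 0 0
  refine (edge H hd hs (by grind) (p := 1) (by grind) fun i hi hne => ?_).a hm (by grind)
  rcases eq_or_ne i (m - 1) with rfl | hne'
  · exact h
  · exact (H.glue.cross_eq_zero hd H.part₁ H.part₂ hi (by grind) (by simp [hne, hne'])).1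

theorem dd_two_edges (H : HomInh A T₁ T₁' T₂ T₂' (mDD k) f₁ (mI s n) f₂)
    (h₀ : A (f₁ 0) (f₂ 0) = -1) (h₁ : A (f₁ 1) (f₂ 0) = -1) : Listed A T₁' .half T₂' .inh := by
  wlog h : A (f₂ 0) (f₁ 1) ≤ A (f₂ 0) (f₁ 0) generalizing f₁
  · exact this H.swap h₁ h₀ (by grind)
  have g0 := H.glue.offDiag_nonpos hd H.part₁ H.part₂ 0 0
  have hds := disjoint_symm hd
  -- With 1 on both vertices of `d 2` and 2 on the vertex they are bonded to, the rows of `d 2`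
  -- vanish exactly. So the sum of the two opposite multiplicities is at most 4, and at most 3 if `n
  -- ≥ 2`.
  have hc : Caps A (mDD k) f₁ (f₂ 0) (fun _ => 1) 2 (-(A (f₂ 0) (f₁ 0) + A (f₂ 0) (f₁ 1))) := by
    refine ⟨by simp, fun i hi => ?_, ?_⟩
    · simp only [Model.row, Finset.sum_range_succ, Finset.sum_range_zero]
      grind
    · simp [Finset.sum_range_succ]
  have b1 := hc.point H.glue hd H.part₁ H.part₂ H.dynkin (by grind) 2 (by simp)
  have b2 := hc.two H.glue hd H.part₁ H.part₂ H.dynkin (by grind)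
  obtain ⟨x, hx⟩ : ∃ x, A (f₂ 0) (f₁ 0) = -x := ⟨_, (neg_neg _).symm⟩
  obtain ⟨y, hy⟩ : ∃ y, A (f₂ 0) (f₁ 1) = -y := ⟨_, (neg_neg _).symm⟩
  rw [hx, hy] at b1 b2 h
  rcases hs with ⟨rfl, hn⟩ | ⟨rfl, hn⟩
  · rcases (by grind : (x = 1 ∧ y = 1 ∧ 2 ≤ n) ∨ (x = 1 ∧ y = 2 ∧ n = 2) ∨ (x = 1 ∧ y = 1 ∧ n = 1) ∨
      (x = 1 ∧ y = 2 ∧ n = 1) ∨ (x = 1 ∧ y = 3 ∧ n = 1) ∨ (x = 2 ∧ y = 2 ∧ n = 1)) with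
      ⟨rfl, rfl, hn⟩ | ⟨rfl, rfl, rfl⟩ | ⟨rfl, rfl, rfl⟩ | ⟨rfl, rfl, rfl⟩ | ⟨rfl, rfl, rfl⟩ |
      ⟨rfl, rfl, rfl⟩
    · refine (H.glue.symm.listed_of_disjoint hds H.part₂ H.part₁ (.D_aa_hd2 (n + 2) (by omega))
        (fun j => n - 1 - j) (fun i => n + i) ?_ ?_ ?_ ?_ ?_ ?_).symm <;> grind (splits := 25)
    · refine H.glue.listed_of_disjoint hd H.part₁ H.part₂ .affB3_hd2_aa (fun i => 3 * i)
        (fun j => 2 - j) ?_ ?_ ?_ ?_ ?_ ?_ <;> grind (splits := 25)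
    · refine H.glue.listed_of_disjoint hd H.part₁ H.part₂ .A3_hd2_aa (fun i => 2 * i)
        (fun _ => 1) ?_ ?_ ?_ ?_ ?_ ?_ <;> grind (splits := 20)
    · refine H.glue.listed_of_disjoint hd H.part₁ H.part₂ .B3_hd2_aa (fun i => 2 * i)
        (fun _ => 1) ?_ ?_ ?_ ?_ ?_ ?_ <;> grind (splits := 20)
    · refine H.glue.listed_of_disjoint hd H.part₁ H.part₂ .affG2_hd2_aa (fun i => 2 * i)
        (fun _ => 1) ?_ ?_ ?_ ?_ ?_ ?_ <;> grind (splits := 20)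
    · refine H.glue.listed_of_disjoint hd H.part₁ H.part₂ .twD3_hd2_aa (fun i => 2 * i)
        (fun _ => 1) ?_ ?_ ?_ ?_ ?_ ?_ <;> grind (splits := 20)
  · obtain ⟨rfl, rfl⟩ : x = 1 ∧ y = 1 := by grind
    refine H.glue.listed_of_disjoint hd H.part₁ H.part₂ (.twAodd_hd2_cc (n + 1) (by omega))
      (fun i => i) (fun j => j + 2) ?_ ?_ ?_ ?_ ?_ ?_ <;> grind (splits := 25)

/-- The two entries add up to `-2 / k`. For `k = 1` this is one double entry or two simple ones, for
`k = 2` one simple entry. -/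
theorem dd_inh (H : HomInh A T₁ T₁' T₂ T₂' (mDD k) f₁ (mI s n) f₂) (hk : IsHalfOrOne c₁ k) :
    Listed A T₁' c₁ T₂' .inh := by
  have he := double H hd hs rfl (by simp) (by simp) (by simp)
  have g0 := H.glue.offDiag_nonpos hd H.part₁ H.part₂ 0 0
  have g1 := H.glue.offDiag_nonpos hd H.part₁ H.part₂ 1 0
  wlog h : A (f₁ 0) (f₂ 0) ≤ A (f₁ 1) (f₂ 0) generalizing f₁
  · exact this H.swap (by grind) g1 g0 (by grind)
  rcases hk with ⟨rfl, rfl⟩ | ⟨rfl, rfl⟩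
  · by_cases h1 : A (f₁ 1) (f₂ 0) = 0
    · exact (edge H hd hs (by simp) (p := 2) (by grind) (by grind)).dd_half (by grind)
    · exact dd_two_edges hd hs H (by grind) (by grind)
  · exact (edge H hd hs (by simp) (p := 1) (by grind) (by grind)).dd_one (by grind)

/-- If there is only one decorated vertex, its doubled coefficient must divide 2. This eliminates
the models `c`, `f`, `g`, `b'` and fixes the factor of `point`, `b` and `d`. -/
theorem listed_of_disjoint (H : HomInh A T₁ T₁' T₂ T₂' M₁ f₁ (mI s n) f₂) (h₁ : IsModel M₁ c₁)
    (hc : c₁ ≠ .inh) : Listed A T₁' c₁ T₂' .inh := by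
  cases h₁ with
  | point c k h =>
    obtain ⟨rfl, rfl⟩ : c₁ = .one ∧ k = 1 := by grind [single H hd hs rfl (by simp)]
    exact (edge_single H hd hs (by simp) rfl rfl).1.point (edge_single H hd hs (by simp) rfl rfl).2
  | a m hm => exact a_inh hd hs hm H
  | b m hm c k h =>
    obtain ⟨rfl, rfl⟩ : c₁ = .one ∧ k = 1 := by grind [single H hd hs rfl (by grind)]
    exact (edge_single H hd hs (by grind) rfl rfl).1.b hm (edge_single H hd hs (by grind) rfl rfl).2
  | c m hm => grind [single H hd hs rfl (by grind)]
  | d m hm c k h =>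
    obtain ⟨rfl, rfl⟩ : c₁ = .half ∧ k = 1 := by grind [single H hd hs rfl (by grind)]
    have := edge_single H hd hs (by grind) rfl (by grind)
    exact this.1.d hm this.2
  | dd c k h => exact dd_inh hd hs H h
  | f => grind [single H hd hs rfl (by simp)]
  | g c k h => grind [single H hd hs rfl (by simp)]
  | b' c k h => grind [single H hd hs rfl (by simp)]
  | aa => exact absurd rfl hc
  | cc => exact absurd rfl hc

end HomInh

end PrimSph

namespace PrimSph

open Matrix

variable {S : Type*} [Fintype S] {A : Matrix S S ℤ} {T T' T₁ T₁' T₂ T₂' : Set S} {c₁ c₂ : Factor}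
  {M M₁ M₂ : Model} {f f₁ f₂ : ℕ → S} {m n : ℕ} {k k₁ k₂ s t p q : ℤ}

/-! ### Two inhomogeneous parts without common vertices -/

/-- Two inhomogeneous parts satisfying the condition on the colabels. -/
structure InhInh (A : Matrix S S ℤ) (T₁ T₁' T₂ T₂' : Set S) (M₁ : Model) (f₁ : ℕ → S) (M₂ : Model)
    (f₂ : ℕ → S) : Prop where
  dynkin : IsDynkin A
  glue : Glue A T₁ T₁' T₂ T₂'
  part₁ : Part A T₁ T₁' M₁ f₁
  part₂ : Part A T₂ T₂' M₂ f₂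
  colabel : IsAffineType A → (graph A).Connected → ∀ k, IsColabeling A k →
    ∀ x ∈ T₁', ∀ y ∈ T₂', k x = k y

theorem InhInh.symm (H : InhInh A T₁ T₁' T₂ T₂' M₁ f₁ M₂ f₂) : InhInh A T₂ T₂' T₁ T₁' M₂ f₂ M₁ f₁ :=
  ⟨H.dynkin, H.glue.symm, H.part₂, H.part₁, fun h h' k hk x hx y hy =>
    (H.colabel h h' k hk y hy x hx).symm⟩

omit [Fintype S] in
theorem Part.reachable (P : Part A T T' (mI s n) f) {i : ℕ} (hi : i < n) :
    (graph A).Reachable (f 0) (f i) := by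
  induction i with
  | zero => exact SimpleGraph.Reachable.refl _
  | succ i ih =>
    refine (ih (by omega)).trans (SimpleGraph.Adj.reachable ⟨fun h => ?_, Or.inl ?_⟩)
    · have := P.inj i (by grind) (i + 1) (by grind) h
      omega
    · rw [P.cartan i (by grind) (i + 1) (by grind)]
      grind

namespace Edge

variable (E : Edge A T₁ T₁' T₂ T₂' (mI t m) f₁ s n f₂ p q)

include E

/-- The condition on the colabels is imposed on irreducible affine diagrams only, so irreducibility
has to be checked before it can be used. -/
theorem connected (hp : p ≠ 0) : (graph A).Connected := by
  have h0 : (graph A).Reachable (f₂ 0) (f₁ 0) := by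
    refine SimpleGraph.Adj.reachable ⟨fun h => ?_, Or.inr ?_⟩
    · refine E.disjoint _ (E.part₁.mem_of_lt E.rank) ?_
      rw [← h]
      exact E.part₂.mem_of_lt E.one_le.2
    · rw [E.left]
      simpa using hp
  have h : ∀ x, (graph A).Reachable (f₂ 0) x := by
    intro x
    rcases E.glue.exists_cover E.part₁ E.part₂ x with ⟨i, hi, rfl⟩ | ⟨i, hi, rfl⟩
    · exact h0.trans (E.part₁.reachable hi)
    · exact E.part₂.reachable hi
  have : Nonempty S := ⟨f₂ 0⟩
  exact ⟨fun x y => (h x).symm.trans (h y)⟩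

theorem symm (ht : t = 1 ∧ 1 ≤ m ∨ t = 2 ∧ 2 ≤ m) : Edge A T₂ T₂' T₁ T₁' (mI s n) f₂ t m f₁ q p :=
  ⟨E.dynkin, E.glue.symm, disjoint_symm E.disjoint, E.part₂, E.part₁, E.one_le.2, ht, E.right,
    E.left,
    fun i hi hne =>
      (E.glue.cross_eq_zero E.disjoint E.part₁ E.part₂ E.rank hi (by simp [hne])).symm⟩

/-- The colabels of the two decorated vertices agree. -/
theorem colabel_eq (H : InhInh A T₁ T₁' T₂ T₂' (mI t m) f₁ (mI s n) f₂) (hp : p ≠ 0)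
    (ha : IsAffineType A) (K₁ K₂ : ℕ → ℤ)
    (h₁ : ∀ i < m, 0 < K₁ i ∧ (mI t m).row K₁ i = if i = 0 then p * K₂ 0 else 0)
    (h₂ : ∀ j < n, 0 < K₂ j ∧ (mI s n).row K₂ j = if j = 0 then q * K₁ 0 else 0)
    {i : ℕ} (hi : i < m) (hi' : K₁ i = 1) : K₁ 0 = K₂ 0 := by
  obtain ⟨v, hv₁, hv₂⟩ := E.glue.exists_vector E.disjoint E.part₁ E.part₂ K₁ K₂
  have hn := E.one_le.2
  have e₁ : ∀ i < m, ∑ j ∈ Finset.range n, A (f₁ i)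
    (f₂ j) * K₂ j = -if i = 0 then p * K₂ 0 else 0 := by
    intro i hi
    rw [Finset.sum_eq_single_of_mem 0 (Finset.mem_range.2 hn) fun j hj hne => by
      rw [(E.glue.cross_eq_zero E.disjoint E.part₁ E.part₂ hi (Finset.mem_range.1 hj)
        (by simp [hne])).1, zero_mul]]
    split_ifs with h
    · rw [h, E.left, neg_mul]
    · rw [(E.eq_zero i hi h).1, zero_mul, neg_zero]
  have e₂ : ∀ j < n, ∑ i ∈ Finset.range m, A (f₂ j)
    (f₁ i) * K₁ i = -if j = 0 then q * K₁ 0 else 0 := by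
    intro j hj
    rw [Finset.sum_eq_single_of_mem 0 (by simpa using E.rank) fun i hi hne => by
      rw [(E.glue.cross_eq_zero E.disjoint E.part₁ E.part₂ (Finset.mem_range.1 hi) hj
        (by simp [hne])).2, zero_mul]]
    split_ifs with h
    · rw [h, E.right, neg_mul]
    · rw [(E.glue.cross_eq_zero E.disjoint E.part₁ E.part₂ E.rank hj (by simp [h])).2, zero_mul,
        neg_zero]
  have hv : IsColabeling A v := by
    refine ⟨fun x => ?_, ?_, ?_⟩
    · rcases E.glue.exists_cover E.part₁ E.part₂ x with ⟨i, hi, rfl⟩ | ⟨i, hi, rfl⟩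
      · rw [hv₁ i hi]; exact (h₁ i hi).1
      · rw [hv₂ i hi]; exact (h₂ i hi).1
    -- A vertex with value 1 makes the null vector primitive, hence equal to the family of colabels.
    · have h1 : Finset.univ.gcd v ∣ v (f₁ i) := Finset.gcd_dvd (Finset.mem_univ _)
      rw [hv₁ i hi, hi'] at h1
      have h2 : normalize (Finset.univ.gcd v) = Finset.univ.gcd v := Finset.normalize_gcd
      rw [← h2]
      exact normalize_eq_one.2 (isUnit_of_dvd_one h1)
    · ext x
      have h : (v ᵥ* Aᵀ) x = ∑ y, A x y * v y := by
        simp only [vecMul, dotProduct, transpose_apply, mul_comm]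
      rw [h]
      rcases E.glue.exists_cover E.part₁ E.part₂ x with ⟨i, hi, rfl⟩ | ⟨i, hi, rfl⟩
      · rw [E.glue.row_eq E.disjoint E.part₁ E.part₂ hv₁ hv₂ hi, (h₁ i hi).2]
        exact (congrArg _ (e₁ i hi)).trans (add_neg_cancel _)
      · rw [E.glue.symm.row_eq (disjoint_symm E.disjoint) E.part₂ E.part₁ hv₂ hv₁ hi, (h₂ i hi).2]
        exact (congrArg _ (e₂ i hi)).trans (add_neg_cancel _)
  have := H.colabel ha (E.connected hp) v hv (f₁ 0) ((E.part₁.mem_dec_iff E.rank).2 (by simp))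
    (f₂ 0) ((E.part₂.mem_dec_iff hn).2 (by simp))
  rwa [hv₁ 0 E.rank, hv₂ 0 hn] at this

end Edge

namespace InhInh

theorem listed_of_eq_zero (H : InhInh A T₁ T₁' T₂ T₂' (mI t m) f₁ (mI s n) f₂)
    (hd : ∀ x ∈ T₁, x ∉ T₂) (h0 : A (f₁ 0) (f₂ 0) = 0) (ht : 1 ≤ t) (hs : 1 ≤ s)
    {X : Matrix (Fin m) (Fin m) ℤ} {Y : Matrix (Fin n) (Fin n) ℤ}
    (hE : IsListed (double X Y [0] [] c₁ [] [0] c₂))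
    (hX : ∀ i < m, ∀ j < m, ext X i j = chain 1 t m i j)
    (hY : ∀ i < n, ∀ j < n, ext Y i j = chain 1 s n i j) : Listed A T₁' c₁ T₂' c₂ := by
  have g := H.glue
  refine listed_of_double g.gcm hE f₁ f₂ (g.exists_cover H.part₁ H.part₂)
    (fun i hi j hj => (H.part₁.cartan i hi j hj).trans (hX i hi j hj).symm)
    (fun i hi j hj => (H.part₂.cartan i hi j hj).trans (hY i hi j hj).symm) ?_ ?_ ?_ ?_ ?_
  · grind
  · grind
  · intro i hi j hj
    by_cases h : i = 0 ∧ j = 0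
    · rw [h.1, h.2, h0]
    · exact (g.cross_eq_zero hd H.part₁ H.part₂ hi hj (by simpa using h)).1
  · intro i hi
    have h1 : f₁ i ∉ T₂' := fun h => g.not_mem₁ _ h (H.part₁.mem_of_lt hi)
    have h2 := H.part₁.mem_dec_iff hi
    grind
  · intro i hi
    have h1 : f₂ i ∉ T₁' := fun h => g.not_mem₂ _ h (H.part₂.mem_of_lt hi)
    have h2 := H.part₂.mem_dec_iff hi
    grind

theorem edge (H : InhInh A T₁ T₁' T₂ T₂' (mI t m) f₁ (mI s n) f₂) (hd : ∀ x ∈ T₁, x ∉ T₂)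
    (hm : 1 ≤ m) (hs : s = 1 ∧ 1 ≤ n ∨ s = 2 ∧ 2 ≤ n) :
    Edge A T₁ T₁' T₂ T₂' (mI t m) f₁ s n f₂ (-A (f₁ 0) (f₂ 0)) (-A (f₂ 0) (f₁ 0)) :=
  ⟨H.dynkin, H.glue, hd, H.part₁, H.part₂, hm, hs, by simp, by simp, fun i hi hne =>
    H.glue.cross_eq_zero hd H.part₁ H.part₂ hi (by grind) (by simp [hne])⟩

theorem aa_aa_of_left (H : InhInh A T₁ T₁' T₂ T₂' (mI 1 m) f₁ (mI 1 n) f₂)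
    (E : Edge A T₁ T₁' T₂ T₂' (mI 1 m) f₁ 1 n f₂ 1 q) (hq : 1 ≤ q) : Listed A T₁' .inh T₂' .inh :=
      by
  have hn := E.one_le.2
  have hm : 1 ≤ m := E.rank
  have hl := E.left
  have hr := E.right
  have hs := disjoint_symm E.disjoint
  rcases hq.eq_or_lt with rfl | hq
  · refine E.glue.listed_of_disjoint E.disjoint E.part₁ E.part₂ (.A_aa_aa (m + n) m hm (by omega))
      (fun i => m - 1 - i) (fun j => m + j) ?_ ?_ ?_ ?_ ?_ ?_ <;> grind (splits := 20)
  rcases hm.eq_or_lt with rfl | hm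
  · have b1 := E.bound_point (K := fun _ => 1) 2 (by simp) (by grind)
    have b2 := E.bound_two (K := fun _ => 1) (by grind)
    rcases (by grind : q = 2 ∨ q = 3 ∧ n = 1 ∨ q = 3 ∧ n = 2 ∨ q = 4 ∧ n = 1) with
      rfl | ⟨rfl, rfl⟩ | ⟨rfl, rfl⟩ | ⟨rfl, rfl⟩
    · refine (E.glue.symm.listed_of_disjoint hs E.part₂ E.part₁ (.B_aa_aa (n + 1) (by omega))
        (fun j => n - 1 - j) (fun _ => n) ?_ ?_ ?_ ?_ ?_ ?_).symm <;> grind (splits := 20)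
    · refine (E.glue.symm.listed_of_disjoint hs E.part₂ E.part₁ .G2_aa_aa
        (fun _ => 0) (fun _ => 1) ?_ ?_ ?_ ?_ ?_ ?_).symm <;> grind (splits := 20)
    -- This would be `G₂⁽¹⁾`, and the next case `A₂⁽²⁾`; the decorated colabels are 1 and 2.
    · have := E.colabel_eq H (by simp) (by grind) (fun _ => 1) (fun j => 2 - j) (by grind)
        (by grind) (i := 0) (by simp) rfl
      simp at this
    · have := E.colabel_eq H (by simp) (by grind) (fun _ => 1) (fun _ => 2) (by grind)
        (by grind) (i := 0) (by simp) rfl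
      simp at this
  · rcases E.chain_bound (M₁ := mI 1 m) hm (fun _ _ _ => rfl) (by omega) with h | h | ⟨ha, h⟩
    · obtain ⟨rfl, rfl⟩ := h
      refine E.glue.listed_of_disjoint E.disjoint E.part₁ E.part₂ (.C_aa_cc (m + 1) m (by omega)
        (by omega) (by omega)) (fun i => m - 1 - i) (fun _ => m) ?_ ?_ ?_ ?_ ?_ ?_ <;>
        grind (splits := 20)
    · obtain ⟨rfl, rfl, rfl⟩ : q = 2 ∧ m = 2 ∧ n = 2 := h
      refine (E.glue.symm.listed_of_disjoint hs E.part₂ E.part₁ .F4_aa_aa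
        (fun j => 1 - j) (fun i => 2 + i) ?_ ?_ ?_ ?_ ?_ ?_).symm <;> grind (splits := 20)
    -- In all three affine cases the colabels descend to 1 on the first chain, from `m` at its
    -- decorated vertex, while the other decorated vertex has colabel `m + 1`.
    · have := E.colabel_eq H (by simp) ha (fun i => m - i)
        (fun j => if j = 0 then m + 1 else if n = 3 then 3 - j else 2) (by grind) (by grind)
        (i := m - 1) (by omega) (by grind)
      grind

theorem aa_aa (H : InhInh A T₁ T₁' T₂ T₂' (mI 1 m) f₁ (mI 1 n) f₂) (hd : ∀ x ∈ T₁, x ∉ T₂)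
    (hm : 1 ≤ m) (hn : 1 ≤ n) : Listed A T₁' .inh T₂' .inh := by
  by_cases h0 : A (f₁ 0) (f₂ 0) = 0
  · exact H.listed_of_eq_zero hd h0 le_rfl le_rfl (.AxA_aa_aa m n hm hn) (by grind) (by grind)
  have g0 := H.glue.offDiag_nonpos hd H.part₁ H.part₂ 0 0
  have E := H.edge hd hm (Or.inl ⟨rfl, hn⟩)
  obtain ⟨p, hp⟩ : ∃ p, -A (f₁ 0) (f₂ 0) = p := ⟨_, rfl⟩
  obtain ⟨q, hq⟩ : ∃ q, -A (f₂ 0) (f₁ 0) = q := ⟨_, rfl⟩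
  rw [hp, hq] at E
  rcases (by grind : p = 1 ∧ 1 ≤ q ∨ q = 1 ∧ 1 ≤ p ∨ 2 ≤ p ∧ 2 ≤ q) with ⟨rfl, h⟩ | ⟨rfl, h⟩ | h
  · exact H.aa_aa_of_left E h
  · exact (H.symm.aa_aa_of_left (E.symm (Or.inl ⟨rfl, hm⟩)) h).symm
  -- With both multiplicities at least 2, the vector supported on the two bonded vertices with
  -- values 1 is admissible. Equality leaves nothing but these two vertices.
  · obtain ⟨b1, rfl, -, b2⟩ := E.bound_point (K := fun i => if i = 0 then 1 else 0) 1 (by simp)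
      (by grind)
      (by grind)
    have r0 := b2 0 (by grind)
    have r1 := b2 1
    obtain ⟨rfl, rfl, rfl⟩ : m = 1 ∧ p = 2 ∧ q = 2 := by grind
    refine E.glue.listed_of_disjoint E.disjoint E.part₁ E.part₂ .affA1_aa_aa
      (fun _ => 0) (fun _ => 1) ?_ ?_ ?_ ?_ ?_ ?_ <;> grind

theorem aa_cc (H : InhInh A T₁ T₁' T₂ T₂' (mI 1 m) f₁ (mI 2 n) f₂) (hd : ∀ x ∈ T₁, x ∉ T₂)
    (hm : 1 ≤ m) (hn : 2 ≤ n) : Listed A T₁' .inh T₂' .inh := by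
  by_cases h0 : A (f₁ 0) (f₂ 0) = 0
  · exact H.listed_of_eq_zero hd h0 le_rfl (by simp) (.AxC_aa_cc m n hm hn) (by grind) (by grind)
  have g0 := H.glue.offDiag_nonpos hd H.part₁ H.part₂ 0 0
  have E := H.edge hd hm (Or.inr ⟨rfl, hn⟩)
  obtain ⟨p, hp⟩ : ∃ p, -A (f₁ 0) (f₂ 0) = p := ⟨_, rfl⟩
  obtain ⟨q, hq⟩ : ∃ q, -A (f₂ 0) (f₁ 0) = q := ⟨_, rfl⟩
  rw [hp, hq] at E
  have hp0 : 1 ≤ p := by grind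
  have hq0 : 1 ≤ q := by grind
  -- The value `p` on the bonded vertex and 2 on all of `C n` give `p q ≤ 2`; equality forbids
  -- further vertices in the first part.
  have b := E.bound_const (K := fun i => if i = 0 then p else 0) 2 (by simp) (by grind) rfl
  have hpq : p = 1 ∧ q = 1 ∨ p * q = 2 ∧ m = 1 := by
    rcases (by grind : p = 1 ∧ q = 1 ∨ 2 ≤ p ∨ 2 ≤ q) with h | h
    · exact Or.inl h
    have h2 : 2 ≤ q * p := by rcases h with h | h <;> nlinarith
    obtain ⟨b1, -, b2⟩ := b (by simpa using h2)
    have r1 := b2 1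
    refine Or.inr ⟨by simpa [mul_comm] using b1, by grind⟩
  rcases hpq with ⟨rfl, rfl⟩ | ⟨h, rfl⟩
  · refine E.glue.listed_of_disjoint E.disjoint E.part₁ E.part₂ (.C_aa_cc (m + n) m (by omega)
      (by omega) (by omega)) (fun i => m - 1 - i) (fun j => m + j) ?_ ?_ ?_ ?_ ?_ ?_ <;>
      grind (splits := 20)
  · have hp2 : p ≤ 2 := Int.le_of_dvd (by simp) ⟨q, h.symm⟩
    have h12 : p = 1 ∧ q = 2 ∨ p = 2 ∧ q = 1 := by
      rcases (by omega : p = 1 ∨ p = 2) with rfl | rfl <;> omega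
    rcases h12 with ⟨rfl, rfl⟩ | ⟨rfl, rfl⟩
    · have := E.colabel_eq H (by simp) (b (by simp)).2.1 (fun _ => 1) (fun _ => 2)
        (by grind)
        (by grind) (i := 0) (by simp) rfl
      simp at this
    · refine E.glue.listed_of_disjoint E.disjoint E.part₁ E.part₂ (.affC_cc_cc n 1 hn le_rfl
        (by omega)) (fun _ => 0) (fun j => j + 1) ?_ ?_ ?_ ?_ ?_ ?_ <;> grind (splits := 20)

theorem cc_cc (H : InhInh A T₁ T₁' T₂ T₂' (mI 2 m) f₁ (mI 2 n) f₂) (hd : ∀ x ∈ T₁, x ∉ T₂)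
    (hm : 2 ≤ m) (hn : 2 ≤ n) : Listed A T₁' .inh T₂' .inh := by
  by_cases h0 : A (f₁ 0) (f₂ 0) = 0
  · exact H.listed_of_eq_zero hd h0 (by simp) (by simp) (.CxC_cc_cc m n hm hn) (by grind) (by grind)
  have g0 := H.glue.offDiag_nonpos hd H.part₁ H.part₂ 0 0
  have E := H.edge hd (by omega) (Or.inr ⟨rfl, hn⟩)
  obtain ⟨p, hp⟩ : ∃ p, -A (f₁ 0) (f₂ 0) = p := ⟨_, rfl⟩
  obtain ⟨q, hq⟩ : ∃ q, -A (f₂ 0) (f₁ 0) = q := ⟨_, rfl⟩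
  rw [hp, hq] at E
  have hp0 : 1 ≤ p := by grind
  have hq0 : 1 ≤ q := by grind
  -- The values `p` on the first part and 1 on the second use both double bonds; the bound becomes
  -- `p q = 1`.
  obtain ⟨b, -⟩ := E.bound_const (K := fun _ => p) 1 (by simp) (by grind) rfl
    (by nlinarith)
  obtain ⟨rfl, rfl⟩ : q = 1 ∧ p = 1 := by
    have : q = 1 := by nlinarith
    exact ⟨this, by nlinarith⟩
  refine E.glue.listed_of_disjoint E.disjoint E.part₁ E.part₂ (.affC_cc_cc (m + n - 1) m (by omega)
    (by omega) (by omega)) (fun i => m - 1 - i) (fun j => m + j) ?_ ?_ ?_ ?_ ?_ ?_ <;>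
    grind (splits := 20)

theorem listed_of_disjoint (H : InhInh A T₁ T₁' T₂ T₂' (mI t m) f₁ (mI s n) f₂)
    (hd : ∀ x ∈ T₁, x ∉ T₂) (ht : t = 1 ∧ 1 ≤ m ∨ t = 2 ∧ 2 ≤ m)
      (hs : s = 1 ∧ 1 ≤ n ∨ s = 2 ∧ 2 ≤ n) :
    Listed A T₁' .inh T₂' .inh := by
  rcases ht with ⟨rfl, hm⟩ | ⟨rfl, hm⟩ <;> rcases hs with ⟨rfl, hn⟩ | ⟨rfl, hn⟩
  · exact H.aa_aa hd hm hn
  · exact H.aa_cc hd hm hn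
  · exact (H.symm.aa_cc (disjoint_symm hd) hn hm).symm
  · exact H.cc_cc hd hm hn

end InhInh

end PrimSph

namespace PrimSph

open Matrix

variable {S : Type*} {A : Matrix S S ℤ} {T T' T₁ T₁' T₂ T₂' : Set S} {c₁ c₂ : Factor}
  {M M₁ M₂ : Model} {f f₁ f₂ u v : ℕ → S} {k l m n : ℕ} {r s r₁ s₁ r₂ s₂ : ℤ}

/-! ### Arms -/

/-- The vertices `u 0, …, u (k - 1)` form a connected component, which is a chain, of the
undecorated vertices of a part. -/
structure Arm (A : Matrix S S ℤ) (T T' : Set S) (k : ℕ) (r s : ℤ) (u : ℕ → S) : Prop where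
  ne_zero : r ≠ 0 ∧ s ≠ 0
  inj : ∀ i < k, ∀ j < k, u i = u j → i = j
  mem : ∀ i < k, u i ∈ T
  not_mem : ∀ i < k, u i ∉ T'
  cartan : ∀ i < k, ∀ j < k, A (u i) (u j) = chain r s k i j
  closed : ∀ y ∈ T, y ∉ T' → ∀ i < k, A y (u i) ≠ 0 → ∃ j < k, u j = y

theorem Part.arm (p : Part A T T' M f) (α : ℕ → ℕ) (k : ℕ) (r s : ℤ) (hrs : r ≠ 0 ∧ s ≠ 0)
    (hα : ∀ i < k, α i < M.rank ∧ α i ∉ M.dec) (hi : ∀ i < k, ∀ j < k, α i = α j → i = j)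
    (he : ∀ i < k, ∀ j < k, M.entry (α i) (α j) = chain r s k i j)
    (hc : ∀ j < M.rank, j ∉ M.dec → ∀ i < k, M.entry j (α i) ≠ 0 → ∃ i' < k, α i' = j) :
    Arm A T T' k r s fun i => f (α i) := by
  refine ⟨hrs, fun i h j h' e => hi i h j h' (p.inj _ (hα i h).1 _ (hα j h').1 e),
    fun i h => p.mem_of_lt (hα i h).1, fun i h h' => (hα i h).2 ((p.mem_dec_iff (hα i h).1).1 h'),
    fun i h j h' => ?_, fun y hy hy' i h hne => ?_⟩
  · rw [p.cartan _ (hα i h).1 _ (hα j h').1, he i h j h']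
  · obtain ⟨j, hj, rfl⟩ := (p.mem y).1 hy
    rw [p.cartan _ hj _ (hα i h).1] at hne
    obtain ⟨i', h1, rfl⟩ := hc j hj (fun h => hy' ((p.mem_dec_iff hj).2 h)) i h hne
    exact ⟨i', h1, rfl⟩

/-- A neighbour of a common vertex which is undecorated in one part belongs to the other one. -/
theorem Arm.mem_of_adj (a : Arm A T₁ T₁' k r s u) (g : Glue A T₁ T₁' T₂ T₂')
    {y : S} (hy : y ∈ T₂) (hy' : y ∉ T₂') {i : ℕ} (hi : i < k) (h : A y (u i) ≠ 0) :
    ∃ j < k, u j = y :=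
  a.closed y (g.step₁ y _ hy' (a.mem i hi) h) (fun h' => g.not_mem₂ y h' hy) i hi h

/-- Starting at the common vertex, one walks along the second arm in both directions. Each next
vertex is an undecorated neighbour of a common one and is therefore common too. -/
theorem Arm.forall_mem (a₁ : Arm A T₁ T₁' k r₁ s₁ u) (a₂ : Arm A T₂ T₂' l r₂ s₂ v)
    (g : Glue A T₁ T₁' T₂ T₂') {i j : ℕ} (hi : i < k) (hj : j < l) (h : u i = v j) :
    ∀ j < l, ∃ i < k, u i = v j := by
  have key : ∀ i j, i < l → j < l → chain r₂ s₂ l i j ≠ 0 → (∃ i < k, u i = v j) →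
      ∃ j < k, u j = v i := by
    rintro i j hi hj hne ⟨i', hi', h⟩
    refine a₁.mem_of_adj g (a₂.mem i hi) (a₂.not_mem i hi) hi' ?_
    rwa [h, a₂.cartan i hi j hj]
  have := a₂.ne_zero
  have up : ∀ d, j + d < l → ∃ i < k, u i = v (j + d) := by
    intro d
    induction d with
    | zero => exact fun _ => ⟨i, hi, h⟩
    | succ d ih => exact fun hd => key _ (j + d) hd (by omega) (by grind) (ih (by omega))
  have down : ∀ d, d ≤ j → ∃ i < k, u i = v (j - d) := by
    intro d
    induction d with
    | zero => exact fun _ => ⟨i, hi, h⟩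
    | succ d ih => exact fun hd => key _ (j - d) (by omega) (by omega) (by grind) (ih (by omega))
  intro j' hj'
  rcases le_total j j' with hle | hle
  · simpa [Nat.add_sub_cancel' hle] using up (j' - j) (by omega)
  · simpa [Nat.sub_sub_self hle] using down (j - j') (by omega)

/-- An injective map preserving adjacency of a finite path cannot turn back, so its first step
determines its direction. -/
theorem eq_id_or_reverse {σ : ℕ → ℕ} (hσ : ∀ i < k, σ i < k)
    (hi : ∀ i < k, ∀ j < k, σ i = σ j → i = j)
    (h : ∀ i, i + 1 < k → σ (i + 1) = σ i + 1 ∨ σ i = σ (i + 1) + 1) :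
    (∀ i < k, σ i = i) ∨ ∀ i < k, σ i = k - 1 - i := by
  rcases Nat.lt_or_ge k 2 with hk | hk
  · left
    intro i hi
    have := hσ i hi
    omega
  have h0 := h 0 (by omega)
  rcases h0 with h0 | h0
  · have key : ∀ i, i + 1 < k → σ (i + 1) = σ i + 1 := by
      intro i
      induction i with
      | zero => exact fun _ => h0
      | succ i ih =>
        intro hik
        rcases h (i + 1) hik with h1 | h1
        · exact h1
        · have := hi i (by omega) (i + 1 + 1) (by omega) (by have := ih (by omega); omega)
          omega
    have key' : ∀ i < k, σ i = σ 0 + i := by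
      intro i
      induction i with
      | zero => simp
      | succ i ih => intro hik; rw [key i hik, ih (by omega)]; omega
    left
    intro i hik
    have h1 := key' i hik
    have h2 := key' (k - 1) (by omega)
    have h3 := hσ (k - 1) (by omega)
    omega
  · have key : ∀ i, i + 1 < k → σ i = σ (i + 1) + 1 := by
      intro i
      induction i with
      | zero => exact fun _ => h0
      | succ i ih =>
        intro hik
        rcases h (i + 1) hik with h1 | h1
        · have := hi i (by omega) (i + 1 + 1) (by omega) (by have := ih (by omega); omega)
          omega
        · exact h1
    have key' : ∀ i < k, σ 0 = σ i + i := by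
      intro i
      induction i with
      | zero => simp
      | succ i ih => intro hik; rw [ih (by omega), key i hik]; omega
    right
    intro i hik
    have h1 := key' i hik
    have h2 := key' (k - 1) (by omega)
    have h3 := hσ 0 (by omega)
    omega

/-- Two arms with a common vertex coincide, up to the direction. -/
theorem Arm.eq_or_reverse (a₁ : Arm A T₁ T₁' k r₁ s₁ u) (a₂ : Arm A T₂ T₂' l r₂ s₂ v)
    (g : Glue A T₁ T₁' T₂ T₂') {i j : ℕ} (hi : i < k) (hj : j < l) (h : u i = v j) :
    k = l ∧ ((∀ i < k, u i = v i) ∧ (2 ≤ k → r₁ = r₂ ∧ s₁ = s₂) ∨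
      (∀ i < k, u i = v (k - 1 - i)) ∧ (k = 2 → r₁ = s₂ ∧ s₁ = r₂) ∧
        (3 ≤ k → r₁ = 1 ∧ s₁ = 1 ∧ r₂ = 1 ∧ s₂ = 1)) := by
  have h₁ := a₁.forall_mem a₂ g hi hj h
  have h₂ := a₂.forall_mem a₁ g.symm hj hi h.symm
  have hkl : k = l := by
    refine le_antisymm ?_ ?_
    · choose! σ hσ using h₂
      have := Finset.card_le_card_of_injOn (s := Finset.range k) (t := Finset.range l) σ
        (fun i hi => by simpa using (hσ i (by simpa using hi)).1) (fun i hi j hj e => by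
          refine a₁.inj i (by simpa using hi) j (by simpa using hj) ?_
          rw [← (hσ i (by simpa using hi)).2, ← (hσ j (by simpa using hj)).2, e])
      simpa using this
    · choose! σ hσ using h₁
      have := Finset.card_le_card_of_injOn (s := Finset.range l) (t := Finset.range k) σ
        (fun i hi => by simpa using (hσ i (by simpa using hi)).1) (fun i hi j hj e => by
          refine a₂.inj i (by simpa using hi) j (by simpa using hj) ?_
          rw [← (hσ i (by simpa using hi)).2, ← (hσ j (by simpa using hj)).2, e])
      simpa using this
  subst hkl
  refine ⟨rfl, ?_⟩
  choose! σ hσ using h₂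
  have hc : ∀ i < k, ∀ j < k, chain r₁ s₁ k i j = chain r₂ s₂ k (σ i) (σ j) := fun i hi j hj => by
    rw [← a₁.cartan i hi j hj, ← (hσ i hi).2, ← (hσ j hj).2, a₂.cartan _ (hσ i hi).1 _ (hσ j hj).1]
  rcases eq_id_or_reverse (fun i hi => (hσ i hi).1) (fun i hi j hj e => by
    refine a₁.inj i hi j hj ?_
    rw [← (hσ i hi).2, ← (hσ j hj).2, e]) (fun i hi => by
    have := hc i (by omega) (i + 1) hi
    have := a₁.ne_zero
    have := a₁.inj i (by omega) (i + 1) hi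
    have : σ i ≠ σ (i + 1) := fun e => by
      have := a₁.inj i (by omega) (i + 1) hi (by
        rw [← (hσ i (by omega)).2, ← (hσ (i + 1) hi).2, e])
      omega
    grind) with h | h
  · refine Or.inl ⟨fun i hi => by rw [← (hσ i hi).2, h i hi], fun hk => ?_⟩
    have h1 := hc (k - 2) (by omega) (k - 1) (by omega)
    have h2 := hc (k - 1) (by omega) (k - 2) (by omega)
    rw [h _ (by omega), h _ (by omega)] at h1 h2
    grind
  · refine Or.inr ⟨fun i hi => by rw [← (hσ i hi).2, h i hi], fun hk => ?_, fun hk => ?_⟩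
    · have h1 := hc 0 (by omega) 1 (by omega)
      have h2 := hc 1 (by omega) 0 (by omega)
      rw [h _ (by omega), h _ (by omega)] at h1 h2
      grind
    -- For `k ≥ 3` the reversal matches the last bond of each arm, the only one that may be
    -- multiple, with the first bond of the other, which is simple.
    · have h1 := hc 0 (by omega) 1 (by omega)
      have h2 := hc 1 (by omega) 0 (by omega)
      have h3 := hc (k - 2) (by omega) (k - 1) (by omega)
      have h4 := hc (k - 1) (by omega) (k - 2) (by omega)
      rw [h _ (by omega), h _ (by omega)] at h1 h2 h3 h4
      clear h₁ hσ hc a₁ a₂ h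
      rw [show k - 1 - (k - 2) = 1 by omega, show k - 1 - (k - 1) = 0 by omega] at h3 h4
      rw [show k - 1 - 0 = k - 1 by omega, show k - 1 - 1 = k - 2 by omega] at h1 h2
      simp only [chain] at h1 h2 h3 h4
      grind

end PrimSph

namespace PrimSph

open Matrix

variable {S : Type*} {A : Matrix S S ℤ} {T T' T₁ T₁' T₂ T₂' : Set S} {c₁ c₂ : Factor}
  {M M₁ M₂ : Model} {f f₁ f₂ : ℕ → S} {k k₁ k₂ m n e a i j : ℕ} {α α₁ α₂ : ℕ → ℕ}
  {r s r₁ s₁ r₂ s₂ κ : ℤ}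

/-! ### The arms of the models -/

/-- The vertices `α 0, …, α (k - 1)` of the model form an arm. -/
structure ArmData (M : Model) (α : ℕ → ℕ) (k : ℕ) (r s : ℤ) : Prop where
  ne_zero : r ≠ 0 ∧ s ≠ 0
  mem : ∀ i < k, α i < M.rank ∧ α i ∉ M.dec
  inj : ∀ i < k, ∀ j < k, α i = α j → i = j
  entry : ∀ i < k, ∀ j < k, M.entry (α i) (α j) = chain r s k i j
  closed : ∀ j < M.rank, j ∉ M.dec → ∀ i < k, M.entry j (α i) ≠ 0 → ∃ i' < k, α i' = j

theorem ArmData.arm (d : ArmData M α k r s) (p : Part A T T' M f) :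
    Arm A T T' k r s fun i => f (α i) :=
  p.arm α k r s d.ne_zero d.mem d.inj d.entry d.closed

/-- All undecorated vertices of the model belong to the arm. -/
structure OneArm (M : Model) (α : ℕ → ℕ) (k : ℕ) (r s : ℤ) : Prop extends ArmData M α k r s where
  complete : ∀ j < M.rank, j ∉ M.dec → ∃ i < k, α i = j

theorem OneArm.mk' (hrs : r ≠ 0 ∧ s ≠ 0) (hm : ∀ i < k, α i < M.rank ∧ α i ∉ M.dec)
    (hi : ∀ i < k, ∀ j < k, α i = α j → i = j)
    (he : ∀ i < k, ∀ j < k, M.entry (α i) (α j) = chain r s k i j)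
    (hc : ∀ j < M.rank, j ∉ M.dec → ∃ i < k, α i = j) : OneArm M α k r s :=
  ⟨⟨hrs, hm, hi, he, fun j hj hd _ _ _ => hc j hj hd⟩, hc⟩

/-- Removing the decorated vertex from `c n` leaves two arms, the end vertex and a chain of type `C
(n - 2)`. Besides `d 3`, this is the only case with more than one arm. -/
theorem armData_c₀ (hn : 3 ≤ n) : ArmData (mC n) (fun _ => 0) 1 1 1 := by
  refine ⟨by simp, by grind, by grind, by grind, fun j hj hd i hi h => ⟨0, ?_⟩⟩
  grind

theorem armData_c (n : ℕ) : ArmData (mC n) (· + 2) (n - 2) 1 2 := by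
  refine ⟨by simp, by grind, by grind, by grind, fun j hj hd i hi h => ⟨j - 2, ?_⟩⟩
  grind

theorem armData_d₃ (hj : j = 1 ∨ j = 2) : ArmData (mD 3 κ) (fun _ => j) 1 1 1 := by
  refine ⟨by simp, by grind, by grind, by grind, fun j' hj' hd i hi h => ⟨0, ?_⟩⟩
  grind

theorem oneArm_a (n : ℕ) : OneArm (mA n) (· + 1) (n - 2) 1 1 := by
  refine .mk' (by simp) (by grind) (by grind) (by grind) fun j hj hd => ⟨j - 1, ?_⟩
  grind

theorem oneArm_b (n : ℕ) : OneArm (mB n κ) (· + 1) (n - 1) 2 1 := by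
  refine .mk' (by simp) (by grind) (by grind) (by grind) fun j hj hd => ⟨j - 1, ?_⟩
  grind

/-- Removing a leaf from `D 4` leaves a chain with the branch vertex in the middle; hence the
unusual enumeration. -/
theorem oneArm_d₄ : OneArm (mD 4 κ) (fun i => if i = 0 then 2 else if i = 1 then 1 else 3) 3 1 1 :=
    by
  refine .mk' (by simp) (by grind) (by grind) ?_ fun j hj hd =>
    ⟨if j = 1 then 1 else if j = 2 then 0 else 2, ?_⟩
  · intro i hi j hj
    interval_cases i <;> interval_cases j <;> rfl
  · grind

theorem oneArm_f : OneArm mF (fun i => i) 3 2 1 := by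
  refine .mk' (by simp) (by grind) (by grind) (by grind) fun j hj hd => ⟨j, ?_⟩
  grind

theorem oneArm_g : OneArm (mG κ) (fun i => i) 1 1 1 := by
  refine .mk' (by simp) (by grind) (by grind) (by grind) fun j hj hd => ⟨j, ?_⟩
  grind

theorem oneArm_b' : OneArm (mB' κ) (fun i => i) 2 1 1 := by
  refine .mk' (by simp) (by grind) (by grind) (by grind) fun j hj hd => ⟨j, ?_⟩
  grind

theorem oneArm_inh (hs : s ≠ 0) (n : ℕ) : OneArm (mI s n) (· + 1) (n - 1) 1 s := by
  refine .mk' (by simp [hs]) (by grind) (by grind) (by grind) fun j hj hd => ⟨j - 1, ?_⟩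
  grind

/-! ### Parts with common vertices -/

/-- The common vertices are undecorated. -/
theorem Glue.not_dec (g : Glue A T₁ T₁' T₂ T₂') (p : Part A T₁ T₁' M f) (hi : i < M.rank)
    (h : f i ∈ T₂) : i ∉ M.dec :=
  fun h' => g.not_mem₂ _ ((p.mem_dec_iff hi).2 h') h

/-- How the common arm of two parts is embedded into both. -/
def ArmMatch (k : ℕ) (r₁ s₁ r₂ s₂ : ℤ) (σ : ℕ → ℕ) : Prop :=
  (∀ i, σ i = i) ∧ (2 ≤ k → r₁ = r₂ ∧ s₁ = s₂) ∨
  (∀ i, σ i = k - 1 - i) ∧ 2 ≤ k ∧ (k = 2 → r₁ = s₂ ∧ s₁ = r₂) ∧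
    (3 ≤ k → r₁ = 1 ∧ s₁ = 1 ∧ r₂ = 1 ∧ s₂ = 1)

theorem ArmMatch.lt {σ : ℕ → ℕ} (h : ArmMatch k r₁ s₁ r₂ s₂ σ) {i : ℕ} (hi : i < k) :
    σ i < k ∧ σ (σ i) = i := by
  rcases h with ⟨h, -⟩ | ⟨h, -⟩ <;> rw [h, h] <;> omega

theorem ArmData.exists_match (d₁ : ArmData M₁ α₁ k₁ r₁ s₁) (d₂ : ArmData M₂ α₂ k₂ r₂ s₂)
    (g : Glue A T₁ T₁' T₂ T₂') (p₁ : Part A T₁ T₁' M₁ f₁) (p₂ : Part A T₂ T₂' M₂ f₂)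
    (hi : i < k₁) (hj : j < k₂) (h : f₁ (α₁ i) = f₂ (α₂ j)) :
    k₁ = k₂ ∧ ∃ σ, ArmMatch k₁ r₁ s₁ r₂ s₂ σ ∧ ∀ i < k₁, f₁ (α₁ i) = f₂ (α₂ (σ i)) := by
  obtain ⟨rfl, ⟨h1, h2⟩ | ⟨h1, h2, h3⟩⟩ := (d₁.arm p₁).eq_or_reverse (d₂.arm p₂) g hi hj h
  · exact ⟨rfl, fun i => i, Or.inl ⟨fun _ => rfl, h2⟩, h1⟩
  -- An arm with one vertex counts as matched by the identity, so that reversals always have length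
  -- at least 2.
  · rcases Nat.lt_or_ge k₁ 2 with hk | hk
    · refine ⟨rfl, fun i => i, Or.inl ⟨fun _ => rfl, by omega⟩, fun i hi => ?_⟩
      rw [h1 i hi, show k₁ - 1 - i = i by omega]
    · exact ⟨rfl, fun i => k₁ - 1 - i, Or.inr ⟨fun _ => rfl, hk, h2, h3⟩, h1⟩

/-- As the second part has only one arm, all common vertices lie on it, and the match of the arms
describes the whole intersection. -/
theorem OneArm.exists_match (d₁ : ArmData M₁ α₁ k₁ r₁ s₁) (d₂ : OneArm M₂ α₂ k₂ r₂ s₂)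
    (g : Glue A T₁ T₁' T₂ T₂') (p₁ : Part A T₁ T₁' M₁ f₁) (p₂ : Part A T₂ T₂' M₂ f₂)
    (hi : i < k₁) (h : f₁ (α₁ i) ∈ T₂) :
    k₁ = k₂ ∧ ∃ σ, ArmMatch k₁ r₁ s₁ r₂ s₂ σ ∧ (∀ i < k₁, f₁ (α₁ i) = f₂ (α₂ (σ i))) ∧
      ∀ i < M₁.rank, ∀ j < M₂.rank, f₁ i = f₂ j ↔ ∃ t < k₁, α₁ t = i ∧ α₂ (σ t) = j := by
  obtain ⟨j, hj, hj'⟩ := (p₂.mem _).1 h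
  have hd : ∀ j < M₂.rank, f₂ j ∈ T₁ → ∃ i < k₂, α₂ i = j := fun j hj h =>
    d₂.complete j hj (g.symm.not_dec p₂ hj h)
  obtain ⟨j, hjk, rfl⟩ := hd j hj (hj' ▸ p₁.mem_of_lt (d₁.mem i hi).1)
  obtain ⟨rfl, σ, hσ, hm⟩ := d₁.exists_match d₂.toArmData g p₁ p₂ hi hjk hj'.symm
  refine ⟨rfl, σ, hσ, hm, fun i hi j hj => ⟨fun h => ?_, ?_⟩⟩
  · obtain ⟨t, ht, rfl⟩ := hd j hj (h ▸ p₁.mem_of_lt hi)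
    have ht' := hσ.lt ht
    refine ⟨σ t, ht'.1, p₁.inj _ (d₁.mem _ ht'.1).1 _ hi ?_, by rw [ht'.2]⟩
    rw [h, hm _ ht'.1, ht'.2]
  · rintro ⟨t, ht, rfl, rfl⟩
    exact hm t ht

theorem Glue.exists_match (g : Glue A T₁ T₁' T₂ T₂') (p₁ : Part A T₁ T₁' M₁ f₁)
    (p₂ : Part A T₂ T₂' M₂ f₂) (d₁ : OneArm M₁ α₁ k₁ r₁ s₁) (d₂ : OneArm M₂ α₂ k₂ r₂ s₂) {x : S}
    (hx₁ : x ∈ T₁) (hx₂ : x ∈ T₂) :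
    k₁ = k₂ ∧ 1 ≤ k₁ ∧ ∃ σ, ArmMatch k₁ r₁ s₁ r₂ s₂ σ ∧ (∀ i < k₁, f₁ (α₁ i) = f₂ (α₂ (σ i))) ∧
      ∀ i < M₁.rank, ∀ j < M₂.rank, f₁ i = f₂ j ↔ ∃ t < k₁, α₁ t = i ∧ α₂ (σ t) = j := by
  obtain ⟨i, hi, rfl⟩ := (p₁.mem x).1 hx₁
  obtain ⟨i, hik, rfl⟩ := d₁.complete i hi (g.not_dec p₁ hi hx₂)
  obtain ⟨h, h'⟩ := d₂.exists_match d₁.toArmData g p₁ p₂ hik hx₂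
  exact ⟨h, by omega, h'⟩

/-- The types of the arms of two parts with common vertices agree. -/
theorem Glue.type_eq (g : Glue A T₁ T₁' T₂ T₂') (p₁ : Part A T₁ T₁' M₁ f₁)
    (p₂ : Part A T₂ T₂' M₂ f₂) (d₁ : OneArm M₁ α₁ k₁ r₁ s₁) (d₂ : OneArm M₂ α₂ k₂ r₂ s₂) {x : S}
    (hx₁ : x ∈ T₁) (hx₂ : x ∈ T₂) :
    k₁ = k₂ ∧ 1 ≤ k₁ ∧ (k₁ = 2 → r₁ = r₂ ∧ s₁ = s₂ ∨ r₁ = s₂ ∧ s₁ = r₂) ∧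
      (3 ≤ k₁ → r₁ = r₂ ∧ s₁ = s₂) ∧ (k₁ = 1 → f₁ (α₁ 0) = f₂ (α₂ 0)) := by
  obtain ⟨h, h', σ, ⟨hσ, ht⟩ | ⟨hσ, hk, ht, ht'⟩, hm, -⟩ := g.exists_match p₁ p₂ d₁ d₂ hx₁ hx₂
  · exact ⟨h, h', fun hk => Or.inl (ht (by omega)), fun hk => ht (by omega), fun hk => by
      rw [hm 0 (by omega), hσ]⟩
  · exact ⟨h, h', fun hk => Or.inr (ht (by omega)), fun hk => by have := ht' hk; omega, by omega⟩

theorem Glue.exists_match_c (g : Glue A T₁ T₁' T₂ T₂') (hm : 3 ≤ m) (p₁ : Part A T₁ T₁' (mC m) f₁)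
    (p₂ : Part A T₂ T₂' M₂ f₂) (d₂ : OneArm M₂ α₂ k₂ r₂ s₂) {x : S}
    (hx₁ : x ∈ T₁) (hx₂ : x ∈ T₂) :
    (k₂ = 1 ∧ f₁ 0 = f₂ (α₂ 0) ∧ ∀ i < m, ∀ j < M₂.rank, f₁ i = f₂ j ↔ i = 0 ∧ j = α₂ 0) ∨
    (m - 2 = k₂ ∧ ∃ σ, ArmMatch (m - 2) 1 2 r₂ s₂ σ ∧ (∀ i < m - 2, f₁ (i + 2) = f₂ (α₂ (σ i))) ∧
      ∀ i < m, ∀ j < M₂.rank, f₁ i = f₂ j ↔ ∃ t < m - 2, t + 2 = i ∧ α₂ (σ t) = j) := by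
  obtain ⟨i, hi, rfl⟩ := (p₁.mem x).1 hx₁
  have hd := g.not_dec p₁ hi hx₂
  rcases Nat.eq_zero_or_pos i with rfl | hi'
  · obtain ⟨h, σ, hσ, h', hC⟩ := d₂.exists_match (armData_c₀ hm) g p₁ p₂ (i := 0) (by simp) hx₂
    have h0 := (hσ.lt zero_lt_one).1
    rw [Nat.lt_one_iff] at h0
    refine Or.inl ⟨h.symm, by rw [h' 0 zero_lt_one, h0], fun i hi j hj => ?_⟩
    rw [hC i hi j hj]
    simp [h0, eq_comm]
  · obtain ⟨h, h'⟩ := d₂.exists_match (armData_c m) g p₁ p₂ (i := i - 2) (by grind) (by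
      rwa [show i - 2 + 2 = i by grind])
    exact Or.inr ⟨h, h'⟩

theorem Glue.exists_match_d₃ (g : Glue A T₁ T₁' T₂ T₂') (p₁ : Part A T₁ T₁' (mD 3 κ) f₁)
    (p₂ : Part A T₂ T₂' M₂ f₂) (d₂ : OneArm M₂ α₂ k₂ r₂ s₂) {x : S}
    (hx₁ : x ∈ T₁) (hx₂ : x ∈ T₂) :
    k₂ = 1 ∧ ∃ l, (l = 1 ∨ l = 2) ∧ f₁ l = f₂ (α₂ 0) ∧
      ∀ i < 3, ∀ j < M₂.rank, f₁ i = f₂ j ↔ i = l ∧ j = α₂ 0 := by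
  obtain ⟨l, hi, rfl⟩ := (p₁.mem x).1 hx₁
  have hd := g.not_dec p₁ hi hx₂
  have hl : l = 1 ∨ l = 2 := by grind
  obtain ⟨h, σ, hσ, h', hC⟩ := d₂.exists_match (armData_d₃ hl) g p₁ p₂ (i := 0) (by simp) hx₂
  have h0 := (hσ.lt zero_lt_one).1
  rw [Nat.lt_one_iff] at h0
  refine ⟨h.symm, l, hl, by rw [h' 0 zero_lt_one, h0], fun i hi j hj => ?_⟩
  rw [hC i hi j hj]
  simp [h0, eq_comm]

/-- The analogue of `Glue.cross_eq_zero` for overlapping parts: if there were a bond, the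
undecorated vertex would lie in the second part and the bond would already be visible in the second
model. -/
theorem Glue.entry_eq_zero (g : Glue A T₁ T₁' T₂ T₂') (p₁ : Part A T₁ T₁' M₁ f₁)
    (p₂ : Part A T₂ T₂' M₂ f₂) (hi : i < M₁.rank) (hd : i ∉ M₁.dec) (hj : j < M₂.rank)
    (h : ∀ i' < M₂.rank, f₁ i = f₂ i' → M₂.entry i' j = 0) :
    A (f₁ i) (f₂ j) = 0 ∧ A (f₂ j) (f₁ i) = 0 := by
  suffices h0 : A (f₁ i) (f₂ j) = 0 from ⟨h0, g.gcm.zero_symm _ _ h0⟩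
  by_contra hne
  obtain ⟨i', hi', h1⟩ := (p₂.mem _).1 (g.step₂ _ _ (fun h' => hd ((p₁.mem_dec_iff hi).1 h'))
    (p₂.mem_of_lt hj) hne)
  rw [← h1, p₂.cartan i' hi' j hj] at hne
  exact hne (h i' hi' h1.symm)

/-- If at most one common vertex is adjacent to the given one, only this vertex and the decorated
vertex contribute. The exact value is needed where the inequality `Glue.pairing_le` is too weak. -/
theorem Glue.pairing_single_common (g : Glue A T₁ T₁' T₂ T₂') (p₁ : Part A T₁ T₁' M₁ f₁)
    (p₂ : Part A T₂ T₂' M₂ f₂) {b : ℕ} (hb : b < M₂.rank) (hl : M₁.dec = [e]) (he : e < M₁.rank)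
    (ha : a < M₁.rank) (hj : j < M₂.rank) (haj : f₁ a = f₂ j)
    (h : ∀ i < M₁.rank, ∀ i' < M₂.rank, f₁ i = f₂ i' → i' ≠ j → M₂.entry i' b = 0) :
    pairing A M₁ f₁ (f₂ b) = M₁.weight e * A (f₁ e) (f₂ b) + M₁.weight a * M₂.entry j b := by
  have hne : e ≠ a := by
    rintro rfl
    exact g.not_dec p₁ ha (haj ▸ p₂.mem_of_lt hj) (by simp [hl])
  rw [pairing_eq_sum {e, a}, Finset.sum_pair hne, haj, p₂.cartan j hj b hb]
  · simp [he, ha]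
  · intro i hi h'
    refine (g.entry_eq_zero p₁ p₂ hi (by grind) hb fun i' hi' h1 => h i hi i' hi' h1 ?_).1
    rintro rfl
    grind [p₁.inj i hi a ha]

theorem Glue.pairing_double_common (g : Glue A T₁ T₁' T₂ T₂') (p₁ : Part A T₁ T₁' M₁ f₁)
    (p₂ : Part A T₂ T₂' M₂ f₂) {b e' : ℕ} (hb : b < M₂.rank) (hl : M₁.dec = [e, e'])
    (he : e < M₁.rank) (he' : e' < M₁.rank) (hee : e ≠ e')
    (ha : a < M₁.rank) (hj : j < M₂.rank) (haj : f₁ a = f₂ j)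
    (h : ∀ i < M₁.rank, ∀ i' < M₂.rank, f₁ i = f₂ i' → i' ≠ j → M₂.entry i' b = 0) :
    pairing A M₁ f₁ (f₂ b) = M₁.weight e * A (f₁ e) (f₂ b) + M₁.weight e' * A (f₁ e') (f₂ b) +
      M₁.weight a * M₂.entry j b := by
  have hd := g.not_dec p₁ ha (haj ▸ p₂.mem_of_lt hj)
  rw [pairing_eq_sum {e, e', a}, Finset.sum_insert (by grind), Finset.sum_pair (by grind), haj,
    p₂.cartan j hj b hb, add_assoc]
  · simp [he, he', ha]
  · intro i hi h'
    refine (g.entry_eq_zero p₁ p₂ hi (by grind) hb fun i' hi' h1 => h i hi i' hi' h1 ?_).1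
    rintro rfl
    grind [p₁.inj i hi a ha]

theorem IsModel.weight_nonneg {c : Factor} (h : IsModel M c) (i : ℕ) : 0 ≤ M.weight i := by
  cases h <;> grind

/-- The contributions of two vertices bound a pairing. -/
theorem pairing_le {x : S} (g : IsGCM A) (p : Part A T T' M f) (hx : x ∉ T)
    (hw : ∀ i, 0 ≤ M.weight i) (hi : i < M.rank) (hj : j < M.rank) (hij : i ≠ j) :
    pairing A M f x ≤ M.weight i * A (f i) x + M.weight j * A (f j) x := by
  have hneg : ∀ i < M.rank, M.weight i * A (f i) x ≤ 0 := fun i hi =>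
    mul_nonpos_of_nonneg_of_nonpos (hw i) (g.offDiag _ _ fun h => hx (h ▸ p.mem_of_lt hi))
  rw [pairing, ← Finset.sum_erase_add _ _ (Finset.mem_range.2 hi),
    ← Finset.sum_erase_add _ _ (Finset.mem_erase.2 ⟨hij.symm, Finset.mem_range.2 hj⟩)]
  have : ∑ l ∈ ((Finset.range M.rank).erase i).erase j, M.weight l * A (f l) x ≤ 0 :=
    Finset.sum_nonpos fun l hl =>
      hneg l (Finset.mem_range.1 (Finset.mem_of_mem_erase (Finset.mem_of_mem_erase hl)))
  linarith

theorem Glue.pairing_le (g : Glue A T₁ T₁' T₂ T₂') (p₁ : Part A T₁ T₁' M₁ f₁)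
    (p₂ : Part A T₂ T₂' M₂ f₂) {b : ℕ} (hb : b < M₂.rank) (hd : b ∈ M₂.dec)
    (hw : ∀ i, 0 ≤ M₁.weight i) (ha : a < M₁.rank) (hj : j < M₂.rank)
    (haj : f₁ a = f₂ j) (he : e < M₁.rank) (hea : e ≠ a) :
    pairing A M₁ f₁ (f₂ b) ≤ M₁.weight e * A (f₁ e) (f₂ b) + M₁.weight a * M₂.entry j b ∧
      A (f₁ e) (f₂ b) ≤ 0 := by
  have hx := g.not_mem₁ _ ((p₂.mem_dec_iff hb).2 hd)
  have := PrimSph.pairing_le g.gcm p₁ hx hw he ha hea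
  rw [haj, p₂.cartan j hj b hb] at this
  exact ⟨this, g.gcm.offDiag _ _ fun h => hx (h ▸ p₁.mem_of_lt he)⟩

/-- Recognising an entry of the list. The relation `C` describes the common vertices, and `η`
enumerates the vertices of the second part which are not common. -/
theorem Glue.listed_of_common (g : Glue A T₁ T₁' T₂ T₂') (p₁ : Part A T₁ T₁' M₁ f₁)
    (p₂ : Part A T₂ T₂' M₂ f₂) {C : ℕ → ℕ → Prop}
    (hC : ∀ i < M₁.rank, ∀ j < M₂.rank, f₁ i = f₂ j ↔ C i j)
    {N : ℕ} {X : Matrix (Fin N) (Fin N) ℤ} {l₁ l₂ : List ℕ}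
    (hE : IsListed (single X l₁ c₁ l₂ c₂)) (b₁ b₂ τ ρ η θ : ℕ → ℕ) (r : ℕ) (hN : N = M₁.rank + r)
    (hz : ∀ i < M₁.rank, i ∈ M₁.dec → ∀ j < M₂.rank, j ∈ M₂.dec →
      A (f₁ i) (f₂ j) = ext X (b₁ i) (b₂ j) ∧ A (f₂ j) (f₁ i) = ext X (b₂ j) (b₁ i))
    (hη : ∀ t < r, η t < M₂.rank ∧ (∀ i < M₁.rank, ¬C i (η t)) ∧ ∀ t' < r, η t = η t' → t = t')
    (hc : ∀ j < M₂.rank, ρ j < M₁.rank ∧ C (ρ j) j ∨ θ j < r ∧ η (θ j) = j)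
    (h₁ : ∀ i < M₁.rank, b₁ i < N ∧ (b₁ i ∈ l₁ ↔ i ∈ M₁.dec) ∧ b₁ i ∉ l₂)
    (h₂ : ∀ j < M₂.rank, b₂ j < N ∧ (b₂ j ∈ l₂ ↔ j ∈ M₂.dec) ∧ b₂ j ∉ l₁)
    (h₁₁ : ∀ i < M₁.rank, ∀ j < M₁.rank, ext X (b₁ i) (b₁ j) = M₁.entry i j)
    (h₂₂ : ∀ i < M₂.rank, ∀ j < M₂.rank, ext X (b₂ i) (b₂ j) = M₂.entry i j)
    (hb : ∀ i < M₁.rank, ∀ j < M₂.rank, C i j → b₁ i = b₂ j ∧ j = τ i)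
    (h₁₂ : ∀ i < M₁.rank, ¬(τ i < M₂.rank ∧ C i (τ i)) → ∀ t < r, ¬(i ∈ M₁.dec ∧ η t ∈ M₂.dec) →
      ext X (b₁ i) (b₂ (η t)) = 0 ∧ ext X (b₂ (η t)) (b₁ i) = 0) :
    Listed A T₁' c₁ T₂' c₂ := by
  refine Listed.of_cover hE g.gcm p₁.inj (r := r) (h := fun t => f₂ (η t))
    (fun i hi j hj h => (hη i hi).2.2 j hj (p₂.inj _ (hη i hi).1 _ (hη j hj).1 h))
    (fun i hi t ht h => (hη t ht).2.1 i hi ((hC i hi _ (hη t ht).1).1 h)) (fun x => ?_) hN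
    b₁ (fun t => b₂ (η t)) (fun i hi => (h₁ i hi).1) (fun t ht => (h₂ _ (hη t ht).1).1)
    (fun i hi j hj => by rw [h₁₁ i hi j hj, p₁.cartan i hi j hj])
    (fun i hi j hj => by
      rw [h₂₂ _ (hη i hi).1 _ (hη j hj).1, p₂.cartan _ (hη i hi).1 _ (hη j hj).1])
    (fun i hi t ht => ?_) (fun i hi => ?_) (fun t ht => ?_)
  · rcases g.cover x with hx | hx
    · exact Or.inl ((p₁.mem x).1 hx)
    · obtain ⟨j, hj, rfl⟩ := (p₂.mem x).1 hx
      rcases hc j hj with ⟨hi, h⟩ | ⟨ht, h⟩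
      · exact Or.inl ⟨_, hi, (hC _ hi j hj).2 h⟩
      · exact Or.inr ⟨_, ht, congrArg f₂ h⟩
  · have hj := (hη t ht).1
    -- The cross entries are read off from the second model if the first vertex is common, from `hz`
    -- if both vertices are decorated, and vanish otherwise.
    by_cases hi' : ∃ j < M₂.rank, C i j
    · obtain ⟨j, hj', h⟩ := hi'
      rw [(hC i hi j hj').2 h, (hb i hi j hj' h).1, h₂₂ _ hj' _ hj, h₂₂ _ hj _ hj',
        p₂.cartan _ hj' _ hj, p₂.cartan _ hj _ hj']
      exact ⟨rfl, rfl⟩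
    · push Not at hi'
      by_cases hd : i ∈ M₁.dec ∧ η t ∈ M₂.dec
      · exact ⟨(hz i hi hd.1 _ hj hd.2).1.symm, (hz i hi hd.1 _ hj hd.2).2.symm⟩
      · have h0 : A (f₁ i) (f₂ (η t)) = 0 ∧ A (f₂ (η t)) (f₁ i) = 0 := by
          by_cases hd₁ : i ∈ M₁.dec
          · exact (g.symm.entry_eq_zero p₂ p₁ hj (fun h => hd ⟨hd₁, h⟩) hi fun i' hi' h =>
              absurd ((hC i' hi' _ hj).1 h.symm) ((hη t ht).2.1 i' hi')).symm
          · exact g.entry_eq_zero p₁ p₂ hi hd₁ hj fun i' hi'' h =>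
              absurd ((hC i hi i' hi'').1 h) (hi' i' hi'')
        rw [h0.1, h0.2]
        exact h₁₂ i hi (fun h => hi' _ h.1 h.2) t ht hd
  · rw [p₁.mem_dec_iff hi]
    exact ⟨(h₁ i hi).2.1, iff_of_false (h₁ i hi).2.2 fun h => g.not_mem₁ _ h (p₁.mem_of_lt hi)⟩
  · have hj := (hη t ht).1
    rw [p₂.mem_dec_iff hj]
    exact ⟨iff_of_false (h₂ _ hj).2.2 fun h => g.not_mem₂ _ h (p₂.mem_of_lt hj), (h₂ _ hj).2.1⟩

/-- The case where there are no bonds between decorated vertices of the two parts. -/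
theorem Glue.listed_of_common_of_eq_zero (g : Glue A T₁ T₁' T₂ T₂') (p₁ : Part A T₁ T₁' M₁ f₁)
    (p₂ : Part A T₂ T₂' M₂ f₂) {C : ℕ → ℕ → Prop}
    (hC : ∀ i < M₁.rank, ∀ j < M₂.rank, f₁ i = f₂ j ↔ C i j)
    (hz : ∀ i ∈ M₁.dec, ∀ j ∈ M₂.dec, A (f₁ i) (f₂ j) = 0)
    {N : ℕ} {X : Matrix (Fin N) (Fin N) ℤ} {l₁ l₂ : List ℕ}
    (hE : IsListed (single X l₁ c₁ l₂ c₂)) (b₁ b₂ τ ρ η θ : ℕ → ℕ) (r : ℕ) (hN : N = M₁.rank + r)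
    (hη : ∀ t < r, η t < M₂.rank ∧ (∀ i < M₁.rank, ¬C i (η t)) ∧ ∀ t' < r, η t = η t' → t = t')
    (hc : ∀ j < M₂.rank, ρ j < M₁.rank ∧ C (ρ j) j ∨ θ j < r ∧ η (θ j) = j)
    (h₁ : ∀ i < M₁.rank, b₁ i < N ∧ (b₁ i ∈ l₁ ↔ i ∈ M₁.dec) ∧ b₁ i ∉ l₂)
    (h₂ : ∀ j < M₂.rank, b₂ j < N ∧ (b₂ j ∈ l₂ ↔ j ∈ M₂.dec) ∧ b₂ j ∉ l₁)
    (h₁₁ : ∀ i < M₁.rank, ∀ j < M₁.rank, ext X (b₁ i) (b₁ j) = M₁.entry i j)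
    (h₂₂ : ∀ i < M₂.rank, ∀ j < M₂.rank, ext X (b₂ i) (b₂ j) = M₂.entry i j)
    (hb : ∀ i < M₁.rank, ∀ j < M₂.rank, C i j → b₁ i = b₂ j ∧ j = τ i)
    (h₁₂ : ∀ i < M₁.rank, ¬(τ i < M₂.rank ∧ C i (τ i)) → ∀ t < r,
      ext X (b₁ i) (b₂ (η t)) = 0 ∧ ext X (b₂ (η t)) (b₁ i) = 0) :
    Listed A T₁' c₁ T₂' c₂ := by
  refine g.listed_of_common p₁ p₂ hC hE b₁ b₂ τ ρ η θ r hN (fun i hi hi' j hj hj' => ?_) hη hc h₁ h₂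
    h₁₁ h₂₂ hb fun i hi h t ht _ => h₁₂ i hi h t ht
  -- A decorated vertex of the second part is not common, hence enumerated by `η`; so `h₁₂` says
  -- that the entry of the list also has no bond here.
  have hne : ∀ i' < M₁.rank, ¬C i' j := fun i' hi'' h =>
    g.symm.not_dec p₂ hj (by rw [← (hC i' hi'' j hj).2 h]; exact p₁.mem_of_lt hi'') hj'
  obtain ⟨hi'', h⟩ | ⟨ht, h⟩ := hc j hj
  · exact absurd h (hne _ hi'')
  · have := h₁₂ i hi (fun h => g.not_dec p₁ hi
      (by rw [(hC i hi _ h.1).2 h.2]; exact p₂.mem_of_lt h.1) hi') (θ j) ht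
    rw [h] at this
    rw [this.1, this.2, hz i hi' j hj']
    exact ⟨rfl, g.gcm.zero_symm _ _ (hz i hi' j hj')⟩

end PrimSph

/-! ### Two homogeneous parts with common vertices -/

namespace PrimSph

open Matrix

variable {S : Type*} {A : Matrix S S ℤ} {T₁ T₁' T₂ T₂' : Set S} {c₁ c₂ : Factor}
  {M₁ M₂ : Model} {f₁ f₂ : ℕ → S} {k₁ k₂ m n a b e i j : ℕ} {α₁ α₂ : ℕ → ℕ}
  {r₁ s₁ r₂ s₂ κ₁ κ₂ V : ℤ} {x : S}

namespace HomHom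

/-- The common vertex `f₁ a = f₂ j` already contributes to the pairing of `ω₁` with the decorated
coroot at `f₂ b`, whose value must be `-V`. As no contribution is positive, little or nothing is
left for a further vertex `f₁ e`. -/
theorem bound (H : HomHom A T₁ T₁' T₂ T₂' M₁ f₁ M₂ f₂) (hV : pairing A M₂ f₂ (f₂ b) = V)
    (a j e : ℕ) (haj : f₁ a = f₂ j) (hw : ∀ i, 0 ≤ M₁.weight i) (hb : b < M₂.rank := by grind)
    (hd : b ∈ M₂.dec := by grind) (ha : a < M₁.rank := by grind) (hj : j < M₂.rank := by grind)
    (he : e < M₁.rank := by grind) (hea : e ≠ a := by grind) :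
    0 ≤ M₁.weight e * A (f₁ e) (f₂ b) + M₁.weight a * M₂.entry j b + V ∧ A (f₁ e) (f₂ b) ≤ 0 := by
  have h := H.glue.pairing_le H.part₁ H.part₂ hb hd hw ha hj haj he hea
  have := H.sum (f₂ b)
  exact ⟨by linarith, h.2⟩

theorem b_b_common (hm : 2 ≤ m) (h₁ : IsOneOrTwo c₁ κ₁) (h₂ : IsOneOrTwo c₂ κ₂)
    (H : HomHom A T₁ T₁' T₂ T₂' (mB m κ₁) f₁ (mB n κ₂) f₂) (hx₁ : x ∈ T₁) (hx₂ : x ∈ T₂) :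
    Listed A T₁' c₁ T₂' c₂ := by
  obtain ⟨hk, hk', σ, hσ, hm', hC⟩ := H.glue.exists_match H.part₁ H.part₂ (oneArm_b m)
    (oneArm_b n) hx₁ hx₂
  obtain rfl : m = n := by omega
  have hσ : ∀ i, σ i = i := by grind [ArmMatch]
  have h0 := hm' 0 (by omega)
  rw [hσ] at h0
  -- The two bounds are `κ₁ ≤ κ₂` and `κ₂ ≤ κ₁`, each with a nonpositive multiple of the unknown
  -- bond to spare.
  have hκ : c₁ = c₂ ∧ A (f₁ 0) (f₂ 0) = 0 := by
    have B := H.bound (H.part₂.pairing_b hm) 1 1 0 h0 (IsModel.b m hm c₁ κ₁ h₁).weight_nonneg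
    have B' := H.symm.bound (H.part₁.pairing_b hm) 1 1 0 h0.symm
      (IsModel.b m hm c₂ κ₂ h₂).weight_nonneg
    clear * - B B' h₁ h₂
    rcases h₁ with ⟨rfl, rfl⟩ | ⟨rfl, rfl⟩ <;> rcases h₂ with ⟨rfl, rfl⟩ | ⟨rfl, rfl⟩ <;> grind
  obtain ⟨rfl, hz⟩ := hκ
  have hC' : ∀ i < m, ∀ j < m, f₁ i = f₂ j ↔ i = j ∧ i ≠ 0 := by
    intro i hi j hj
    rw [hC i hi j hj]
    exact ⟨by grind, fun h => ⟨i - 1, by grind⟩⟩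
  rcases Nat.lt_or_ge m 3 with hm3 | hm3
  · obtain rfl : m = 2 := by omega
    rcases h₁ with ⟨rfl, -⟩ | ⟨rfl, -⟩
    · refine H.glue.listed_of_common_of_eq_zero H.part₁ H.part₂ hC' (by simp [hz])
        (.affC_c_c 2 0 le_rfl) (fun i => i) (fun i => 2 - i) (fun i => i) (fun j => j)
        (fun _ => 0) (fun _ => 0) 1 rfl ?_ ?_ ?_ ?_ ?_ ?_ ?_ ?_ <;> clear * - <;> grind
    · refine H.glue.listed_of_common_of_eq_zero H.part₁ H.part₂ hC' (by simp [hz])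
        .affC2_2b_2b (fun i => i) (fun i => 2 - i) (fun i => i) (fun j => j)
        (fun _ => 0) (fun _ => 0) 1 rfl ?_ ?_ ?_ ?_ ?_ ?_ ?_ ?_ <;> clear * - <;> grind
  · refine H.glue.listed_of_common_of_eq_zero H.part₁ H.part₂ hC' (by simp [hz])
      (.affB_b_b m c₁ hm3 (h₁.imp And.left And.left)) (fun i => if i = 0 then 0 else i + 1)
      (fun i => i + 1) (fun i => i) (fun j => j) (fun _ => 0)
        (fun _ => 0) 1 rfl ?_ ?_ ?_ ?_ ?_ ?_ ?_ ?_ <;> clear * - hm3 <;> grind (splits := 20)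

theorem b_f_common (h₁ : IsOneOrTwo c₁ κ₁)
    (H : HomHom A T₁ T₁' T₂ T₂' (mB m κ₁) f₁ (mF) f₂) (hx₁ : x ∈ T₁) (hx₂ : x ∈ T₂) :
    Listed A T₁' c₁ T₂' .one := by
  obtain ⟨hk, hk', σ, hσ, hm', hC⟩ := H.glue.exists_match H.part₁ H.part₂
    (oneArm_b m) oneArm_f hx₁ hx₂
  obtain rfl : m = 4 := by omega
  have hσ : ∀ i, σ i = i := by grind [ArmMatch]
  have h2 := hm' 2 (by omega)
  rw [hσ] at h2
  have hκ : c₁ = .one ∧ A (f₁ 0) (f₂ 3) = 0 := by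
    have B := H.bound H.part₂.pairing_f 3 2 0 h2 (IsModel.b 4 (by simp) c₁ κ₁ h₁).weight_nonneg
    rcases h₁ with ⟨rfl, rfl⟩ | ⟨rfl, rfl⟩ <;> grind
  obtain ⟨rfl, hz⟩ := hκ
  have hC' : ∀ i < 4, ∀ j < 4, f₁ i = f₂ j ↔ i = j + 1 := by
    intro i hi j hj
    rw [hC i hi j hj]
    exact ⟨by grind, fun h => ⟨j, by grind⟩⟩
  refine H.glue.listed_of_common_of_eq_zero H.part₁ H.part₂ hC' (by simp [hz])
    .affF4_b_f (fun i => i) (fun j => j + 1) (fun i => i - 1) (fun j => j + 1) (fun _ => 3)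
      (fun _ => 0) 1 rfl ?_ ?_ ?_ ?_ ?_ ?_ ?_ ?_ <;> clear * - <;> grind

theorem b'_b'_common (h₁ : IsHalfOrOne c₁ κ₁) (h₂ : IsHalfOrOne c₂ κ₂)
    (H : HomHom A T₁ T₁' T₂ T₂' (mB' κ₁) f₁ (mB' κ₂) f₂) (hx₁ : x ∈ T₁) (hx₂ : x ∈ T₂) :
    Listed A T₁' c₁ T₂' c₂ := by
  obtain ⟨-, -, σ, hσ, hm', hC⟩ := H.glue.exists_match H.part₁ H.part₂ oneArm_b' oneArm_b' hx₁ hx₂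
  have h0 := hm' 0 (by omega)
  have h1 := hm' 1 (by omega)
  -- The identity match would place the vertex of coefficient `2 κ` at the double bond in both
  -- parts, and the two bounds would read `2 κ₁ ≤ κ₂` and `2 κ₂ ≤ κ₁`.
  have hσ : ∀ i, σ i = 2 - 1 - i := by
    rcases hσ with ⟨hσ, -⟩ | ⟨hσ, -⟩
    · rw [hσ] at h1
      have B := H.bound H.part₂.pairing_b' 1 1 2 h1 (IsModel.b' c₁ κ₁ h₁).weight_nonneg
      have B' := H.symm.bound H.part₁.pairing_b' 1 1 2 h1.symm (IsModel.b' c₂ κ₂ h₂).weight_nonneg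
      clear * - B B' h₁ h₂
      rcases h₁ with ⟨rfl, rfl⟩ | ⟨rfl, rfl⟩ <;> rcases h₂ with ⟨rfl, rfl⟩ | ⟨rfl, rfl⟩ <;> grind
    · exact hσ
  rw [hσ] at h0 h1
  have hκ : c₁ = c₂ ∧ A (f₁ 2) (f₂ 2) = 0 := by
    have B := H.bound H.part₂.pairing_b' 0 1 2 h0 (IsModel.b' c₁ κ₁ h₁).weight_nonneg
    have B' := H.symm.bound H.part₁.pairing_b' 0 1 2 h1.symm (IsModel.b' c₂ κ₂ h₂).weight_nonneg
    clear * - B B' h₁ h₂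
    rcases h₁ with ⟨rfl, rfl⟩ | ⟨rfl, rfl⟩ <;> rcases h₂ with ⟨rfl, rfl⟩ | ⟨rfl, rfl⟩ <;> grind
  obtain ⟨rfl, hz⟩ := hκ
  have hC' : ∀ i < 3, ∀ j < 3, f₁ i = f₂ j ↔ i = 1 - j ∧ j ≤ 1 := by
    intro i hi j hj
    rw [hC i hi j hj]
    exact ⟨by grind, fun h => ⟨i, by grind⟩⟩
  refine H.glue.listed_of_common_of_eq_zero H.part₁ H.part₂ hC' (by simp [hz])
    (.twD4_b'_b' c₁ (h₁.symm.imp And.left And.left)) (fun i => 2 - i) (fun j => j + 1)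
    (fun i => 1 - i) (fun j => 1 - j) (fun _ => 2) (fun _ => 0) 1 rfl
    ?_ ?_ ?_ ?_ ?_ ?_ ?_ ?_ <;> clear * - <;> grind

theorem d₄_d₄_common (h₁ : IsHalfOrOne c₁ κ₁) (h₂ : IsHalfOrOne c₂ κ₂)
    (H : HomHom A T₁ T₁' T₂ T₂' (mD 4 κ₁) f₁ (mD 4 κ₂) f₂) (hx₁ : x ∈ T₁) (hx₂ : x ∈ T₂) :
    Listed A T₁' c₁ T₂' c₂ := by
  obtain ⟨-, -, σ, hσ, hm', hC⟩ := H.glue.exists_match H.part₁ H.part₂ oneArm_d₄ oneArm_d₄ hx₁ hx₂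
  have h1 : f₁ 1 = f₂ 1 := by
    have := hm' 1 (by omega)
    rcases hσ with ⟨hσ, -⟩ | ⟨hσ, -⟩ <;> simpa [hσ] using this
  have hκ : c₁ = c₂ ∧ A (f₁ 0) (f₂ 0) = 0 := by
    have B := H.bound (H.part₂.pairing_d (by simp)) 1 1 0 h1
      (IsModel.d 4 (by simp) c₁ κ₁ h₁).weight_nonneg
    have B' := H.symm.bound (H.part₁.pairing_d (by simp)) 1 1 0 h1.symm
      (IsModel.d 4 (by simp) c₂ κ₂ h₂).weight_nonneg
    clear * - B B' h₁ h₂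
    rcases h₁ with ⟨rfl, rfl⟩ | ⟨rfl, rfl⟩ <;> rcases h₂ with ⟨rfl, rfl⟩ | ⟨rfl, rfl⟩ <;> grind
  obtain ⟨rfl, hz⟩ := hκ
  -- `l` is the leaf of the second fork which is identified with leaf 2 of the first.
  obtain ⟨l, hl, hC'⟩ : ∃ l, (l = 2 ∨ l = 3) ∧ ∀ i < 4, ∀ j < 4, f₁ i = f₂ j ↔
      j ≠ 0 ∧ i = if j = 1 then 1 else if j = l then 2 else 3 := by
    rcases hσ with ⟨hσ, -⟩ | ⟨hσ, -⟩
    · refine ⟨2, by simp, fun i hi j hj => ?_⟩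
      rw [hC i hi j hj]
      simp only [hσ]
      clear * - hi hj
      decide +revert
    · refine ⟨3, by simp, fun i hi j hj => ?_⟩
      rw [hC i hi j hj]
      simp only [hσ]
      clear * - hi hj
      decide +revert
  refine H.glue.listed_of_common_of_eq_zero H.part₁ H.part₂ hC' (by simp [hz])
    (.affD_d_d 4 c₁ le_rfl (h₁.symm.imp And.left And.left)) (fun i => if i = 0 then 0 else i + 1)
    (fun j => if j ≤ 1 then j + 1 else if j = l then 3 else 4)
    (fun i => if i = 1 then 1 else if i = 2 then l else 5 - l)
    (fun j => if j = 1 then 1 else if j = l then 2 else 3) (fun _ => 0)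
      (fun _ => 0) 1 rfl ?_ ?_ ?_ ?_ ?_ ?_ ?_ ?_ <;> clear * - hl <;> grind (splits := 25)

theorem a_b_common (h₂ : IsOneOrTwo c₂ κ₂)
    (H : HomHom A T₁ T₁' T₂ T₂' (mA m) f₁ (mB n κ₂) f₂) (hx₁ : x ∈ T₁) (hx₂ : x ∈ T₂) :
    Listed A T₁' .one T₂' c₂ := by
  obtain ⟨hk, hk', σ, hσ, hm', hC⟩ := H.glue.exists_match H.part₁ H.part₂ (oneArm_a m)
    (oneArm_b n) hx₁ hx₂
  have hn2 : n = 2 ∧ m = 3 := by grind [ArmMatch]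
  obtain ⟨rfl, rfl⟩ := hn2
  have h0 := hm' 0 (by omega)
  have hσ : σ 0 = 0 := by grind [ArmMatch]
  rw [hσ] at h0
  have hκ : c₂ = .one ∧ A (f₁ 0) (f₂ 0) = 0 ∧ A (f₁ 2) (f₂ 0) = 0 := by
    have B := H.bound (H.part₂.pairing_b le_rfl) 1 1 0 h0 (by simp)
    have B₂ := H.bound (H.part₂.pairing_b le_rfl) 1 1 2 h0 (by simp)
    have B' := H.symm.bound (H.part₁.pairing_a (by simp)).1 1 1 0 h0.symm
      (IsModel.b 2 le_rfl c₂ κ₂ h₂).weight_nonneg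
    rcases h₂ with ⟨rfl, rfl⟩ | ⟨rfl, rfl⟩ <;> grind
  obtain ⟨rfl, hz, hz'⟩ := hκ
  have hC' : ∀ i < 3, ∀ j < 2, f₁ i = f₂ j ↔ i = 1 ∧ j = 1 := by
    intro i hi j hj
    rw [hC i hi j hj]
    exact ⟨by grind, fun h => ⟨0, by grind⟩⟩
  refine H.glue.listed_of_common_of_eq_zero H.part₁ H.part₂ hC' (by simp [hz, hz'])
    (.twAodd_a3_c 3 le_rfl) (fun i => if i = 0 then 0 else if i = 1 then 2 else 1) (fun j => 3 - j)
    (fun _ => 1) (fun _ => 1) (fun _ => 0) (fun _ => 0) 1 rfl ?_ ?_ ?_ ?_ ?_ ?_ ?_ ?_ <;>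
      clear * - <;> grind

/-- The equations at the ends of the chain read `2 κ₂ y - κ₂ + 2 = 0`, so that `κ₂ = 2` and the
decorated vertices are not bonded. The equation at the fork then requires `κ₂ = 1`. -/
theorem a_d₄_common (h₂ : IsHalfOrOne c₂ κ₂)
    (H : HomHom A T₁ T₁' T₂ T₂' (mA m) f₁ (mD 4 κ₂) f₂) (hx₁ : x ∈ T₁) (hx₂ : x ∈ T₂) : False := by
  obtain ⟨hk, hk', σ, hσ, hm', hC⟩ := H.glue.exists_match H.part₁ H.part₂
    (oneArm_a m) oneArm_d₄ hx₁ hx₂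
  obtain rfl : m = 5 := by omega
  obtain ⟨l, hl, h1, h2, h3⟩ : ∃ l, (l = 2 ∨ l = 3) ∧ f₁ 1 = f₂ l ∧ f₁ 2 = f₂ 1 ∧ f₁ 3 = f₂
    (5 - l) := by
    have h0 := hm' 0 (by omega)
    have h1 := hm' 1 (by omega)
    have h2 := hm' 2 (by omega)
    rcases hσ with ⟨hσ, -⟩ | ⟨hσ, -⟩ <;> rw [hσ] at h0 h1 h2
    · exact ⟨2, by simp, h0, h1, h2⟩
    · exact ⟨3, by simp, h0, h1, h2⟩
  have nd := fun i hi j hj (h : f₁ i = f₂ j) =>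
    H.glue.not_dec H.part₁ (i := i) hi (h ▸ H.part₂.mem_of_lt hj)
  have nd' := fun j hj i hi (h : f₂ j = f₁ i) =>
    H.glue.symm.not_dec H.part₂ (i := j) hj (h ▸ H.part₁.mem_of_lt hi)
  have e₁ := H.glue.pairing_double_common H.part₁ H.part₂ (b := 0) (a := 2) (by simp) rfl (by simp)
    (by simp) (by simp) (by simp) (by simp) h2 (fun i hi j hj h hne => by
      have := nd' j hj i hi h.symm
      clear * - this hne hj
      grind)
  have e₂ := H.glue.symm.pairing_single_common H.part₂ H.part₁ (b := 0) (a := l) (by simp) rfl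
    (by simp)
    (by grind) (by simp) h1.symm (fun i hi j hj h hne => by
      have := nd j hj i hi h.symm
      clear * - this hne hj
      grind)
  have e₃ := H.glue.symm.pairing_single_common H.part₂ H.part₁ (b := 4) (a := 5 - l) (by simp) rfl
    (by simp)
    (by grind) (by simp) h3.symm (fun i hi j hj h hne => by
      have := nd j hj i hi h.symm
      clear * - this hne hj
      grind)
  have s₁ := H.sum (f₂ 0)
  have s₂ := H.sum (f₁ 0)
  have s₃ := H.sum (f₁ 4)
  rw [e₁, H.part₂.pairing_d (by simp)] at s₁
  rw [e₂, (H.part₁.pairing_a (by simp)).1] at s₂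
  rw [e₃, (H.part₁.pairing_a (by simp)).2] at s₃
  have z₁ := H.glue.gcm.zero_symm (f₂ 0) (f₁ 0)
  have z₂ := H.glue.gcm.zero_symm (f₂ 0) (f₁ 4)
  clear * - s₁ s₂ s₃ z₁ z₂ hl h₂
  rcases h₂ with ⟨rfl, rfl⟩ | ⟨rfl, rfl⟩ <;> grind

/-- The double bond at the decorated vertex of `b' 3` forces `κ₂ ≥ 2`, whereas the end of the chain
adjacent to the common vertex forces `κ₂ ≤ 1`. -/
theorem a_b'_common (h₂ : IsHalfOrOne c₂ κ₂)
    (H : HomHom A T₁ T₁' T₂ T₂' (mA m) f₁ (mB' κ₂) f₂) (hx₁ : x ∈ T₁) (hx₂ : x ∈ T₂) : False := by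
  obtain ⟨hk, hk', σ, hσ, hm', hC⟩ := H.glue.exists_match H.part₁ H.part₂
    (oneArm_a m) oneArm_b' hx₁ hx₂
  obtain rfl : m = 4 := by omega
  obtain ⟨a, ha, h1⟩ : ∃ a, (a = 1 ∨ a = 2) ∧ f₁ a = f₂ 1 := by
    have h0 := hm' 0 (by omega)
    have h1 := hm' 1 (by omega)
    rcases hσ with ⟨hσ, -⟩ | ⟨hσ, -⟩ <;> rw [hσ] at h0 h1
    · exact ⟨2, by simp, h1⟩
    · exact ⟨1, by simp, h0⟩
  have B := H.bound H.part₂.pairing_b' a 1 0 h1 (by simp)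
  have B₀ := H.symm.bound (H.part₁.pairing_a (by simp)).1 1 a 2 h1.symm
    (IsModel.b' c₂ κ₂ h₂).weight_nonneg
  have B₁ := H.symm.bound (H.part₁.pairing_a (by simp)).2 1 a 2 h1.symm
    (IsModel.b' c₂ κ₂ h₂).weight_nonneg
  clear * - B B₀ B₁ h₂ ha
  rcases h₂ with ⟨rfl, rfl⟩ | ⟨rfl, rfl⟩ <;> grind

theorem a_a_common (hm : 2 ≤ m) (H : HomHom A T₁ T₁' T₂ T₂' (mA m) f₁ (mA n) f₂) (hx₁ : x ∈ T₁)
    (hx₂ : x ∈ T₂) :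
    Listed A T₁' .one T₂' .one := by
  obtain ⟨hk, hk', σ, hσ, hm', -⟩ := H.glue.exists_match H.part₁ H.part₂ (oneArm_a m)
    (oneArm_a n) hx₁ hx₂
  obtain rfl : m = n := by omega
  wlog hσ' : ∀ i < m, i = 0 ∨ i = m - 1 ∨ f₁ i = f₂ i generalizing f₂ σ
  · rcases hσ with ⟨hσ, -⟩ | ⟨hσ, -⟩
    · refine absurd (fun i hi => ?_) hσ'
      have := hm' (i - 1)
      grind
    · refine this (fun i => i) (H := H.reverse hm) (hσ := Or.inl ⟨fun _ => rfl, by simp⟩)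
        (hm' := fun i hi => ?_) (hσ' := fun i hi => ?_)
      · rw [hm' i hi, hσ]
        grind
      · have := hm' (i - 1)
        grind
  have h1 : f₁ 1 = f₂ 1 := by grind
  have h2 : f₁ (m - 2) = f₂ (m - 2) := by grind
  have hw : ∀ i, 0 ≤ (mA m).weight i := by simp
  have B₀ := H.bound (H.part₂.pairing_a hm).1 1 1 0 h1 hw
  have B₁ := H.bound (H.part₂.pairing_a hm).1 1 1 (m - 1) h1 hw
  have B₂ := H.bound (H.part₂.pairing_a hm).2 (m - 2) (m - 2) 0 h2 hw
  have B₃ := H.bound (H.part₂.pairing_a hm).2 (m - 2) (m - 2) (m - 1) h2 hw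
  have hz : A (f₁ 0) (f₂ 0) = 0 ∧ A (f₁ (m - 1)) (f₂ 0) = 0 ∧ A (f₁ 0) (f₂ (m - 1)) = 0 ∧
      A (f₁ (m - 1)) (f₂ (m - 1)) = 0 := by
    clear * - B₀ B₁ B₂ B₃ hk'
    grind
  clear B₀ B₁ B₂ B₃
  have hC' : ∀ i < m, ∀ j < m, f₁ i = f₂ j ↔ i = j ∧ i ≠ 0 ∧ i ≠ m - 1 := by
    refine fun i hi j hj => ⟨fun h => ?_, by grind⟩
    have h3 := H.glue.not_dec H.part₁ hi (h ▸ H.part₂.mem_of_lt hj)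
    have h4 := hσ' i hi
    have h5 := H.part₂.inj i hi j hj
    grind
  refine H.glue.listed_of_common_of_eq_zero H.part₁ H.part₂ hC' (by simp [hz])
    (.affD_a_a (m + 1) (by omega)) (fun i => if i = 0 then 0 else i + 1)
    (fun j => if j = m - 1 then m + 1 else j + 1) (fun i => i) (fun j => j)
    (fun t => if t = 0 then 0 else m - 1) (fun j => if j = 0 then 0 else 1) 2 rfl
    ?_ ?_ ?_ ?_ ?_ ?_ ?_ ?_ <;> clear * - hk' <;> grind (splits := 25)

end HomHom

end PrimSph

namespace PrimSph

open Matrix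

variable {S : Type*} {A : Matrix S S ℤ} {T₁ T₁' T₂ T₂' : Set S} {c₁ c₂ : Factor}
  {M₁ M₂ : Model} {f₁ f₂ : ℕ → S} {k m n a b e i i' j : ℕ} {α : ℕ → ℕ}
  {r s κ κ₁ κ₂ V : ℤ} {x : S}

/-! ### Forks -/

/-- The undecorated part of a fork is connected: one passes to the branch vertex `n - 3` and from
there to the target. -/
theorem fork_connected {P : ℕ → Prop} (hn : 5 ≤ n)
    (h : ∀ i j, 1 ≤ i → i < n → 1 ≤ j → j < n → fork n i j ≠ 0 → P j → P i) (hi : 1 ≤ i)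
      (hin : i < n)
    (hP : P i) (hj : 1 ≤ j) (hjn : j < n) : P j := by
  have up : ∀ d, i + d + 3 ≤ n → P (i + d) := by
    intro d
    induction d with
    | zero => exact fun _ => hP
    | succ d ih =>
      exact fun hd => h _ (i + d) (by omega) (by omega) (by omega) (by omega)
        (by clear * - hd hi; grind (splits := 20)) (ih (by omega))
  have hc : P (n - 3) := by
    rcases Nat.lt_or_ge (n - 3) i with hlt | hle
    · exact h _ i (by omega) (by omega) hi hin (by clear * - hlt hin hi hn; grind (splits := 20)) hP
    · have := up (n - 3 - i) (by omega)
      rwa [show i + (n - 3 - i) = n - 3 by omega] at this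
  have down : ∀ d, 1 ≤ n - 3 - d → P (n - 3 - d) := by
    intro d
    induction d with
    | zero => exact fun _ => hc
    | succ d ih =>
      exact fun hd => h _ (n - 3 - d) (by omega) (by omega) (by omega) (by omega)
        (by clear * - hd; grind (splits := 20)) (ih (by omega))
  rcases Nat.lt_or_ge (n - 3) j with hlt | hle
  · exact h _ (n - 3) hj hjn (by omega) (by omega)
      (by clear * - hlt hjn hn; grind (splits := 20)) hc
  · have := down (n - 3 - j) (by omega)
    rwa [show n - 3 - (n - 3 - j) = j by omega] at this

/-- A fork has no vertex in common with an arm. -/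
theorem Glue.not_common_fork (g : Glue A T₁ T₁' T₂ T₂') (hm : 5 ≤ m)
    (p₁ : Part A T₁ T₁' (mD m κ) f₁) (p₂ : Part A T₂ T₂' M₂ f₂) (d : ArmData M₂ α k r s)
    (hi : i < m) (hj : j < k) (h : f₁ i = f₂ (α j)) : False := by
  have a := d.arm p₂
  have hd : ∀ i < m, 1 ≤ i → f₁ i ∉ T₁' := fun i hi h1 h => by
    have := (p₁.mem_dec_iff hi).1 h
    grind
  have h1 : 1 ≤ i := by
    rcases Nat.eq_zero_or_pos i with rfl | h1
    · exact absurd ((p₁.mem_dec_iff hi).2 (by simp))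
        fun h' => g.not_mem₂ _ h' (h ▸ p₂.mem_of_lt (d.mem j hj).1)
    · exact h1
  have key : ∀ l, 1 ≤ l → l < m → ∃ t < k, f₂ (α t) = f₁ l := by
    intro l hl hlm
    refine fork_connected (P := fun l => ∃ t < k, f₂ (α t) = f₁ l) hm
      (fun l l' h1 h2 h3 h4 hne => ?_)
      h1 hi ⟨j, hj, h.symm⟩ hl hlm
    rintro ⟨t, ht, h5⟩
    refine a.mem_of_adj g.symm (p₁.mem_of_lt h2) (hd l h2 h1) ht ?_
    simp only [h5]
    rwa [p₁.cartan l h2 l' h4]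
  -- The whole undecorated fork would lie on a chain. Its branch vertex has the three undecorated
  -- neighbours `m - 4`, `m - 2`, `m - 1`, but a vertex of a chain has at most two.
  obtain ⟨t₀, ht₀, h₀⟩ := key (m - 3) (by omega) (by omega)
  have nb : ∀ l, 1 ≤ l → l < m → l ≠ m - 3 → fork m l (m - 3) ≠ 0 →
      ∃ t, f₂ (α t) = f₁ l ∧ (t = t₀ + 1 ∨ t + 1 = t₀) := by
    intro l hl hlm hne hf
    obtain ⟨t, ht, h1⟩ := key l hl hlm
    refine ⟨t, h1, ?_⟩
    have h2 := a.cartan t ht t₀ ht₀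
    simp only [h1, h₀] at h2
    rw [p₁.cartan l hlm (m - 3) (by grind)] at h2
    have h3 : t ≠ t₀ := by
      rintro rfl
      exact hne (p₁.inj l hlm (m - 3) (by grind) (h1.symm.trans h₀))
    clear * - h2 h3 hf
    grind
  obtain ⟨t₁, h₁, h₁'⟩ := nb (m - 4) (by omega) (by omega) (by omega)
    (by clear * - hm; grind (splits := 20))
  obtain ⟨t₂, h₂, h₂'⟩ := nb (m - 2) (by omega) (by omega) (by omega)
    (by clear * - hm; grind (splits := 20))
  obtain ⟨t₃, h₃, h₃'⟩ := nb (m - 1) (by omega) (by omega) (by omega)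
    (by clear * - hm; grind (splits := 20))
  have i₁ : t₁ ≠ t₂ := by
    rintro rfl
    have := p₁.inj (m - 4) (by grind) (m - 2) (by grind) (h₁.symm.trans h₂)
    omega
  have i₂ : t₁ ≠ t₃ := by
    rintro rfl
    have := p₁.inj (m - 4) (by grind) (m - 1) (by grind) (h₁.symm.trans h₃)
    omega
  have i₃ : t₂ ≠ t₃ := by
    rintro rfl
    have := p₁.inj (m - 2) (by grind) (m - 1) (by grind) (h₂.symm.trans h₃)
    omega
  omega

/-- Coincidences of vertices propagate along bonds to undecorated neighbours. -/
theorem Glue.exists_neighbour (g : Glue A T₁ T₁' T₂ T₂') (p₁ : Part A T₁ T₁' M₁ f₁)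
    (p₂ : Part A T₂ T₂' M₂ f₂) (hi : i < M₁.rank) (hd : i ∉ M₁.dec) (hi' : i' < M₁.rank)
    (hj : j < M₂.rank) (h : f₁ i' = f₂ j) (hne : M₁.entry i i' ≠ 0) :
    ∃ j' < M₂.rank, j' ∉ M₂.dec ∧ f₁ i = f₂ j' ∧ M₂.entry j' j ≠ 0 := by
  rw [← p₁.cartan i hi i' hi', h] at hne
  obtain ⟨j', hj', h'⟩ := (p₂.mem _).1
    (g.step₂ _ _ (fun h => hd ((p₁.mem_dec_iff hi).1 h)) (p₂.mem_of_lt hj) hne)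
  refine ⟨j', hj', g.symm.not_dec p₂ hj' (h' ▸ p₁.mem_of_lt hi), h'.symm, ?_⟩
  rwa [← p₂.cartan j' hj' j hj, h']

theorem Glue.forall_mem_fork (g : Glue A T₁ T₁' T₂ T₂') (hm : 5 ≤ m)
    (p₁ : Part A T₁ T₁' (mD m κ) f₁) (hi : i < m) (h : f₁ i ∈ T₂) (hj : 1 ≤ j) (hjm : j < m) :
    f₁ j ∈ T₂ := by
  have h0 : 1 ≤ i := by
    have := g.not_dec p₁ hi h
    grind
  refine fork_connected (P := fun l => f₁ l ∈ T₂) hm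
    (fun l l' h1 h2 h3 h4 hne h5 => ?_) h0 hi h hj hjm
  refine g.step₂ _ _ (fun h => ?_) h5 (by rwa [p₁.cartan l h2 l' h4])
  have := (p₁.mem_dec_iff h2).1 h
  grind

section

variable (g : Glue A T₁ T₁' T₂ T₂') (hm : 5 ≤ m) (hn : 5 ≤ n) (p₁ : Part A T₁ T₁' (mD m κ₁) f₁)
  (p₂ : Part A T₂ T₂' (mD n κ₂) f₂) (h : f₁ 1 = f₂ 1)

include g hm hn p₁ p₂ h

omit hm hn in
-- Induction along the handles: the next vertex of the first fork is a neighbour of `f₂ (i - 1)`,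
-- and by injectivity it is not one of those already passed.
theorem Glue.fork_path (hi : 1 ≤ i) (him : i + 3 ≤ m) (hin : i + 3 ≤ n) : f₁ i = f₂ i := by
  induction i using Nat.strong_induction_on with
  | _ i ih =>
  rcases hi.eq_or_lt with rfl | hi1
  · exact h
  have h1 := ih (i - 1) (by omega) (by omega) (by omega) (by omega)
  obtain ⟨j, hj, hd, h2, h3⟩ := g.exists_neighbour p₁ p₂ (i := i) (i' := i - 1) (j := i - 1)
    (by grind)
    (by grind) (by grind) (by grind) h1 (by clear * - hi1 him; grind (splits := 20))
  have h4 : j = i - 2 ∨ j = i - 1 ∨ j = i := by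
    clear * - h3 hi1 hin hj
    grind (splits := 20)
  rcases h4 with rfl | rfl | rfl
  · have h5 := ih (i - 2) (by omega) (by grind) (by omega) (by omega)
    have := p₁.inj i (by grind) (i - 2) (by grind) (h2.trans h5.symm)
    omega
  · have := p₁.inj i (by grind) (i - 1) (by grind) (h2.trans h1.symm)
    omega
  · exact h2

omit hn in
theorem Glue.fork_end : ∀ l, l = m - 2 ∨ l = m - 1 → m ≤ n →
    ∃ j < n, f₁ l = f₂ j ∧ (j = m - 2 ∨ m = n ∧ j = m - 1) := by
  intro l hl hmn
  have h1 := g.fork_path p₁ p₂ h (i := m - 3) (by omega) (by omega) (by omega)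
  have h0 := g.fork_path p₁ p₂ h (i := m - 4) (by omega) (by omega) (by omega)
  obtain ⟨j, hj, hd, h2, h3⟩ := g.exists_neighbour p₁ p₂ (i := l) (i' := m - 3) (j := m - 3)
    (by grind)
    (by grind) (by grind) (by grind) h1 (by clear * - hl hm; grind (splits := 20))
  refine ⟨j, hj, h2, ?_⟩
  have h4 : j = m - 4 ∨ j = m - 3 ∨ j = m - 2 ∨ m = n ∧ j = m - 1 := by
    clear * - h3 hm hmn hj
    grind (splits := 20)
  rcases h4 with rfl | rfl | h4
  · have := p₁.inj l (by grind) (m - 4) (by grind) (h2.trans h0.symm)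
    omega
  · have := p₁.inj l (by grind) (m - 3) (by grind) (h2.trans h1.symm)
    omega
  · exact h4

omit hn in
-- If the second handle were longer, both leaves of the first fork would have to go to the single
-- next vertex of that handle.
theorem Glue.fork_le : n ≤ m := by
  by_contra hlt
  obtain ⟨j, hj, h1, h2⟩ := g.fork_end hm p₁ p₂ h (m - 2) (by simp) (by omega)
  obtain ⟨j', hj', h1', h2'⟩ := g.fork_end hm p₁ p₂ h (m - 1) (by simp) (by omega)
  obtain rfl : j = j' := by omega
  have := p₁.inj (m - 2) (by grind) (m - 1) (by grind) (h1.trans h1'.symm)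
  omega

theorem Glue.fork_eq : m = n ∧ ∃ l, (l = m - 2 ∨ l = m - 1) ∧ ∀ i < m, ∀ j < n, f₁ i = f₂ j ↔
    j ≠ 0 ∧ i = if j + 3 ≤ m then j else if j = l then m - 2 else m - 1 := by
  obtain rfl : m = n := le_antisymm (g.symm.fork_le hn p₂ p₁ h.symm) (g.fork_le hm p₁ p₂ h)
  obtain ⟨l, hl, h1, h2⟩ := g.fork_end hm p₁ p₂ h (m - 2) (by simp) le_rfl
  obtain ⟨l', hl', h1', h2'⟩ := g.fork_end hm p₁ p₂ h (m - 1) (by simp) le_rfl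
  have hll : l ≠ l' := by
    rintro rfl
    have := p₁.inj (m - 2) (by grind) (m - 1) (by grind) (h1.trans h1'.symm)
    omega
  refine ⟨rfl, l, by omega, fun i hi j hj => ?_⟩
  have key : ∀ j < m, j ≠ 0 → f₁ (if j + 3 ≤ m then j else if j = l then m - 2 else m - 1) =
      f₂ j := by
    intro j hj hj0
    have hp := g.fork_path p₁ p₂ h (i := j)
    grind
  constructor
  · intro h3
    have hj0 : j ≠ 0 := by
      have := g.symm.not_dec p₂ hj (h3 ▸ p₁.mem_of_lt hi)
      grind
    exact ⟨hj0, p₁.inj i hi _ (by grind) (h3.trans (key j hj hj0).symm)⟩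
  · rintro ⟨hj0, rfl⟩
    exact key j hj hj0

end

theorem HomHom.d_d_common (hm : 5 ≤ m) (hn : 5 ≤ n) (h₁ : IsHalfOrOne c₁ κ₁)
    (h₂ : IsHalfOrOne c₂ κ₂)
    (H : HomHom A T₁ T₁' T₂ T₂' (mD m κ₁) f₁ (mD n κ₂) f₂) (hx₁ : x ∈ T₁) (hx₂ : x ∈ T₂) :
    Listed A T₁' c₁ T₂' c₂ := by
  obtain ⟨i, hi, rfl⟩ := (H.part₁.mem x).1 hx₁
  obtain ⟨j, hj, hij⟩ := (H.part₂.mem _).1 hx₂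
  have m₁ := fun l => H.glue.forall_mem_fork hm H.part₁ (j := l) hi hx₂
  have m₂ := fun l => H.glue.symm.forall_mem_fork hn H.part₂ (j := l) hj (hij ▸ hx₁)
  obtain ⟨a, ha, ha'⟩ := (H.part₁.mem _).1 (m₂ 1 le_rfl (by omega))
  obtain ⟨a', hb, hb'⟩ := (H.part₂.mem _).1 (m₁ 1 le_rfl (by omega))
  have nd := H.glue.not_dec H.part₁ ha (ha' ▸ H.part₂.mem_of_lt (by grind))
  have e₁ := H.glue.pairing_single_common H.part₁ H.part₂ (b := 0) (a := a) (j := 1) (by grind) rfl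
    (by grind) ha (by grind) ha' (fun i hi j hj h hne => by
      have := H.glue.symm.not_dec H.part₂ hj (h ▸ H.part₁.mem_of_lt hi)
      clear * - this hne hj hn
      grind (splits := 20))
  have e₂ := H.glue.symm.pairing_single_common H.part₂ H.part₁ (b := 0) (a := a') (j := 1)
    (by grind) rfl
    (by grind) hb (by grind) hb' (fun i hi j hj h hne => by
      have := H.glue.not_dec H.part₁ hj (h ▸ H.part₂.mem_of_lt hi)
      clear * - this hne hj hm
      grind (splits := 20))
  have s₁ := H.sum (f₂ 0)
  have s₂ := H.sum (f₁ 0)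
  rw [e₁, H.part₂.pairing_d (by omega)] at s₁
  rw [e₂, H.part₁.pairing_d (by omega)] at s₂
  have z := H.glue.gcm.zero_symm (f₁ 0) (f₂ 0)
  have z' := H.glue.gcm.zero_symm (f₂ 0) (f₁ 0)
  have n₁ := H.glue.gcm.offDiag (f₁ 0) (f₂ 0) (fun h => H.glue.not_mem₂ (f₁ 0)
    ((H.part₁.mem_dec_iff (by grind)).2 (by simp)) (h ▸ H.part₂.mem_of_lt (by grind)))
  have n₂ := H.glue.gcm.offDiag (f₂ 0) (f₁ 0) (fun h => H.glue.not_mem₂ (f₁ 0)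
    ((H.part₁.mem_dec_iff (by grind)).2 (by simp)) (h ▸ H.part₂.mem_of_lt (by grind)))
  -- Integrality of the two equations and the symmetric vanishing of the bond leave only equal
  -- factors, no bond, and a vertex `a` of coefficient `2 κ₁`, that is, not a leaf.
  have hκ : c₁ = c₂ ∧ A (f₁ 0) (f₂ 0) = 0 ∧ a + 2 < m := by
    clear * - s₁ s₂ z z' n₁ n₂ h₁ h₂ hm hn
    have x₁ : (mD n κ₂).entry 1 0 = -1 := by clear * - hn; grind (splits := 20)
    have x₂ : (mD m κ₁).entry 1 0 = -1 := by clear * - hm; grind (splits := 20)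
    rw [x₁] at s₁
    rw [x₂] at s₂
    rcases h₁ with ⟨rfl, rfl⟩ | ⟨rfl, rfl⟩ <;> rcases h₂ with ⟨rfl, rfl⟩ | ⟨rfl, rfl⟩ <;> grind
  obtain ⟨rfl, hz, ham⟩ := hκ
  -- Otherwise `a` has at least two undecorated neighbours, `a - 1` and `a + 1`. Both would have to
  -- be `f₂ 2`, the only undecorated neighbour of `f₂ 1`.
  have ha1 : a = 1 := by
    by_contra hne
    have key : ∀ l, l + 1 = a ∨ l = a + 1 → f₁ l = f₂ 2 := by
      intro l hl
      obtain ⟨j, hj, hd, h2, h3⟩ := H.glue.exists_neighbour H.part₁ H.part₂ (i := l) (i' := a)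
        (j := 1)
        (by grind) (by grind) (by grind) (by grind) ha' (by
          clear * - hl ham
          grind (splits := 20))
      have h4 : j = 1 ∨ j = 2 := by
        clear * - h3 hn hj hd
        grind (splits := 20)
      rcases h4 with rfl | rfl
      · have := H.part₁.inj l (by grind) a ha (h2.trans ha'.symm)
        omega
      · exact h2
    have := H.part₁.inj (a - 1) (by grind) (a + 1) (by grind)
      ((key (a - 1) (by grind)).trans (key (a + 1) (by simp)).symm)
    omega
  subst ha1
  obtain ⟨rfl, l, hl, hC⟩ := H.glue.fork_eq hm hn H.part₁ H.part₂ ha'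
  refine H.glue.listed_of_common_of_eq_zero H.part₁ H.part₂ hC (by simp [hz])
    (.affD_d_d m c₁ (by omega) (h₁.symm.imp And.left And.left))
      (fun i => if i = 0 then 0 else i + 1)
    (fun j => if j + 3 ≤ m then j + 1 else if j = l then m - 1 else m)
    (fun i => if i + 3 ≤ m then i else if i = m - 2 then l else 2 * m - 3 - l)
    (fun j => if j + 3 ≤ m then j else if j = l then m - 2 else m - 1)
    (fun _ => 0) (fun _ => 0) 1 rfl ?_ ?_ ?_ ?_ ?_ ?_ ?_ ?_ <;> clear * - hm hl <;>
    grind (splits := 40)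

end PrimSph

/-! ### Common arms involving `g 2`, `f 4`, `c n` and `d 3` -/

namespace PrimSph

open Matrix

variable {S : Type*} {A : Matrix S S ℤ} {T₁ T₁' T₂ T₂' : Set S} {c₁ c₂ : Factor}
  {M₁ M₂ : Model} {f₁ f₂ : ℕ → S} {k m n a b e i i' j : ℕ} {α : ℕ → ℕ}
  {r s κ κ₁ κ₂ V : ℤ} {x : S}

namespace HomHom

/-- The common vertex has coefficient at least 2 and sits at the triple bond, so it contributes `-6`
or less, which the value `2 κ₂ ≤ 4` cannot compensate. The other exclusions with `g 2` and the
models `a` and `c` work in the same way. -/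
theorem b_g_common (hm : 2 ≤ m) (h₁ : IsOneOrTwo c₁ κ₁) (h₂ : IsOneOrTwo c₂ κ₂)
    (H : HomHom A T₁ T₁' T₂ T₂' (mB m κ₁) f₁ (mG κ₂) f₂) (hx₁ : x ∈ T₁) (hx₂ : x ∈ T₂) : False := by
  have ht := H.glue.type_eq H.part₁ H.part₂ (oneArm_b m) oneArm_g hx₁ hx₂
  have B := H.bound H.part₂.pairing_g 1 0 0 (ht.2.2.2.2 (by omega))
    (IsModel.b m hm c₁ κ₁ h₁).weight_nonneg
  clear * - B h₁ h₂
  rcases h₁ with ⟨rfl, rfl⟩ | ⟨rfl, rfl⟩ <;> rcases h₂ with ⟨rfl, rfl⟩ | ⟨rfl, rfl⟩ <;> grind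

theorem f_f_common (H : HomHom A T₁ T₁' T₂ T₂' (mF) f₁ (mF) f₂) (hx₁ : x ∈ T₁) (hx₂ : x ∈ T₂) :
    False := by
  obtain ⟨-, -, σ, hσ, hm', -⟩ := H.glue.exists_match H.part₁ H.part₂ oneArm_f oneArm_f hx₁ hx₂
  have h2 := hm' 2 (by omega)
  have hσ : σ 2 = 2 := by
    clear * - hσ
    grind [ArmMatch]
  rw [hσ] at h2
  have B := H.bound H.part₂.pairing_f 2 2 3 h2 IsModel.f.weight_nonneg
  clear * - B
  grind

theorem g_g_common (h₁ : IsOneOrTwo c₁ κ₁) (h₂ : IsOneOrTwo c₂ κ₂)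
    (H : HomHom A T₁ T₁' T₂ T₂' (mG κ₁) f₁ (mG κ₂) f₂) (hx₁ : x ∈ T₁) (hx₂ : x ∈ T₂) : False := by
  have ht := (H.glue.type_eq H.part₁ H.part₂ oneArm_g oneArm_g hx₁ hx₂).2.2.2.2 rfl
  have B := H.bound H.part₂.pairing_g 0 0 1 ht (IsModel.g c₁ κ₁ h₁).weight_nonneg
  have B' := H.symm.bound H.part₁.pairing_g 0 0 1 ht.symm (IsModel.g c₂ κ₂ h₂).weight_nonneg
  clear * - B B' h₁ h₂
  rcases h₁ with ⟨rfl, rfl⟩ | ⟨rfl, rfl⟩ <;> rcases h₂ with ⟨rfl, rfl⟩ | ⟨rfl, rfl⟩ <;> grind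

theorem a_g_common (h₂ : IsOneOrTwo c₂ κ₂)
    (H : HomHom A T₁ T₁' T₂ T₂' (mA m) f₁ (mG κ₂) f₂) (hx₁ : x ∈ T₁) (hx₂ : x ∈ T₂) : False := by
  have ht := H.glue.type_eq H.part₁ H.part₂ (oneArm_a m) oneArm_g hx₁ hx₂
  have B := H.bound H.part₂.pairing_g 1 0 0 (ht.2.2.2.2 (by omega)) (by simp)
  clear * - B h₂
  rcases h₂ with ⟨rfl, rfl⟩ | ⟨rfl, rfl⟩ <;> grind

theorem c_b_common (hm : 3 ≤ m) (hn : 2 ≤ n) (h₂ : IsOneOrTwo c₂ κ₂)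
    (H : HomHom A T₁ T₁' T₂ T₂' (mC m) f₁ (mB n κ₂) f₂) (hx₁ : x ∈ T₁) (hx₂ : x ∈ T₂) :
    Listed A T₁' .one T₂' c₂ := by
  have hw := (IsModel.c m hm).weight_nonneg
  have hw' := (IsModel.b n hn c₂ κ₂ h₂).weight_nonneg
  rcases H.glue.exists_match_c hm H.part₁ H.part₂ (oneArm_b n) hx₁ hx₂ with
    ⟨hk, h0, hC'⟩ | ⟨hk, σ, hσ, hm', hC⟩
  · obtain rfl : n = 2 := by omega
    have B := H.bound (H.part₂.pairing_b hn) 0 1 1 h0 hw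
    have B' := H.symm.bound (H.part₁.pairing_c hm) 1 0 0 h0.symm hw'
    have hκ : c₂ = .one ∧ A (f₁ 1) (f₂ 0) = 0 := by
      clear * - B B' h₂ hm
      rcases h₂ with ⟨rfl, rfl⟩ | ⟨rfl, rfl⟩ <;> grind
    obtain ⟨rfl, hz⟩ := hκ
    refine H.glue.listed_of_common_of_eq_zero H.part₁ H.part₂ hC' (by simp [hz])
      (.affC_c_c m (m - 2) (by omega)) (fun i => m - 1 - i) (fun j => m - j) (fun _ => 1)
        (fun _ => 0)
      (fun _ => 0) (fun _ => 0) 1 rfl ?_ ?_ ?_ ?_ ?_ ?_ ?_ ?_ <;> clear * - hm <;>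
        grind (splits := 20)
  · rcases Nat.lt_or_ge m 4 with hm4 | hm4
    · have hmn : m = 3 ∧ n = 2 := by omega
      obtain ⟨rfl, rfl⟩ := hmn
      have h0 := hm' 0 (by omega)
      rw [Nat.lt_one_iff.1 (hσ.lt zero_lt_one).1] at h0
      have B' := H.symm.bound (H.part₁.pairing_c hm) 1 2 0 h0.symm hw'
      clear * - B' h₂
      rcases h₂ with ⟨rfl, rfl⟩ | ⟨rfl, rfl⟩ <;> grind
    -- The double bonds of `C (m - 2)` and `B (n - 1)` point in opposite directions along the arms,
    -- so they match only by reversing an arm of length 2.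
    · have hmn : m = 4 ∧ n = 3 ∧ ∀ i, σ i = 1 - i := by
        clear * - hσ hk hm4
        grind [ArmMatch]
      obtain ⟨rfl, rfl, hσ⟩ := hmn
      have h0 := hm' 0 (by omega)
      have h1 := hm' 1 (by omega)
      rw [hσ] at h0 h1
      have B := H.bound (H.part₂.pairing_b hn) 3 1 1 h1 hw
      have B' := H.symm.bound (H.part₁.pairing_c hm) 2 2 0 h0.symm hw'
      have hκ : c₂ = .one ∧ A (f₁ 1) (f₂ 0) = 0 := by
        clear * - B B' h₂
        rcases h₂ with ⟨rfl, rfl⟩ | ⟨rfl, rfl⟩ <;> grind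
      obtain ⟨rfl, hz⟩ := hκ
      have hC' : ∀ i < 4, ∀ j < 3, f₁ i = f₂ j ↔ i = 4 - j ∧ j ≠ 0 := by
        intro i hi j hj
        rw [hC i hi j hj]
        simp only [hσ]
        clear * - hi hj
        decide +revert
      refine H.glue.listed_of_common_of_eq_zero H.part₁ H.part₂ hC' (by simp [hz])
        .twE6_c_b (fun i => i) (fun j => 4 - j) (fun i => 4 - i) (fun j => 4 - j)
        (fun _ => 0) (fun _ => 0) 1 rfl ?_ ?_ ?_ ?_ ?_ ?_ ?_ ?_ <;> clear * - <;>
          grind (splits := 20)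

theorem c_g_common (hm : 3 ≤ m) (h₂ : IsOneOrTwo c₂ κ₂)
    (H : HomHom A T₁ T₁' T₂ T₂' (mC m) f₁ (mG κ₂) f₂) (hx₁ : x ∈ T₁) (hx₂ : x ∈ T₂) : False := by
  have hw := (IsModel.c m hm).weight_nonneg
  rcases H.glue.exists_match_c hm H.part₁ H.part₂ oneArm_g hx₁ hx₂ with
    ⟨-, h0, -⟩ | ⟨hk, σ, hσ, hm', -⟩
  · have B := H.bound H.part₂.pairing_g 0 0 1 h0 hw
    clear * - B h₂
    rcases h₂ with ⟨rfl, rfl⟩ | ⟨rfl, rfl⟩ <;> grind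
  · obtain rfl : m = 3 := by omega
    have h0 := hm' 0 (by omega)
    rw [Nat.lt_one_iff.1 (hσ.lt zero_lt_one).1] at h0
    have B := H.bound H.part₂.pairing_g 2 0 1 h0 hw
    clear * - B h₂
    rcases h₂ with ⟨rfl, rfl⟩ | ⟨rfl, rfl⟩ <;> grind

theorem c_a_common (hm : 3 ≤ m) (H : HomHom A T₁ T₁' T₂ T₂' (mC m) f₁ (mA n) f₂) (hx₁ : x ∈ T₁)
    (hx₂ : x ∈ T₂) :
    Listed A T₁' .one T₂' .one := by
  have hw := (IsModel.c m hm).weight_nonneg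
  rcases H.glue.exists_match_c hm H.part₁ H.part₂ (oneArm_a n) hx₁ hx₂ with
    ⟨hk, h0, hC⟩ | ⟨hk, σ, hσ, hm', hC⟩
  · obtain rfl : n = 3 := by omega
    have B := H.bound (H.part₂.pairing_a (by simp)).1 0 1 1 h0 hw
    have B' := H.bound (H.part₂.pairing_a (by simp)).2 0 1 1 h0 hw
    have hz : A (f₁ 1) (f₂ 0) = 0 ∧ A (f₁ 1) (f₂ 2) = 0 := by
      clear * - B B' hm
      grind
    have hz' := And.intro (H.glue.gcm.zero_symm _ _ hz.1) (H.glue.gcm.zero_symm _ _ hz.2)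
    have hC' : ∀ i < 3, ∀ j < m, f₂ i = f₁ j ↔ i = 1 ∧ j = 0 := by
      intro i hi j hj
      rw [eq_comm, hC j hj i hi, and_comm]
    refine (H.symm.glue.listed_of_common_of_eq_zero H.part₂ H.part₁ hC' (by simp [hz'])
      (.twAodd_a3_c (m + 1) (by omega)) (fun i => if i = 0 then 0 else if i = 1 then 2 else 1)
      (fun j => j + 2) (fun _ => 0) (fun _ => 1) (fun t => t + 1) (fun j => j - 1) (m - 1)
        (by grind)
      ?_ ?_ ?_ ?_ ?_ ?_ ?_ ?_).symm <;> clear * - hm <;> grind (splits := 25)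
  · exfalso
    have hmn : m = 3 ∧ n = 3 := by
      clear * - hσ hk hm
      grind [ArmMatch]
    obtain ⟨rfl, rfl⟩ := hmn
    have h0 := hm' 0 (by omega)
    rw [Nat.lt_one_iff.1 (hσ.lt zero_lt_one).1] at h0
    have B := H.symm.bound (H.part₁.pairing_c hm) 1 2 0 h0.symm (by simp)
    clear * - B
    grind

theorem c_c_common (hm : 3 ≤ m) (hn : 3 ≤ n) (H : HomHom A T₁ T₁' T₂ T₂' (mC m) f₁ (mC n) f₂)
    (hx₁ : x ∈ T₁) (hx₂ : x ∈ T₂) :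
    Listed A T₁' .one T₂' .one := by
  have hw := (IsModel.c m hm).weight_nonneg
  -- The arm of type `C` carries the coefficient 4, or ends in a double bond, next to the decorated
  -- vertex; in every combination involving it the contribution exceeds what the pairing allows.
  have key : ∀ i < m, ∀ j < n, f₁ i = f₂ j → i = 0 ∧ j = 0 := by
    intro i hi j hj h
    have hdi := H.glue.not_dec H.part₁ hi (h ▸ H.part₂.mem_of_lt hj)
    have hdj := H.glue.symm.not_dec H.part₂ hj (h ▸ H.part₁.mem_of_lt hi)
    have i2 : i = 0 ∨ 2 ≤ i := by grind
    have j2 : j = 0 ∨ 2 ≤ j := by grind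
    rcases i2 with rfl | i2 <;> rcases j2 with rfl | j2
    · exact ⟨rfl, rfl⟩
    · obtain ⟨hk, -⟩ := (armData_c₀ hm).exists_match (armData_c n) H.glue H.part₁ H.part₂ (i := 0)
        (j := j - 2) (by simp) (by grind) (by rwa [Nat.sub_add_cancel j2])
      have hjn : j = 2 ∧ n = 3 := by grind
      obtain ⟨rfl, rfl⟩ := hjn
      have B := H.bound (H.part₂.pairing_c hn) 0 2 1 h hw
      clear * - B hm
      grind
    · obtain ⟨hk, -⟩ := (armData_c m).exists_match (armData_c₀ hn) H.glue H.part₁ H.part₂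
        (i := i - 2)
        (j := 0) (by grind) (by simp) (by rwa [Nat.sub_add_cancel i2])
      have him : i = 2 ∧ m = 3 := by grind
      obtain ⟨rfl, rfl⟩ := him
      have B := H.symm.bound (H.part₁.pairing_c hm) 0 2 1 h.symm (IsModel.c n hn).weight_nonneg
      clear * - B hn
      grind
    · obtain ⟨hk, σ, hσ, hm'⟩ := (armData_c m).exists_match (armData_c n) H.glue H.part₁ H.part₂
        (i := i - 2) (j := j - 2) (by grind) (by grind)
        (by rwa [Nat.sub_add_cancel i2, Nat.sub_add_cancel j2])
      have h0 := hm' 0 (by omega)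
      have hσ : σ 0 = 0 := by
        clear * - hσ hk
        grind [ArmMatch]
      rw [hσ] at h0
      have B := H.bound (H.part₂.pairing_c hn) 2 2 1 h0 hw
      clear * - B hm hn hk
      grind
  obtain ⟨i, hi, rfl⟩ := (H.part₁.mem x).1 hx₁
  obtain ⟨j, hj, hij⟩ := (H.part₂.mem _).1 hx₂
  obtain ⟨rfl, rfl⟩ := key i hi j hj hij.symm
  have B := H.bound (H.part₂.pairing_c hn) 0 0 1 hij.symm hw
  have hz : A (f₁ 1) (f₂ 1) = 0 := by
    clear * - B hm hn
    grind
  have hC' : ∀ i < m, ∀ j < n, f₁ i = f₂ j ↔ i = 0 ∧ j = 0 :=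
    fun i hi j hj => ⟨key i hi j hj, by rintro ⟨rfl, rfl⟩; exact hij.symm⟩
  refine H.glue.listed_of_common_of_eq_zero H.part₁ H.part₂ hC' (by simp [hz])
    (.affC_c_c (m + n - 2) (m - 2) (by omega)) (fun i => m - 1 - i) (fun j => m - 1 + j)
    (fun _ => 0) (fun _ => 0) (fun t => t + 1) (fun j => j - 1) (n - 1)
      (by grind) ?_ ?_ ?_ ?_ ?_ ?_ ?_ ?_ <;>
    clear * - hm hn <;> grind (splits := 20)

theorem d₃_a_common (h₁ : IsHalfOrOne c₁ κ₁)
    (H : HomHom A T₁ T₁' T₂ T₂' (mD 3 κ₁) f₁ (mA n) f₂) (hx₁ : x ∈ T₁) (hx₂ : x ∈ T₂) : False := by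
  obtain ⟨hk, l, hl, h0, hC⟩ := H.glue.exists_match_d₃ H.part₁ H.part₂ (oneArm_a n) hx₁ hx₂
  obtain rfl : n = 3 := by omega
  have e₁ := H.glue.pairing_single_common H.part₁ H.part₂ (b := 0) (by simp) rfl (by simp)
    (by grind)
    (by simp) h0 (fun i hi j hj h hne => absurd ((hC i hi j hj).1 h).2 hne)
  have e₂ := H.glue.pairing_single_common H.part₁ H.part₂ (b := 2) (by simp) rfl (by simp)
    (by grind)
    (by simp) h0 (fun i hi j hj h hne => absurd ((hC i hi j hj).1 h).2 hne)
  have e₃ := H.symm.glue.pairing_double_common H.part₂ H.part₁ (b := 0) (by simp) rfl (by simp)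
    (by simp)
    (by simp) (by simp) (by grind) h0.symm
      (fun i hi j hj h hne => absurd ((hC j hj i hi).1 h.symm).1 hne)
  have s₁ := H.sum (f₂ 0)
  have s₂ := H.sum (f₂ 2)
  have s₃ := H.sum (f₁ 0)
  rw [e₁, (H.part₂.pairing_a (by simp)).1] at s₁
  rw [e₂, (H.part₂.pairing_a (by simp)).2] at s₂
  rw [e₃, H.part₁.pairing_d le_rfl] at s₃
  have z₁ := H.glue.gcm.zero_symm (f₁ 0) (f₂ 0)
  have z₂ := H.glue.gcm.zero_symm (f₁ 0) (f₂ 2)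
  clear * - s₁ s₂ s₃ z₁ z₂ hl h₁
  rcases h₁ with ⟨rfl, rfl⟩ | ⟨rfl, rfl⟩ <;> grind

theorem d₃_b_common (hn : 2 ≤ n) (h₁ : IsHalfOrOne c₁ κ₁) (h₂ : IsOneOrTwo c₂ κ₂)
    (H : HomHom A T₁ T₁' T₂ T₂' (mD 3 κ₁) f₁ (mB n κ₂) f₂) (hx₁ : x ∈ T₁) (hx₂ : x ∈ T₂) : False :=
      by
  obtain ⟨hk, l, hl, h0, hC⟩ := H.glue.exists_match_d₃ H.part₁ H.part₂ (oneArm_b n) hx₁ hx₂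
  obtain rfl : n = 2 := by omega
  have e₁ := H.glue.pairing_single_common H.part₁ H.part₂ (b := 0) (by simp) rfl (by simp)
    (by grind)
    (by simp) h0 (fun i hi j hj h hne => absurd ((hC i hi j hj).1 h).2 hne)
  have e₂ := H.symm.glue.pairing_single_common H.part₂ H.part₁ (b := 0) (by simp) rfl (by simp)
    (by simp) (by grind) h0.symm (fun i hi j hj h hne => absurd ((hC j hj i hi).1 h.symm).1 hne)
  have s₁ := H.sum (f₂ 0)
  have s₂ := H.sum (f₁ 0)
  rw [e₁, H.part₂.pairing_b hn] at s₁
  rw [e₂, H.part₁.pairing_d le_rfl] at s₂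
  have z₁ := H.glue.gcm.zero_symm (f₁ 0) (f₂ 0)
  clear * - s₁ s₂ z₁ hl h₁ h₂
  rcases h₁ with ⟨rfl, rfl⟩ | ⟨rfl, rfl⟩ <;> rcases h₂ with ⟨rfl, rfl⟩ | ⟨rfl, rfl⟩ <;> grind

theorem d₃_g_common (h₁ : IsHalfOrOne c₁ κ₁) (h₂ : IsOneOrTwo c₂ κ₂)
    (H : HomHom A T₁ T₁' T₂ T₂' (mD 3 κ₁) f₁ (mG κ₂) f₂) (hx₁ : x ∈ T₁) (hx₂ : x ∈ T₂) : False := by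
  obtain ⟨hk, l, hl, h0, hC⟩ := H.glue.exists_match_d₃ H.part₁ H.part₂ oneArm_g hx₁ hx₂
  have e₁ := H.glue.pairing_single_common H.part₁ H.part₂ (b := 1) (by simp) rfl (by simp)
    (by grind)
    (by simp) h0 (fun i hi j hj h hne => absurd ((hC i hi j hj).1 h).2 hne)
  have s₁ := H.sum (f₂ 1)
  rw [e₁, H.part₂.pairing_g] at s₁
  have B := H.bound H.part₂.pairing_g l 0 0 h0 (IsModel.d 3 le_rfl c₁ κ₁ h₁).weight_nonneg
  clear * - s₁ B hl h₁ h₂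
  rcases h₁ with ⟨rfl, rfl⟩ | ⟨rfl, rfl⟩ <;> rcases h₂ with ⟨rfl, rfl⟩ | ⟨rfl, rfl⟩ <;> grind

/-- Both outer vertices of `d 3` may be common, each as an arm of its own; so all three terms are
kept. -/
theorem pairing_d₃ (y : S) : pairing A (mD 3 κ) f₁ y =
    2 * κ * A (f₁ 0) y + κ * A (f₁ 1) y + κ * A (f₁ 2) y := by
  simp [pairing, Finset.sum_range_succ]

theorem d₃_d₃_common (h₁ : IsHalfOrOne c₁ κ₁) (h₂ : IsHalfOrOne c₂ κ₂)
    (H : HomHom A T₁ T₁' T₂ T₂' (mD 3 κ₁) f₁ (mD 3 κ₂) f₂) (hx₁ : x ∈ T₁) (hx₂ : x ∈ T₂) :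
    Listed A T₁' c₁ T₂' c₂ := by
  have nd := fun i hi j hj (h : f₁ i = f₂ j) =>
    H.glue.not_dec H.part₁ (i := i) hi (h ▸ H.part₂.mem_of_lt hj)
  have nd' := fun j hj i hi (h : f₂ j = f₁ i) =>
    H.glue.symm.not_dec H.part₂ (i := j) hj (h ▸ H.part₁.mem_of_lt hi)
  obtain ⟨a, ha, rfl⟩ := (H.part₁.mem x).1 hx₁
  obtain ⟨l, hl, hal⟩ := (H.part₂.mem _).1 hx₂
  have ha' : a = 1 ∨ a = 2 := by
    have := nd a ha l hl hal.symm
    clear * - this ha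
    grind
  have hl' : l = 1 ∨ l = 2 := by
    have := nd' l hl a ha hal
    clear * - this hl
    grind
  have s₁ := H.sum (f₂ 0)
  have s₂ := H.sum (f₁ 0)
  rw [H.part₂.pairing_d le_rfl, pairing_d₃] at s₁
  rw [H.part₁.pairing_d le_rfl, pairing_d₃] at s₂
  have v₁ : A (f₁ a) (f₂ 0) = -1 := by
    rw [← hal, H.part₂.cartan l hl 0 (by simp)]
    clear * - hl'
    grind
  have v₂ : A (f₂ l) (f₁ 0) = -1 := by
    rw [hal, H.part₁.cartan a ha 0 (by simp)]
    clear * - ha'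
    grind
  have n₁ := H.glue.gcm.offDiag (f₁ 0) (f₂ 0) (fun h => nd 0 (by simp) 0 (by simp) h (by simp))
  have n₂ := H.glue.gcm.offDiag (f₂ 0) (f₁ 0) (fun h => nd 0 (by simp) 0 (by simp) h.symm (by simp))
  have z := H.glue.gcm.zero_symm (f₁ 0) (f₂ 0)
  -- If the other outer vertices coincide too, the diagram is a 4-cycle. If only one outer vertex is
  -- common, the two equations have no simultaneous integral solution.
  by_cases hc : f₁ (3 - a) = f₂ (3 - l)
  · have w₁ : A (f₁ (3 - a)) (f₂ 0) = -1 := by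
      rw [hc, H.part₂.cartan _ (by grind) 0 (by simp)]
      clear * - hl'
      grind
    have w₂ : A (f₂ (3 - l)) (f₁ 0) = -1 := by
      rw [← hc, H.part₁.cartan _ (by grind) 0 (by simp)]
      clear * - ha'
      grind
    have hκ : c₁ = c₂ ∧ A (f₁ 0) (f₂ 0) = 0 := by
      clear * - s₁ s₂ v₁ v₂ w₁ w₂ n₁ n₂ h₁ h₂ ha' hl'
      rcases h₁ with ⟨rfl, rfl⟩ | ⟨rfl, rfl⟩ <;> rcases h₂ with ⟨rfl, rfl⟩ | ⟨rfl, rfl⟩ <;> grind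
    obtain ⟨rfl, hz⟩ := hκ
    have hC' : ∀ i < 3, ∀ j < 3, f₁ i = f₂ j ↔ j ≠ 0 ∧ i = if j = l then a else 3 - a := by
      intro i hi j hj
      have key : ∀ j, j ≠ 0 → j < 3 → f₁ (if j = l then a else 3 - a) = f₂ j := by
        clear * - hal hc ha' hl'
        grind
      refine ⟨fun h => ?_, by rintro ⟨h0, rfl⟩; exact key j h0 hj⟩
      have h0 : j ≠ 0 := by
        have := nd' j hj i hi h.symm
        clear * - this
        grind
      exact ⟨h0, H.part₁.inj i hi _ (by grind) (h.trans (key j h0 hj).symm)⟩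
    refine H.glue.listed_of_common_of_eq_zero H.part₁ H.part₂ hC' (by simp [hz])
      (.affA3_d3_d3 c₁ (h₁.symm.imp And.left And.left))
        (fun i => if i = 0 then 0 else if i = a then 1 else 3)
      (fun j => if j = 0 then 2 else if j = l then 1 else 3) (fun i => if i = a then l else 3 - l)
      (fun j => if j = l then a else 3 - a) (fun _ => 0)
        (fun _ => 0) 1 rfl ?_ ?_ ?_ ?_ ?_ ?_ ?_ ?_ <;>
      clear * - ha' hl' <;> grind (splits := 30)
  · exfalso
    have w₁ : A (f₁ (3 - a)) (f₂ 0) = 0 := by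
      refine (H.glue.entry_eq_zero H.part₁ H.part₂ (by grind) (by grind) (by simp)
        fun j hj h => ?_).1
      have := nd' j hj _ (by grind) h.symm
      have := H.part₁.inj a ha (3 - a) (by grind)
      clear * - hc h hj this hal ha' hl' nd'
      grind
    have w₂ : A (f₂ (3 - l)) (f₁ 0) = 0 := by
      refine (H.symm.glue.entry_eq_zero H.part₂ H.part₁ (by grind) (by grind) (by simp)
        fun j hj h => ?_).1
      have := nd j hj _ (by grind) h.symm
      have := H.part₂.inj l hl (3 - l) (by grind)
      clear * - hc h hj this hal ha' hl' nd
      grind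
    clear * - s₁ s₂ v₁ v₂ w₁ w₂ n₁ n₂ z h₁ h₂ ha' hl'
    rcases h₁ with ⟨rfl, rfl⟩ | ⟨rfl, rfl⟩ <;> rcases h₂ with ⟨rfl, rfl⟩ | ⟨rfl, rfl⟩ <;> grind

end HomHom

end PrimSph

/-! ### Exhaustion of the pairs of homogeneous models with common vertices -/

namespace PrimSph

open Matrix

variable {S : Type*} {A : Matrix S S ℤ} {T₁ T₁' T₂ T₂' : Set S} {c₁ c₂ : Factor}
  {M₁ M₂ : Model} {f₁ f₂ : ℕ → S} {k k₂ m n a i j : ℕ} {α α₂ : ℕ → ℕ}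
  {r s r₂ s₂ κ κ₁ κ₂ : ℤ} {x : S}

namespace HomHom

theorem d₃_c_common (hn : 3 ≤ n) (h₁ : IsHalfOrOne c₁ κ₁)
    (H : HomHom A T₁ T₁' T₂ T₂' (mD 3 κ₁) f₁ (mC n) f₂) (hx₁ : x ∈ T₁) (hx₂ : x ∈ T₂) :
    Listed A T₁' c₁ T₂' .one := by
  have hw := (IsModel.d 3 le_rfl c₁ κ₁ h₁).weight_nonneg
  have hw' := (IsModel.c n hn).weight_nonneg
  have key : ∀ i < 3, ∀ j < n, f₁ i = f₂ j → (i = 1 ∨ i = 2) ∧ (j = 0 ∨ j = 2 ∧ n = 3 ∧ κ₁ = 1) :=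
    by
    intro i hi j hj h
    have hi' : i = 1 ∨ i = 2 := by
      have := H.glue.not_dec H.part₁ hi (h ▸ H.part₂.mem_of_lt hj)
      grind
    have hdj := H.glue.symm.not_dec H.part₂ hj (h ▸ H.part₁.mem_of_lt hi)
    have j2 : j = 0 ∨ 2 ≤ j := by grind
    refine ⟨hi', j2.imp_right fun j2 => ?_⟩
    obtain ⟨hk, -⟩ := (armData_d₃ hi').exists_match (armData_c n) H.glue H.part₁ H.part₂ (i := 0)
      (j := j - 2) (by simp) (by grind) (by rwa [Nat.sub_add_cancel j2])
    have hjn : j = 2 ∧ n = 3 := by omega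
    obtain ⟨rfl, rfl⟩ := hjn
    have B := H.bound (H.part₂.pairing_c hn) i 2 0 h hw
    clear * - B hi' h₁
    rcases h₁ with ⟨rfl, rfl⟩ | ⟨rfl, rfl⟩ <;> grind
  have s₁ := H.sum (f₂ 1)
  rw [H.part₂.pairing_c hn, pairing_d₃] at s₁
  have val : ∀ i, (i = 1 ∨ i = 2) → A (f₁ i) (f₂ 1) = 0 ∨ f₁ i = f₂ 0 ∧ A (f₁ i) (f₂ 1) = -1 ∨
      f₁ i = f₂ 2 ∧ n = 3 ∧ κ₁ = 1 ∧ A (f₁ i) (f₂ 1) = -2 := by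
    intro i hi
    by_cases h : f₁ i ∈ T₂
    · obtain ⟨j, hj, h⟩ := (H.part₂.mem _).1 h
      right
      rcases (key i (by grind) j hj h.symm).2 with rfl | ⟨rfl, rfl, h3⟩
      · left
        rw [← h, H.part₂.cartan 0 hj 1 (by grind)]
        clear * - hn
        grind
      · right
        rw [← h, H.part₂.cartan 2 hj 1 (by grind)]
        exact ⟨rfl, rfl, h3, rfl⟩
    · left
      refine (H.glue.entry_eq_zero H.part₁ H.part₂ (by grind) (by grind) (by grind)
        fun j hj h' => ?_).1
      exact absurd (h' ▸ H.part₂.mem_of_lt hj) h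
  -- If an outer vertex were the end vertex of `C n`, integrality of the equation at `f₂ 1` would
  -- give `κ₁ = 2` and no further contribution. The equation at `f₁ 0` would then have only the
  -- terms `-2` and `4`.
  have notX : ∀ a, (a = 1 ∨ a = 2) → f₁ a ≠ f₂ 0 := by
    intro a ha h
    have v := val (3 - a) (by omega)
    have hne : f₁ (3 - a) ≠ f₂ 0 := fun h' => by
      have := H.part₁.inj a (by grind) (3 - a) (by grind) (h.trans h'.symm)
      omega
    have va : A (f₁ a) (f₂ 1) = -1 := by
      rw [h, H.part₂.cartan 0 (by grind) 1 (by grind)]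
      clear * - hn
      grind
    have h0 : A (f₁ (3 - a)) (f₂ 1) = 0 ∧ κ₁ = 2 ∧ A (f₁ 0) (f₂ 1) = 0 := by
      clear * - v hne va s₁ ha h₁
      rcases h₁ with ⟨rfl, rfl⟩ | ⟨rfl, rfl⟩ <;> grind
    have h0' : ∀ j < n, f₁ (3 - a) ≠ f₂ j := by
      intro j hj h'
      have := (key _ (by grind) j hj h').2
      have := h0.2.1
      grind
    have e₂ := H.symm.glue.pairing_single_common H.part₂ H.part₁ (b := 0) (by simp) rfl (by grind)
      (by grind) (by grind) h.symm (fun i hi j hj h' hne => by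
        have := (key j hj i hi h'.symm).1
        have h3 : j = 3 - a := by omega
        exact absurd (h3 ▸ h'.symm) (h0' i hi))
    have s₂ := H.sum (f₁ 0)
    rw [H.part₁.pairing_d le_rfl, e₂, H.glue.gcm.zero_symm _ _ h0.2.2, h0.2.1] at s₂
    clear * - s₂ ha hn
    grind
  obtain ⟨l, hl, rfl⟩ := (H.part₁.mem x).1 hx₁
  obtain ⟨j, hj, hj'⟩ := (H.part₂.mem _).1 hx₂
  obtain ⟨hl', hj2⟩ := key l hl j hj hj'.symm
  rcases hj2 with rfl | ⟨rfl, rfl, hκ⟩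
  · exact absurd hj'.symm (notX l hl')
  have hκ' : c₁ = .half := by
    clear * - h₁ hκ
    grind
  subst hκ hκ'
  have hC' : ∀ i < 3, ∀ j < 3, f₁ i = f₂ j ↔ i = l ∧ j = 2 := by
    refine fun i hi j hj => ⟨fun h => ?_, by rintro ⟨rfl, rfl⟩; exact hj'.symm⟩
    obtain ⟨h1, rfl | ⟨rfl, -⟩⟩ := key i hi j hj h
    · exact absurd h (notX i h1)
    · exact ⟨H.part₁.inj i hi l hl (h.trans hj'), rfl⟩
  have B := H.bound (H.part₂.pairing_c hn) l 2 0 hj'.symm hw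
  have hz : A (f₁ 0) (f₂ 1) = 0 := by
    clear * - B hl'
    grind
  refine H.glue.listed_of_common_of_eq_zero H.part₁ H.part₂ hC' (by simp [hz])
    .affF4_hd3_c (fun i => if i = 0 then 1 else if i = l then 2 else 0) (fun j => 4 - j)
    (fun _ => 2) (fun _ => l) (fun t => t) (fun j => j) 2 rfl ?_ ?_ ?_ ?_ ?_ ?_ ?_ ?_ <;>
    clear * - hl' <;> grind (splits := 25)

/-- Since `k₂ ≥ 2`, the common arm would be `C (m - 2)` with its multiple last bond; the assumption
`hr` excludes such a bond in both directions. -/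
theorem not_common_c (hm : 3 ≤ m) (H : HomHom A T₁ T₁' T₂ T₂' (mC m) f₁ M₂ f₂)
    (d₂ : OneArm M₂ α₂ k₂ r₂ s₂)
    (hk : 2 ≤ k₂) (hr : r₂ = s₂ ∨ 3 ≤ k₂ ∧ s₂ = 1) (hx₁ : x ∈ T₁) (hx₂ : x ∈ T₂) : False := by
  rcases H.glue.exists_match_c hm H.part₁ H.part₂ d₂ hx₁ hx₂ with ⟨hk', -⟩ | ⟨hk', σ, hσ, -⟩
  · omega
  · rcases hσ with ⟨-, hσ⟩ | ⟨-, -, h1, h2⟩ <;> omega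

theorem not_common_d₃ (H : HomHom A T₁ T₁' T₂ T₂' (mD 3 κ) f₁ M₂ f₂) (d₂ : OneArm M₂ α₂ k₂ r₂ s₂)
    (hk : k₂ ≠ 1) (hx₁ : x ∈ T₁) (hx₂ : x ∈ T₂) : False :=
  hk (H.glue.exists_match_d₃ H.part₁ H.part₂ d₂ hx₁ hx₂).1

end HomHom

/-- The models having undecorated vertices, all components of which are chains. -/
inductive HasArm : Model → Factor → Prop
  | d₃ (c : Factor) (κ : ℤ) (hc : IsHalfOrOne c κ) : HasArm (mD 3 κ) c
  | c (n : ℕ) (h : 3 ≤ n) : HasArm (mC n) .one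
  | a (n : ℕ) (h : 3 ≤ n) : HasArm (mA n) .one
  | b (n : ℕ) (h : 2 ≤ n) (c : Factor) (κ : ℤ) (hc : IsOneOrTwo c κ) : HasArm (mB n κ) c
  | d₄ (c : Factor) (κ : ℤ) (hc : IsHalfOrOne c κ) : HasArm (mD 4 κ) c
  | f : HasArm mF .one
  | g (c : Factor) (κ : ℤ) (hc : IsOneOrTwo c κ) : HasArm (mG κ) c
  | b' (c : Factor) (κ : ℤ) (hc : IsHalfOrOne c κ) : HasArm (mB' κ) c

theorem HasArm.exists_arm {c : Factor} (h : HasArm M₁ c) (hi : i < M₁.rank) (hd : i ∉ M₁.dec) :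
    ∃ α k r s, ArmData M₁ α k r s ∧ ∃ t < k, α t = i := by
  have one : ∀ {α k r s}, OneArm M₁ α k r s → ∃ α k r s, ArmData M₁ α k r s ∧ ∃ t < k, α t = i :=
    fun o => ⟨_, _, _, _, o.toArmData, o.complete i hi hd⟩
  cases h with
  | d₃ => exact ⟨_, _, _, _, armData_d₃ (j := i) (by grind), 0, by simp⟩
  | c n hn =>
    rcases Nat.eq_zero_or_pos i with rfl | h0
    · exact ⟨_, _, _, _, armData_c₀ hn, 0, by simp⟩
    · exact ⟨_, _, _, _, armData_c n, i - 2, by grind⟩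
  | a n => exact one (oneArm_a n)
  | b n => exact one (oneArm_b n)
  | d₄ => exact one oneArm_d₄
  | f => exact one oneArm_f
  | g => exact one oneArm_g
  | b' => exact one oneArm_b'

/-- A model of which a part has vertices in common with another part. -/
theorem IsModel.hasArm_or_fork {c : Factor} (h : IsModel M₁ c) (hc : c ≠ .inh) (hi : i < M₁.rank)
    (hd : i ∉ M₁.dec) :
    HasArm M₁ c ∨ ∃ n κ, 5 ≤ n ∧ M₁ = mD n κ ∧ IsHalfOrOne c κ := by
  cases h with
  | point => grind
  | a n h => exact Or.inl (.a n (by grind))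
  | b n h c k hc => exact Or.inl (.b n h c k hc)
  | c n h => exact Or.inl (.c n h)
  | d n h c k hc =>
    have hn : n = 3 ∨ n = 4 ∨ 5 ≤ n := by omega
    rcases hn with rfl | rfl | hn
    · exact Or.inl (.d₃ c k hc)
    · exact Or.inl (.d₄ c k hc)
    · exact Or.inr ⟨n, k, hn, rfl, hc⟩
  | dd => grind
  | f => exact Or.inl .f
  | g c k h => exact Or.inl (.g c k h)
  | b' c k h => exact Or.inl (.b' c k h)
  | aa => exact absurd rfl hc
  | cc => exact absurd rfl hc

namespace HomHom

variable (hx₁ : x ∈ T₁) (hx₂ : x ∈ T₂)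

include hx₁ hx₂

theorem d₃_common (h₁ : IsHalfOrOne c₁ κ₁) (H : HomHom A T₁ T₁' T₂ T₂' (mD 3 κ₁) f₁ M₂ f₂)
    (h₂ : HasArm M₂ c₂) : Listed A T₁' c₁ T₂' c₂ := by
  cases h₂ with
  | d₃ c κ h => exact d₃_d₃_common h₁ h H hx₁ hx₂
  | c n hn => exact d₃_c_common hn h₁ H hx₁ hx₂
  | a n hn => exact (d₃_a_common h₁ H hx₁ hx₂).elim
  | b n hn c κ h => exact (d₃_b_common hn h₁ h H hx₁ hx₂).elim
  | d₄ => exact (not_common_d₃ H oneArm_d₄ (by simp) hx₁ hx₂).elim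
  | f => exact (not_common_d₃ H oneArm_f (by simp) hx₁ hx₂).elim
  | g c κ h => exact (d₃_g_common h₁ h H hx₁ hx₂).elim
  | b' => exact (not_common_d₃ H oneArm_b' (by simp) hx₁ hx₂).elim

theorem c_common (hm : 3 ≤ m) (H : HomHom A T₁ T₁' T₂ T₂' (mC m) f₁ M₂ f₂)
    (h₂ : HasArm M₂ c₂) : Listed A T₁' .one T₂' c₂ := by
  cases h₂ with
  | d₃ c κ h => exact (d₃_common hx₂ hx₁ h H.symm (.c m hm)).symm
  | c n hn => exact c_c_common hm hn H hx₁ hx₂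
  | a n hn => exact c_a_common hm H hx₁ hx₂
  | b n hn c κ h => exact c_b_common hm hn h H hx₁ hx₂
  | d₄ => exact (not_common_c hm H oneArm_d₄ (by simp) (by simp) hx₁ hx₂).elim
  | f => exact (not_common_c hm H oneArm_f (by simp) (by simp) hx₁ hx₂).elim
  | g c κ h => exact (c_g_common hm h H hx₁ hx₂).elim
  | b' => exact (not_common_c hm H oneArm_b' (by simp) (by simp) hx₁ hx₂).elim

theorem a_common (hm : 3 ≤ m) (H : HomHom A T₁ T₁' T₂ T₂' (mA m) f₁ M₂ f₂)
    (h₂ : HasArm M₂ c₂) : Listed A T₁' .one T₂' c₂ := by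
  cases h₂ with
  | d₃ c κ h => exact (d₃_common hx₂ hx₁ h H.symm (.a m hm)).symm
  | c n hn => exact (c_common hx₂ hx₁ hn H.symm (.a m hm)).symm
  | a n hn => exact a_a_common (by omega) H hx₁ hx₂
  | b n hn c κ h => exact a_b_common h H hx₁ hx₂
  | d₄ c κ h => exact (a_d₄_common h H hx₁ hx₂).elim
  | f =>
    have := H.glue.type_eq H.part₁ H.part₂ (oneArm_a m) oneArm_f hx₁ hx₂
    omega
  | g c κ h => exact (a_g_common h H hx₁ hx₂).elim
  | b' c κ h => exact (a_b'_common h H hx₁ hx₂).elim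

theorem b_common (hm : 2 ≤ m) (h₁ : IsOneOrTwo c₁ κ₁)
    (H : HomHom A T₁ T₁' T₂ T₂' (mB m κ₁) f₁ M₂ f₂)
    (h₂ : HasArm M₂ c₂) : Listed A T₁' c₁ T₂' c₂ := by
  cases h₂ with
  | d₃ c κ h => exact (d₃_common hx₂ hx₁ h H.symm (.b m hm c₁ κ₁ h₁)).symm
  | c n hn => exact (c_common hx₂ hx₁ hn H.symm (.b m hm c₁ κ₁ h₁)).symm
  | a n hn => exact (a_common hx₂ hx₁ hn H.symm (.b m hm c₁ κ₁ h₁)).symm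
  | b n hn c κ h => exact b_b_common hm h₁ h H hx₁ hx₂
  | d₄ =>
    have := H.glue.type_eq H.part₁ H.part₂ (oneArm_b m) oneArm_d₄ hx₁ hx₂
    omega
  | f => exact b_f_common h₁ H hx₁ hx₂
  | g c κ h => exact (b_g_common hm h₁ h H hx₁ hx₂).elim
  | b' =>
    have := H.glue.type_eq H.part₁ H.part₂ (oneArm_b m) oneArm_b' hx₁ hx₂
    omega

theorem d₄_common (h₁ : IsHalfOrOne c₁ κ₁) (H : HomHom A T₁ T₁' T₂ T₂' (mD 4 κ₁) f₁ M₂ f₂)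
    (h₂ : HasArm M₂ c₂) : Listed A T₁' c₁ T₂' c₂ := by
  cases h₂ with
  | d₃ c κ h => exact (d₃_common hx₂ hx₁ h H.symm (.d₄ c₁ κ₁ h₁)).symm
  | c n hn => exact (c_common hx₂ hx₁ hn H.symm (.d₄ c₁ κ₁ h₁)).symm
  | a n hn => exact (a_common hx₂ hx₁ hn H.symm (.d₄ c₁ κ₁ h₁)).symm
  | b n hn c κ h => exact (b_common hx₂ hx₁ hn h H.symm (.d₄ c₁ κ₁ h₁)).symm
  | d₄ c κ h => exact d₄_d₄_common h₁ h H hx₁ hx₂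
  | f =>
    have := H.glue.type_eq H.part₁ H.part₂ oneArm_d₄ oneArm_f hx₁ hx₂
    omega
  | g =>
    have := H.glue.type_eq H.part₁ H.part₂ oneArm_d₄ oneArm_g hx₁ hx₂
    omega
  | b' =>
    have := H.glue.type_eq H.part₁ H.part₂ oneArm_d₄ oneArm_b' hx₁ hx₂
    omega

theorem f_common (H : HomHom A T₁ T₁' T₂ T₂' (mF) f₁ M₂ f₂) (h₂ : HasArm M₂ c₂) :
    Listed A T₁' .one T₂' c₂ := by
  cases h₂ with
  | d₃ c κ h => exact (d₃_common hx₂ hx₁ h H.symm .f).symm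
  | c n hn => exact (c_common hx₂ hx₁ hn H.symm .f).symm
  | a n hn => exact (a_common hx₂ hx₁ hn H.symm .f).symm
  | b n hn c κ h => exact (b_common hx₂ hx₁ hn h H.symm .f).symm
  | d₄ c κ h => exact (d₄_common hx₂ hx₁ h H.symm .f).symm
  | f => exact (f_f_common H hx₁ hx₂).elim
  | g =>
    have := H.glue.type_eq H.part₁ H.part₂ oneArm_f oneArm_g hx₁ hx₂
    omega
  | b' =>
    have := H.glue.type_eq H.part₁ H.part₂ oneArm_f oneArm_b' hx₁ hx₂
    omega

theorem g_common (h₁ : IsOneOrTwo c₁ κ₁) (H : HomHom A T₁ T₁' T₂ T₂' (mG κ₁) f₁ M₂ f₂)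
    (h₂ : HasArm M₂ c₂) : Listed A T₁' c₁ T₂' c₂ := by
  cases h₂ with
  | d₃ c κ h => exact (d₃_common hx₂ hx₁ h H.symm (.g c₁ κ₁ h₁)).symm
  | c n hn => exact (c_common hx₂ hx₁ hn H.symm (.g c₁ κ₁ h₁)).symm
  | a n hn => exact (a_common hx₂ hx₁ hn H.symm (.g c₁ κ₁ h₁)).symm
  | b n hn c κ h => exact (b_common hx₂ hx₁ hn h H.symm (.g c₁ κ₁ h₁)).symm
  | d₄ c κ h => exact (d₄_common hx₂ hx₁ h H.symm (.g c₁ κ₁ h₁)).symm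
  | f => exact (f_common hx₂ hx₁ H.symm (.g c₁ κ₁ h₁)).symm
  | g c κ h => exact (g_g_common h₁ h H hx₁ hx₂).elim
  | b' =>
    have := H.glue.type_eq H.part₁ H.part₂ oneArm_g oneArm_b' hx₁ hx₂
    omega

theorem listed_of_arms (H : HomHom A T₁ T₁' T₂ T₂' M₁ f₁ M₂ f₂) (h₁ : HasArm M₁ c₁)
    (h₂ : HasArm M₂ c₂) : Listed A T₁' c₁ T₂' c₂ := by
  cases h₁ with
  | d₃ c κ h => exact d₃_common hx₁ hx₂ h H h₂
  | c n hn => exact c_common hx₁ hx₂ hn H h₂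
  | a n hn => exact a_common hx₁ hx₂ hn H h₂
  | b n hn c κ h => exact b_common hx₁ hx₂ hn h H h₂
  | d₄ c κ h => exact d₄_common hx₁ hx₂ h H h₂
  | f => exact f_common hx₁ hx₂ H h₂
  | g c κ h => exact g_common hx₁ hx₂ h H h₂
  | b' c κ h =>
    have h₁ : HasArm (mB' κ) c₁ := .b' c₁ κ h
    cases h₂ with
    | d₃ c κ h => exact (d₃_common hx₂ hx₁ h H.symm h₁).symm
    | c n hn => exact (c_common hx₂ hx₁ hn H.symm h₁).symm
    | a n hn => exact (a_common hx₂ hx₁ hn H.symm h₁).symm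
    | b n hn c κ h => exact (b_common hx₂ hx₁ hn h H.symm h₁).symm
    | d₄ c κ h => exact (d₄_common hx₂ hx₁ h H.symm h₁).symm
    | f => exact (f_common hx₂ hx₁ H.symm h₁).symm
    | g c κ h => exact (g_common hx₂ hx₁ h H.symm h₁).symm
    | b' c κ h' => exact b'_b'_common h h' H hx₁ hx₂

theorem listed_of_common (H : HomHom A T₁ T₁' T₂ T₂' M₁ f₁ M₂ f₂) (h₁ : IsModel M₁ c₁)
    (hc₁ : c₁ ≠ .inh) (h₂ : IsModel M₂ c₂) (hc₂ : c₂ ≠ .inh) : Listed A T₁' c₁ T₂' c₂ := by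
  obtain ⟨i, hi, rfl⟩ := (H.part₁.mem x).1 hx₁
  obtain ⟨j, hj, hij⟩ := (H.part₂.mem _).1 hx₂
  have hdi := H.glue.not_dec H.part₁ hi hx₂
  have hdj := H.glue.symm.not_dec H.part₂ hj (hij ▸ hx₁)
  rcases h₁.hasArm_or_fork hc₁ hi hdi with a₁ | ⟨m, κ₁, hm, rfl, k₁⟩ <;>
    rcases h₂.hasArm_or_fork hc₂ hj hdj with a₂ | ⟨n, κ₂, hn, rfl, k₂⟩
  · exact listed_of_arms hx₁ hx₂ H a₁ a₂
  · obtain ⟨α, k, r, s, d, t, ht, rfl⟩ := a₁.exists_arm hi hdi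
    exact (H.symm.glue.not_common_fork hn H.part₂ H.part₁ d hj ht hij).elim
  · obtain ⟨α, k, r, s, d, t, ht, rfl⟩ := a₂.exists_arm hj hdj
    exact (H.glue.not_common_fork hm H.part₁ H.part₂ d hi ht hij.symm).elim
  · exact d_d_common hm hn k₁ k₂ H hx₁ hx₂

end HomHom

end PrimSph

/-! ### A homogeneous and an inhomogeneous part with common vertices -/

namespace PrimSph

open Matrix

variable {S : Type*} [Fintype S] {A : Matrix S S ℤ} {T₁ T₁' T₂ T₂' : Set S} {c₁ c₂ : Factor}
  {M₁ M₂ : Model} {f₁ f₂ : ℕ → S} {k m n i j : ℕ} {s κ : ℤ} {x : S}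

namespace HomInh

theorem pair_eq (H : HomInh A T₁ T₁' T₂ T₂' M₁ f₁ (mI s n) f₂) (hs : IsInhType s n) :
    pairing A M₁ f₁ (f₂ 0) = -2 :=
  H.pair _ ((H.part₂.mem_dec_iff (by grind)).2 (by simp))

/-- The same principle as `HomHom.bound`, with prescribed value `-2`. The vertex next to the
decorated one is common, and its bond is simple unless `n = 2` and the inhomogeneous part has type
`C 2`; hence the case distinction on `n`. -/
theorem bound (H : HomInh A T₁ T₁' T₂ T₂' M₁ f₁ (mI s n) f₂) (hn : 2 ≤ n) (hs : IsInhType s n)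
    (h₁ : IsModel M₁ c₁) (a e : ℕ) (haj : f₁ a = f₂ 1) (ha : a < M₁.rank := by grind)
    (he : e < M₁.rank := by grind) (hea : e ≠ a := by grind) :
    0 ≤ M₁.weight e * A (f₁ e) (f₂ 0) - M₁.weight a * (if n = 2 then s else 1) + 2 ∧
      A (f₁ e) (f₂ 0) ≤ 0 := by
  have h := H.glue.pairing_le H.part₁ H.part₂ (b := 0) (by grind) (by simp) h₁.weight_nonneg ha
    (by grind) haj he hea
  rw [H.pair_eq hs] at h
  have h1 : (mI s n).entry 1 0 = -(if n = 2 then s else 1) := by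
    clear * - hn
    grind
  rw [h1] at h
  exact ⟨by linarith, h.2⟩

theorem pairing_common (H : HomInh A T₁ T₁' T₂ T₂' M₁ f₁ (mI s n) f₂) (hn : 2 ≤ n)
    (hs : IsInhType s n)
    (a e : ℕ) (haj : f₁ a = f₂ 1) (hl : M₁.dec = [e]) (ha : a < M₁.rank := by grind)
    (he : e < M₁.rank := by grind) :
    M₁.weight e * A (f₁ e) (f₂ 0) - M₁.weight a * (if n = 2 then s else 1) = -2 := by
  have h1 : (mI s n).entry 1 0 = -(if n = 2 then s else 1) := by
    clear * - hn
    grind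
  have h := H.glue.pairing_single_common H.part₁ H.part₂ (b := 0) (by grind) hl he ha (by grind) haj
    (fun i hi j hj h hne => by
      have := H.glue.symm.not_dec H.part₂ hj (h ▸ H.part₁.mem_of_lt hi)
      clear * - this hne hj
      grind)
  rw [H.pair_eq hs, h1] at h
  linarith

theorem a_common (hm : 3 ≤ m) (hs : IsInhType s n)
    (H : HomInh A T₁ T₁' T₂ T₂' (mA m) f₁ (mI s n) f₂) (hx₁ : x ∈ T₁) (hx₂ : x ∈ T₂) :
    Listed A T₁' .one T₂' .inh := by
  obtain ⟨hk, hk', σ, hσ, hm', -⟩ :=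
    H.glue.exists_match H.part₁ H.part₂ (oneArm_a m) (oneArm_inh (by grind) n) hx₁ hx₂
  obtain rfl : n = m - 1 := by omega
  have hs1 : 2 ≤ m - 2 → s = 1 := by
    rcases hσ with ⟨-, h⟩ | ⟨-, -, h, h'⟩ <;> omega
  have hor : (∀ i < m - 1, i ≠ 0 → f₁ i = f₂ i) ∨ ∀ i < m - 1, i ≠ 0 → f₁ i = f₂ (m - 1 - i) := by
    rcases hσ with ⟨hσ, -⟩ | ⟨hσ, -⟩
    · refine Or.inl fun i hi h0 => ?_
      have := hm' (i - 1) (by omega)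
      rwa [hσ, Nat.sub_add_cancel (by omega)] at this
    · refine Or.inr fun i hi h0 => ?_
      have := hm' (i - 1) (by omega)
      rwa [hσ, Nat.sub_add_cancel (by omega), 
        show m - 2 - 1 - (i - 1) + 1 = m - 1 - i by omega] at this
  clear hm' hσ
  wlog hσ' : ∀ i < m - 1, i ≠ 0 → f₁ i = f₂ (m - 1 - i) generalizing f₁
  · have h := hor.resolve_right hσ'
    have h' : ∀ i < m - 1, i ≠ 0 → f₁ (m - 1 - i) = f₂ (m - 1 - i) :=
      fun i hi h0 => h _ (by omega) (by omega)
    exact this (H.reverse (by omega)) (Or.inr h') h'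
  have h1 : f₁ (m - 2) = f₂ 1 := by
    rw [hσ' (m - 2) (by omega) (by omega), show m - 1 - (m - 2) = 1 by omega]
  have B := H.bound (by omega) hs (.a m (by omega)) (m - 2) 0 h1
  have B' := H.bound (by omega) hs (.a m (by omega)) (m - 2) (m - 1) h1
  have hz : s = 1 ∧ A (f₁ 0) (f₂ 0) = 0 ∧ A (f₁ (m - 1)) (f₂ 0) = 0 := by
    clear * - B B' hs1 hs hm
    rcases hs with ⟨rfl, -⟩ | ⟨rfl, -⟩ <;> grind
  obtain ⟨rfl, hz⟩ := hz
  have hC' : ∀ i < m, ∀ j < m - 1, f₁ i = f₂ j ↔ i = m - 1 - j ∧ j ≠ 0 := by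
    intro i hi j hj
    have key : ∀ j < m - 1, j ≠ 0 → f₁ (m - 1 - j) = f₂ j := fun j hj h0 => by
      rw [hσ' _ (by omega) (by omega), show m - 1 - (m - 1 - j) = j by omega]
    refine ⟨fun h => ?_, by rintro ⟨rfl, h0⟩; exact key j hj h0⟩
    have h0 : j ≠ 0 := by
      have := H.glue.symm.not_dec H.part₂ hj (h ▸ H.part₁.mem_of_lt hi)
      grind
    exact ⟨H.part₁.inj i hi _ (by grind) (h.trans (key j hj h0).symm), h0⟩
  refine H.glue.listed_of_common_of_eq_zero H.part₁ H.part₂ hC' (by simp [hz])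
    (.D_a_aa (m + 1) (by omega)) (fun i => i) (fun j => if j = 0 then m else m - 1 - j)
    (fun i => m - 1 - i) (fun j => m - 1 - j) (fun _ => 0)
      (fun _ => 0) 1 rfl ?_ ?_ ?_ ?_ ?_ ?_ ?_ ?_ <;>
    clear * - hm <;> grind (splits := 25)

theorem b_common (hm : 2 ≤ m) (hs : IsInhType s n) (h₁ : IsOneOrTwo c₁ κ)
    (H : HomInh A T₁ T₁' T₂ T₂' (mB m κ) f₁ (mI s n) f₂)
    (hx₁ : x ∈ T₁) (hx₂ : x ∈ T₂) : Listed A T₁' c₁ T₂' .inh := by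
  obtain ⟨hk, hk', σ, hσ, hm', hC⟩ :=
    H.glue.exists_match H.part₁ H.part₂ (oneArm_b m) (oneArm_inh (by grind) n) hx₁ hx₂
  obtain rfl : m = n := by omega
  have h1 : f₁ (σ 0 + 1) = f₂ 1 := by
    rw [hm' (σ 0) (hσ.lt (by omega)).1, (hσ.lt (by omega)).2]
  have ha := (hσ.lt (i := 0) (by omega)).1
  have B := H.bound hm hs (.b m hm c₁ κ h₁) (σ 0 + 1) 0 h1
  have hκ : c₁ = .one ∧ A (f₁ 0) (f₂ 0) = 0 ∧ (s = 1 ∨ m ≠ 2) := by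
    clear * - B h₁ hs
    rcases hs with ⟨rfl, -⟩ | ⟨rfl, -⟩ <;> rcases h₁ with ⟨rfl, rfl⟩ | ⟨rfl, rfl⟩ <;> grind
  obtain ⟨rfl, hz, hs2⟩ := hκ
  have hz' := H.glue.gcm.zero_symm _ _ hz
  -- An arm `B (m - 1)` of length at least 2 matches the arm of an inhomogeneous part only if it has
  -- length 2, is reversed, and `s = 2`.
  have hcase : m = 2 ∧ s = 1 ∧ σ 0 = 0 ∨ m = 3 ∧ s = 2 ∧ ∀ i, σ i = 1 - i := by
    clear * - hs2 hσ hm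
    rcases hσ with ⟨hσ, h⟩ | ⟨hσ, hk, h, h'⟩ <;> grind
  clear hσ
  rcases hcase with ⟨rfl, rfl, hσ⟩ | ⟨rfl, rfl, hσ⟩
  · have hC' : ∀ i < 2, ∀ j < 2, f₂ i = f₁ j ↔ i = 1 ∧ j = 1 := by
      intro i hi j hj
      rw [eq_comm, hC j hj i hi]
      exact ⟨by clear * - hσ; grind, fun h => ⟨0, by clear * - hσ h; grind⟩⟩
    refine (H.glue.symm.listed_of_common_of_eq_zero H.part₂ H.part₁ hC' (by simp [hz'])
      (.C_aa_c 3 le_rfl) (fun i => i) (fun j => 2 - j) (fun _ => 1) (fun _ => 1) (fun _ => 0)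
      (fun _ => 0) 1 rfl ?_ ?_ ?_ ?_ ?_ ?_ ?_ ?_).symm <;> clear * - <;> grind
  · have hC' : ∀ i < 3, ∀ j < 3, f₁ i = f₂ j ↔ i = 3 - j ∧ j ≠ 0 := by
      intro i hi j hj
      rw [hC i hi j hj]
      simp only [hσ]
      clear * - hi hj
      decide +revert
    refine H.glue.listed_of_common_of_eq_zero H.part₁ H.part₂ hC' (by simp [hz])
      .F4_b_cc (fun i => i) (fun j => 3 - j) (fun i => 3 - i) (fun j => 3 - j) (fun _ => 0)
      (fun _ => 0) 1 rfl ?_ ?_ ?_ ?_ ?_ ?_ ?_ ?_ <;> clear * - <;> grind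

theorem c_common (hm : 3 ≤ m) (hs : IsInhType s n)
    (H : HomInh A T₁ T₁' T₂ T₂' (mC m) f₁ (mI s n) f₂) (hx₁ : x ∈ T₁) (hx₂ : x ∈ T₂) :
    Listed A T₁' .one T₂' .inh := by
  rcases H.glue.exists_match_c hm H.part₁ H.part₂ (oneArm_inh (by grind) n) hx₁ hx₂ with
    ⟨hk, h0, hC⟩ | ⟨hk, σ, hσ, hm', hC⟩
  · obtain rfl : n = 2 := by omega
    have B := H.bound le_rfl hs (.c m hm) 0 1 h0
    have hz : s = 1 ∧ A (f₁ 1) (f₂ 0) = 0 := by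
      clear * - B hs hm
      rcases hs with ⟨rfl, -⟩ | ⟨rfl, -⟩ <;> grind
    obtain ⟨rfl, hz⟩ := hz
    have hz' := H.glue.gcm.zero_symm _ _ hz
    have hC' : ∀ i < 2, ∀ j < m, f₂ i = f₁ j ↔ i = 1 ∧ j = 0 := by
      intro i hi j hj
      rw [eq_comm, hC j hj i hi, and_comm]
    refine (H.glue.symm.listed_of_common_of_eq_zero H.part₂ H.part₁ hC' (by simp [hz'])
      (.C_aa_c (m + 1) (by omega)) (fun i => i) (fun j => j + 1) (fun _ => 0) (fun _ => 1)
      (fun t => t + 1) (fun j => j - 1) (m - 1)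
        (by grind) ?_ ?_ ?_ ?_ ?_ ?_ ?_ ?_).symm <;> clear * - hm <;> grind
  · have h1 : f₁ (σ 0 + 2) = f₂ 1 := by
      rw [hm' (σ 0) (hσ.lt (by omega)).1, (hσ.lt (by omega)).2]
    have ha := (hσ.lt (i := 0) (by omega)).1
    have B := H.bound (by omega) hs (.c m hm) (σ 0 + 2) 1 h1
    have hz : s = 1 ∧ m = 3 ∧ σ 0 = 0 ∧ A (f₁ 1) (f₂ 0) = 0 := by
      clear * - B hs hm hσ ha hk
      rcases hs with ⟨rfl, -⟩ | ⟨rfl, -⟩ <;> rcases hσ with ⟨hσ, h⟩ | ⟨hσ, hk, h, h'⟩ <;> grind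
    obtain ⟨rfl, rfl, hσ, hz⟩ := hz
    obtain rfl : n = 2 := by omega
    have hz' := H.glue.gcm.zero_symm _ _ hz
    have hC' : ∀ i < 2, ∀ j < 3, f₂ i = f₁ j ↔ i = 1 ∧ j = 2 := by
      intro i hi j hj
      rw [eq_comm, hC j hj i hi]
      simp [hσ, eq_comm, and_comm]
    refine (H.glue.symm.listed_of_common_of_eq_zero H.part₂ H.part₁ hC' (by simp [hz'])
      .F4_aa_c (fun i => i) (fun j => 3 - j) (fun _ => 2) (fun _ => 1)
      (fun t => t) (fun j => j) 2 rfl ?_ ?_ ?_ ?_ ?_ ?_ ?_ ?_).symm <;>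
      clear * - <;> grind (splits := 20)

theorem d₃_common (hs : IsInhType s n) (h₁ : IsHalfOrOne c₁ κ)
    (H : HomInh A T₁ T₁' T₂ T₂' (mD 3 κ) f₁ (mI s n) f₂) (hx₁ : x ∈ T₁) (hx₂ : x ∈ T₂) :
    Listed A T₁' c₁ T₂' .inh := by
  obtain ⟨hk, l, hl, h0, hC⟩ :=
    H.glue.exists_match_d₃ H.part₁ H.part₂ (oneArm_inh (by grind) n) hx₁ hx₂
  obtain rfl : n = 2 := by omega
  have e := H.pairing_common le_rfl hs l 0 h0 rfl
  have B := H.bound le_rfl hs (.d 3 le_rfl c₁ κ h₁) l 0 h0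
  -- The equation `2 κ A (f₁ 0) (f₂ 0) = κ s - 2` has a nonpositive integral solution only for `κ s
  -- = 2`.
  have hz : A (f₁ 0) (f₂ 0) = 0 ∧ (c₁ = .one ∧ s = 1 ∨ c₁ = .half ∧ s = 2) := by
    clear * - e B h₁ hs hl
    rcases hs with ⟨rfl, -⟩ | ⟨rfl, -⟩ <;> rcases h₁ with ⟨rfl, rfl⟩ | ⟨rfl, rfl⟩ <;> grind
  obtain ⟨hz, ⟨rfl, rfl⟩ | ⟨rfl, rfl⟩⟩ := hz
  · have hz' := H.glue.gcm.zero_symm _ _ hz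
    have hC' : ∀ i < 2, ∀ j < 3, f₂ i = f₁ j ↔ i = 1 ∧ j = l := by
      intro i hi j hj
      rw [eq_comm, hC j hj i hi, and_comm]
    refine (H.glue.symm.listed_of_common_of_eq_zero H.part₂ H.part₁ hC' (by simp [hz'])
      .A4_aa_d3 (fun i => i) (fun j => if j = 0 then 2 else if j = l then 1 else 3) (fun _ => l)
      (fun _ => 1) (fun t => if t = 0 then 0 else 3 - l) (fun j => if j = 0 then 0 else 1) 2 rfl
      ?_ ?_ ?_ ?_ ?_ ?_ ?_ ?_).symm <;> clear * - hl <;> grind (splits := 20)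
  · refine H.glue.listed_of_common_of_eq_zero H.part₁ H.part₂ hC (by simp [hz])
      .B4_hd3_cc (fun i => if i = 0 then 1 else if i = l then 2 else 0) (fun j => 3 - j)
        (fun _ => 1)
      (fun _ => l) (fun _ => 0) (fun _ => 0) 1 rfl ?_ ?_ ?_ ?_ ?_ ?_ ?_ ?_ <;> clear * - hl <;>
        grind (splits := 20)

theorem d₄_common (hs : IsInhType s n) (h₁ : IsHalfOrOne c₁ κ)
    (H : HomInh A T₁ T₁' T₂ T₂' (mD 4 κ) f₁ (mI s n) f₂) (hx₁ : x ∈ T₁) (hx₂ : x ∈ T₂) :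
    Listed A T₁' c₁ T₂' .inh := by
  obtain ⟨hk, -, σ, hσ, hm', hC⟩ :=
    H.glue.exists_match H.part₁ H.part₂ oneArm_d₄ (oneArm_inh (by grind) n) hx₁ hx₂
  obtain rfl : n = 4 := by omega
  have hs1 : s = 1 := by
    rcases hσ with ⟨-, h⟩ | ⟨-, -, h, h'⟩ <;> omega
  subst hs1
  obtain ⟨l, hl, hC⟩ : ∃ l, (l = 2 ∨ l = 3) ∧ ∀ i < 4, ∀ j < 4, f₁ i = f₂ j ↔
      j ≠ 0 ∧ i = if j = 2 then 1 else if j = 1 then l else 5 - l := by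
    rcases hσ with ⟨hσ, -⟩ | ⟨hσ, -⟩
    · refine ⟨2, by simp, fun i hi j hj => ?_⟩
      rw [hC i hi j hj]
      simp only [hσ]
      clear * - hi hj
      decide +revert
    · refine ⟨3, by simp, fun i hi j hj => ?_⟩
      rw [hC i hi j hj]
      simp only [hσ]
      clear * - hi hj
      decide +revert
  have h1 : f₁ l = f₂ 1 := (hC l (by omega) 1 (by omega)).2 (by simp)
  have e := H.pairing_common (by simp) hs l 0 h1 rfl
  have B := H.bound (by simp) hs (.d 4 (by simp) c₁ κ h₁) l 0 h1
  have hz : A (f₁ 0) (f₂ 0) = 0 ∧ c₁ = .one := by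
    clear * - e B h₁ hl
    rcases h₁ with ⟨rfl, rfl⟩ | ⟨rfl, rfl⟩ <;> grind
  obtain ⟨hz, rfl⟩ := hz
  have hz' := H.glue.gcm.zero_symm _ _ hz
  have hC' : ∀ i < 4, ∀ j < 4, f₂ i = f₁ j ↔
        i ≠ 0 ∧ j = if i = 2 then 1 else if i = 1 then l else 5 - l := by
    intro i hi j hj
    rw [eq_comm, hC j hj i hi]
  refine (H.glue.symm.listed_of_common_of_eq_zero H.part₂ H.part₁ hC' (by simp [hz'])
    .D5_aa_d (fun i => if i = 3 then 4 else i)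
    (fun j => if j = 0 then 3 else if j = 1 then 2 else if j = l then 1 else 4)
    (fun i => if i = 2 then 1 else if i = 1 then l else 5 - l)
    (fun j => if j = 1 then 2 else if j = l then 1 else 3) (fun _ => 0) (fun _ => 0) 1 rfl
    ?_ ?_ ?_ ?_ ?_ ?_ ?_ ?_).symm <;> clear * - hl <;> grind (splits := 30)

theorem g_common (hs : IsInhType s n) (h₁ : IsOneOrTwo c₁ κ)
    (H : HomInh A T₁ T₁' T₂ T₂' (mG κ) f₁ (mI s n) f₂) (hx₁ : x ∈ T₁) (hx₂ : x ∈ T₂) :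
    Listed A T₁' c₁ T₂' .inh := by
  obtain ⟨hk, -, σ, hσ, hm', hC⟩ :=
    H.glue.exists_match H.part₁ H.part₂ oneArm_g (oneArm_inh (by grind) n) hx₁ hx₂
  obtain rfl : n = 2 := by omega
  have h0 := hm' 0 (by simp)
  have hσ0 := Nat.lt_one_iff.1 (hσ.lt zero_lt_one).1
  rw [hσ0] at h0
  have B := H.bound le_rfl hs (.g c₁ κ h₁) 0 1 h0
  have hz : s = 1 ∧ c₁ = .one ∧ A (f₁ 1) (f₂ 0) = 0 := by
    clear * - B hs h₁
    rcases hs with ⟨rfl, -⟩ | ⟨rfl, -⟩ <;> rcases h₁ with ⟨rfl, rfl⟩ | ⟨rfl, rfl⟩ <;> grind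
  obtain ⟨rfl, rfl, hz⟩ := hz
  have hz' := H.glue.gcm.zero_symm _ _ hz
  have hC' : ∀ i < 2, ∀ j < 2, f₂ i = f₁ j ↔ i = 1 ∧ j = 0 := by
    intro i hi j hj
    rw [eq_comm, hC j hj i hi]
    exact ⟨by clear * - hσ0; grind, fun h => ⟨0, by clear * - hσ0 h; grind⟩⟩
  refine (H.glue.symm.listed_of_common_of_eq_zero H.part₂ H.part₁ hC' (by simp [hz'])
    .affG2_aa_g (fun i => i) (fun j => j + 1) (fun _ => 0) (fun _ => 1) (fun _ => 1)
    (fun _ => 0) 1 rfl ?_ ?_ ?_ ?_ ?_ ?_ ?_ ?_).symm <;> clear * - <;> grind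

/-- The arm of `b' 3` is of type `A₂` and can be matched in both directions. The identity leads to
factor 1 and `B₄`, the reversal to factor `1/2` and `B₃⁽¹⁾`. -/
theorem b'_common (hs : IsInhType s n) (h₁ : IsHalfOrOne c₁ κ)
    (H : HomInh A T₁ T₁' T₂ T₂' (mB' κ) f₁ (mI s n) f₂)
    (hx₁ : x ∈ T₁) (hx₂ : x ∈ T₂) : Listed A T₁' c₁ T₂' .inh := by
  obtain ⟨hk, -, σ, hσ, hm', hC⟩ :=
    H.glue.exists_match H.part₁ H.part₂ oneArm_b' (oneArm_inh (by grind) n) hx₁ hx₂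
  obtain rfl : n = 3 := by omega
  have h0 := hm' 0 (by simp)
  have h1 := hm' 1 (by simp)
  rcases hσ with ⟨hσ, h⟩ | ⟨hσ, -, h, -⟩
  · obtain ⟨-, rfl⟩ := h le_rfl
    rw [hσ] at h0
    have e := H.pairing_common (by simp) hs 0 2 h0 rfl
    have B := H.bound (by simp) hs (.b' c₁ κ h₁) 0 2 h0
    have hz : c₁ = .one ∧ A (f₁ 2) (f₂ 0) = 0 := by
      clear * - B e h₁
      rcases h₁ with ⟨rfl, rfl⟩ | ⟨rfl, rfl⟩ <;> grind
    obtain ⟨rfl, hz⟩ := hz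
    have hz' := H.glue.gcm.zero_symm _ _ hz
    have hC' : ∀ i < 3, ∀ j < 3, f₂ i = f₁ j ↔ i = j + 1 := by
      intro i hi j hj
      rw [eq_comm, hC j hj i hi]
      simp only [hσ]
      clear * - hi hj
      decide +revert
    refine (H.glue.symm.listed_of_common_of_eq_zero H.part₂ H.part₁ hC' (by simp [hz'])
      .B4_aa_b' (fun i => i) (fun j => j + 1) (fun i => i - 1) (fun j => j + 1) (fun _ => 2)
      (fun _ => 0) 1 rfl ?_ ?_ ?_ ?_ ?_ ?_ ?_ ?_).symm <;>
      clear * - <;> grind (splits := 20)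
  · obtain ⟨rfl, -⟩ := h rfl
    rw [hσ] at h1
    have B := H.bound (by simp) hs (.b' c₁ κ h₁) 1 2 h1
    have hz : c₁ = .half ∧ A (f₁ 2) (f₂ 0) = 0 := by
      clear * - B h₁
      rcases h₁ with ⟨rfl, rfl⟩ | ⟨rfl, rfl⟩ <;> grind
    obtain ⟨rfl, hz⟩ := hz
    have hz' := H.glue.gcm.zero_symm _ _ hz
    have hC' : ∀ i < 3, ∀ j < 3, f₂ i = f₁ j ↔ i = 2 - j ∧ j ≠ 2 := by
      intro i hi j hj
      rw [eq_comm, hC j hj i hi]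
      simp only [hσ]
      clear * - hi hj
      decide +revert
    refine (H.glue.symm.listed_of_common_of_eq_zero H.part₂ H.part₁ hC' (by simp [hz'])
      .affB3_aa_hb' (fun i => if i = 0 then 0 else 3 - i) (fun j => j + 1) (fun i => 2 - i)
      (fun j => 2 - j) (fun _ => 2) (fun _ => 0) 1 rfl ?_ ?_ ?_ ?_ ?_ ?_ ?_ ?_).symm <;>
      clear * - <;> grind (splits := 20)

theorem listed_of_common (H : HomInh A T₁ T₁' T₂ T₂' M₁ f₁ (mI s n) f₂) (hs : IsInhType s n)
    (h₁ : IsModel M₁ c₁) (hc : c₁ ≠ .inh) (hx₁ : x ∈ T₁) (hx₂ : x ∈ T₂) :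
    Listed A T₁' c₁ T₂' .inh := by
  obtain ⟨i, hi, rfl⟩ := (H.part₁.mem x).1 hx₁
  have hdi := H.glue.not_dec H.part₁ hi hx₂
  have o : OneArm (mI s n) (· + 1) (n - 1) 1 s := oneArm_inh (by grind) n
  rcases h₁.hasArm_or_fork hc hi hdi with a₁ | ⟨m, κ₁, hm, rfl, k₁⟩
  · cases a₁ with
    | d₃ c κ h => exact d₃_common hs h H hx₁ hx₂
    | c n hn => exact c_common hn hs H hx₁ hx₂
    | a n hn => exact a_common hn hs H hx₁ hx₂
    | b n hn c κ h => exact b_common hn hs h H hx₁ hx₂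
    | d₄ c κ h => exact d₄_common hs h H hx₁ hx₂
    | f =>
      have := H.glue.type_eq H.part₁ H.part₂ oneArm_f o hx₁ hx₂
      omega
    | g c κ h => exact g_common hs h H hx₁ hx₂
    | b' c κ h => exact b'_common hs h H hx₁ hx₂
  · obtain ⟨j, hj, hij⟩ := (H.part₂.mem _).1 hx₂
    obtain ⟨t, ht, rfl⟩ := o.complete j hj (H.glue.symm.not_dec H.part₂ hj (hij ▸ hx₁))
    exact (H.glue.not_common_fork hm H.part₁ H.part₂ o.toArmData hi ht hij.symm).elim

end HomInh

end PrimSph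

namespace PrimSph

open Matrix

variable {S : Type*} [Fintype S] {A : Matrix S S ℤ} {T₁ T₁' T₂ T₂' : Set S}
  {f₁ f₂ : ℕ → S} {m n a : ℕ} {s t : ℤ} {x : S}

namespace InhInh

/-! ### Two inhomogeneous parts with common vertices -/

/-- The criterion for a vector with values `K` on the first part and `1` on the decorated vertex of
the second part, if all other vertices of the second part are common. -/
theorem eq_zero_of_common (H : InhInh A T₁ T₁' T₂ T₂' (mI t n) f₁ (mI s n) f₂)
    (hc : ∀ j < n, j ≠ 0 → f₂ j ∈ T₁) (hn : 2 ≤ n) (ha : a < n) (ha1 : f₁ a = f₂ 1) (K : ℕ → ℤ)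
    (hK : ∀ i < n, 0 ≤ K i ∧ (mI t n).row K i + (if i = 0 then A (f₁ 0) (f₂ 0) else
      if i = a then -(if n = 2 then s else 1) else 0) ≤ 0)
    (h : 2 + A (f₂ 0) (f₁ 0) * K 0 - K a ≤ 0) :
    (∀ i < n, (mI t n).row K i + (if i = 0 then A (f₁ 0) (f₂ 0) else
      if i = a then -(if n = 2 then s else 1) else 0) = 0) ∧
    2 + A (f₂ 0) (f₁ 0) * K 0 - K a = 0 := by
  classical
  have p₁ := H.part₁
  have p₂ := H.part₂
  have h0 : ∀ i < n, f₁ i ≠ f₂ 0 := fun i hi h => H.glue.not_mem₁ (f₂ 0)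
    ((p₂.mem_dec_iff (by grind)).2 (by simp)) (h ▸ p₁.mem_of_lt hi)
  have ha0 : a ≠ 0 := by
    rintro rfl
    exact H.glue.not_dec p₁ ha (ha1 ▸ p₂.mem_of_lt (by grind)) (by simp)
  -- Among the vertices of the first part, only the decorated one and the neighbour `f₂ 1` can be
  -- bonded to `f₂ 0`.
  have hz : ∀ i < n, i ≠ 0 → i ≠ a → A (f₁ i) (f₂ 0) = 0 ∧ A (f₂ 0) (f₁ i) = 0 := by
    refine fun i hi hi0 hia => H.glue.entry_eq_zero p₁ p₂ hi (by simpa using hi0) (by grind) ?_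
    intro j hj hij
    have hj1 : j ≠ 1 := fun hj1 => hia (p₁.inj i hi a ha (by rw [hij, hj1, ha1]))
    have hj0 : j ≠ 0 := fun hj0 => h0 i hi (by rw [hij, hj0])
    clear * - hj1 hj0
    grind
  have h10 : A (f₁ a) (f₂ 0) = -(if n = 2 then s else 1) := by
    rw [ha1, p₂.cartan 1 (by grind) 0 (by grind)]
    clear * - hn
    grind
  have h01 : A (f₂ 0) (f₁ a) = -1 := by
    rw [ha1, p₂.cartan 0 (by grind) 1 (by grind)]
    clear * - hn
    grind
  have hcov : ∀ y, (∃ i < n, f₁ i = y) ∨ f₂ 0 = y := by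
    intro y
    rcases H.glue.exists_cover p₁ p₂ y with h | ⟨j, hj, rfl⟩
    · exact Or.inl h
    · by_cases hj0 : j = 0
      · exact Or.inr (by rw [hj0])
      · exact Or.inl ((p₁.mem _).1 (hc j hj hj0))
  have sum_eq : ∀ F : S → ℤ, ∑ y, F y = ∑ i ∈ Finset.range n, F (f₁ i) + F (f₂ 0) := by
    intro F
    have hu : (Finset.univ : Finset S) = insert (f₂ 0) ((Finset.range n).image f₁) := by
      ext y
      simpa [eq_comm] using (hcov y).symm
    rw [hu, Finset.sum_insert (by simpa using h0), Finset.sum_image, add_comm]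
    exact fun i hi j hj h => p₁.inj i (by simpa using hi) j (by simpa using hj) h
  obtain ⟨v, hv, hv0⟩ : ∃ v : S → ℤ, (∀ i < n, v (f₁ i) = K i) ∧ v (f₂ 0) = 1 := by
    refine ⟨fun y => if h : ∃ i < n, f₁ i = y then K h.choose else 1, fun i hi => ?_, ?_⟩
    · have h : ∃ j < n, f₁ j = f₁ i := ⟨i, hi, rfl⟩
      exact (dif_pos h).trans (congrArg K (p₁.inj _ h.choose_spec.1 i hi h.choose_spec.2))
    · exact dif_neg fun ⟨i, hi, h⟩ => h0 i hi h
  have e₁ : ∀ i < n, ∑ y, A (f₁ i) y * v y = (mI t n).row K i +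
      (if i = 0 then A (f₁ 0) (f₂ 0) else if i = a then -(if n = 2 then s else 1) else 0) := by
    intro i hi
    rw [sum_eq, hv0, mul_one]
    congr 1
    · exact Finset.sum_congr rfl fun j hj => by
        rw [hv j (by simpa using hj), p₁.cartan i hi j (by simpa using hj)]
    · by_cases h : i = 0
      · rw [if_pos h, h]
      · by_cases h' : i = a
        · rw [if_neg h, if_pos h', h', h10]
        · rw [if_neg h, if_neg h', (hz i hi h h').1]
  have e₂ : ∑ y, A (f₂ 0) y * v y = 2 + A (f₂ 0) (f₁ 0) * K 0 - K a := by
    rw [sum_eq, hv0, H.glue.gcm.diag, ← Finset.sum_subset (s₁ := {0, a}), Finset.sum_pair ha0.symm,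
      hv 0 (by omega), hv a ha, h01]
    · ring
    · intro i hi
      rw [Finset.mem_range]
      grind
    · intro i hi hia
      rw [(hz i (by simpa using hi) (by grind) (by grind)).2, zero_mul]
  obtain ⟨-, e⟩ := H.dynkin.mulVec_eq_zero v (x₀ := f₂ 0)
    (fun y => by
      rcases hcov y with ⟨i, hi, rfl⟩ | rfl
      · rw [hv i hi]; exact (hK i hi).1
      · rw [hv0]; exact zero_le_one)
    (by rw [hv0]; exact zero_lt_one)
    (fun y => by
      rcases hcov y with ⟨i, hi, rfl⟩ | rfl
      · rw [e₁ i hi]; exact (hK i hi).2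
      · rwa [e₂])
  exact ⟨fun i hi => (e₁ i hi).symm.trans (e _), e₂.symm.trans (e _)⟩

theorem offDiag_nonpos (H : InhInh A T₁ T₁' T₂ T₂' (mI t n) f₁ (mI s n) f₂) (hn : 2 ≤ n) :
    A (f₁ 0) (f₂ 0) ≤ 0 ∧ A (f₂ 0) (f₁ 0) ≤ 0 ∧ (A (f₁ 0) (f₂ 0) = 0 ↔ A (f₂ 0) (f₁ 0) = 0) := by
  have h0 : f₁ 0 ≠ f₂ 0 := fun h => H.glue.not_mem₁ (f₂ 0)
    ((H.part₂.mem_dec_iff (by grind)).2 (by simp)) (h ▸ H.part₁.mem_of_lt (by grind))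
  exact ⟨H.glue.gcm.offDiag _ _ h0, H.glue.gcm.offDiag _ _ h0.symm, H.glue.gcm.zero_symm _ _,
    H.glue.gcm.zero_symm _ _⟩

theorem listed_of_reverse (H : InhInh A T₁ T₁' T₂ T₂' (mI 1 n) f₁ (mI 1 n) f₂)
    (hc : ∀ j < n, j ≠ 0 → f₂ j ∈ T₁) (hn : 2 ≤ n)
    (hC : ∀ i < n, ∀ j < n, f₁ i = f₂ j ↔ i = n - j ∧ j ≠ 0) : Listed A T₁' .inh T₂' .inh := by
  have g0 := H.offDiag_nonpos hn
  by_cases hz : A (f₁ 0) (f₂ 0) = 0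
  · refine H.glue.listed_of_common_of_eq_zero H.part₁ H.part₂ hC (by simp [hz])
      (.A_aa_aa' (n + 1) (by omega)) (fun i => i) (fun j => n - j) (fun i => n - i) (fun j => n - j)
      (fun _ => 0) (fun _ => 0) 1 rfl ?_ ?_ ?_ ?_ ?_ ?_ ?_ ?_ <;> clear * - hn <;>
        grind (splits := 20)
  have h1 := (hC (n - 1) (by omega) 1 (by omega)).2 (by omega)
  -- A bond between the decorated vertices closes the path to a cycle. On it the constant vector 1
  -- has nonpositive rows; since they must vanish, the bond is simple.
  obtain ⟨b, b'⟩ := H.eq_zero_of_common hc hn (by omega) h1 (fun _ => 1)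
    (fun i hi => by
      rw [row_inh _ _ hi]
      clear * - hi hn hz g0
      grind)
    (by clear * - hn hz g0; grind)
  have b0 := b 0 (by omega)
  rw [row_inh _ _ (by omega)] at b0
  have hl : A (f₁ 0) (f₂ 0) = -1 := by clear * - b0 hn; grind
  have hr : A (f₂ 0) (f₁ 0) = -1 := by clear * - b'; grind
  refine H.glue.listed_of_common H.part₁ H.part₂ hC (.affA_aa_aa n hn)
    (fun i => if i = 0 then 0 else n + 1 - i) (fun j => j + 1) (fun i => n - i) (fun j => n - j)
    (fun _ => 0) (fun _ => 0) 1 rfl ?_ ?_ ?_ ?_ ?_ ?_ ?_ ?_ ?_ <;> clear * - hn hl hr <;>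
    grind (splits := 25)

theorem listed_of_id (H : InhInh A T₁ T₁' T₂ T₂' (mI s n) f₁ (mI s n) f₂)
    (hc : ∀ j < n, j ≠ 0 → f₂ j ∈ T₁) (hn : 3 ≤ n)
    (hs : s = 1 ∨ s = 2) (hC : ∀ i < n, ∀ j < n, f₁ i = f₂ j ↔ i = j ∧ j ≠ 0) :
    Listed A T₁' .inh T₂' .inh := by
  have g0 := H.offDiag_nonpos (by omega)
  have hz : A (f₁ 0) (f₂ 0) = 0 := by
    by_contra hz
    have h1 := (hC 1 (by omega) 1 (by omega)).2 (by omega)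
    -- A bond would create a triangle. The vector 1 on it and 0 elsewhere is negative at the next
    -- vertex of the arm, which exists because `n ≥ 3`.
    obtain ⟨b, -⟩ := H.eq_zero_of_common hc (by omega) (by omega) h1
      (fun i => if i < 2 then 1 else 0)
      (fun i hi => by
        rw [row_inh _ _ hi]
        clear * - hi hn hz g0 hs
        grind)
      (by clear * - hn hz g0; grind)
    have b2 := b 2 (by omega)
    rw [row_inh _ _ (by omega)] at b2
    clear * - b2 hn hs
    grind
  rcases hs with rfl | rfl
  · refine H.glue.listed_of_common_of_eq_zero H.part₁ H.part₂ hC (by simp [hz])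
      (.D_aa_aa (n + 1) (by omega)) (fun i => n - 1 - i) (fun j => if j = 0 then n else n - 1 - j)
      (fun i => i) (fun j => j) (fun _ => 0) (fun _ => 0) 1 rfl ?_ ?_ ?_ ?_ ?_ ?_ ?_ ?_ <;>
      clear * - hn <;> grind (splits := 25)
  · refine H.glue.listed_of_common_of_eq_zero H.part₁ H.part₂ hC (by simp [hz])
      (.twAodd_cc_cc n hn) (fun i => if i = 0 then 0 else i + 1) (fun j => j + 1)
      (fun i => i) (fun j => j) (fun _ => 0) (fun _ => 0) 1 rfl ?_ ?_ ?_ ?_ ?_ ?_ ?_ ?_ <;>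
      clear * - hn <;> grind (splits := 25)

theorem listed_of_two (H : InhInh A T₁ T₁' T₂ T₂' (mI t 2) f₁ (mI 2 2) f₂)
    (hc : ∀ j < 2, j ≠ 0 → f₂ j ∈ T₁) (ht : t = 1 ∨ t = 2)
    (hC : ∀ i < 2, ∀ j < 2, f₁ i = f₂ j ↔ i = 1 ∧ j = 1) : Listed A T₁' .inh T₂' .inh := by
  have g0 := H.offDiag_nonpos le_rfl
  have hz : A (f₁ 0) (f₂ 0) = 0 := by
    by_contra hz
    have h1 := (hC 1 (by omega) 1 (by omega)).2 (by omega)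
    -- Here the diagram would be a triangle with a double bond, on which the constant vector 1 has
    -- the row `-t` at the common vertex.
    obtain ⟨b, -⟩ := H.eq_zero_of_common hc le_rfl (by omega) h1 (fun i => 1)
      (fun i hi => by
        rw [row_inh _ _ hi]
        clear * - hi hz g0 ht
        grind)
      (by clear * - hz g0; grind)
    have b1 := b 1 (by omega)
    rw [row_inh _ _ (by omega)] at b1
    clear * - b1 ht
    grind
  rcases ht with rfl | rfl
  · refine H.glue.listed_of_common_of_eq_zero H.part₁ H.part₂ hC (by simp [hz])
      .B3_aa_cc (fun i => i) (fun j => 2 - j)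
      (fun i => i) (fun j => j) (fun _ => 0) (fun _ => 0) 1 rfl ?_ ?_ ?_ ?_ ?_ ?_ ?_ ?_ <;>
      clear * - <;> grind (splits := 25)
  · refine H.glue.listed_of_common_of_eq_zero H.part₁ H.part₂ hC (by simp [hz])
      .twD3_cc_cc (fun i => i) (fun j => 2 - j)
      (fun i => i) (fun j => j) (fun _ => 0) (fun _ => 0) 1 rfl ?_ ?_ ?_ ?_ ?_ ?_ ?_ ?_ <;>
      clear * - <;> grind (splits := 25)

theorem listed_of_common (H : InhInh A T₁ T₁' T₂ T₂' (mI t m) f₁ (mI s n) f₂)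
    (ht : HomInh.IsInhType t m) (hs : HomInh.IsInhType s n) (hx₁ : x ∈ T₁) (hx₂ : x ∈ T₂) :
    Listed A T₁' .inh T₂' .inh := by
  obtain ⟨hk, hk', σ, hσ, hm, hC⟩ := H.glue.exists_match H.part₁ H.part₂ (oneArm_inh (by grind) m)
    (oneArm_inh (by grind) n) hx₁ hx₂
  obtain rfl : m = n := by omega
  have hc : ∀ j < m, j ≠ 0 → f₂ j ∈ T₁ := by
    intro j hj hj0
    have h := hσ.lt (i := j - 1) (by omega)
    have h' := hm _ h.1
    rw [h.2, Nat.sub_add_cancel (by omega)] at h'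
    rw [← h']
    exact H.part₁.mem_of_lt (by grind)
  have hc' : ∀ j < m, j ≠ 0 → f₁ j ∈ T₂ := by
    intro j hj hj0
    have h' := hm (j - 1) (by omega)
    rw [Nat.sub_add_cancel (by omega)] at h'
    rw [h']
    exact H.part₂.mem_of_lt (by have := hσ.lt (i := j - 1) (by omega); grind)
  rcases (by omega : m = 2 ∨ 3 ≤ m) with rfl | hm3
  · have hσ0 : σ 0 = 0 := by have := hσ.lt (i := 0) (by omega); omega
    have hC' : ∀ i < 2, ∀ j < 2, f₁ i = f₂ j ↔ i = 1 ∧ j = 1 := by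
      intro i hi j hj
      rw [hC i hi j hj]
      exact ⟨by clear * - hσ0; grind, fun h => ⟨0, by clear * - hσ0 h; grind⟩⟩
    rcases hs with ⟨rfl, -⟩ | ⟨rfl, -⟩
    · rcases ht with ⟨rfl, -⟩ | ⟨rfl, -⟩
      · exact H.listed_of_reverse hc le_rfl fun i hi j hj => (hC' i hi j hj).trans (by omega)
      · exact (H.symm.listed_of_two hc' (Or.inl rfl) fun i hi j hj => by
          rw [eq_comm, hC' j hj i hi, and_comm]).symm
    · exact H.listed_of_two hc (ht.imp And.left And.left) hC'
  · rcases hσ with ⟨hσ, h⟩ | ⟨hσ, -, h, h'⟩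
    · obtain ⟨-, rfl⟩ := h (by omega)
      refine H.listed_of_id hc hm3 (hs.imp And.left And.left) fun i hi j hj => ?_
      rw [hC i hi j hj]
      simp only [hσ]
      exact ⟨by omega, fun h => ⟨i - 1, by omega⟩⟩
    · obtain ⟨rfl, rfl⟩ : t = 1 ∧ s = 1 := by omega
      refine H.listed_of_reverse hc (by omega) fun i hi j hj => ?_
      rw [hC i hi j hj]
      simp only [hσ]
      exact ⟨by omega, fun h => ⟨i - 1, by omega⟩⟩

end InhInh

end PrimSph

namespace PrimSph

open Matrix

variable {S : Type*} {A : Matrix S S ℤ} {T₁ T₁' T₂ T₂' : Set S} {c₁ c₂ : Factor}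
  {M₁ M₂ : Model} {f₁ f₂ : ℕ → S}

/-! ### The remaining cases -/

/-- If the second part is the empty diagram `a 0`, then `S` is the first part, and every local model
is an entry of the list up to a renumbering. -/
theorem Glue.listed_of_rank_zero (g : Glue A T₁ T₁' T₂ T₂') (p₁ : Part A T₁ T₁' M₁ f₁)
    (p₂ : Part A T₂ T₂' (mI 1 0) f₂) (h₁ : IsModel M₁ c₁) : Listed A T₁' c₁ T₂' .inh := by
  have hd : ∀ x ∈ T₁, x ∉ T₂ := by
    intro x _ hx
    obtain ⟨i, hi, -⟩ := (p₂.mem x).1 hx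
    exact absurd hi (Nat.not_lt_zero i)
  have key : ∀ {N : ℕ} {X : Matrix (Fin N) (Fin N) ℤ} {l : List ℕ}, N = M₁.rank →
      IsListed (single X l c₁ [] .inh) → ∀ a : ℕ → ℕ,
      (∀ i < M₁.rank, a i < M₁.rank ∧ (a i ∈ l ↔ i ∈ M₁.dec)) →
      (∀ i < M₁.rank, ∀ j < M₁.rank, ext X (a i) (a j) = M₁.entry i j) →
      Listed A T₁' c₁ T₂' .inh := by
    rintro N X l rfl hE a h h'
    exact g.listed_of_disjoint hd p₁ p₂ hE a id rfl
      (fun i hi => ⟨(h i hi).1, (h i hi).2, by simp⟩) (by simp) h' (by simp) (by simp)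
  cases h₁ with
  | point c k h =>
    rcases h with ⟨rfl, rfl⟩ | ⟨rfl, rfl⟩
    · exact key rfl (.A_a 1 le_rfl) id (by clear * -; grind) (by clear * -; grind)
    · exact key rfl .A1_2a id (by clear * -; grind) (by clear * -; grind)
  | a n hn => exact key rfl (.A_a n (by omega)) id (by clear * -; grind) (by clear * -; grind)
  | b n hn c k h =>
    exact key rfl (.B_b n _ hn (h.imp And.left And.left)) id (by clear * -; grind)
      (by clear * -; grind)
  | c n hn => exact key rfl (.C_c n hn) id (by clear * -; grind) (by clear * -; grind)
  | d n hn c k h =>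
    have h' := (h.imp And.left And.left).symm
    rcases hn.eq_or_lt with rfl | hn
    · exact key rfl (.A3_d3 _ h') (fun i => if i = 0 then 1 else if i = 1 then 0 else 2)
        (by clear * -; grind) (by clear * -; grind)
    · exact key rfl (.D_d n _ hn h') id (by clear * -; grind) (by clear * -; grind)
  | dd c k h =>
    refine listed_of_double g.gcm (.A1xA1_d2 _ (h.imp And.left And.left).symm) (fun _ => f₁ 0)
      (fun _ => f₁ 1) (fun x => ?_) ?_ ?_ ?_ ?_ ?_ ?_ ?_
    · rcases g.exists_cover p₁ p₂ x with ⟨i, hi, rfl⟩ | ⟨j, hj, -⟩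
      · rcases (by grind : i = 0 ∨ i = 1) with rfl | rfl
        · exact Or.inl ⟨0, by simp⟩
        · exact Or.inr ⟨0, by simp⟩
      · exact absurd hj (Nat.not_lt_zero j)
    · intro i hi j hj
      rw [g.gcm.diag]
      clear * - hi hj
      grind
    · intro i hi j hj
      rw [g.gcm.diag]
      clear * - hi hj
      grind
    · omega
    · omega
    · intro i hi j hj
      rw [p₁.cartan 0 (by simp) 1 (by simp)]
      clear * -
      grind
    · intro i hi
      have h1 := (p₁.mem_dec_iff (i := 0) (by simp)).2 (by simp)
      have h2 : f₁ 0 ∉ T₂' := fun h => g.not_mem₁ _ h (p₁.mem_of_lt (by simp))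
      clear * - h1 h2 hi
      grind
    · intro i hi
      have h1 := (p₁.mem_dec_iff (i := 1) (by simp)).2 (by simp)
      have h2 : f₁ 1 ∉ T₂' := fun h => g.not_mem₁ _ h (p₁.mem_of_lt (by simp))
      clear * - h1 h2 hi
      grind
  | f => exact key rfl .F4_f id (by clear * -; grind) (by clear * -; grind)
  | g c k h =>
    exact key rfl (.G2_g _ (h.imp And.left And.left)) id (by clear * -; grind) (by clear * -; grind)
  | b' c k h =>
    exact key rfl (.B3_b' _ (h.imp And.left And.left).symm) id (by clear * -; grind)
      (by clear * -; grind)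
  | aa n =>
    rcases Nat.eq_zero_or_pos n with rfl | hn
    -- Two empty parts do not occur here, since `f₁ 0` is a vertex of `S`; the empty diagram is
    -- treated separately.
    · rcases g.exists_cover p₁ p₂ (f₁ 0) with ⟨j, hj, -⟩ | ⟨j, hj, -⟩ <;>
        exact absurd hj (Nat.not_lt_zero j)
    · exact key rfl (.A_aa n hn) id (by clear * -; grind) (by clear * -; grind)
  | cc n hn => exact key rfl (.C_cc n hn) id (by clear * -; grind) (by clear * -; grind)

theorem IsModel.exists_inh (h : IsModel M₁ .inh) :
    ∃ s n, M₁ = mI s n ∧ (HomInh.IsInhType s n ∨ s = 1 ∧ n = 0) := by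
  generalize hc : Factor.inh = c at h
  cases h with
  | aa n => exact ⟨1, n, rfl, by clear * -; grind⟩
  | cc n hn => exact ⟨2, n, rfl, Or.inl (Or.inr ⟨rfl, hn⟩)⟩
  | _ => grind

theorem HomHom.listed [Fintype S] (H : HomHom A T₁ T₁' T₂ T₂' M₁ f₁ M₂ f₂) (h₁ : IsModel M₁ c₁)
    (hc₁ : c₁ ≠ .inh)
    (h₂ : IsModel M₂ c₂) (hc₂ : c₂ ≠ .inh) : Listed A T₁' c₁ T₂' c₂ := by
  by_cases hd : ∀ x ∈ T₁, x ∉ T₂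
  · exact H.listed_of_disjoint hd h₁ hc₁ h₂ hc₂
  · push Not at hd
    obtain ⟨x, hx₁, hx₂⟩ := hd
    exact HomHom.listed_of_common hx₁ hx₂ H h₁ hc₁ h₂ hc₂

theorem HomInh.listed [Fintype S] (H : HomInh A T₁ T₁' T₂ T₂' M₁ f₁ M₂ f₂) (h₁ : IsModel M₁ c₁)
    (hc₁ : c₁ ≠ .inh)
    (h₂ : IsModel M₂ .inh) : Listed A T₁' c₁ T₂' .inh := by
  obtain ⟨s, n, rfl, hs | ⟨rfl, rfl⟩⟩ := h₂.exists_inh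
  · by_cases hd : ∀ x ∈ T₁, x ∉ T₂
    · exact HomInh.listed_of_disjoint hd hs H h₁ hc₁
    · push Not at hd
      obtain ⟨x, hx₁, hx₂⟩ := hd
      exact H.listed_of_common hs h₁ hc₁ hx₁ hx₂
  · exact H.glue.listed_of_rank_zero H.part₁ H.part₂ h₁

theorem InhInh.listed [Fintype S] (H : InhInh A T₁ T₁' T₂ T₂' M₁ f₁ M₂ f₂) (h₁ : IsModel M₁ .inh)
    (h₂ : IsModel M₂ .inh) : Listed A T₁' .inh T₂' .inh := by
  obtain ⟨s, n, rfl, hs | ⟨rfl, rfl⟩⟩ := h₂.exists_inh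
  · obtain ⟨t, m, rfl, ht | ⟨rfl, rfl⟩⟩ := h₁.exists_inh
    · by_cases hd : ∀ x ∈ T₁, x ∉ T₂
      · exact H.listed_of_disjoint hd ht hs
      · push Not at hd
        obtain ⟨x, hx₁, hx₂⟩ := hd
        exact H.listed_of_common ht hs hx₁ hx₂
    · exact (H.glue.symm.listed_of_rank_zero H.part₂ H.part₁ h₂).symm
  · exact H.glue.listed_of_rank_zero H.part₁ H.part₂ h₁

theorem LocalModel.Identifies.factor_eq_inh [IsEmpty S] {M : LocalModel} {e : Fin M.rank ↪ S}
    {T T' : Set S} {c : Factor} (h : M.Identifies e A T T' c) : c = .inh := by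
  have hr : M.rank = 0 := by
    by_contra h0
    exact isEmptyElim (e ⟨0, Nat.pos_of_ne_zero h0⟩)
  rw [← h.factor_eq]
  have hM := h.isLocalModel
  clear h
  cases hM <;> simp at hr ⊢ <;> omega

end PrimSph

/-- Every primitive spherical diagram is isomorphic to an entry of the list. -/
theorem mainTheorem2 {S : Type*} [Fintype S] (D : PrimSph.Diagram S)
    (hD : D.IsPrimitiveSpherical) :
    ∃ (T : Type) (E : PrimSph.Diagram T), PrimSph.IsListed E ∧ D.IsIsomorphic E := by
  have g := hD.glue
  obtain ⟨hdyn, -, -, M₁, M₂, e₁, e₂, I₁, I₂, hh, hi, ih, ii⟩ := hD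
  obtain ⟨A, T₁', c₁, T₂', c₂⟩ := D
  simp only at *
  rcases isEmpty_or_nonempty S with hS | hS
  -- Every homogeneous model has a vertex, so on the empty diagram both factors are `inh`.
  · obtain rfl := I₁.factor_eq_inh
    obtain rfl := I₂.factor_eq_inh
    exact ⟨Fin 0, _, .empty, Equiv.equivOfIsEmpty _ _, isEmptyElim,
      Or.inl ⟨Set.eq_of_subset_of_subset isEmptyElim isEmptyElim, rfl,
        Set.eq_of_subset_of_subset isEmptyElim isEmptyElim, rfl⟩⟩
  obtain ⟨N₁, f₁, m₁, p₁, w₁⟩ := I₁.exists_part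
  obtain ⟨N₂, f₂, m₂, p₂, w₂⟩ := I₂.exists_part
  by_cases hc₁ : c₁ = .inh <;> by_cases hc₂ : c₂ = .inh
  · subst hc₁ hc₂
    exact PrimSph.InhInh.listed ⟨hdyn, g, p₁, p₂, ii rfl rfl⟩ m₁ m₂
  · subst hc₁
    refine (PrimSph.HomInh.listed ⟨hdyn, g.symm, p₂, p₁, fun x hx => ?_⟩ m₂ hc₂ m₁).symm
    have h := w₂ x
    rw [ih rfl hc₂ x hx] at h
    -- The prescribed value `-1` becomes `-2` for doubled weights.
    exact_mod_cast h.trans (by norm_num : (2 : ℚ) * -1 = (-2 : ℤ))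
  · subst hc₂
    refine PrimSph.HomInh.listed ⟨hdyn, g, p₁, p₂, fun x hx => ?_⟩ m₁ hc₁ m₂
    have h := w₁ x
    rw [hi hc₁ rfl x hx] at h
    exact_mod_cast h.trans (by norm_num : (2 : ℚ) * -1 = (-2 : ℤ))
  · refine PrimSph.HomHom.listed ⟨g, p₁, p₂, fun x => ?_⟩ m₁ hc₁ m₂ hc₂
    have h : ((PrimSph.pairing A N₁ f₁ x + PrimSph.pairing A N₂ f₂ x : ℤ) : ℚ) = 0 := by
      rw [Int.cast_add, w₁, w₂, ← mul_add, hh hc₁ hc₂ x, mul_zero]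
    exact_mod_cast h
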